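/- **Geometry.** Let $n\in\{2,3\}$. A tube in $\mathbb R^n$ is given by an interval $I=(-\Lambda,\Lambda)$, a curve $\gamma\in C^2(I;\mathbb R^n)$, a linear isometric embedding $\iota:\mathbb R^{n-1}\to\mathbb R^n$ and a cross-section $S\subset\mathbb R^{n-1}$; the domain is $\mathscr N=\{\gamma(a)+\iota(y): a\in I,\ y\in S\}$ and its lateral boundary is $\hat\Gamma=\{\gamma(a)+\iota(y): a\in I,\ y\in\partial S\}$. We fix $K>0$ and require $\Lambda\ge 1/K$, $|\gamma'|\le K$, $|\gamma''|\le K$, and $\mathrm{dist}(\gamma'(a),\iota(\mathbb R^{n-1}))\ge 1/K$ for all $a\in I$ (so $\gamma$ is regular and injective). For $\varepsilon>0$ the tube is a *nozzle* if $S$ is a bounded simply connected Lipschitz domain with $\operatorname{diam}S\le\varepsilon$, and (for $n=3$) a *slab* if $S$ is the interior of a nondegenerate convex quadrilateral whose extent is at most $\varepsilon$ in one direction and lies in $[1/K,K]$ in the orthogonal direction $e$ (its long direction). Let $\Omega=\bigcup_{i=1}^M\mathscr N_i$ be a finite union of pairwise disjoint nozzles or slabs, with lateral boundary $\hat\Gamma=\bigcup_i\hat\Gamma_i$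 and outward unit normal $\nu$ of $\mathscr N_i$ on $\hat\Gamma_i$, and let $Q=\Omega\times[0,T]$. **Setting.** Let $\mu>0$ and $\alpha_1,\dots,\alpha_4\in(0,1)$. For $j=1,2$ let $u^j$ be a complex-valued distributional solution in $\Omega\times(0,T)$ of $$\partial_tH(u^j)+\nabla\cdot\mathbf F^j(\mathbf x,t,u^j)=f^j(\mathbf x,t,u^j,\nabla u^j)+\mu\Delta u^j ,$$ where $\|f^j\|_{C^{0,\alpha_2}(\overline Q\times\mathbb C\times\mathbb C^n)}\le C_2$, each component of $\mathbf F^j$ has $C^{0,\alpha_3}(\overline Q\times\mathbb C)$-norm at most $C_3$ (these norms being the maximum of the Hölder norms in each variable separately, with half the exponent in $t$), and $\|u^j\|_{C^{1,\alpha_4}(\overline Q)}\le C_4$, meaning that $u^j,\nabla u^j,\partial_tu^j$ have Hölder norms at most $C_4$ on $\overline Q$ with exponent $\alpha_4$ in the distance $|\mathbf x-\mathbf y|+|t-s|^{1/2}$. Let $h^1,h^2\in C^{0,\alpha_4}(\overline Q)$ (same distance) and assume the measurements agree, $$(u^1,\ \partial_\nu u^1+h^1)=(u^2,\ \partial_\nu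 u^2+h^2)\quad\text{on }\hat\Gamma\times[0,T]$$ (the second components where $\nu$ exists), together with the flux balance $$\int_{T_1}^{T_2}\!\!\int_\Gamma \nu\cdot\big(\mathbf F^1(\mathbf x,t,u^1)-\mathbf F^2(\mathbf x,t,u^2)\big)\,d\sigma\,dt=\int_{T_1}^{T_2}\!\!\int_\Gamma\mu(h^1-h^2)\,d\sigma\,dt$$ for all measurable $\Gamma\subset\hat\Gamma_i$ (every $i$) and $0\le T_1<T_2\le T$. **Rotated components.** For $n=2$ put $\mathbf F'=(F_1\cos\theta+F_2\sin\theta,\,-F_1\sin\theta+F_2\cos\theta)$; for $n=3$ put $\mathbf F'=(F_1\cos\beta\cos\theta+F_2\sin\beta-F_3\cos\beta\sin\theta,\ -F_1\sin\beta\cos\theta+F_2\cos\beta+F_3\sin\beta\sin\theta,\ F_1\sin\theta+F_3\cos\theta)$. The angles are *aligned* with $\gamma'(b)$ if $\gamma'(b)$ lies on the new $x_1$-axis ($n=2$), respectively on the new $x_2$-axis ($n=3$), and, for a slab, if also the new $x_3$-axis is orthogonal to the long direction $\iota(e)$. The recovered components $F'_k$ are $k=2$ if $n=2$; $k=1,3$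 for a nozzle in $\mathbb R^3$; $k=3$ for a slab. **(a)** Let $0<l<1+\alpha_3\alpha_4$ and $C_1,\dots,C_4,C_h>0$. There is a constant $C>0$, depending only on $n,\mu,l,\alpha_1,\dots,\alpha_4,C_1,\dots,C_4,C_h$, such that for all $K,T>0$ there is $\varepsilon_0>0$ so that the following holds for all $0<\varepsilon<\varepsilon_0$. Assume the setting above with $\|H\|_{C^{0,\alpha_1}(\mathbb C)}\le C_1$ and $\|h^1-h^2\|_{L^\infty(Q)}\le C_h$, and assume that the curve of each component is covered by windows $[a_1,a_2]\subset I$ with $a_2-a_1\le\varepsilon^l$ each of which contains distinct $b_1,b_2\in(a_1,a_2)$ with $\gamma'(b_1)\parallel\gamma'(b_2)$. Then, for every point $\mathbf x=\gamma(a)+\iota(y)\in\Omega$, every such window with $a\in[a_1,a_2]$, all angles aligned with $\gamma'(b_1)$, every recovered component $k$, every $t\in[0,T]$ and $j=1,2$, $$\big|F^{1\prime}_k(\mathbf x,t,u^j(\mathbf x,t))-F^{2\prime}_k(\mathbf x,t,u^j(\mathbf x,t))\big|\le C\varepsilon^\tau,$$ $$\tau=\begin{cases}\alpha_3\alpha_4\,l,&0<l\le\frac1{1+\alpha_3\alpha_4},\\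 \tfrac12\,[1-l(1-\alpha_3\alpha_4)],&\frac1{1+\alpha_3\alpha_4}<l<1,\\ \tfrac12(1-l+\alpha_3\alpha_4),&1\le l<1+\alpha_3\alpha_4.\end{cases}$$ **(b)** Let $C_1',C_2,C_4>0$. There is a constant $C'>0$, depending only on $n,\mu,\alpha_1,\dots,\alpha_4,C_1',C_2,C_4$, such that for all $C_3,K,T>0$ there is $\varepsilon_0>0$ so that the following holds for all $0<\varepsilon<\varepsilon_0$. Assume the setting above with $H\in C^{1,\alpha_1}(\mathbb C)$ (as a map of the real plane), $\|H\|_{C^{1,\alpha_1}(\mathbb C)}\le C_1'$, $\mathbf F^1(\mathbf x,t,u^1)=\mathbf F^2(\mathbf x,t,u^2)$ and $h^1=h^2$ in $Q$, and assume that for each $\mathbf x\in\Omega$ there is $\mathbf x_0\in\hat\Gamma$ at which $\nu$ exists such that $\mathbf x-\mathbf x_0\parallel\nu_{\mathbf x_0}$. Then for all $(\mathbf x,t)\in Q$ and $j=1,2$, $$\big|f^1(\mathbf x,t,u^j,\nabla u^j)-f^2(\mathbf x,t,u^j,\nabla u^j)\big|\le C'\varepsilon^{\tau_1},\qquad \tau_1=\frac{\alpha_2\alpha_4^2}{1+\alpha_2\alpha_4}.$$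 -/

import Mathlib

open Set Filter Topology MeasureTheory
open scoped ContDiff

noncomputable section

namespace BalanceLaw

/-- Euclidean space `ℝᵏ`. -/
abbrev E (k : ℕ) : Type := EuclideanSpace ℝ (Fin k)

/-! ### Product-type domains

The ambient space is `ℝᵐ⁺¹` (`m = 1, 2`), cross-sections live in `ℝᵐ`. -/

/-- A bounded Lipschitz domain: nonempty, open, connected, bounded, and near each boundary point the
region below the graph of a Lipschitz function of the variables orthogonal to some unit vector. -/
structure IsLipschitzDomain {m : ℕ} (S : Set (E m)) : Prop where
  isOpen : IsOpen S
  isConnected : IsConnected S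
  isBounded : Bornology.IsBounded S
  graph : ∀ p ∈ frontier S, ∃ (r : ℝ) (e : E m) (κ : NNReal) (g : E m → ℝ),
    0 < r ∧ ‖e‖ = 1 ∧ LipschitzWith κ g ∧
      ∀ y ∈ Metric.ball p r, y ∈ S ↔ inner ℝ y e < g (y - inner ℝ y e • e)

/-- The data of a tube: the cross-section `sec ⊂ ℝᵐ`, put into the hyperplane `emb (ℝᵐ)` of `ℝᵐ⁺¹`,
is translated along the curve `curve : (-len, len) → ℝᵐ⁺¹`. -/
structure Tube (m : ℕ) where
  len : ℝ
  curve : ℝ → E (m + 1)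
  emb : E m →ₗᵢ[ℝ] E (m + 1)
  sec : Set (E m)

namespace Tube

variable {m : ℕ}

/-- The parameter interval `I = (-len, len)`. -/
def I (N : Tube m) : Set ℝ := Ioo (-N.len) N.len

/-- The union of the translated cross-sections. -/
def dom (N : Tube m) : Set (E (m + 1)) :=
  {x | ∃ a ∈ N.I, ∃ y ∈ N.sec, x = N.curve a + N.emb y}

/-- The lateral boundary: the union of the boundaries of the translated cross-sections. -/
def lateral (N : Tube m) : Set (E (m + 1)) :=
  {x | ∃ a ∈ N.I, ∃ y ∈ frontier N.sec, x = N.curve a + N.emb y}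

/-- The curve is `C²` with bounds given by `K`, not too short, and uniformly transversal to the
hyperplane of the cross-sections (so it is regular and injective, and the translated cross-sections
are pairwise disjoint). -/
structure CurveBound (N : Tube m) (K : ℝ) : Prop where
  length : 1 / K ≤ N.len
  smooth : ContDiffOn ℝ 2 N.curve N.I
  deriv_le : ∀ a ∈ N.I, ‖deriv N.curve a‖ ≤ K
  deriv2_le : ∀ a ∈ N.I, ‖deriv (deriv N.curve) a‖ ≤ K
  transversal : ∀ a ∈ N.I, ∀ y : E m, 1 / K ≤ ‖deriv N.curve a - N.emb y‖

/-- Nozzle: the cross-section is a simply connected bounded Lipschitz domain of diameter `≤ ε`. -/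
structure IsNozzle (N : Tube m) (ε : ℝ) : Prop where
  lipschitz : IsLipschitzDomain N.sec
  simplyConnected : SimplyConnectedSpace N.sec
  diam_le : Metric.diam N.sec ≤ ε

/-- Slab: the cross-section is an (open, nondegenerate) quadrilateral whose extent is at most `ε`
in the direction `f` and between `1 / K` and `K` in the orthogonal direction `e`.
(The two orthonormal vectors force `2 ≤ m`.) -/
structure IsSlab (N : Tube m) (ε K : ℝ) (e f : E m) : Prop where
  norm_e : ‖e‖ = 1
  norm_f : ‖f‖ = 1
  orthogonal : inner ℝ e f = 0
  quadrilateral : ∃ v : Fin 4 → E m, N.sec = interior (convexHull ℝ (range v))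
  nonempty : N.sec.Nonempty
  width_le : ∀ y ∈ N.sec, ∀ z ∈ N.sec, inner ℝ (y - z) f ≤ ε
  length_le : ∀ y ∈ N.sec, ∀ z ∈ N.sec, inner ℝ (y - z) e ≤ K
  le_length : ∃ y ∈ N.sec, ∃ z ∈ N.sec, 1 / K ≤ inner ℝ (y - z) e

/-- A nozzle or a slab of width `ε`. -/
def IsProductType (N : Tube m) (ε K : ℝ) : Prop :=
  N.CurveBound K ∧ (N.IsNozzle ε ∨ ∃ e f, N.IsSlab ε K e f)

/-- `a₁, a₂` bound a window of the curve, of length at most `ε ^ l`, that contains two distinct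
parameters `b₁, b₂` with parallel tangents. -/
structure IsWindow (N : Tube m) (ε l a₁ a₂ b₁ b₂ : ℝ) : Prop where
  left_mem : a₁ ∈ N.I
  right_mem : a₂ ∈ N.I
  length_le : a₂ - a₁ ≤ ε ^ l
  fst_mem : b₁ ∈ Ioo a₁ a₂
  snd_mem : b₂ ∈ Ioo a₁ a₂
  ne : b₁ ≠ b₂
  parallel : ∃ c : ℝ, deriv N.curve b₂ = c • deriv N.curve b₁

/-- Tangent directions are repeated within `ε ^ l` all along the curve. -/
def RepeatedTangents (N : Tube m) (ε l : ℝ) : Prop :=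
  ∀ a ∈ N.I, ∃ a₁ a₂ b₁ b₂, a ∈ Icc a₁ a₂ ∧ N.IsWindow ε l a₁ a₂ b₁ b₂

end Tube

/-- The union of the components. -/
def unionDom {m M : ℕ} (N : Fin M → Tube m) : Set (E (m + 1)) := ⋃ i, (N i).dom

/-- `ν` is the outward unit normal of `D` at `x`: to first order at `x`, the set `D` is the
half-space `⟨y - x, ν⟩ < 0`. -/
def IsOutwardNormal {k : ℕ} (D : Set (E k)) (x ν : E k) : Prop :=
  ‖ν‖ = 1 ∧ ∀ η : ℝ, 0 < η → ∀ᶠ y in 𝓝 x,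
    (inner ℝ (y - x) ν < -η * ‖y - x‖ → y ∈ D) ∧ (η * ‖y - x‖ < inner ℝ (y - x) ν → y ∉ D)

open Classical in
/-- The outward unit normal field (zero at the points that have no normal). -/
def outwardNormal {k : ℕ} (D : Set (E k)) (x : E k) : E k :=
  if h : ∃ ν, IsOutwardNormal D x ν then h.choose else 0

/-- The product `ν · w` of a real and a complex vector. -/
def dotC {k : ℕ} (ν : E k) (w : Fin k → ℂ) : ℂ := ∑ i, (ν i : ℂ) * w i

/-! ### Rotated coordinates -/

/-- The rotation of the coordinate system, with angle `θ` in the plane, angles `θ, β` in space. -/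
def rot : (m : ℕ) → ℝ → ℝ → Matrix (Fin (m + 1)) (Fin (m + 1)) ℝ
  | 1, θ, _ => !![Real.cos θ, Real.sin θ; -Real.sin θ, Real.cos θ]
  | 2, θ, β =>
    !![Real.cos β * Real.cos θ, Real.sin β, -(Real.cos β * Real.sin θ);
      -(Real.sin β * Real.cos θ), Real.cos β, Real.sin β * Real.sin θ;
      Real.sin θ, 0, Real.cos θ]
  | _, _, _ => 1

/-- The new axis with which the tangent of the curve gets aligned: the first one in the plane, the
second one in space. -/
def tangentAxis : (m : ℕ) → Fin (m + 1)
  | 2 => 1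
  | _ => 0

/-- The rotated coordinates have the vector `v` along the axis `tangentAxis m`. -/
def Aligned {m : ℕ} (θ β : ℝ) (v : E (m + 1)) : Prop :=
  ∀ k, k ≠ tangentAxis m → ((rot m θ β).mulVec (fun i => v i)) k = 0

/-- The components of the flux in the rotated coordinates. -/
def rotFlux {m : ℕ} (θ β : ℝ) (F : Fin (m + 1) → ℂ) : Fin (m + 1) → ℂ :=
  ((rot m θ β).map (fun r : ℝ => (r : ℂ))).mulVec F

/-- The component `k` in the coordinates rotated by `θ, β` is one that is recovered in the window of
`N` around `b`: the tangent at `b` is aligned; for a nozzle `k` is any component transversal to the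
tangent; for a slab the third axis is orthogonal to the long direction `e`, and `k` is the third
component. -/
def IsRecovered {m : ℕ} (N : Tube m) (ε K b θ β : ℝ) (k : Fin (m + 1)) : Prop :=
  Aligned θ β (deriv N.curve b) ∧
    ((N.IsNozzle ε ∧ k ≠ tangentAxis m) ∨
      (∃ e f, N.IsSlab ε K e f ∧
        ((rot m θ β).mulVec (fun i => N.emb e i)) (Fin.last m) = 0 ∧ k = Fin.last m))

/-! ### Hölder norms -/

/-- `‖g‖_{C^{0,α}(S)} = sup |g| + sup |g x - g y| / d(x,y)^α ≤ C`, with respect to the distance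
function `d`. -/
def HolderNormLE {X Y : Type*} [NormedAddCommGroup Y] (d : X → X → ℝ) (α C : ℝ) (S : Set X)
    (g : X → Y) : Prop :=
  ∃ A B : ℝ, 0 ≤ A ∧ 0 ≤ B ∧ A + B ≤ C ∧ (∀ x ∈ S, ‖g x‖ ≤ A) ∧
    ∀ x ∈ S, ∀ y ∈ S, ‖g x - g y‖ ≤ B * d x y ^ α

/-- The parabolic distance `|x - y| + |t - s|^{1/2}`. -/
def parDist {k : ℕ} (p q : E k × ℝ) : ℝ := dist p.1 q.1 + Real.sqrt |p.2 - q.2|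

/-- The norm of `f ∈ C^{0,α}(closure Ω × [0,T] × ℂ × ℂⁿ)`: the largest of the Hölder norms in each
variable separately, with exponent `α / 2` in time. -/
structure SourceNormLE {k : ℕ} (Ω : Set (E k)) (T α C : ℝ)
    (f : E k → ℝ → ℂ → EuclideanSpace ℂ (Fin k) → ℂ) : Prop where
  space : ∀ t ∈ Icc 0 T, ∀ z p, HolderNormLE dist α C (closure Ω) (fun x => f x t z p)
  time : ∀ x ∈ closure Ω, ∀ z p, HolderNormLE dist (α / 2) C (Icc 0 T) (fun t => f x t z p)
  state : ∀ x ∈ closure Ω, ∀ t ∈ Icc 0 T, ∀ p, HolderNormLE dist α C univ (fun z => f x t z p)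
  grad : ∀ x ∈ closure Ω, ∀ t ∈ Icc 0 T, ∀ z, HolderNormLE dist α C univ (fun p => f x t z p)

/-- The norm of a flux component in `C^{0,α}(closure Ω × [0,T] × ℂ)`. -/
structure FluxNormLE {k : ℕ} (Ω : Set (E k)) (T α C : ℝ) (f : E k → ℝ → ℂ → ℂ) : Prop where
  space : ∀ t ∈ Icc 0 T, ∀ z, HolderNormLE dist α C (closure Ω) (fun x => f x t z)
  time : ∀ x ∈ closure Ω, ∀ z, HolderNormLE dist (α / 2) C (Icc 0 T) (fun t => f x t z)
  state : ∀ x ∈ closure Ω, ∀ t ∈ Icc 0 T, HolderNormLE dist α C univ (fun z => f x t z)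

/-- `u ∈ C^{1,α}(closure Ω × [0,T])` with norm at most `C`, where `Du`, `ut` are the continuous
extensions to `closure Ω × [0,T]` of the spatial gradient and of the time derivative of `u`. -/
structure C1HolderLE {k : ℕ} (Ω : Set (E k)) (T α C : ℝ) (u : E k → ℝ → ℂ)
    (Du : E k → ℝ → EuclideanSpace ℂ (Fin k)) (ut : E k → ℝ → ℂ) : Prop where
  deriv : ∀ x ∈ Ω, ∀ t ∈ Ioo 0 T, ∃ L : E k × ℝ →L[ℝ] ℂ,
    HasFDerivAt (fun p : E k × ℝ => u p.1 p.2) L (x, t) ∧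
      (∀ i, L (EuclideanSpace.single i 1, 0) = Du x t i) ∧ L (0, 1) = ut x t
  norm_u : HolderNormLE parDist α C (closure Ω ×ˢ Icc 0 T) (fun p => u p.1 p.2)
  norm_Du : HolderNormLE parDist α C (closure Ω ×ˢ Icc 0 T) (fun p => Du p.1 p.2)
  norm_ut : HolderNormLE parDist α C (closure Ω ×ˢ Icc 0 T) (fun p => ut p.1 p.2)

/-- `‖H‖_{C^{0,α}(ℂ)} ≤ C`. -/
def StateNormLE (α C : ℝ) (H : ℂ → ℂ) : Prop := HolderNormLE dist α C univ H

/-- `‖H‖_{C^{1,α}(ℂ)} ≤ C`, where `ℂ` is regarded as the real plane. -/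
def StateC1NormLE (α C : ℝ) (H : ℂ → ℂ) : Prop :=
  ContDiff ℝ 1 H ∧ HolderNormLE dist α C univ H ∧ HolderNormLE dist α C univ (fderiv ℝ H)

/-! ### The equation and the measurement -/

/-- `∂ₜ H(u) + ∇ · F(x,t,u) = f(x,t,u,∇u) + μ Δu` in `Ω × (0,T)` in the sense of distributions. -/
def IsWeakSolution {k : ℕ} (Ω : Set (E k)) (T μ : ℝ) (H : ℂ → ℂ)
    (F : E k → ℝ → ℂ → Fin k → ℂ) (f : E k → ℝ → ℂ → EuclideanSpace ℂ (Fin k) → ℂ)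
    (u : E k → ℝ → ℂ) (Du : E k → ℝ → EuclideanSpace ℂ (Fin k)) : Prop :=
  ∀ φ : E k × ℝ → ℝ, ContDiff ℝ ∞ φ → HasCompactSupport φ → tsupport φ ⊆ Ω ×ˢ Ioo 0 T →
    (∫ p in Ω ×ˢ Ioo 0 T,
        (-(H (u p.1 p.2) * (fderiv ℝ φ p (0, 1) : ℂ))
          - ∑ i, F p.1 p.2 (u p.1 p.2) i * (fderiv ℝ φ p (EuclideanSpace.single i 1, 0) : ℂ)
          + (μ : ℂ) * ∑ i, Du p.1 p.2 i * (fderiv ℝ φ p (EuclideanSpace.single i 1, 0) : ℂ)))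
      = ∫ p in Ω ×ˢ Ioo 0 T, f p.1 p.2 (u p.1 p.2) (Du p.1 p.2) * (φ p : ℂ)

/-- The hypotheses that are common to both parts: two configurations `(H, Fʲ, fʲ)` (`j = 0, 1`)
with solutions `uʲ`, a priori bounds, equal measurements `(u, ∂_ν u + h)` on the lateral boundary,
and the flux balance on the subsets `Γ × (T₁, T₂)` of the lateral boundary. -/
structure IsSetting {m M : ℕ} (N : Fin M → Tube m) (T μ α₂ α₃ α₄ C₂ C₃ C₄ : ℝ) (H : ℂ → ℂ)
    (F : Fin 2 → E (m + 1) → ℝ → ℂ → Fin (m + 1) → ℂ)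
    (f : Fin 2 → E (m + 1) → ℝ → ℂ → EuclideanSpace ℂ (Fin (m + 1)) → ℂ)
    (u : Fin 2 → E (m + 1) → ℝ → ℂ)
    (Du : Fin 2 → E (m + 1) → ℝ → EuclideanSpace ℂ (Fin (m + 1)))
    (ut : Fin 2 → E (m + 1) → ℝ → ℂ)
    (h : Fin 2 → E (m + 1) → ℝ → ℂ) : Prop where
  source : ∀ j, SourceNormLE (unionDom N) T α₂ C₂ (f j)
  flux : ∀ j k, FluxNormLE (unionDom N) T α₃ C₃ (fun x t z => F j x t z k)
  solution_norm : ∀ j, C1HolderLE (unionDom N) T α₄ C₄ (u j) (Du j) (ut j)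
  solution : ∀ j, IsWeakSolution (unionDom N) T μ H (F j) (f j) (u j) (Du j)
  coupling : ∀ j, ∃ C, HolderNormLE parDist α₄ C (closure (unionDom N) ×ˢ Icc 0 T)
    (fun p => h j p.1 p.2)
  dirichlet : ∀ i, ∀ x ∈ (N i).lateral, ∀ t ∈ Icc 0 T, u 0 x t = u 1 x t
  neumann : ∀ i, ∀ x ∈ (N i).lateral, ∀ t ∈ Icc 0 T, ∀ ν, IsOutwardNormal (N i).dom x ν →
    dotC ν (Du 0 x t) + h 0 x t = dotC ν (Du 1 x t) + h 1 x t
  balance : ∀ i, ∀ Γ ⊆ (N i).lateral, MeasurableSet Γ → ∀ T₁ T₂, 0 ≤ T₁ → T₁ < T₂ → T₂ ≤ T →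
    (∫ t in T₁..T₂, ∫ x in Γ, dotC (outwardNormal (N i).dom x)
        (fun k => F 0 x t (u 0 x t) k - F 1 x t (u 1 x t) k) ∂(Measure.hausdorffMeasure (m : ℝ)))
      = ∫ t in T₁..T₂, ∫ x in Γ, (μ : ℂ) * (h 0 x t - h 1 x t)
          ∂(Measure.hausdorffMeasure (m : ℝ))

/-- The rate in the recovery of the flux, as a function of `a = α₃ α₄` and of `l`. -/
def fluxRate (a l : ℝ) : ℝ :=
  if l ≤ 1 / (1 + a) then a * l
  else if l < 1 then (1 - l * (1 - a)) / 2
  else (1 - l + a) / 2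

/-- The rate in the recovery of the source. -/
def sourceRate (α₂ α₄ : ℝ) : ℝ := α₂ * α₄ ^ 2 / (1 + α₂ * α₄)

end BalanceLaw

end

open BalanceLaw

/-! Because ε₀ may depend on K and T, it suffices to prove both estimates with exponents strictly
larger than the asserted ones and with constants that depend on K (`fluxConst`, `sourceConst`). For
small ε the surplus power of ε absorbs these constants, so C = C' = 1 will do (`fluxRate_lt`,
`sourceRate_lt`).

The geometry is handled in a `Shear`: the curve is parametrized by its height over the hyperplane of
the sections. The tube is then a sheared product, and normals of the lateral boundary are lifts of
normals of the section.

Flux. The balance holds on every piece of the lateral boundary and every time interval, hence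
pointwise almost everywhere (`Shear.ae_flux_eq`). Together with the Neumann data it says that U = F¹
− F² + μ(∇u¹ − ∇u²) is tangential to the lateral boundary. Let r be the row of the rotation that
gives the component: it is almost orthogonal to the tangent of the curve, and the section has width
at most ε along its projection. Over the closed section, maximize the linear function with gradient
`proj r` minus (ε/ρ²)‖z − y‖². The maximum is attained at a boundary point p within ρ of y, where
the gradient is `proj r` up to O(ε/ρ). On a smooth boundary this gradient would be normal, so U
would be orthogonal to its lift. On a Lipschitz boundary the same conclusion holds: a continuous
field that is tangent at almost every point is the velocity at p of a curve in the boundary, along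
which the maximum is stationary (`GraphChart.apply_eq_zero_of_isMaxOn`). Hence r·U(p) = O(ε/ρ +
ε^l). The gradient term is small because u¹ − u² vanishes on the boundary, and Hölder continuity
carries the flux from p to y. With s₀ = min(α₃, α₄) the choice ρ = ε^(1/(1+s₀)) makes ε/ρ equal to
ρ^s₀.

Source. If the coupling terms agree, w = u¹ − u² and its whole gradient vanish on the lateral
boundary (`SliceHolder.grad_eq_zero`), so w = O(ε^(1+α₄)). The difference of the weak equations is
tested with a bump of size r along the tube and along the long direction of a slab, of duration r²,
cut off near the lateral boundary. Integrating by parts twice along the tube costs ε^(1+α₄)/r². In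
the cut-off layer of width δ the smallness of w and ∇w compensates the derivatives of the cut-off up
to a factor δ^(α₄−1), the volume is O(δ), and the contribution vanishes as δ → 0
(`IsDifference.norm_le_of_cell`). Thus f¹ − f² = O(ε^(1+α₄)/r² + r^(α₂α₄)), and r =
ε^((1+α₄)/(2+α₂α₄)) balances the two terms. -/

namespace BalanceLaw

/-! ### Products of real and complex vectors -/

section Dot

variable {k : ℕ}

theorem dotC_add_left (v v' : E k) (w : Fin k → ℂ) : dotC (v + v') w = dotC v w + dotC v' w := by
  simp [dotC, add_mul, Finset.sum_add_distrib]

theorem dotC_sub_left (v v' : E k) (w : Fin k → ℂ) : dotC (v - v') w = dotC v w - dotC v' w := by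
  simp [dotC, sub_mul, Finset.sum_sub_distrib]

theorem dotC_smul_left (c : ℝ) (v : E k) (w : Fin k → ℂ) : dotC (c • v) w = c * dotC v w := by
  simp [dotC, Finset.mul_sum, mul_assoc]

theorem dotC_zero_left (w : Fin k → ℂ) : dotC (0 : E k) w = 0 := by
  simp [dotC]

theorem dotC_add_right (v : E k) (w w' : Fin k → ℂ) : dotC v (w + w') = dotC v w + dotC v w' := by
  simp [dotC, mul_add, Finset.sum_add_distrib]

theorem dotC_sub_right (v : E k) (w w' : Fin k → ℂ) : dotC v (w - w') = dotC v w - dotC v w' := by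
  simp [dotC, mul_sub, Finset.sum_sub_distrib]

theorem dotC_smul_right (v : E k) (c : ℂ) (w : Fin k → ℂ) : dotC v (c • w) = c * dotC v w := by
  simp [dotC, Finset.mul_sum, mul_left_comm]

theorem norm_dotC_le (v : E k) (w : Fin k → ℂ) : ‖dotC v w‖ ≤ ‖v‖ * ∑ i, ‖w i‖ := by
  rw [dotC, Finset.mul_sum]
  refine (norm_sum_le _ _).trans (Finset.sum_le_sum fun i _ => ?_)
  rw [norm_mul, Complex.norm_real]
  exact mul_le_mul_of_nonneg_right (PiLp.norm_apply_le v i) (norm_nonneg _)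

/-- Cauchy–Schwarz. -/
theorem norm_dotC_le_euclidean (v : E k) (w : EuclideanSpace ℂ (Fin k)) :
    ‖dotC v w‖ ≤ ‖v‖ * ‖w‖ := by
  have h : ‖dotC v w‖ ≤ ∑ i, ‖v i‖ * ‖w i‖ := by
    rw [dotC]
    refine (norm_sum_le _ _).trans (Finset.sum_le_sum fun i _ => ?_)
    rw [norm_mul, Complex.norm_real]
  refine h.trans ?_
  rw [EuclideanSpace.norm_eq, EuclideanSpace.norm_eq]
  exact Real.sum_mul_le_sqrt_mul_sqrt _ _ _

/-- The maximum and tangency arguments are about real vector fields; this and `im_dotC` reduce a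
complex orthogonality relation to two real ones. -/
theorem re_dotC (v : E k) (w : Fin k → ℂ) :
    (dotC v w).re = inner ℝ v (WithLp.toLp 2 fun i => (w i).re) := by
  simp [dotC, PiLp.inner_apply, mul_comm]

theorem im_dotC (v : E k) (w : Fin k → ℂ) :
    (dotC v w).im = inner ℝ v (WithLp.toLp 2 fun i => (w i).im) := by
  simp [dotC, PiLp.inner_apply, mul_comm]

/-- A linear functional is determined by its values on the standard basis. -/
theorem clm_apply_eq_dotC {F : Type*} [NormedAddCommGroup F] [NormedSpace ℝ F]
    (L : E k × F →L[ℝ] ℂ) (w : Fin k → ℂ)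
    (hL : ∀ i, L (EuclideanSpace.single i 1, 0) = w i) (v : E k) : L (v, 0) = dotC v w := by
  have hv : v = ∑ i, v i • EuclideanSpace.single i (1 : ℝ) := by
    ext j; simp [Finset.sum_apply, Pi.single_apply]
  have : L (v, 0) = (L.comp (ContinuousLinearMap.inl ℝ (E k) F)) v := by simp
  rw [this]
  conv_lhs => rw [hv]
  rw [map_sum, dotC]
  refine Finset.sum_congr rfl fun i _ => ?_
  rw [map_smul]
  simp [hL]

end Dot

/-! ### Consequences of Hölder bounds -/

section Holder

variable {X Y : Type*} [NormedAddCommGroup Y] {d : X → X → ℝ} {α C : ℝ} {S : Set X} {g : X → Y}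

theorem HolderNormLE.norm_le (h : HolderNormLE d α C S g) {x : X} (hx : x ∈ S) : ‖g x‖ ≤ C := by
  obtain ⟨A, B, hA, hB, hAB, h1, -⟩ := h
  exact (h1 x hx).trans (by linarith)

theorem HolderNormLE.norm_sub_le (h : HolderNormLE d α C S g) {x y : X} (hx : x ∈ S) (hy : y ∈ S)
    (hd : 0 ≤ d x y) : ‖g x - g y‖ ≤ C * d x y ^ α := by
  obtain ⟨A, B, hA, hB, hAB, -, h2⟩ := h
  exact (h2 x hx y hy).trans
    (mul_le_mul_of_nonneg_right (by linarith) (Real.rpow_nonneg hd _))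

theorem parDist_nonneg {k : ℕ} (p q : E k × ℝ) : 0 ≤ parDist p q :=
  add_nonneg dist_nonneg (Real.sqrt_nonneg _)

theorem parDist_same_time {k : ℕ} (x y : E k) (t : ℝ) : parDist (x, t) (y, t) = dist x y := by
  simp [parDist]

theorem parDist_self {k : ℕ} (p : E k × ℝ) : parDist p p = 0 := by
  simp [parDist]

theorem continuous_parDist_left {k : ℕ} (q : E k × ℝ) : Continuous fun p => parDist p q := by
  unfold parDist; fun_prop

theorem HolderNormLE.continuousOn_parDist {k : ℕ} {S : Set (E k × ℝ)} {g : E k × ℝ → Y}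
    (hα : 0 < α) (h : HolderNormLE parDist α C S g) : ContinuousOn g S := by
  intro q hq
  rw [ContinuousWithinAt, tendsto_iff_norm_sub_tendsto_zero]
  have h1 : Tendsto (fun p => C * parDist p q ^ α) (𝓝[S] q) (𝓝 0) := by
    have : Continuous fun p => C * parDist p q ^ α :=
      continuous_const.mul ((continuous_parDist_left q).rpow_const fun _ => Or.inr hα.le)
    have h2 := this.tendsto q
    rw [parDist_self, Real.zero_rpow hα.ne', mul_zero] at h2
    exact h2.mono_left nhdsWithin_le_nhds
  refine squeeze_zero' (Eventually.of_forall fun _ => norm_nonneg _) ?_ h1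
  filter_upwards [self_mem_nhdsWithin] with p hp
  exact h.norm_sub_le hp hq (parDist_nonneg _ _)

end Holder

end BalanceLaw

namespace BalanceLaw

/-! ### Straightened tubes -/

/-- A tube whose curve is parametrized by the height over the hyperplane of the cross-sections:
the translated cross-section at height `s` is `s • nrm + emb (prof s + sec)`. -/
structure Shear (m : ℕ) where
  emb : E m →ₗᵢ[ℝ] E (m + 1)
  nrm : E (m + 1)
  range : Set ℝ
  prof : ℝ → E m
  dprof : ℝ → E m
  sec : Set (E m)
  lip : NNReal
  norm_nrm : ‖nrm‖ = 1
  orth : ∀ y, inner ℝ nrm (emb y) = 0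
  isOpen_range : IsOpen range
  ordConnected_range : range.OrdConnected
  hasDerivAt_prof : ∀ s ∈ range, HasDerivAt prof (dprof s) s
  continuousOn_dprof : ContinuousOn dprof range
  norm_dprof_le : ∀ s ∈ range, ‖dprof s‖ ≤ lip

namespace Shear

variable {m : ℕ} (N : Shear m)

/-- The orthogonal projection to the hyperplane of the cross-sections, in the coordinates of `ℝᵐ`. -/
noncomputable def proj : E (m + 1) →L[ℝ] E m :=
  ContinuousLinearMap.adjoint N.emb.toContinuousLinearMap

/-- The height over the hyperplane of the cross-sections. -/
noncomputable def ht : E (m + 1) →L[ℝ] ℝ := innerSL ℝ N.nrm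

theorem ht_apply (x : E (m + 1)) : N.ht x = inner ℝ N.nrm x := rfl

theorem inner_proj (x : E (m + 1)) (y : E m) : inner ℝ (N.proj x) y = inner ℝ x (N.emb y) := by
  rw [proj, ContinuousLinearMap.adjoint_inner_left]; rfl

@[simp] theorem proj_emb (y : E m) : N.proj (N.emb y) = y := by
  refine ext_inner_right ℝ fun z => ?_
  rw [inner_proj, LinearIsometry.inner_map_map]

@[simp] theorem proj_nrm : N.proj N.nrm = 0 := by
  refine ext_inner_right ℝ fun z => ?_
  rw [inner_proj, N.orth, inner_zero_left]

@[simp] theorem ht_emb (y : E m) : N.ht (N.emb y) = 0 := N.orth y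

@[simp] theorem ht_nrm : N.ht N.nrm = 1 := by
  rw [ht_apply, real_inner_self_eq_norm_sq, N.norm_nrm, one_pow]

theorem norm_proj_le (x : E (m + 1)) : ‖N.proj x‖ ≤ ‖x‖ := by
  have h : ‖N.proj‖ ≤ 1 := by
    rw [proj, LinearIsometryEquiv.norm_map]
    exact N.emb.norm_toContinuousLinearMap_le
  simpa using (N.proj.le_opNorm x).trans (mul_le_mul_of_nonneg_right h (norm_nonneg _))

theorem abs_ht_le (x : E (m + 1)) : |N.ht x| ≤ ‖x‖ := by
  rw [ht_apply]
  simpa [N.norm_nrm] using abs_real_inner_le_norm N.nrm x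

/-- The range of `ι` has codimension one, so its orthogonal complement is the line spanned by `n`;
what remains after removing the component along `n` is orthogonal to that line. -/
theorem decomp_of_orth {m : ℕ} (ι : E m →ₗᵢ[ℝ] E (m + 1)) (n : E (m + 1)) (hn : ‖n‖ = 1)
    (ho : ∀ y, inner ℝ n (ι y) = 0) (x : E (m + 1)) : ∃ y, x = inner ℝ n x • n + ι y := by
  set R := LinearMap.range ι.toLinearMap with hR
  have hfr : Module.finrank ℝ R = m := by
    rw [hR, LinearMap.finrank_range_of_inj ι.injective]; simp
  have h1 : Module.finrank ℝ Rᗮ = 1 := by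
    have := R.finrank_add_finrank_orthogonal
    rw [hfr] at this; simp at this; omega
  have hnR : n ∈ Rᗮ := by
    rw [Submodule.mem_orthogonal]
    rintro _ ⟨y, rfl⟩
    rw [real_inner_comm]; exact ho y
  have hn0 : n ≠ 0 := by rintro rfl; simp at hn
  have hx : x - inner ℝ n x • n ∈ R := by
    rw [← Submodule.orthogonal_orthogonal R, Submodule.mem_orthogonal]
    intro v hv
    obtain ⟨c, hc⟩ := (finrank_eq_one_iff_of_nonzero' (⟨n, hnR⟩ : Rᗮ)
      (by simpa [Subtype.ext_iff] using hn0)).1 h1 ⟨v, hv⟩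
    have hc' : v = c • n := by simpa [Subtype.ext_iff] using hc.symm
    rw [hc', inner_sub_right, inner_smul_left, inner_smul_left, inner_smul_right,
      real_inner_self_eq_norm_sq, hn]
    simp
  obtain ⟨y, hy⟩ := hx
  exact ⟨y, sub_eq_iff_eq_add'.1 hy.symm⟩

theorem decomp (x : E (m + 1)) : N.ht x • N.nrm + N.emb (N.proj x) = x := by
  obtain ⟨y, hy⟩ := decomp_of_orth N.emb N.nrm N.norm_nrm N.orth x
  have : N.proj x = y := by rw [hy]; simp
  rw [this, ht_apply]; exact hy.symm

/-- The coordinate in the cross-section. -/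
noncomputable def sc (x : E (m + 1)) : E m := N.proj x - N.prof (N.ht x)

/-- The point at height `s` with coordinate `y` in the cross-section. -/
noncomputable def pt (s : ℝ) (y : E m) : E (m + 1) := s • N.nrm + N.emb (y + N.prof s)

@[simp] theorem ht_pt (s : ℝ) (y : E m) : N.ht (N.pt s y) = s := by simp [pt]

@[simp] theorem sc_pt (s : ℝ) (y : E m) : N.sc (N.pt s y) = y := by
  rw [sc, ht_pt]; simp [pt]

@[simp] theorem pt_ht_sc (x : E (m + 1)) : N.pt (N.ht x) (N.sc x) = x := by
  rw [pt, sc, sub_add_cancel, N.decomp]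

/-- The domain. -/
def dom : Set (E (m + 1)) := {x | N.ht x ∈ N.range ∧ N.sc x ∈ N.sec}

/-- The lateral boundary. -/
def lateral : Set (E (m + 1)) := {x | N.ht x ∈ N.range ∧ N.sc x ∈ frontier N.sec}

theorem pt_mem_dom {s : ℝ} {y : E m} (hs : s ∈ N.range) (hy : y ∈ N.sec) : N.pt s y ∈ N.dom := by
  simp [dom, hs, hy]

theorem pt_mem_lateral {s : ℝ} {y : E m} (hs : s ∈ N.range) (hy : y ∈ frontier N.sec) :
    N.pt s y ∈ N.lateral := by
  simp [lateral, hs, hy]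

theorem pt_sub_pt_same (s : ℝ) (y z : E m) : N.pt s y - N.pt s z = N.emb (y - z) := by
  simp [pt]

theorem dist_pt_pt_same (s : ℝ) (y z : E m) : dist (N.pt s y) (N.pt s z) = dist y z := by
  rw [dist_eq_norm, pt_sub_pt_same, LinearIsometry.norm_map, dist_eq_norm]

theorem continuous_pt_right (s : ℝ) : Continuous (N.pt s) := by
  unfold pt; fun_prop

theorem continuousOn_prof : ContinuousOn N.prof N.range := fun s hs =>
  (N.hasDerivAt_prof s hs).continuousAt.continuousWithinAt

theorem lipschitzOn_prof : LipschitzOnWith N.lip N.prof N.range :=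
  (N.ordConnected_range.convex).lipschitzOnWith_of_nnnorm_hasDerivWithin_le
    (fun s hs => (N.hasDerivAt_prof s hs).hasDerivWithinAt)
    fun s hs => by exact_mod_cast N.norm_dprof_le s hs

theorem norm_prof_sub_le {s s' : ℝ} (hs : s ∈ N.range) (hs' : s' ∈ N.range) :
    ‖N.prof s - N.prof s'‖ ≤ N.lip * |s - s'| := by
  simpa [dist_eq_norm] using N.lipschitzOn_prof.dist_le_mul s hs s' hs'

theorem norm_sc_sub_le {x x' : E (m + 1)} (hx : N.ht x ∈ N.range) (hx' : N.ht x' ∈ N.range) :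
    ‖N.sc x - N.sc x'‖ ≤ (1 + N.lip) * ‖x - x'‖ := by
  have h1 : N.sc x - N.sc x' = N.proj (x - x') - (N.prof (N.ht x) - N.prof (N.ht x')) := by
    rw [sc, sc, map_sub]; abel
  have h2 := N.norm_prof_sub_le hx hx'
  rw [← map_sub] at h2
  have h3 := mul_le_mul_of_nonneg_left (N.abs_ht_le (x - x')) N.lip.coe_nonneg
  rw [h1]
  refine (norm_sub_le _ _).trans ?_
  linarith [N.norm_proj_le (x - x')]

theorem norm_pt_sub_le {s s' : ℝ} (hs : s ∈ N.range) (hs' : s' ∈ N.range) (y y' : E m) :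
    ‖N.pt s y - N.pt s' y'‖ ≤ (1 + N.lip) * |s - s'| + ‖y - y'‖ := by
  have h1 : N.pt s y - N.pt s' y'
      = (s - s') • N.nrm + (N.emb (y - y') + N.emb (N.prof s - N.prof s')) := by
    simp only [pt, map_add, map_sub, sub_smul]; abel
  rw [h1]
  refine (norm_add_le _ _).trans ?_
  rw [norm_smul, N.norm_nrm, Real.norm_eq_abs]
  have := norm_add_le (N.emb (y - y')) (N.emb (N.prof s - N.prof s'))
  rw [LinearIsometry.norm_map, LinearIsometry.norm_map] at this
  linarith [N.norm_prof_sub_le hs hs']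

theorem continuousOn_sc : ContinuousOn N.sc {x | N.ht x ∈ N.range} := by
  unfold sc
  exact N.proj.continuous.continuousOn.sub
    (N.continuousOn_prof.comp N.ht.continuous.continuousOn fun x hx => hx)

theorem isOpen_strip : IsOpen {x | N.ht x ∈ N.range} := N.isOpen_range.preimage N.ht.continuous

theorem isOpen_dom (hS : IsOpen N.sec) : IsOpen N.dom :=
  N.continuousOn_sc.isOpen_inter_preimage N.isOpen_strip hS

theorem lateral_subset_closure : N.lateral ⊆ closure N.dom := by
  rintro x ⟨hx, hx'⟩
  rw [← N.pt_ht_sc x]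
  have h1 : N.sc x ∈ closure N.sec := frontier_subset_closure hx'
  refine map_mem_closure (N.continuous_pt_right _) h1 fun y hy => N.pt_mem_dom hx hy

theorem disjoint_lateral_dom (hS : IsOpen N.sec) {x : E (m + 1)} (hx : x ∈ N.lateral) :
    x ∉ N.dom := fun h => by
  have := hx.2
  rw [hS.frontier_eq] at this
  exact this.2 h.2

/-- The boundary of the tube also contains its two end faces; the condition that the height lies in
the open range excludes them. -/
theorem mem_lateral_of_closure (hS : IsOpen N.sec) {x : E (m + 1)} (hx : x ∈ closure N.dom)
    (hx' : x ∉ N.dom) (hs : N.ht x ∈ N.range) : x ∈ N.lateral := by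
  refine ⟨hs, ?_⟩
  rw [hS.frontier_eq]
  refine ⟨?_, fun h => hx' ⟨hs, h⟩⟩
  have hc : ContinuousAt N.sc x := N.continuousOn_sc.continuousAt (N.isOpen_strip.mem_nhds hs)
  exact closure_mono (by rintro _ ⟨z, hz, rfl⟩; exact hz.2)
    (mem_closure_image hc hx)

/-- The vector with projection `v` that is orthogonal to the tangent of the curve. -/
noncomputable def lift (s : ℝ) (v : E m) : E (m + 1) := N.emb v - inner ℝ v (N.dprof s) • N.nrm

/-- The tangent of the curve. -/
noncomputable def tangent (s : ℝ) : E (m + 1) := N.nrm + N.emb (N.dprof s)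

/-- Subtracting the multiple `N.ht x` of the tangent moves `x` into the hyperplane, and the lift,
being orthogonal to the tangent, does not see the subtraction. This turns orthogonality to a normal
of the tube into a condition in the cross-section. -/
theorem inner_lift (s : ℝ) (v : E m) (x : E (m + 1)) :
    inner ℝ (N.lift s v) x = inner ℝ v (N.proj x - N.ht x • N.dprof s) := by
  rw [lift, inner_sub_left, inner_smul_left, inner_sub_right, inner_smul_right, ht_apply,
    real_inner_comm x (N.emb v), ← inner_proj, real_inner_comm v]
  simp; ring

@[simp] theorem proj_lift (s : ℝ) (v : E m) : N.proj (N.lift s v) = v := by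
  simp [lift]

theorem lift_add (s : ℝ) (v v' : E m) : N.lift s (v + v') = N.lift s v + N.lift s v' := by
  simp only [lift, map_add, inner_add_left, add_smul]; abel

theorem lift_smul (s c : ℝ) (v : E m) : N.lift s (c • v) = c • N.lift s v := by
  simp only [lift, map_smul, inner_smul_left, smul_sub, smul_smul]; simp

theorem norm_lift_le {s : ℝ} (hs : s ∈ N.range) (v : E m) :
    ‖N.lift s v‖ ≤ (1 + N.lip) * ‖v‖ := by
  rw [lift]
  refine (norm_sub_le _ _).trans ?_
  rw [norm_smul, N.norm_nrm, LinearIsometry.norm_map, Real.norm_eq_abs, mul_one]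
  have h1 := abs_real_inner_le_norm v (N.dprof s)
  have h2 := mul_le_mul_of_nonneg_left (N.norm_dprof_le s hs) (norm_nonneg v)
  linarith

theorem norm_tangent_le {s : ℝ} (hs : s ∈ N.range) : ‖N.tangent s‖ ≤ 1 + N.lip := by
  rw [tangent]
  refine (norm_add_le _ _).trans ?_
  rw [N.norm_nrm, LinearIsometry.norm_map]
  linarith [N.norm_dprof_le s hs]

theorem hasDerivAt_pt {s : ℝ} (hs : s ∈ N.range) (y : E m) :
    HasDerivAt (fun s => N.pt s y) (N.tangent s) s := by
  unfold pt tangent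
  have h1 : HasDerivAt (fun s : ℝ => s • N.nrm) N.nrm s := by
    simpa using (hasDerivAt_id s).smul_const N.nrm
  exact h1.add (N.emb.toContinuousLinearMap.hasFDerivAt.comp_hasDerivAt s
    ((N.hasDerivAt_prof s hs).const_add y))

theorem hasFDerivAt_sc {x : E (m + 1)} (hx : N.ht x ∈ N.range) :
    HasFDerivAt N.sc (N.proj - N.ht.smulRight (N.dprof (N.ht x))) x := by
  have h1 : HasFDerivAt (fun x => N.prof (N.ht x)) (N.ht.smulRight (N.dprof (N.ht x))) x := by
    have := (N.hasDerivAt_prof _ hx).hasFDerivAt.comp x N.ht.hasFDerivAt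
    refine this.congr_fderiv ?_
    ext v; simp
  exact N.proj.hasFDerivAt.sub h1

end Shear

end BalanceLaw

/-! ### Parametrization of a tube by height. -/

namespace BalanceLaw

/-- A hyperplane has a unit normal. -/
theorem exists_unit_normal {m : ℕ} (ι : E m →ₗᵢ[ℝ] E (m + 1)) :
    ∃ n : E (m + 1), ‖n‖ = 1 ∧ ∀ y, inner ℝ n (ι y) = 0 := by
  set R := LinearMap.range ι.toLinearMap with hR
  have hfr : Module.finrank ℝ R = m := by
    rw [hR, LinearMap.finrank_range_of_inj ι.injective]; simp
  have h1 : Module.finrank ℝ Rᗮ = 1 := by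
    have := R.finrank_add_finrank_orthogonal
    rw [hfr] at this; simp at this; omega
  obtain ⟨v, hv⟩ := (Module.finrank_pos_iff_exists_ne_zero (R := ℝ) (M := Rᗮ)).1 (by omega)
  have hv0 : (v : E (m + 1)) ≠ 0 := by simpa using hv
  refine ⟨‖(v : E (m + 1))‖⁻¹ • (v : E (m + 1)), ?_, fun y => ?_⟩
  · rw [norm_smul, norm_inv, norm_norm, inv_mul_cancel₀ (norm_ne_zero_iff.2 hv0)]
  · have h2 : inner ℝ (v : E (m + 1)) (ι y) = 0 :=
      Submodule.inner_left_of_mem_orthogonal (K := R) ⟨y, rfl⟩ v.2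
    rw [inner_smul_left, h2, mul_zero]

/-- A tube has a straightening. -/
theorem Tube.CurveBound.exists_shear {m : ℕ} {N : Tube m} {K : ℝ} (hK : 0 < K)
    (hN : N.CurveBound K) :
    ∃ P : Shear m, P.emb = N.emb ∧ P.sec = N.sec ∧ P.dom = N.dom ∧ P.lateral = N.lateral ∧
      (P.lip : ℝ) = K ^ 2 ∧
      (∀ s ∈ P.range, Icc s (s + 1 / (2 * K ^ 2)) ⊆ P.range ∨
        Icc (s - 1 / (2 * K ^ 2)) s ⊆ P.range) ∧
      ∀ a ∈ N.I, ∃ s ∈ P.range, (∀ y, N.curve a + N.emb y = P.pt s y) ∧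
        ∃ c : ℝ, 1 / K ≤ |c| ∧ deriv N.curve a = c • P.tangent s := by
  have hlen : 0 < N.len := lt_of_lt_of_le (by positivity) hN.length
  have hIopen : IsOpen N.I := isOpen_Ioo
  have hIconv : Convex ℝ N.I := convex_Ioo _ _
  have hder : ∀ a ∈ N.I, HasDerivAt N.curve (deriv N.curve a) a := fun a ha =>
    ((hN.smooth.differentiableOn (by norm_num)).differentiableAt
      (hIopen.mem_nhds ha)).hasDerivAt
  have hdc : ContinuousOn (deriv N.curve) N.I :=
    (hN.smooth.continuousOn_deriv_of_isOpen hIopen (by norm_num))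
  -- the unit normal, pointing in the direction of the curve
  obtain ⟨n, hn1, hno, hnpos⟩ : ∃ n : E (m + 1), ‖n‖ = 1 ∧ (∀ y, inner ℝ n (N.emb y) = 0) ∧
      ∀ a ∈ N.I, 1 / K ≤ inner ℝ n (deriv N.curve a) := by
    obtain ⟨n, hn1, hno⟩ := exists_unit_normal N.emb
    -- Taking `y` to be the projection of the velocity in the transversality bound leaves exactly
    -- the component along the normal.
    have habs : ∀ a ∈ N.I, 1 / K ≤ |inner ℝ n (deriv N.curve a)| := by
      intro a ha
      obtain ⟨y, hy⟩ := Shear.decomp_of_orth N.emb n hn1 hno (deriv N.curve a)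
      have h2 := hN.transversal a ha y
      have h3 : deriv N.curve a - N.emb y = inner ℝ n (deriv N.curve a) • n :=
        sub_eq_iff_eq_add.2 hy
      rw [h3, norm_smul, hn1, mul_one, Real.norm_eq_abs] at h2
      exact h2
    have hcont : ContinuousOn (fun a => inner ℝ n (deriv N.curve a)) N.I :=
      continuousOn_const.inner hdc
    have hne : ∀ a ∈ N.I, inner ℝ n (deriv N.curve a) ≠ 0 := fun a ha h0 => by
      have := habs a ha
      rw [h0, abs_zero] at this
      exact absurd this (not_le.2 (by positivity))
    have hpre : IsPreconnected ((fun a => inner ℝ n (deriv N.curve a)) '' N.I) :=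
      hIconv.isPreconnected.image _ hcont
    have hsign : (∀ a ∈ N.I, 0 < inner ℝ n (deriv N.curve a)) ∨
        ∀ a ∈ N.I, inner ℝ n (deriv N.curve a) < 0 := by
      by_contra! hcon
      obtain ⟨⟨a, ha, ha'⟩, b, hb, hb'⟩ := hcon
      have := hpre.ordConnected.out (mem_image_of_mem _ ha) (mem_image_of_mem _ hb) ⟨ha', hb'⟩
      obtain ⟨c, hc, hc'⟩ := this
      exact hne c hc hc'
    rcases hsign with h | h
    · exact ⟨n, hn1, hno, fun a ha => by have := habs a ha; rwa [abs_of_pos (h a ha)] at this⟩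
    · refine ⟨-n, by rwa [norm_neg], fun y => by rw [inner_neg_left, hno, neg_zero], fun a ha => ?_⟩
      have := habs a ha
      rwa [abs_of_neg (h a ha), ← inner_neg_left] at this
  -- the height along the curve
  set k : ℝ → ℝ := fun a => inner ℝ n (N.curve a) with hk
  have hkd : ∀ a ∈ N.I, HasDerivAt k (inner ℝ n (deriv N.curve a)) a := fun a ha =>
    (innerSL ℝ n).hasFDerivAt.comp_hasDerivAt a (hder a ha)
  have hkgrow : ∀ a ∈ N.I, ∀ b ∈ N.I, a ≤ b → 1 / K * (b - a) ≤ k b - k a := by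
    intro a ha b hb hab
    refine (hIconv.mul_sub_le_image_sub_of_le_deriv
      (fun x hx => (hkd x hx).continuousAt.continuousWithinAt)
      (fun x hx => ((hkd x (interior_subset hx)).differentiableAt).differentiableWithinAt)
      (fun x hx => ?_)) a ha b hb hab
    rw [(hkd x (interior_subset hx)).deriv]
    exact hnpos x (interior_subset hx)
  have hkabs : ∀ a ∈ N.I, ∀ b ∈ N.I, |a - b| ≤ K * |k a - k b| := by
    have key : ∀ a ∈ N.I, ∀ b ∈ N.I, a ≤ b → |a - b| ≤ K * |k a - k b| := by
      intro a ha b hb hab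
      have h := hkgrow a ha b hb hab
      have h4 : K * (1 / K * (b - a)) ≤ K * (k b - k a) := mul_le_mul_of_nonneg_left h hK.le
      have h5 : K * (1 / K * (b - a)) = b - a := by field_simp
      rw [abs_sub_comm a b, abs_sub_comm (k a), abs_of_nonneg (sub_nonneg.2 hab)]
      calc b - a ≤ K * (k b - k a) := by linarith
        _ ≤ K * |k b - k a| := mul_le_mul_of_nonneg_left (le_abs_self _) hK.le
    intro a ha b hb
    rcases le_total a b with h | h
    · exact key a ha b hb h
    · rw [abs_sub_comm, abs_sub_comm (k a)]; exact key b hb a ha h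
  have hkinj : InjOn k N.I := fun a ha b hb hab => by
    have := hkabs a ha b hb
    rw [hab, sub_self, abs_zero, mul_zero] at this
    exact sub_eq_zero.1 (abs_nonpos_iff.1 this)
  have hkcont : ContinuousOn k N.I := fun x hx => (hkd x hx).continuousAt.continuousWithinAt
  set J := k '' N.I with hJ
  set A : ℝ → ℝ := Function.invFunOn k N.I with hA
  have hAmem : ∀ s ∈ J, A s ∈ N.I := fun s hs => Function.invFunOn_mem hs
  have hkA : ∀ s ∈ J, k (A s) = s := fun s hs => Function.invFunOn_eq hs
  have hAk : ∀ a ∈ N.I, A (k a) = a := fun a ha => hkinj (hAmem _ ⟨a, ha, rfl⟩) ha (hkA _ ⟨a, ha, rfl⟩)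
  have hJord : J.OrdConnected := (hIconv.isPreconnected.image _ hkcont).ordConnected
  -- The parameter interval extends by more than 1/(2K) from `a` towards its midpoint, and the
  -- height grows at rate at least 1/K.
  have hJroom : ∀ s ∈ J, Icc s (s + 1 / (2 * K ^ 2)) ⊆ J ∨ Icc (s - 1 / (2 * K ^ 2)) s ⊆ J := by
    rintro _ ⟨a, ha, rfl⟩
    have e1 : 1 / K * (1 / (2 * K)) = 1 / (2 * K ^ 2) := by field_simp
    have hl : 1 / (2 * K) < N.len := by
      refine lt_of_lt_of_le ?_ hN.length
      rw [div_lt_div_iff₀ (by positivity) hK]; linarith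
    have h0 : 0 < 1 / (2 * K) := by positivity
    rcases le_total a 0 with h | h
    · left
      have hb : a + 1 / (2 * K) ∈ N.I := ⟨by have := ha.1; linarith, by linarith⟩
      have := hkgrow a ha _ hb (by linarith)
      rw [add_sub_cancel_left, e1] at this
      exact (Icc_subset_Icc_right (by linarith)).trans (hJord.out ⟨a, ha, rfl⟩ ⟨_, hb, rfl⟩)
    · right
      have hb : a - 1 / (2 * K) ∈ N.I := ⟨by linarith, by have := ha.2; linarith⟩
      have := hkgrow _ hb a ha (by linarith)
      rw [sub_sub_cancel, e1] at this
      exact (Icc_subset_Icc_left (by linarith)).trans (hJord.out ⟨_, hb, rfl⟩ ⟨a, ha, rfl⟩)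
  have hJopen : IsOpen J := by
    rw [isOpen_iff_mem_nhds]
    rintro _ ⟨a, ha, rfl⟩
    obtain ⟨b, hb1, hb2⟩ := exists_between ha.1
    obtain ⟨c, hc1, hc2⟩ := exists_between ha.2
    have hb : b ∈ N.I := ⟨hb1, hb2.trans ha.2⟩
    have hc : c ∈ N.I := ⟨ha.1.trans hc1, hc2⟩
    have h1 := hkgrow b hb a ha hb2.le
    have h2 := hkgrow a ha c hc hc1.le
    have h3 : 0 < 1 / K * (a - b) := mul_pos (by positivity) (sub_pos.2 hb2)
    have h4 : 0 < 1 / K * (c - a) := mul_pos (by positivity) (sub_pos.2 hc1)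
    exact mem_of_superset (Icc_mem_nhds (by linarith) (by linarith))
      (hJord.out ⟨b, hb, rfl⟩ ⟨c, hc, rfl⟩)
  have hAcont : ∀ s ∈ J, ContinuousAt A s := by
    intro s hs
    have hlip : LipschitzOnWith K.toNNReal A J := LipschitzOnWith.of_dist_le_mul fun x hx y hy => by
      have := hkabs _ (hAmem x hx) _ (hAmem y hy)
      rw [hkA x hx, hkA y hy] at this
      rw [Real.coe_toNNReal _ hK.le]; exact this
    exact hlip.continuousOn.continuousAt (hJopen.mem_nhds hs)
  have hnpos' : ∀ a ∈ N.I, 0 < inner ℝ n (deriv N.curve a) := fun a ha =>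
    lt_of_lt_of_le (by positivity) (hnpos a ha)
  have hAd : ∀ s ∈ J, HasDerivAt A (inner ℝ n (deriv N.curve (A s)))⁻¹ s := fun s hs =>
    (hkd _ (hAmem s hs)).of_local_left_inverse (hAcont s hs) (hnpos' _ (hAmem s hs)).ne'
      (by filter_upwards [hJopen.mem_nhds hs] with z hz using hkA z hz)
  set pr : E (m + 1) →L[ℝ] E m :=
    ContinuousLinearMap.adjoint N.emb.toContinuousLinearMap with hpr
  have hprn : ‖pr‖ ≤ 1 := by
    rw [hpr, LinearIsometryEquiv.norm_map]
    exact N.emb.norm_toContinuousLinearMap_le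
  set dp : ℝ → E m := fun s => (inner ℝ n (deriv N.curve (A s)))⁻¹ • pr (deriv N.curve (A s))
    with hdp
  let P : Shear m :=
    { emb := N.emb
      nrm := n
      range := J
      prof := fun s => pr (N.curve (A s))
      dprof := dp
      sec := N.sec
      -- The speed is at most K and the rate of ascent at least 1/K; the slope of the profile is
      -- bounded by their quotient.
      lip := ⟨K ^ 2, by positivity⟩
      norm_nrm := hn1
      orth := hno
      isOpen_range := hJopen
      ordConnected_range := hJord
      hasDerivAt_prof := fun s hs => by
        have h1 : HasDerivAt (fun s => N.curve (A s))
            ((inner ℝ n (deriv N.curve (A s)))⁻¹ • deriv N.curve (A s)) s :=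
          (hder _ (hAmem s hs)).scomp s (hAd s hs)
        have h2 := pr.hasFDerivAt.comp_hasDerivAt s h1
        rw [map_smul] at h2
        exact h2
      continuousOn_dprof := fun s hs => by
        have h1 : ContinuousAt (fun s => deriv N.curve (A s)) s :=
          ContinuousAt.comp (f := A) (hdc.continuousAt (hIopen.mem_nhds (hAmem s hs)))
            (hAcont s hs)
        exact (((continuousAt_const.inner h1).inv₀ (hnpos' _ (hAmem s hs)).ne').smul
          (pr.continuous.continuousAt.comp h1)).continuousWithinAt
      norm_dprof_le := fun s hs => by
        have h1 := hnpos _ (hAmem s hs)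
        have h2 := hN.deriv_le _ (hAmem s hs)
        change ‖dp s‖ ≤ K ^ 2
        rw [hdp, norm_smul, norm_inv, Real.norm_eq_abs, abs_of_pos (hnpos' _ (hAmem s hs)), sq]
        refine mul_le_mul ?_ ?_ (norm_nonneg _) hK.le
        · rw [inv_le_comm₀ (hnpos' _ (hAmem s hs)) hK]; simpa using h1
        · have := (pr.le_opNorm (deriv N.curve (A s))).trans
            (mul_le_mul_of_nonneg_right hprn (norm_nonneg _))
          linarith }
  have hprP : P.proj = pr := rfl
  have hcurve : ∀ a ∈ N.I, ∀ y, N.curve a + N.emb y = P.pt (k a) y := by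
    intro a ha y
    have h1 := P.decomp (N.curve a)
    have h2 : P.prof (k a) = P.proj (N.curve a) := by
      change pr (N.curve (A (k a))) = _; rw [hAk a ha]; rfl
    rw [Shear.pt, h2, map_add]
    change _ = inner ℝ P.nrm (N.curve a) • P.nrm + (N.emb y + P.emb (P.proj (N.curve a)))
    conv_lhs => rw [← h1]
    rw [Shear.ht_apply]; abel
  refine ⟨P, rfl, rfl, ?_, ?_, rfl, hJroom, fun a ha => ⟨k a, ⟨a, ha, rfl⟩, hcurve a ha,
    inner ℝ n (deriv N.curve a), ?_, ?_⟩⟩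
  · ext x
    constructor
    · rintro ⟨⟨a, ha, hax⟩, hy⟩
      refine ⟨a, ha, P.sc x, hy, ?_⟩
      rw [hcurve a ha]
      conv_lhs => rw [← P.pt_ht_sc x]
      rw [hax]
    · rintro ⟨a, ha, y, hy, rfl⟩
      rw [hcurve a ha]
      exact P.pt_mem_dom ⟨a, ha, rfl⟩ hy
  · ext x
    constructor
    · rintro ⟨⟨a, ha, hax⟩, hy⟩
      refine ⟨a, ha, P.sc x, hy, ?_⟩
      rw [hcurve a ha]
      conv_lhs => rw [← P.pt_ht_sc x]
      rw [hax]
    · rintro ⟨a, ha, y, hy, rfl⟩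
      rw [hcurve a ha]
      exact P.pt_mem_lateral ⟨a, ha, rfl⟩ hy
  · rw [abs_of_pos (hnpos' a ha)]; exact hnpos a ha
  · have h1 := P.decomp (deriv N.curve a)
    have h2 : P.dprof (k a) = (inner ℝ n (deriv N.curve a))⁻¹ • P.proj (deriv N.curve a) := by
      change dp (k a) = _
      simp only [hdp, hAk a ha]; rfl
    rw [Shear.tangent, h2, smul_add, map_smul, smul_smul, mul_inv_cancel₀ (hnpos' a ha).ne',
      one_smul]
    exact h1.symm

end BalanceLaw

namespace BalanceLaw

/-! ### Graph charts of Lipschitz domains -/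

/-- In the ball `B(p, r)`, the set `S` is the region below the graph of `g` in direction `e`, where
`g` is regarded as a function on the whole space that does not depend on the coordinate along `e`. -/
structure GraphChart {m : ℕ} (S : Set (E m)) (p : E m) (r : ℝ) (e : E m) (κ : NNReal)
    (g : E m → ℝ) : Prop where
  pos : 0 < r
  norm_e : ‖e‖ = 1
  lip : LipschitzWith κ g
  invariant : ∀ y (t : ℝ), g (y + t • e) = g y
  mem_iff : ∀ y ∈ Metric.ball p r, y ∈ S ↔ inner ℝ y e < g y

variable {m : ℕ}

theorem lipschitzWith_sub_inner_smul {e : E m} (he : ‖e‖ = 1) :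
    LipschitzWith 1 fun y : E m => y - inner ℝ y e • e := by
  refine LipschitzWith.of_dist_le_mul fun x y => ?_
  have h1 : (x - inner ℝ x e • e) - (y - inner ℝ y e • e)
      = (x - y) - inner ℝ (x - y) e • e := by
    rw [inner_sub_left, sub_smul]; abel
  rw [NNReal.coe_one, one_mul, dist_eq_norm, dist_eq_norm, h1]
  set z := x - y
  refine le_of_sq_le_sq ?_ (norm_nonneg _)
  rw [norm_sub_sq_real, inner_smul_right, norm_smul, he, mul_one, Real.norm_eq_abs, sq_abs]
  nlinarith [sq_nonneg (inner ℝ z e)]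

/-- Composing the graph function with the projection along `e` defines it on the whole space without
introducing coordinates on the hyperplane orthogonal to `e`. The free coordinate along `e` is later
used to store the height. -/
theorem IsLipschitzDomain.exists_chart {S : Set (E m)} (hS : IsLipschitzDomain S) {p : E m}
    (hp : p ∈ frontier S) : ∃ r e κ g, GraphChart S p r e κ g := by
  obtain ⟨r, e, κ, g, hr, he, hg, h⟩ := hS.graph p hp
  refine ⟨r, e, κ, fun y => g (y - inner ℝ y e • e), hr, he, ?_, fun y t => ?_, h⟩
  · have := hg.comp (lipschitzWith_sub_inner_smul he)
    rw [mul_one] at this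
    exact this
  · congr 1
    rw [inner_add_left, inner_smul_left, real_inner_self_eq_norm_sq, he]
    simp only [conj_trivial, one_pow, mul_one, add_smul]; abel

namespace GraphChart

variable {S : Set (E m)} {p : E m} {r : ℝ} {e : E m} {κ : NNReal} {g : E m → ℝ}

theorem inner_self (h : GraphChart S p r e κ g) : inner ℝ e e = 1 := by
  rw [real_inner_self_eq_norm_sq, h.norm_e, one_pow]

theorem inner_add_smul (h : GraphChart S p r e κ g) (y : E m) (t : ℝ) :
    inner ℝ (y + t • e) e = inner ℝ y e + t := by
  rw [inner_add_left, inner_smul_left, h.inner_self]; simp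

/-- The translation along `e` to the graph. -/
theorem inner_toGraph (h : GraphChart S p r e κ g) (y : E m) :
    inner ℝ (y + (g y - inner ℝ y e) • e) e = g (y + (g y - inner ℝ y e) • e) := by
  rw [h.inner_add_smul, h.invariant]; ring

theorem mem_frontier_iff (h : GraphChart S p r e κ g) (hS : IsOpen S) {q : E m}
    (hq : q ∈ Metric.ball p r) : q ∈ frontier S ↔ inner ℝ q e = g q := by
  rw [hS.frontier_eq]
  constructor
  · rintro ⟨h1, h2⟩
    refine le_antisymm ?_ (not_lt.1 fun h3 => h2 ((h.mem_iff q hq).2 h3))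
    by_contra! h3
    have hU : {y | g y < inner ℝ y e} ∩ Metric.ball p r ∈ 𝓝 q := by
      refine inter_mem ?_ (Metric.isOpen_ball.mem_nhds hq)
      exact (isOpen_lt h.lip.continuous (continuous_id.inner continuous_const)).mem_nhds h3
    obtain ⟨y, hy, hyS⟩ := mem_closure_iff_nhds.1 h1 _ hU
    exact absurd ((h.mem_iff y hy.2).1 hyS) (not_lt.2 (le_of_lt hy.1))
  · intro h1
    have h2 : q ∉ S := fun h2 => absurd ((h.mem_iff q hq).1 h2) (by rw [h1]; exact lt_irrefl _)
    refine ⟨?_, h2⟩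
    have hlim : Tendsto (fun t : ℝ => q + t • e) (𝓝[<] 0) (𝓝 q) := by
      have : Continuous fun t : ℝ => q + t • e := by fun_prop
      simpa using (this.tendsto 0).mono_left nhdsWithin_le_nhds
    refine mem_closure_of_tendsto hlim ?_
    filter_upwards [hlim (Metric.isOpen_ball.mem_nhds hq), self_mem_nhdsWithin] with t ht ht'
    rw [h.mem_iff _ ht, h.inner_add_smul, h.invariant, h1]
    have : t < 0 := ht'
    linarith

theorem hasFDerivAt_add_smul (h : GraphChart S p r e κ g) {y : E m} {g' : E m →L[ℝ] ℝ}
    (hg : HasFDerivAt g g' y) (t : ℝ) : HasFDerivAt g g' (y + t • e) := by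
  have h1 : HasFDerivAt (fun z => g (z - t • e)) g' (y + t • e) := by
    have h2 : HasFDerivAt g g' ((y + t • e) - t • e) := by simpa using hg
    exact h2.comp (y + t • e) ((hasFDerivAt_id _).sub_const (t • e))
  refine h1.congr_of_eventuallyEq (Eventually.of_forall fun z => ?_)
  have := h.invariant z (-t)
  rw [neg_smul, ← sub_eq_add_neg] at this
  exact this.symm

theorem fderiv_apply_e (h : GraphChart S p r e κ g) {y : E m} {g' : E m →L[ℝ] ℝ}
    (hg : HasFDerivAt g g' y) : g' e = 0 := by
  have h1 : HasDerivAt (fun t : ℝ => g (y + t • e)) (g' e) 0 := by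
    have h2 : HasDerivAt (fun t : ℝ => y + t • e) e 0 := by
      simpa using ((hasDerivAt_id (0 : ℝ)).smul_const e).const_add y
    have h3 : HasFDerivAt g g' (y + (0 : ℝ) • e) := by simpa using hg
    exact h3.comp_hasDerivAt 0 h2
  have h4 : (fun t : ℝ => g (y + t • e)) = fun _ => g y := funext fun t => h.invariant y t
  rw [h4] at h1
  exact h1.unique (hasDerivAt_const _ _)

/-- Points of the frontier at which the graph is differentiable are dense. -/
theorem exists_differentiable_near (h : GraphChart S p r e κ g) (hS : IsOpen S)
    (hp : p ∈ frontier S) {U : Set (E m)} (hU : U ∈ 𝓝 p) :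
    ∃ q ∈ U, q ∈ Metric.ball p r ∧ q ∈ frontier S ∧ DifferentiableAt ℝ g q := by
  -- The translation along `e` to the graph fixes `p`, and differentiability of `g` is invariant
  -- under it. Rademacher's theorem near `p` therefore yields regular points of the boundary near
  -- `p`.
  set τ : E m → E m := fun y => y + (g y - inner ℝ y e) • e with hτ
  have hτc : Continuous τ := by
    have := h.lip.continuous
    simp only [hτ]; fun_prop
  have hτp : τ p = p := by
    have := (h.mem_frontier_iff hS (Metric.mem_ball_self h.pos)).1 hp
    simp [hτ, this]
  have hV : τ ⁻¹' (U ∩ Metric.ball p r) ∈ 𝓝 p := by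
    refine hτc.continuousAt.preimage_mem_nhds ?_
    rw [hτp]; exact inter_mem hU (Metric.ball_mem_nhds _ h.pos)
  have hd : Dense {y | DifferentiableAt ℝ g y} :=
    Measure.dense_of_ae (μ := volume) h.lip.ae_differentiableAt
  obtain ⟨y, hy, hyd⟩ := mem_closure_iff_nhds.1 (hd p) _ hV
  refine ⟨τ y, hy.1, hy.2, (h.mem_frontier_iff hS hy.2).2 (h.inner_toGraph y), ?_⟩
  exact (h.hasFDerivAt_add_smul (DifferentiableAt.hasFDerivAt hyd) _).differentiableAt

end GraphChart

/-! ### Outward normals -/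

/-- A defining function with nonzero gradient `w` agrees with its linearization up to `‖w‖ * η * ‖y
- x‖`, so outside the cone of aperture `η` its sign is that of the linear part. -/
theorem isOutwardNormal_of_hasFDerivAt {k : ℕ} {D : Set (E k)} {x w : E k} {ρ : E k → ℝ}
    (hw : w ≠ 0) (hρ : HasFDerivAt ρ (innerSL ℝ w) x) (hx : ρ x = 0)
    (hD : ∀ᶠ y in 𝓝 x, y ∈ D ↔ ρ y < 0) : IsOutwardNormal D x (‖w‖⁻¹ • w) := by
  have hw0 : 0 < ‖w‖ := norm_pos_iff.2 hw
  refine ⟨by rw [norm_smul, norm_inv, norm_norm, inv_mul_cancel₀ hw0.ne'], fun η hη => ?_⟩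
  have h1 := hρ.isLittleO.def (c := ‖w‖ * η) (by positivity)
  filter_upwards [h1, hD] with y hy hyD
  rw [hx, sub_zero, Real.norm_eq_abs, innerSL_apply_apply, abs_le] at hy
  have h2 : inner ℝ (y - x) (‖w‖⁻¹ • w) = ‖w‖⁻¹ * inner ℝ w (y - x) := by
    rw [inner_smul_right, real_inner_comm]
  rw [h2, hyD]
  constructor
  · intro h3
    have h4 := mul_lt_mul_of_pos_left h3 hw0
    rw [← mul_assoc, mul_inv_cancel₀ hw0.ne', one_mul] at h4
    nlinarith [hy.2]
  · intro h3
    have h4 := mul_lt_mul_of_pos_left h3 hw0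
    rw [← mul_assoc ‖w‖ ‖w‖⁻¹, mul_inv_cancel₀ hw0.ne', one_mul] at h4
    have : 0 ≤ ρ y := by nlinarith [hy.1]
    exact not_lt.2 this

/-- Points `x + t • (ν' - ν)` with small t > 0 would be inside according to `ν` and outside
according to `ν'`. -/
theorem IsOutwardNormal.unique {k : ℕ} {D : Set (E k)} {x ν ν' : E k}
    (h : IsOutwardNormal D x ν) (h' : IsOutwardNormal D x ν') : ν = ν' := by
  by_contra hne
  set c := 1 - inner ℝ ν ν' with hc
  have hd2 : ‖ν - ν'‖ ^ 2 = 2 * c := by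
    rw [norm_sub_sq_real, h.1, h'.1]; ring
  have hdpos : 0 < ‖ν' - ν‖ := norm_pos_iff.2 (sub_ne_zero.2 (Ne.symm hne))
  have hcpos : 0 < c := by
    rw [norm_sub_rev] at hd2; nlinarith [sq_pos_of_pos hdpos]
  set d := ν' - ν
  have h1 : inner ℝ d ν = -c := by
    rw [inner_sub_left, real_inner_self_eq_norm_sq, h.1, real_inner_comm]; ring
  have h2 : inner ℝ d ν' = c := by
    rw [inner_sub_left, real_inner_self_eq_norm_sq, h'.1]; ring
  set η := c / (2 * ‖d‖) with hη
  have hηpos : 0 < η := by positivity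
  have hηd : η * ‖d‖ = c / 2 := by rw [hη]; field_simp
  have hlim : Tendsto (fun t : ℝ => x + t • d) (𝓝[>] 0) (𝓝 x) := by
    have : Continuous fun t : ℝ => x + t • d := by fun_prop
    simpa using (this.tendsto 0).mono_left nhdsWithin_le_nhds
  obtain ⟨t, ⟨ht1, ht2⟩, ht0⟩ := ((hlim.eventually ((h.2 η hηpos).and (h'.2 η hηpos))).and
    self_mem_nhdsWithin).exists
  have ht0 : 0 < t := ht0
  simp only [add_sub_cancel_left, norm_smul, inner_smul_left, h1, h2, Real.norm_eq_abs,
    abs_of_pos ht0, conj_trivial] at ht1 ht2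
  have e1 : η * (t * ‖d‖) = t * (c / 2) := by rw [← hηd]; ring
  have e2 : -η * (t * ‖d‖) = -(t * (c / 2)) := by rw [← hηd]; ring
  rw [e2] at ht1
  rw [e1] at ht2
  have h3 : 0 < t * (c / 2) := by positivity
  exact ht2.2 (by nlinarith) (ht1.1 (by nlinarith))

theorem IsOutwardNormal.outwardNormal_eq {k : ℕ} {D : Set (E k)} {x ν : E k}
    (h : IsOutwardNormal D x ν) : outwardNormal D x = ν := by
  have hex : ∃ ν, IsOutwardNormal D x ν := ⟨ν, h⟩
  rw [outwardNormal, dif_pos hex]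
  exact hex.choose_spec.unique h

theorem norm_outwardNormal_le {k : ℕ} (D : Set (E k)) (x : E k) : ‖outwardNormal D x‖ ≤ 1 := by
  unfold outwardNormal
  split_ifs with h
  · exact h.choose_spec.1.le
  · simp

/-- The gradient of a real functional. -/
noncomputable def grad (g' : E m →L[ℝ] ℝ) : E m := (InnerProductSpace.toDual ℝ (E m)).symm g'

theorem inner_grad (g' : E m →L[ℝ] ℝ) (v : E m) : inner ℝ (grad g') v = g' v :=
  InnerProductSpace.toDual_symm_apply

theorem continuous_grad : Continuous (grad (m := m)) :=
  (InnerProductSpace.toDual ℝ (E m)).symm.continuous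

/-- Since `g` is constant along `e`, its gradient has no component there. Hence `e - grad g'`, the
direction of the normal of the section, cannot vanish. -/
theorem GraphChart.grad_ne {S : Set (E m)} {p : E m} {r : ℝ} {e : E m} {κ : NNReal} {g : E m → ℝ}
    (h : GraphChart S p r e κ g) {q : E m} {g' : E m →L[ℝ] ℝ} (hg : HasFDerivAt g g' q) :
    inner ℝ (e - grad g') e = 1 := by
  rw [inner_sub_left, h.inner_self, inner_grad, h.fderiv_apply_e hg, sub_zero]

/-- At the points of the lateral boundary where the graph is differentiable the outward normal
exists. -/
theorem Shear.isOutwardNormal (N : Shear m) {p : E m} {r : ℝ} {e : E m} {κ : NNReal} {g : E m → ℝ}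
    (h : GraphChart N.sec p r e κ g) {s : ℝ} (hs : s ∈ N.range) {q : E m}
    (hq : q ∈ Metric.ball p r) (hqg : inner ℝ q e = g q) {g' : E m →L[ℝ] ℝ}
    (hg : HasFDerivAt g g' q) :
    N.lift s (e - grad g') ≠ 0 ∧ IsOutwardNormal N.dom (N.pt s q)
      (‖N.lift s (e - grad g')‖⁻¹ • N.lift s (e - grad g')) := by
  have hne : N.lift s (e - grad g') ≠ 0 := fun h0 => by
    have h1 := N.proj_lift s (e - grad g')
    have h2 := h.grad_ne hg
    rw [← h1, h0, map_zero, inner_zero_left] at h2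
    exact zero_ne_one h2
  -- The defining function of the tube is that of the section evaluated at `sc`; its gradient is the
  -- lift of the gradient of the latter.
  refine ⟨hne, isOutwardNormal_of_hasFDerivAt
    (ρ := fun x => inner ℝ (N.sc x) e - g (N.sc x)) hne ?_ ?_ ?_⟩
  · have hsx : N.ht (N.pt s q) ∈ N.range := by rwa [N.ht_pt]
    have h1 := N.hasFDerivAt_sc hsx
    rw [N.ht_pt] at h1
    have h2 : HasFDerivAt (fun x => inner ℝ (N.sc x) e)
        ((innerSL ℝ e).comp (N.proj - N.ht.smulRight (N.dprof s))) (N.pt s q) := by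
      have := (innerSL ℝ e).hasFDerivAt.comp (N.pt s q) h1
      refine this.congr_of_eventuallyEq (Eventually.of_forall fun x => ?_)
      simp [real_inner_comm]
    have h3 : HasFDerivAt (fun x => g (N.sc x))
        (g'.comp (N.proj - N.ht.smulRight (N.dprof s))) (N.pt s q) := by
      refine HasFDerivAt.comp (N.pt s q) ?_ h1
      rwa [N.sc_pt]
    refine (h2.sub h3).congr_fderiv ?_
    ext v
    rw [innerSL_apply_apply, N.inner_lift, inner_sub_left, inner_grad]
    simp [inner_sub_right, inner_smul_right]
  · simp [hqg]
  · have hc : ContinuousAt N.sc (N.pt s q) :=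
      N.continuousOn_sc.continuousAt (N.isOpen_strip.mem_nhds (by simpa using hs))
    have h1 : ∀ᶠ x in 𝓝 (N.pt s q), N.ht x ∈ N.range :=
      N.isOpen_strip.mem_nhds (by simpa using hs)
    have h2 : ∀ᶠ x in 𝓝 (N.pt s q), N.sc x ∈ Metric.ball p r :=
      hc.preimage_mem_nhds (by rw [N.sc_pt]; exact Metric.isOpen_ball.mem_nhds hq)
    filter_upwards [h1, h2] with x hx1 hx2
    rw [sub_neg, ← h.mem_iff _ hx2]
    exact ⟨fun hx => hx.2, fun hx => ⟨hx1, hx⟩⟩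

end BalanceLaw

namespace BalanceLaw

variable {m : ℕ}

/-! ### Convex domains are Lipschitz domains -/

theorem norm_le_abs_inner_add_perp {e : E m} (he : ‖e‖ = 1) (v : E m) :
    ‖v‖ ≤ |inner ℝ v e| + ‖v - inner ℝ v e • e‖ := by
  have h := norm_add_le (inner ℝ v e • e) (v - inner ℝ v e • e)
  rw [add_sub_cancel, norm_smul, he, mul_one, Real.norm_eq_abs] at h
  exact h

/-- The direction `e` points from an interior point `c` to the boundary point. By convexity, near
`p` the set contains, below each of its points, a cone of fixed aperture. The supremum of all these
cones is a Lipschitz function whose subgraph is the set. -/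
theorem isLipschitzDomain_of_convex {S : Set (E m)} (ho : IsOpen S) (hne : S.Nonempty)
    (hb : Bornology.IsBounded S) (hc : Convex ℝ S) : IsLipschitzDomain S := by
  refine ⟨ho, ⟨hne, hc.isPreconnected⟩, hb, fun p hp => ?_⟩
  obtain ⟨c, hcS⟩ := hne
  obtain ⟨R, hR, hRS⟩ := Metric.isOpen_iff.1 ho c hcS
  have hpS : p ∉ S := by rw [ho.frontier_eq] at hp; exact hp.2
  have hpc : p - c ≠ 0 := fun h => hpS (by rw [sub_eq_zero.1 h]; exact hcS)
  set D := ‖p - c‖ with hD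
  have hD0 : 0 < D := norm_pos_iff.2 hpc
  set e := D⁻¹ • (p - c) with he
  have he1 : ‖e‖ = 1 := by
    rw [he, norm_smul, norm_inv, Real.norm_eq_abs, abs_of_pos hD0, inv_mul_cancel₀ hD0.ne']
  have hpe : p - c = D • e := by rw [he, smul_smul, mul_inv_cancel₀ hD0.ne', one_smul]
  set π : E m → E m := fun y => y - inner ℝ y e • e with hπ
  have hπlip := lipschitzWith_sub_inner_smul he1
  have hee : inner ℝ e e = 1 := by rw [real_inner_self_eq_norm_sq, he1, one_pow]
  set r := min (D / 4) (R / 4) with hr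
  have hr0 : 0 < r := by positivity
  have hrD : r ≤ D / 4 := min_le_left _ _
  have hrR : r ≤ R / 4 := min_le_right _ _
  set κ : NNReal := ⟨4 * D / R, by positivity⟩ with hκ
  have hκv : (κ : ℝ) = 4 * D / R := rfl
  have hκ0 : 0 < (κ : ℝ) := by rw [hκv]; positivity
  -- the cone condition
  have cone : ∀ z ∈ S ∩ Metric.ball p r, ∀ y ∈ Metric.ball p r,
      κ * ‖π z - π y‖ < inner ℝ z e - inner ℝ y e → y ∈ S := by
    rintro z ⟨hzS, hzp⟩ y hyp hlt
    rw [Metric.mem_ball, dist_eq_norm] at hzp hyp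
    set b := inner ℝ (z - c) e with hbdef
    have hb1 : |b - D| ≤ r := by
      have : b - D = inner ℝ (z - p) e := by
        have : z - c = (z - p) + D • e := by rw [← hpe]; abel
        rw [hbdef, this, inner_add_left, inner_smul_left, hee]; simp
      rw [this]
      refine (abs_real_inner_le_norm _ _).trans ?_
      rw [he1, mul_one]; exact hzp.le
    rw [abs_le] at hb1
    set δ := inner ℝ z e - inner ℝ y e with hδ
    have hδ0 : 0 < δ := lt_of_le_of_lt (by positivity) hlt
    have hδr : δ < 2 * r := by
      have h1 : δ = inner ℝ (z - y) e := by rw [inner_sub_left]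
      have h2 := abs_real_inner_le_norm (z - y) e
      have h3 : ‖z - y‖ ≤ ‖z - p‖ + ‖y - p‖ := by
        have : z - y = (z - p) - (y - p) := by abel
        rw [this]; exact norm_sub_le _ _
      rw [he1, mul_one, ← h1] at h2
      linarith [le_abs_self δ]
    have hb0 : 0 < b := by linarith
    set t := δ / b with ht
    have ht0 : 0 < t := div_pos hδ0 hb0
    have ht1 : t < 1 := by rw [ht, div_lt_one hb0]; linarith
    -- The ray from `z` through `y` meets the hyperplane through `c` orthogonal to `e` here. The
    -- slope `κ = 4 * D / R` makes this point lie in the ball around `c`, and `y` lies between it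
    -- and `z`.
    set c' := z + t⁻¹ • (y - z) with hc'
    have hc'S : c' ∈ S := by
      refine hRS ?_
      rw [Metric.mem_ball, dist_eq_norm]
      have hin : inner ℝ (c' - c) e = 0 := by
        have h1 : c' - c = (z - c) + t⁻¹ • (y - z) := by rw [hc']; abel
        have h2 : inner ℝ (y - z) e = -δ := by rw [inner_sub_left, hδ]; ring
        rw [h1, inner_add_left, inner_smul_left, h2, ← hbdef, ht, inv_div]
        simp only [conj_trivial]
        field_simp
        ring
      have h3 := norm_le_abs_inner_add_perp he1 (c' - c)
      rw [hin, abs_zero, zero_add, zero_smul, sub_zero] at h3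
      have hperp : c' - c = (π z - π p) + t⁻¹ • (π y - π z) := by
        have hlin : ∀ u v : E m, π u - π v = π (u - v) := fun u v => by
          simp only [hπ, inner_sub_left, sub_smul]; abel
        have hadd : ∀ u v : E m, π (u + v) = π u + π v := fun u v => by
          simp only [hπ, inner_add_left, add_smul]; abel
        have hsm : ∀ (a : ℝ) (u : E m), π (a • u) = a • π u := fun a u => by
          simp only [hπ, inner_smul_left, smul_sub, smul_smul]; simp
        have hpi : π (c' - c) = c' - c := by simp only [hπ, hin, zero_smul, sub_zero]
        have hpe0 : π (D • e) = 0 := by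
          simp only [hπ, inner_smul_left, hee]; simp
        have hsplit : c' - c = (z - p) + D • e + t⁻¹ • (y - z) := by
          rw [← hpe, hc']; abel
        rw [← hpi, hsplit, hadd, hadd, hpe0, hsm, add_zero, hlin, hlin]
      have hz : ‖π z - π p‖ ≤ r := by
        have := hπlip.dist_le_mul z p
        rw [NNReal.coe_one, one_mul, dist_eq_norm, dist_eq_norm] at this
        exact this.trans hzp.le
      have hyz : ‖t⁻¹ • (π y - π z)‖ ≤ R / 2 := by
        rw [norm_smul, norm_inv, Real.norm_eq_abs, abs_of_pos ht0, ht, inv_div, norm_sub_rev]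
        have h5 : ‖π z - π y‖ < δ / κ := by rw [lt_div_iff₀ hκ0]; linarith
        have h6 : b / δ * ‖π z - π y‖ ≤ b / δ * (δ / κ) :=
          mul_le_mul_of_nonneg_left h5.le (by positivity)
        have h7 : b / δ * (δ / κ) = b * R / (4 * D) := by rw [hκv]; field_simp
        rw [h7] at h6
        refine h6.trans ?_
        rw [div_le_div_iff₀ (by positivity) (by norm_num)]
        nlinarith
      have h8 := norm_add_le (π z - π p) (t⁻¹ • (π y - π z))
      rw [← hperp] at h8
      linarith
    have hy : y = z + t • (c' - z) := by
      rw [hc', add_sub_cancel_left, smul_smul, mul_inv_cancel₀ ht0.ne', one_smul]; abel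
    rw [hy]
    exact hc.add_smul_sub_mem hzS hc'S ⟨ht0.le, ht1.le⟩
  obtain ⟨z₀, hz₀⟩ : (S ∩ Metric.ball p r).Nonempty := by
    obtain ⟨z, hz1, hz2⟩ := mem_closure_iff_nhds.1 (frontier_subset_closure hp) _
      (Metric.ball_mem_nhds p hr0)
    exact ⟨z, hz2, hz1⟩
  have : Nonempty ↥(S ∩ Metric.ball p r) := ⟨⟨z₀, hz₀⟩⟩
  -- The upper envelope of the downward cones with apices in the set; each of them is `κ`-Lipschitz,
  -- hence so is the supremum.
  set g : E m → ℝ := fun y => ⨆ z : ↥(S ∩ Metric.ball p r), (inner ℝ (z : E m) e - κ * ‖π z - y‖)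
    with hg
  have hbdd : ∀ y, BddAbove (Set.range fun z : ↥(S ∩ Metric.ball p r) =>
      (inner ℝ (z : E m) e - κ * ‖π z - y‖)) := by
    intro y
    refine ⟨‖p‖ + r, ?_⟩
    rintro _ ⟨z, rfl⟩
    have h1 := abs_real_inner_le_norm (z : E m) e
    have h2 : ‖(z : E m)‖ ≤ ‖p‖ + r := by
      have h3 := z.2.2
      rw [Metric.mem_ball, dist_eq_norm] at h3
      have h4 := norm_add_le p ((z : E m) - p)
      rw [add_sub_cancel] at h4
      linarith
    have h5 : 0 ≤ κ * ‖π z - y‖ := by positivity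
    rw [he1, mul_one] at h1
    have := le_abs_self (inner ℝ (z : E m) e)
    simp only
    linarith
  refine ⟨r, e, κ, g, hr0, he1, ?_, fun y hy => ?_⟩
  · refine LipschitzWith.of_le_add_mul κ fun y y' => ?_
    refine ciSup_le fun z => ?_
    have h1 := le_ciSup (hbdd y') z
    have h2 : ‖π z - y'‖ ≤ ‖π z - y‖ + dist y y' := by
      rw [dist_eq_norm]
      have : π z - y' = (π z - y) + (y - y') := by abel
      rw [this]; exact norm_add_le _ _
    have h3 := mul_le_mul_of_nonneg_left h2 κ.coe_nonneg
    linarith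
  · constructor
    · intro hyS
      have hnear : ∀ᶠ t : ℝ in 𝓝[>] 0, y + t • e ∈ S ∩ Metric.ball p r := by
        have h1 : Tendsto (fun t : ℝ => y + t • e) (𝓝[>] 0) (𝓝 y) := by
          have : Continuous fun t : ℝ => y + t • e := by fun_prop
          simpa using (this.tendsto 0).mono_left nhdsWithin_le_nhds
        exact h1 (inter_mem (ho.mem_nhds hyS) (Metric.isOpen_ball.mem_nhds hy))
      obtain ⟨t, ht, ht0⟩ := (hnear.and self_mem_nhdsWithin).exists
      have ht0 : 0 < t := ht0
      have h2 := le_ciSup (hbdd (π y)) ⟨y + t • e, ht⟩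
      have h3 : π (y + t • e) = π y := by
        simp only [hπ, inner_add_left, inner_smul_left, hee, add_smul]; simp
      simp only [h3, sub_self, norm_zero, mul_zero, sub_zero, inner_add_left, inner_smul_left,
        hee] at h2
      simp at h2
      change _ < g (π y)
      linarith
    · intro hlt
      obtain ⟨z, hz⟩ := exists_lt_of_lt_ciSup hlt
      exact cone z z.2 y hy (by simp only [hπ] at hz ⊢; linarith)

/-! ### The volume of a boundary layer -/

/-- The layer is translated along `e` by multiples of `3 * c`. The translates occupy disjoint ranges
of levels, each of width `2 * c`; about `1 / (3 * c)` of them fit in the ball of radius `r + 1`, so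
each has a proportion O(c) of its volume. -/
theorem GraphChart.volume_level_le {S : Set (E m)} {p : E m} {r : ℝ} {e : E m} {κ : NNReal}
    {g : E m → ℝ} (h : GraphChart S p r e κ g) {c : ℝ} (hc : 0 < c) (hc1 : c ≤ 1 / 3) :
    volume.real {y ∈ Metric.ball p r | |inner ℝ y e - g y| ≤ c}
      ≤ 6 * c * volume.real (Metric.ball p (r + 1)) := by
  set A := {y ∈ Metric.ball p r | |inner ℝ y e - g y| ≤ c} with hA
  have hAm : MeasurableSet A := by
    have h1 : MeasurableSet {y | |inner ℝ y e - g y| ≤ c} := by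
      refine measurableSet_le ?_ measurable_const
      have := h.lip.continuous
      exact (Continuous.measurable (by fun_prop))
    exact measurableSet_ball.inter h1
  set J := ⌊1 / (3 * c)⌋₊ with hJ
  have hJ1 : (J : ℝ) ≤ 1 / (3 * c) := Nat.floor_le (by positivity)
  have hJ2 : 1 / (3 * c) < J + 1 := Nat.lt_floor_add_one _
  have hJ3 : 1 ≤ J := Nat.one_le_floor_iff _ |>.2 (by
    rw [le_div_iff₀ (by positivity)]; linarith)
  have hJ4 : 1 ≤ 6 * c * J := by
    have h3 : (1 : ℝ) ≤ J := by exact_mod_cast hJ3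
    rw [div_lt_iff₀ (by positivity)] at hJ2
    nlinarith
  set B : ℕ → Set (E m) := fun j => (fun y => (3 * c * j) • e + y) '' A with hB
  have hBm : ∀ j, MeasurableSet (B j) := fun j => by
    have : B j = (fun y => -((3 * c * j) • e) + y) ⁻¹' A := by
      rw [hB]; exact Set.image_add_left
    rw [this]; exact (measurable_const_add _) hAm
  have hBv : ∀ j, volume.real (B j) = volume.real A := fun j => by
    simp [hB, Measure.real, image_add_left, measure_preimage_add]
  have hlev : ∀ j, ∀ y ∈ B j, |inner ℝ y e - g y - 3 * c * j| ≤ c := by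
    rintro j _ ⟨y, hy, rfl⟩
    have h1 : (3 * c * j : ℝ) • e + y = y + (3 * c * j : ℝ) • e := add_comm _ _
    simp only
    rw [h1, h.inner_add_smul, h.invariant]
    have := hy.2
    rwa [add_sub_right_comm, add_sub_cancel_right]
  have hdisj : PairwiseDisjoint (↑(Finset.range J)) B := by
    intro i _ j _ hij
    rw [Function.onFun, Set.disjoint_left]
    intro y hyi hyj
    have h1 := hlev i y hyi
    have h2 := hlev j y hyj
    rw [abs_le] at h1 h2
    rcases lt_or_gt_of_ne hij with hlt | hlt
    · have : (i : ℝ) + 1 ≤ j := by exact_mod_cast hlt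
      nlinarith
    · have : (j : ℝ) + 1 ≤ i := by exact_mod_cast hlt
      nlinarith
  have hsub : (⋃ j ∈ Finset.range J, B j) ⊆ Metric.ball p (r + 1) := by
    intro y hy
    simp only [mem_iUnion, Finset.mem_range] at hy
    obtain ⟨j, hj, z, hz, rfl⟩ := hy
    have hz1 := hz.1
    rw [Metric.mem_ball, dist_eq_norm] at hz1 ⊢
    have h1 : (3 * c * j : ℝ) • e + z - p = (3 * c * j : ℝ) • e + (z - p) := by abel
    simp only
    rw [h1]
    refine (norm_add_le _ _).trans_lt ?_
    rw [norm_smul, h.norm_e, mul_one, Real.norm_eq_abs, abs_of_nonneg (by positivity)]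
    have : (j : ℝ) ≤ J := by exact_mod_cast hj.le
    have h2 : 3 * c * J ≤ 1 := by
      rw [le_div_iff₀ (by positivity)] at hJ1; linarith
    nlinarith
  have hsum : (J : ℝ) * volume.real A ≤ volume.real (Metric.ball p (r + 1)) := by
    have h1 : volume.real (⋃ j ∈ Finset.range J, B j) = ∑ j ∈ Finset.range J, volume.real (B j) :=
      measureReal_biUnion_finset hdisj (fun j _ => hBm j) fun j hj =>
        ne_top_of_le_ne_top (measure_ball_lt_top (x := p) (r := r + 1)).ne
          (measure_mono ((subset_biUnion_of_mem (u := B) hj).trans hsub))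
    rw [Finset.sum_congr rfl fun j _ => hBv j, Finset.sum_const, Finset.card_range,
      nsmul_eq_mul] at h1
    rw [← h1]
    exact measureReal_mono hsub measure_ball_lt_top.ne
  have hv : 0 ≤ volume.real A := measureReal_nonneg
  nlinarith [mul_le_mul_of_nonneg_left hsum (by positivity : 0 ≤ 6 * c)]

/-- The boundary layer of width `δ` of a Lipschitz domain has volume `O(δ)`. -/
theorem IsLipschitzDomain.exists_volume_layer_le {S : Set (E m)} (hS : IsLipschitzDomain S) :
    ∃ C δ₀ : ℝ, 0 ≤ C ∧ 0 < δ₀ ∧ ∀ δ, 0 < δ → δ ≤ δ₀ →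
      ∃ A : Set (E m), MeasurableSet A ∧ volume A < ⊤ ∧ volume.real A ≤ C * δ ∧
        ∀ q ∈ frontier S, ∀ y, dist y q ≤ δ → y ∈ A := by
  have hcomp : IsCompact (frontier S) :=
    Metric.isCompact_of_isClosed_isBounded isClosed_frontier
      (hS.isBounded.closure.subset frontier_subset_closure)
  choose! r e κ g hch using fun p (hp : p ∈ frontier S) => hS.exists_chart hp
  obtain ⟨t, htc⟩ := hcomp.elim_nhds_subcover' (fun p hp => Metric.ball p (r p / 2))
    fun p hp => Metric.ball_mem_nhds _ (by have := (hch p hp).pos; positivity)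
  have hmin : ∃ δ₀ : ℝ, 0 < δ₀ ∧ ∀ p ∈ t, δ₀ ≤ r p / 2 ∧ (2 + κ p) * δ₀ ≤ 1 / 3 := by
    clear htc
    induction t using Finset.induction_on with
    | empty => exact ⟨1, one_pos, by simp⟩
    | insert p t hp ih =>
      obtain ⟨δ₀, h0, h1⟩ := ih
      have hr := (hch p p.2).pos
      refine ⟨min δ₀ (min (r p / 2) (1 / 3 / (2 + κ p))), by positivity, fun q hq => ?_⟩
      rcases Finset.mem_insert.1 hq with rfl | hq
      · refine ⟨(min_le_right _ _).trans (min_le_left _ _), ?_⟩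
        have h2 : min δ₀ (min (r q / 2) (1 / 3 / (2 + κ q))) ≤ 1 / 3 / (2 + κ q) :=
          (min_le_right _ _).trans (min_le_right _ _)
        rw [le_div_iff₀ (by positivity)] at h2
        linarith
      · obtain ⟨h3, h4⟩ := h1 q hq
        refine ⟨(min_le_left _ _).trans h3, le_trans ?_ h4⟩
        exact mul_le_mul_of_nonneg_left (min_le_left _ _) (by positivity)
  obtain ⟨δ₀, hδ₀, hδt⟩ := hmin
  refine ⟨∑ p ∈ t, 6 * (2 + κ p) * volume.real (Metric.ball (p : E m) (r p + 1)), δ₀,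
    Finset.sum_nonneg fun p _ => by positivity, hδ₀, fun δ hδ hδδ => ?_⟩
  -- Moving by δ away from the graph changes `inner ℝ y (e p) - g p y` by at most `(1 + κ p) * δ`;
  -- the 2 leaves slack.
  set A : E m → Set (E m) := fun p =>
    {y ∈ Metric.ball p (r p) | |inner ℝ y (e p) - g p y| ≤ (2 + κ p) * δ} with hA
  have hAtop : ∀ p, volume (A p) < ⊤ := fun p =>
    (measure_mono (sep_subset _ _)).trans_lt measure_ball_lt_top
  refine ⟨⋃ p ∈ t, A p, ?_, ?_, ?_, ?_⟩
  · refine Finset.measurableSet_biUnion _ fun p _ => ?_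
    have h1 : MeasurableSet {y | |inner ℝ y (e p) - g p y| ≤ (2 + κ p) * δ} := by
      refine measurableSet_le ?_ measurable_const
      have := (hch p p.2).lip.continuous
      exact (Continuous.measurable (by fun_prop))
    exact measurableSet_ball.inter h1
  · exact (measure_biUnion_finset_le _ _).trans_lt (ENNReal.sum_lt_top.2 fun p _ => hAtop p)
  · rw [Finset.sum_mul]
    refine (measureReal_biUnion_finset_le _ _).trans (Finset.sum_le_sum fun p hp => ?_)
    have h1 := (hch p p.2).volume_level_le (c := (2 + κ p) * δ) (by positivity)
      (le_trans (mul_le_mul_of_nonneg_left hδδ (by positivity)) (hδt p hp).2)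
    refine h1.trans (le_of_eq (by ring))
  · intro q hq y hy
    have h1 := htc hq
    simp only [mem_iUnion] at h1
    obtain ⟨p, hpt, hqp⟩ := h1
    simp only [mem_iUnion]
    have hch' := hch p p.2
    refine ⟨p, hpt, ?_, ?_⟩
    · rw [Metric.mem_ball] at hqp ⊢
      have := dist_triangle y q p
      have := (hδt p hpt).1
      linarith
    · have hqb : q ∈ Metric.ball (p : E m) (r p) :=
        Metric.ball_subset_ball (by have := hch'.pos; linarith) hqp
      have h2 := (hch'.mem_frontier_iff hS.isOpen hqb).1 hq
      have h3 : inner ℝ y (e p) - g p y = inner ℝ (y - q) (e p) + (g p q - g p y) := by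
        rw [inner_sub_left, h2]; ring
      have h4 := abs_real_inner_le_norm (y - q) (e p)
      rw [hch'.norm_e, mul_one, ← dist_eq_norm] at h4
      have h5 := hch'.lip.dist_le_mul q y
      rw [Real.dist_eq, dist_comm q y] at h5
      rw [h3]
      refine (abs_add_le _ _).trans ?_
      have := mul_le_mul_of_nonneg_left hy (κ p).coe_nonneg
      linarith

end BalanceLaw

namespace BalanceLaw

/-! ### Functions with Hölder continuous gradient at a fixed time -/

/-- `w` is continuous on `closure Ω` and has in `Ω` the gradient `Dw`, which is bounded and Hölder
continuous on `closure Ω`. -/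
structure SliceHolder {k : ℕ} (Ω : Set (E k)) (α B : ℝ) (w : E k → ℂ)
    (Dw : E k → EuclideanSpace ℂ (Fin k)) : Prop where
  cont : ContinuousOn w (closure Ω)
  deriv : ∀ x ∈ Ω, ∃ L : E k →L[ℝ] ℂ, HasFDerivAt w L x ∧ ∀ v, L v = dotC v (Dw x)
  bound : ∀ x ∈ closure Ω, ‖Dw x‖ ≤ B
  holder : ∀ x ∈ closure Ω, ∀ y ∈ closure Ω, ‖Dw x - Dw y‖ ≤ B * dist x y ^ α

theorem C1HolderLE.slice {k : ℕ} {Ω : Set (E k)} {T α C : ℝ} {u : E k → ℝ → ℂ}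
    {Du : E k → ℝ → EuclideanSpace ℂ (Fin k)} {ut : E k → ℝ → ℂ} (hα : 0 < α)
    (h : C1HolderLE Ω T α C u Du ut) {t : ℝ} (ht : t ∈ Ioo 0 T) :
    SliceHolder Ω α C (fun x => u x t) (fun x => Du x t) := by
  have ht' : t ∈ Icc 0 T := Ioo_subset_Icc_self ht
  refine ⟨?_, fun x hx => ?_, fun x hx => h.norm_Du.norm_le (x := (x, t)) ⟨hx, ht'⟩,
    fun x hx y hy => ?_⟩
  · have h1 := h.norm_u.continuousOn_parDist hα
    exact h1.comp (f := fun x : E k => (x, t)) (by fun_prop) fun x hx => ⟨hx, ht'⟩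
  · obtain ⟨L, hL, hL1, -⟩ := h.deriv x hx t ht
    refine ⟨L.comp (ContinuousLinearMap.inl ℝ (E k) ℝ), ?_, fun v => ?_⟩
    · have h2 : HasFDerivAt (fun x : E k => (x, t)) (ContinuousLinearMap.inl ℝ (E k) ℝ) x :=
        hasFDerivAt_prodMk_left x t
      exact HasFDerivAt.comp x hL h2
    · simpa using clm_apply_eq_dotC L _ hL1 v
  · have := h.norm_Du.norm_sub_le (x := (x, t)) (y := (y, t)) ⟨hx, ht'⟩ ⟨hy, ht'⟩
      (parDist_nonneg _ _)
    rwa [parDist_same_time] at this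

namespace SliceHolder

variable {k : ℕ} {Ω : Set (E k)} {α B : ℝ} {w w' : E k → ℂ}
  {Dw Dw' : E k → EuclideanSpace ℂ (Fin k)}

theorem sub (h : SliceHolder Ω α B w Dw) (h' : SliceHolder Ω α B w' Dw') :
    SliceHolder Ω α (2 * B) (fun x => w x - w' x) (fun x => Dw x - Dw' x) := by
  refine ⟨h.cont.sub h'.cont, fun x hx => ?_, fun x hx => ?_, fun x hx y hy => ?_⟩
  · obtain ⟨L, hL, hL1⟩ := h.deriv x hx
    obtain ⟨L', hL', hL1'⟩ := h'.deriv x hx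
    exact ⟨L - L', hL.sub hL', fun v => by
      rw [_root_.sub_apply, hL1, hL1', ← dotC_sub_right]; rfl⟩
  · exact (norm_sub_le _ _).trans (by linarith [h.bound x hx, h'.bound x hx])
  · have : Dw x - Dw' x - (Dw y - Dw' y) = (Dw x - Dw y) - (Dw' x - Dw' y) := by abel
    rw [this]
    exact (norm_sub_le _ _).trans (by linarith [h.holder x hx y hy, h'.holder x hx y hy])

theorem B_nonneg (h : SliceHolder Ω α B w Dw) {x : E k} (hx : x ∈ closure Ω) : 0 ≤ B :=
  (norm_nonneg _).trans (h.bound x hx)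

theorem continuousOn_grad (hα : 0 < α) (h : SliceHolder Ω α B w Dw) :
    ContinuousOn Dw (closure Ω) := by
  intro q hq
  rw [ContinuousWithinAt, tendsto_iff_norm_sub_tendsto_zero]
  have h1 : Tendsto (fun p => B * dist p q ^ α) (𝓝[closure Ω] q) (𝓝 0) := by
    have : Continuous fun p => B * dist p q ^ α :=
      continuous_const.mul ((continuous_id.dist continuous_const).rpow_const fun _ => Or.inr hα.le)
    have h2 := this.tendsto q
    rw [dist_self, Real.zero_rpow hα.ne', mul_zero] at h2
    exact h2.mono_left nhdsWithin_le_nhds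
  refine squeeze_zero' (Eventually.of_forall fun _ => norm_nonneg _) ?_ h1
  filter_upwards [self_mem_nhdsWithin] with p hp
  exact h.holder p hp q hq

/-- First order Taylor estimate along a segment whose interior lies in `Ω`. -/
theorem norm_sub_sub_le (h : SliceHolder Ω α B w Dw) {x x' : E k}
    (hseg : ∀ τ ∈ Ioo (0 : ℝ) 1, x + τ • (x' - x) ∈ Ω)
    (P : EuclideanSpace ℂ (Fin k)) {b : ℝ}
    (hb : ∀ τ ∈ Ioo (0 : ℝ) 1, ‖Dw (x + τ • (x' - x)) - P‖ ≤ b) :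
    ‖w x' - w x - dotC (x' - x) P‖ ≤ b * ‖x' - x‖ := by
  set φ : ℝ → ℂ := fun τ => w (x + τ • (x' - x)) - τ * dotC (x' - x) P with hφ
  have hline : Continuous fun τ : ℝ => x + τ • (x' - x) := by fun_prop
  have hcl : ∀ τ ∈ Icc (0 : ℝ) 1, x + τ • (x' - x) ∈ closure Ω := by
    intro τ hτ
    have h1 : τ ∈ closure (Ioo (0 : ℝ) 1) := by rwa [closure_Ioo zero_ne_one]
    exact map_mem_closure (f := fun τ : ℝ => x + τ • (x' - x)) hline h1 hseg
  have hφc : ContinuousOn φ (Icc 0 1) := by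
    refine ContinuousOn.sub (h.cont.comp hline.continuousOn hcl) ?_
    exact Continuous.continuousOn (by fun_prop)
  have hd : ∀ τ ∈ Ioo (0 : ℝ) 1,
      HasDerivAt φ (dotC (x' - x) (Dw (x + τ • (x' - x)) - P)) τ := by
    intro τ hτ
    obtain ⟨L, hL, hL1⟩ := h.deriv _ (hseg τ hτ)
    have h2 : HasDerivAt (fun τ : ℝ => x + τ • (x' - x)) (x' - x) τ := by
      simpa using ((hasDerivAt_id τ).smul_const (x' - x)).const_add x
    have h3 := hL.comp_hasDerivAt τ h2
    have h4 : HasDerivAt (fun τ : ℝ => (τ : ℂ) * dotC (x' - x) P) (dotC (x' - x) P) τ := by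
      simpa using (Complex.ofRealCLM.hasDerivAt (x := τ)).mul_const (dotC (x' - x) P)
    rw [hL1] at h3
    have h5 := h3.sub h4
    rw [← dotC_sub_right] at h5
    exact h5
  have hbound : ∀ τ ∈ Ioo (0 : ℝ) 1,
      ‖dotC (x' - x) (Dw (x + τ • (x' - x)) - P)‖ ≤ b * ‖x' - x‖ := by
    intro τ hτ
    refine (norm_dotC_le_euclidean _ _).trans ?_
    rw [mul_comm]
    exact mul_le_mul_of_nonneg_right (hb τ hτ) (norm_nonneg _)
  -- Only the open segment is known to lie in Ω, so the mean value inequality is used between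
  -- interior parameters and extended to each endpoint by continuity.
  have hIoo : ∀ a ∈ Ioo (0 : ℝ) 1, ∀ c ∈ Ioo (0 : ℝ) 1,
      ‖φ c - φ a‖ ≤ b * ‖x' - x‖ * ‖c - a‖ := fun a ha c hc =>
    (convex_Ioo (0 : ℝ) 1).norm_image_sub_le_of_norm_hasDerivWithin_le
      (fun τ hτ => (hd τ hτ).hasDerivWithinAt) hbound ha hc
  have hlim1 : ∀ a ∈ Ioo (0 : ℝ) 1, ‖φ 1 - φ a‖ ≤ b * ‖x' - x‖ * ‖1 - a‖ := by
    intro a ha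
    have h1 : (1 : ℝ) ∈ closure (Ioo (0 : ℝ) 1) := by rw [closure_Ioo zero_ne_one]; simp
    have : (𝓝[Ioo (0 : ℝ) 1] 1).NeBot := mem_closure_iff_nhdsWithin_neBot.1 h1
    have hc1 : Tendsto φ (𝓝[Ioo (0 : ℝ) 1] 1) (𝓝 (φ 1)) :=
      (hφc 1 (by simp)).mono_left (nhdsWithin_mono _ Ioo_subset_Icc_self)
    refine le_of_tendsto_of_tendsto (hc1.sub_const (φ a)).norm (b := 𝓝[Ioo (0 : ℝ) 1] 1)
      (g := fun c => b * ‖x' - x‖ * ‖c - a‖) ?_ ?_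
    · exact (Continuous.tendsto (by fun_prop) 1).mono_left nhdsWithin_le_nhds
    · filter_upwards [self_mem_nhdsWithin] with c hc using hIoo a ha c hc
  have hlim0 : ‖φ 1 - φ 0‖ ≤ b * ‖x' - x‖ * ‖(1 : ℝ) - 0‖ := by
    have h1 : (0 : ℝ) ∈ closure (Ioo (0 : ℝ) 1) := by rw [closure_Ioo zero_ne_one]; simp
    have : (𝓝[Ioo (0 : ℝ) 1] 0).NeBot := mem_closure_iff_nhdsWithin_neBot.1 h1
    have hc1 : Tendsto φ (𝓝[Ioo (0 : ℝ) 1] 0) (𝓝 (φ 0)) :=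
      (hφc 0 (by simp)).mono_left (nhdsWithin_mono _ Ioo_subset_Icc_self)
    refine le_of_tendsto_of_tendsto (hc1.const_sub (φ 1)).norm (b := 𝓝[Ioo (0 : ℝ) 1] 0)
      (g := fun c : ℝ => b * ‖x' - x‖ * ‖1 - c‖) ?_ ?_
    · exact (Continuous.tendsto (by fun_prop) 0).mono_left nhdsWithin_le_nhds
    · filter_upwards [self_mem_nhdsWithin] with c hc using hlim1 c hc
  have e1 : φ 1 - φ 0 = w x' - w x - dotC (x' - x) P := by
    simp [hφ]; ring
  rw [e1] at hlim0
  simpa using hlim0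

theorem norm_sub_le (h : SliceHolder Ω α B w Dw) {x x' : E k}
    (hseg : ∀ τ ∈ Ioo (0 : ℝ) 1, x + τ • (x' - x) ∈ Ω) :
    ‖w x' - w x‖ ≤ B * ‖x' - x‖ := by
  have h1 := h.norm_sub_sub_le hseg 0 (b := B)
    fun τ hτ => by rw [sub_zero]; exact h.bound _ (subset_closure (hseg τ hτ))
  have h2 : dotC (x' - x) (0 : EuclideanSpace ℂ (Fin k)) = 0 := by simp [dotC]
  rwa [h2, sub_zero] at h1

/-- First order Taylor estimate with a centre `c` at which the gradient is evaluated. -/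
theorem norm_sub_sub_le_of_dist_le (hα : 0 < α) (h : SliceHolder Ω α B w Dw) {x x' c : E k}
    (hc : c ∈ closure Ω) (hseg : ∀ τ ∈ Ioo (0 : ℝ) 1, x + τ • (x' - x) ∈ Ω) {R : ℝ}
    (hR : dist x c ≤ R) (hR' : dist x' c ≤ R) :
    ‖w x' - w x - dotC (x' - x) (Dw c)‖ ≤ B * R ^ α * ‖x' - x‖ := by
  refine h.norm_sub_sub_le hseg _ fun τ hτ => ?_
  refine (h.holder _ (subset_closure (hseg τ hτ)) c hc).trans ?_
  refine mul_le_mul_of_nonneg_left (Real.rpow_le_rpow dist_nonneg ?_ hα.le) (h.B_nonneg hc)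
  have h1 : x + τ • (x' - x) ∈ Metric.closedBall c R :=
    (convex_closedBall c R).add_smul_sub_mem (Metric.mem_closedBall.2 hR)
      (Metric.mem_closedBall.2 hR') (Ioo_subset_Icc_self hτ)
  exact Metric.mem_closedBall.1 h1

end SliceHolder

/-! ### Functions that vanish on the lateral boundary -/

/-- The first time at which the ray has left the set: finite by boundedness, positive and attained
by openness. -/
theorem exists_exit {m : ℕ} {S : Set (E m)} (ho : IsOpen S) (hb : Bornology.IsBounded S) {y d : E m}
    (hy : y ∈ S) (hd : d ≠ 0) :
    ∃ τ : ℝ, 0 < τ ∧ y + τ • d ∈ frontier S ∧ ∀ τ' ∈ Ico 0 τ, y + τ' • d ∈ S := by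
  set Z : Set ℝ := {τ | 0 ≤ τ ∧ y + τ • d ∉ S} with hZ
  have hline : Continuous fun τ : ℝ => y + τ • d := by fun_prop
  have hZc : IsClosed Z := by
    have h1 : IsClosed ((fun τ : ℝ => y + τ • d) ⁻¹' Sᶜ) := ho.isClosed_compl.preimage hline
    exact isClosed_Ici.inter h1
  have hZne : Z.Nonempty := by
    obtain ⟨R, hR⟩ := hb.subset_closedBall y
    refine ⟨(|R| + 1) / ‖d‖, by positivity, fun h => ?_⟩
    have h1 := hR h
    rw [Metric.mem_closedBall, dist_eq_norm, add_sub_cancel_left, norm_smul, Real.norm_eq_abs,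
      abs_of_nonneg (by positivity), div_mul_cancel₀ _ (norm_ne_zero_iff.2 hd)] at h1
    linarith [le_abs_self R]
  have hZb : BddBelow Z := ⟨0, fun τ hτ => hτ.1⟩
  have hmem := hZc.csInf_mem hZne hZb
  set τ := sInf Z with hτ
  have hbelow : ∀ τ' ∈ Ico 0 τ, y + τ' • d ∈ S := fun τ' h => by
    by_contra hn
    exact absurd (csInf_le hZb ⟨h.1, hn⟩) (not_le.2 h.2)
  have hpos : 0 < τ := by
    refine lt_of_le_of_ne hmem.1 fun h0 => hmem.2 ?_
    rw [← h0]; simpa using hy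
  refine ⟨τ, hpos, ?_, hbelow⟩
  rw [ho.frontier_eq]
  refine ⟨?_, hmem.2⟩
  have h1 : τ ∈ closure (Ico 0 τ) := by rw [closure_Ico hpos.ne]; exact ⟨hpos.le, le_rfl⟩
  exact map_mem_closure (f := fun τ : ℝ => y + τ • d) hline h1 hbelow

section Lateral

variable {m : ℕ} {N : Shear m} {Ω : Set (E (m + 1))} {α B : ℝ} {w : E (m + 1) → ℂ}
  {Dw : E (m + 1) → EuclideanSpace ℂ (Fin (m + 1))}

theorem Shear.pt_mem_closure {s : ℝ} (hs : s ∈ N.range) {y : E m} (hy : y ∈ closure N.sec) :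
    N.pt s y ∈ closure N.dom :=
  map_mem_closure (N.continuous_pt_right s) hy fun _ hz => N.pt_mem_dom hs hz

theorem Shear.pt_segment (s : ℝ) (y y' : E m) (τ : ℝ) :
    N.pt s y + τ • (N.pt s y' - N.pt s y) = N.pt s (y + τ • (y' - y)) := by
  rw [N.pt_sub_pt_same, Shear.pt, Shear.pt]
  simp only [map_add, map_smul]; abel

/-- The gradient is orthogonal to the tangent of the curve. -/
theorem SliceHolder.dotC_tangent_eq_zero (hα : 0 < α) (h : SliceHolder Ω α B w Dw)
    (hN : N.dom ⊆ Ω) (h0 : ∀ x ∈ N.lateral, w x = 0) {s : ℝ} (hs : s ∈ N.range) {q : E m}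
    (hq : q ∈ frontier N.sec) : dotC (N.tangent s) (Dw (N.pt s q)) = 0 := by
  set c := dotC (N.tangent s) (Dw (N.pt s q)) with hc
  have hqc : q ∈ closure N.sec := frontier_subset_closure hq
  have hncl : closure N.dom ⊆ closure Ω := closure_mono hN
  -- the derivative along the translated curves
  set ψ : ℝ × E m → ℂ := fun p => dotC (N.tangent p.1) (Dw (N.pt p.1 p.2)) with hψ
  have hcont : ContinuousOn ψ (N.range ×ˢ closure N.sec) := by
    have hpt : ContinuousOn (fun p : ℝ × E m => N.pt p.1 p.2) (N.range ×ˢ closure N.sec) := by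
      unfold Shear.pt
      have h1 : ContinuousOn (fun p : ℝ × E m => N.prof p.1) (N.range ×ˢ closure N.sec) :=
        N.continuousOn_prof.comp continuousOn_fst fun p hp => hp.1
      exact (continuousOn_fst.smul continuousOn_const).add
        (N.emb.continuous.comp_continuousOn (continuousOn_snd.add h1))
    have hD : ContinuousOn (fun p : ℝ × E m => Dw (N.pt p.1 p.2)) (N.range ×ˢ closure N.sec) :=
      (h.continuousOn_grad hα).comp hpt fun p hp => hncl (Shear.pt_mem_closure hp.1 hp.2)
    have ht : ContinuousOn (fun p : ℝ × E m => N.tangent p.1) (N.range ×ˢ closure N.sec) := by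
      unfold Shear.tangent
      exact continuousOn_const.add (N.emb.continuous.comp_continuousOn
        (N.continuousOn_dprof.comp continuousOn_fst fun p hp => hp.1))
    simp only [hψ, dotC]
    refine continuousOn_finsetSum _ fun i _ => ContinuousOn.mul ?_ ?_
    · exact Complex.continuous_ofReal.comp_continuousOn
        ((EuclideanSpace.proj i).continuous.comp_continuousOn ht)
    · exact (EuclideanSpace.proj (𝕜 := ℂ) i).continuous.comp_continuousOn hD
  by_contra hc0
  have hcpos : 0 < ‖c‖ := norm_pos_iff.2 hc0
  have hnear := hcont (s, q) ⟨hs, hqc⟩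
  rw [Metric.continuousWithinAt_iff] at hnear
  obtain ⟨δ, hδ, hδ'⟩ := hnear (‖c‖ / 2) (by positivity)
  obtain ⟨δ₁, hδ₁, hδ₁'⟩ := Metric.isOpen_iff.1 N.isOpen_range s hs
  set s' := s + min δ δ₁ / 2 with hs'
  have hmin : 0 < min δ δ₁ := by positivity
  have hball : ∀ σ ∈ Icc s s', dist σ s < min δ δ₁ := fun σ hσ => by
    rw [Real.dist_eq, abs_lt]; constructor <;> linarith [hσ.1, hσ.2]
  have hrange : ∀ σ ∈ Icc s s', σ ∈ N.range := fun σ hσ =>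
    hδ₁' (Metric.mem_ball.2 ((hball σ hσ).trans_le (min_le_right _ _)))
  have hss' : s ≤ s' := by linarith
  -- Differentiability is available only inside Ω, so the increment is computed along translates of
  -- the curve through interior `y` near `q`. As `y` tends to `q` both values of `w` tend to zero,
  -- which contradicts a derivative close to `c ≠ 0`.
  have key : ∀ y ∈ N.sec, dist y q < δ →
      ‖w (N.pt s' y) - w (N.pt s y) - (s' - s : ℝ) * c‖ ≤ ‖c‖ / 2 * ‖s' - s‖ := by
    intro y hy hyq
    have hd : ∀ σ ∈ Icc s s', HasDerivWithinAt (fun σ => w (N.pt σ y) - σ * c)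
        (ψ (σ, y) - c) (Icc s s') σ := by
      intro σ hσ
      obtain ⟨L, hL, hL1⟩ := h.deriv _ (hN (N.pt_mem_dom (hrange σ hσ) hy))
      have h3 := hL.comp_hasDerivAt σ (N.hasDerivAt_pt (hrange σ hσ) y)
      rw [hL1] at h3
      have h4 : HasDerivAt (fun τ : ℝ => (τ : ℂ) * c) c σ := by
        simpa using (Complex.ofRealCLM.hasDerivAt (x := σ)).mul_const c
      exact (h3.sub h4).hasDerivWithinAt
    have hb : ∀ σ ∈ Icc s s', ‖ψ (σ, y) - c‖ ≤ ‖c‖ / 2 := by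
      intro σ hσ
      have h5 := hδ' (x := (σ, y)) ⟨hrange σ hσ, subset_closure hy⟩ (by
        rw [Prod.dist_eq]; exact max_lt ((hball σ hσ).trans_le (min_le_left _ _)) hyq)
      rw [dist_eq_norm] at h5
      exact h5.le
    have h6 := (convex_Icc s s').norm_image_sub_le_of_norm_hasDerivWithin_le hd hb
      (left_mem_Icc.2 hss') (right_mem_Icc.2 hss')
    have e1 : w (N.pt s' y) - s' * c - (w (N.pt s y) - s * c)
        = w (N.pt s' y) - w (N.pt s y) - (s' - s : ℝ) * c := by push_cast; ring
    rwa [e1] at h6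
  have hwlim : ∀ σ ∈ N.range, Tendsto (fun y => w (N.pt σ y)) (𝓝[N.sec] q) (𝓝 0) := by
    intro σ hσ
    have h7 : ContinuousOn (fun y => w (N.pt σ y)) (closure N.sec) :=
      h.cont.comp (N.continuous_pt_right σ).continuousOn
        fun y hy => hncl (Shear.pt_mem_closure hσ hy)
    have h8 := (h7 q hqc).mono_left (nhdsWithin_mono _ subset_closure)
    simp only [h0 _ (N.pt_mem_lateral hσ hq)] at h8
    exact h8
  have : (𝓝[N.sec] q).NeBot := mem_closure_iff_nhdsWithin_neBot.1 hqc
  have hlim := (((hwlim s' (hrange s' ⟨hss', le_rfl⟩)).sub (hwlim s hs)).sub_const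
    ((s' - s : ℝ) * c)).norm
  have hle := le_of_tendsto hlim (b := ‖c‖ / 2 * ‖s' - s‖) (by
    filter_upwards [self_mem_nhdsWithin, mem_nhdsWithin_of_mem_nhds (Metric.ball_mem_nhds q hδ)]
      with y hy hy'
    exact key y hy hy')
  rw [sub_zero, zero_sub, norm_neg, norm_mul, Complex.norm_real] at hle
  have h9 : 0 < ‖s' - s‖ := by rw [Real.norm_eq_abs, abs_of_pos] <;> linarith
  nlinarith

theorem SliceHolder.norm_le_of_exit (h : SliceHolder Ω α B w Dw)
    (hN : N.dom ⊆ Ω) (h0 : ∀ x ∈ N.lateral, w x = 0) {s : ℝ} (hs : s ∈ N.range) {y q : E m}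
    (hq : q ∈ frontier N.sec)
    (hseg : ∀ τ ∈ Ioo (0 : ℝ) 1, y + τ • (q - y) ∈ N.sec) :
    ‖w (N.pt s y)‖ ≤ B * dist q y := by
  have h1 := h.norm_sub_le (x := N.pt s y) (x' := N.pt s q)
    fun τ hτ => by rw [N.pt_segment]; exact hN (N.pt_mem_dom hs (hseg τ hτ))
  rwa [h0 _ (N.pt_mem_lateral hs hq), zero_sub, norm_neg, ← dist_eq_norm, N.dist_pt_pt_same] at h1

/-- A chord of length at most `ℓ` through `y` in the direction `d`. -/
def HasShortChord (S : Set (E m)) (y d : E m) (ℓ : ℝ) : Prop :=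
  ∃ τ₁ τ₂ : ℝ, 0 < τ₁ ∧ 0 < τ₂ ∧ τ₁ + τ₂ ≤ ℓ ∧ y + τ₁ • d ∈ frontier S ∧
    y - τ₂ • d ∈ frontier S ∧ ∀ τ ∈ Ioo (-τ₂) τ₁, y + τ • d ∈ S

/-- The chord ends where the two rays leave the set. The width controls only points of the set, so
the ends are first moved slightly inwards. -/
theorem hasShortChord_of_width {S : Set (E m)} (ho : IsOpen S) (hb : Bornology.IsBounded S)
    {y d : E m} (hy : y ∈ S) (hd : ‖d‖ = 1) {ℓ : ℝ}
    (hw : ∀ z ∈ S, ∀ z' ∈ S, inner ℝ (z - z') d ≤ ℓ) : HasShortChord S y d ℓ := by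
  have hd0 : d ≠ 0 := by rintro rfl; simp at hd
  obtain ⟨τ₁, h1, h1f, h1s⟩ := exists_exit ho hb hy hd0
  obtain ⟨τ₂, h2, h2f, h2s⟩ := exists_exit ho hb hy (neg_ne_zero.2 hd0)
  have hin : ∀ τ ∈ Ioo (-τ₂) τ₁, y + τ • d ∈ S := by
    intro τ hτ
    rcases le_total 0 τ with h | h
    · exact h1s τ ⟨h, hτ.2⟩
    · have := h2s (-τ) ⟨by linarith, by linarith [hτ.1]⟩
      rwa [smul_neg, neg_smul, neg_neg] at this
  refine ⟨τ₁, τ₂, h1, h2, ?_, h1f, ?_, hin⟩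
  · refine le_of_forall_pos_le_add fun η hη => ?_
    set κ := min (η / 2) (min (τ₁ / 2) (τ₂ / 2)) with hκ
    have hκ0 : 0 < κ := by positivity
    have hκ1 : κ ≤ η / 2 := min_le_left _ _
    have hκ2 : κ ≤ τ₁ / 2 := (min_le_right _ _).trans (min_le_left _ _)
    have hκ3 : κ ≤ τ₂ / 2 := (min_le_right _ _).trans (min_le_right _ _)
    have := hw _ (hin (τ₁ - κ) ⟨by linarith, by linarith⟩) _
      (hin (-(τ₂ - κ)) ⟨by linarith, by linarith⟩)
    rw [add_sub_add_left_eq_sub, ← sub_smul, inner_smul_left, real_inner_self_eq_norm_sq, hd] at this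
    simp at this
    linarith
  · rwa [smul_neg, ← sub_eq_add_neg] at h2f

theorem SliceHolder.norm_le_of_chord (h : SliceHolder Ω α B w Dw)
    (hN : N.dom ⊆ Ω) (h0 : ∀ x ∈ N.lateral, w x = 0) {s : ℝ} (hs : s ∈ N.range) {y d : E m}
    (hy : y ∈ N.sec) (hd : ‖d‖ = 1) {ℓ : ℝ} (hch : HasShortChord N.sec y d ℓ) :
    ‖w (N.pt s y)‖ ≤ B * ℓ := by
  obtain ⟨τ₁, τ₂, h1, h2, h12, hf1, hf2, hin⟩ := hch
  have hB := h.B_nonneg (subset_closure (hN (N.pt_mem_dom hs hy)))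
  refine (h.norm_le_of_exit hN h0 hs hf1 fun τ hτ => ?_).trans
    (mul_le_mul_of_nonneg_left ?_ hB)
  · rw [add_sub_cancel_left, smul_smul]
    exact hin _ ⟨by nlinarith [hτ.1], by nlinarith [hτ.2]⟩
  · rw [dist_eq_norm, add_sub_cancel_left, norm_smul, hd, Real.norm_eq_abs, abs_of_pos h1]
    linarith

/-- A quantitative form of Rolle's theorem: `w` vanishes at both ends of the chord, so its mean
derivative along it is zero, and the gradient oscillates by at most `B * ℓ ^ α` there. -/
theorem SliceHolder.norm_dotC_chord_le (hα : 0 < α) (h : SliceHolder Ω α B w Dw)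
    (hN : N.dom ⊆ Ω) (h0 : ∀ x ∈ N.lateral, w x = 0) {s : ℝ} (hs : s ∈ N.range) {y d : E m}
    (hy : y ∈ N.sec) (hd : ‖d‖ = 1) {ℓ : ℝ} (hch : HasShortChord N.sec y d ℓ) :
    ‖dotC (N.emb d) (Dw (N.pt s y))‖ ≤ B * ℓ ^ α := by
  obtain ⟨τ₁, τ₂, h1, h2, h12, hf1, hf2, hin⟩ := hch
  have hB := h.B_nonneg (subset_closure (hN (N.pt_mem_dom hs hy)))
  have hsub : (y + τ₁ • d) - (y - τ₂ • d) = (τ₁ + τ₂) • d := by rw [add_smul]; abel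
  have hT := h.norm_sub_sub_le_of_dist_le hα (x := N.pt s (y - τ₂ • d)) (x' := N.pt s (y + τ₁ • d))
    (c := N.pt s y) (subset_closure (hN (N.pt_mem_dom hs hy)))
    (fun τ hτ => by
      rw [N.pt_segment, hsub]
      refine hN (N.pt_mem_dom hs ?_)
      have : y - τ₂ • d + τ • (τ₁ + τ₂) • d = y + (τ * (τ₁ + τ₂) - τ₂) • d := by
        rw [smul_smul, sub_smul]; abel
      rw [this]
      exact hin _ ⟨by nlinarith [hτ.1], by nlinarith [hτ.2]⟩) (R := ℓ)
    (by
      rw [N.dist_pt_pt_same, dist_eq_norm, sub_sub_cancel_left, norm_neg, norm_smul, hd,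
        Real.norm_eq_abs, abs_of_pos h2]; linarith)
    (by
      rw [N.dist_pt_pt_same, dist_eq_norm, add_sub_cancel_left, norm_smul, hd,
        Real.norm_eq_abs, abs_of_pos h1]; linarith)
  rw [h0 _ (N.pt_mem_lateral hs hf1), h0 _ (N.pt_mem_lateral hs hf2), sub_zero, zero_sub, norm_neg,
    N.pt_sub_pt_same, hsub, map_smul, dotC_smul_left, norm_mul, norm_smul, Complex.norm_real,
    LinearIsometry.norm_map, hd, mul_one, mul_comm] at hT
  have : 0 < ‖τ₁ + τ₂‖ := by rw [Real.norm_eq_abs, abs_of_pos] <;> linarith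
  exact le_of_mul_le_mul_right hT this

/-- A bound of the gradient from bounds in the directions of the cross-section. -/
theorem SliceHolder.norm_dotC_le_of_section (hα : 0 < α) (h : SliceHolder Ω α B w Dw)
    (hN : N.dom ⊆ Ω) (h0 : ∀ x ∈ N.lateral, w x = 0) {s : ℝ} (hs : s ∈ N.range) {y q : E m}
    (hy : y ∈ N.sec) (hq : q ∈ frontier N.sec) {ℓ b : ℝ} (hℓ : dist y q ≤ ℓ) (hb0 : 0 ≤ b)
    (hb : ∀ d : E m, ‖d‖ ≤ 1 → ‖dotC (N.emb d) (Dw (N.pt s y))‖ ≤ b) (v : E (m + 1))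
    (hv : ‖v‖ ≤ 1) :
    ‖dotC v (Dw (N.pt s y))‖ ≤ (1 + N.lip) * (B * ℓ ^ α + b) := by
  set x := N.pt s y
  have hx : x ∈ closure Ω := subset_closure (hN (N.pt_mem_dom hs hy))
  have hxq : N.pt s q ∈ closure Ω :=
    closure_mono hN (N.lateral_subset_closure (N.pt_mem_lateral hs hq))
  have hB := h.B_nonneg hx
  -- The derivative along the curve vanishes at the nearby boundary point `q`; Hölder continuity
  -- transfers this to `x`.
  have ht : ‖dotC (N.tangent s) (Dw x)‖ ≤ (1 + N.lip) * (B * ℓ ^ α) := by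
    have h1 : dotC (N.tangent s) (Dw x) = dotC (N.tangent s) (Dw x - Dw (N.pt s q)) := by
      have := h.dotC_tangent_eq_zero hα hN h0 hs hq
      have h2 : dotC (N.tangent s) (Dw x - Dw (N.pt s q))
        = dotC (N.tangent s) (Dw x) - dotC (N.tangent s) (Dw (N.pt s q)) := dotC_sub_right _ _ _
      rw [h2, this, sub_zero]
    rw [h1]
    refine (norm_dotC_le_euclidean _ _).trans ?_
    refine mul_le_mul (N.norm_tangent_le hs) ?_ (norm_nonneg _) (by positivity)
    refine (h.holder _ hx _ hxq).trans (mul_le_mul_of_nonneg_left ?_ hB)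
    rw [N.dist_pt_pt_same]
    exact Real.rpow_le_rpow dist_nonneg hℓ hα.le
  have hdir : ∀ d : E m, ‖dotC (N.emb d) (Dw x)‖ ≤ ‖d‖ * b := by
    intro d
    rcases eq_or_ne d 0 with rfl | hd
    · simp [dotC_zero_left]
    have hd' : 0 < ‖d‖ := norm_pos_iff.2 hd
    have h3 := hb (‖d‖⁻¹ • d) (by
      rw [norm_smul, norm_inv, norm_norm, inv_mul_cancel₀ hd'.ne'])
    rw [map_smul, dotC_smul_left, norm_mul, Complex.norm_real, norm_inv, norm_norm,
      inv_mul_le_iff₀ hd'] at h3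
    exact h3
  -- Every direction is a multiple of the tangent plus a direction in the section, with coefficients
  -- bounded by `1 + N.lip`.
  have hsplit : v = N.ht v • N.tangent s + N.emb (N.proj v - N.ht v • N.dprof s) := by
    conv_lhs => rw [← N.decomp v]
    simp only [Shear.tangent, smul_add, map_sub, map_smul]; abel
  rw [hsplit, dotC_add_left, dotC_smul_left]
  refine (norm_add_le _ _).trans ?_
  rw [norm_mul, Complex.norm_real, Real.norm_eq_abs]
  have h4 : |N.ht v| ≤ 1 := (N.abs_ht_le v).trans hv
  have h5 : ‖N.proj v - N.ht v • N.dprof s‖ ≤ 1 + N.lip := by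
    refine (_root_.norm_sub_le _ _).trans ?_
    rw [norm_smul, Real.norm_eq_abs]
    have h6 := N.norm_proj_le v
    have h7 := mul_le_mul h4 (N.norm_dprof_le s hs) (norm_nonneg _) zero_le_one
    linarith
  have h8 := hdir (N.proj v - N.ht v • N.dprof s)
  have h9 := mul_le_mul_of_nonneg_right h5 hb0
  have h10 := mul_le_mul h4 ht (norm_nonneg _) zero_le_one
  linarith

end Lateral

end BalanceLaw

namespace BalanceLaw

variable {m : ℕ}

/-! ### Directional derivatives of Lipschitz functions -/

/-- A bound of the directional derivative of a Lipschitz function that holds almost everywhere can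
be integrated along all segments. -/
theorem abs_sub_le_of_ae_fderiv {f : E m → ℝ} {κ : NNReal} (hf : LipschitzWith κ f) {q₀ d : E m}
    {c η ρ : ℝ} (hae : ∀ᵐ q, q ∈ Metric.ball q₀ ρ → DifferentiableAt ℝ f q →
      |fderiv ℝ f q d - c| ≤ η) {τ : ℝ} (hτ : |τ| * ‖d‖ < ρ) :
    |f (q₀ + τ • d) - f q₀ - τ * c| ≤ η * |τ| := by
  set good : Set (E m) := {q | DifferentiableAt ℝ f q ∧
    (q ∈ Metric.ball q₀ ρ → |fderiv ℝ f q d - c| ≤ η)} with hgood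
  have hgood_ae : ∀ᵐ q, q ∈ good := by
    filter_upwards [hae, hf.ae_differentiableAt (μ := volume)] with q h1 h2
    exact ⟨h2, fun h3 => h1 h3 h2⟩
  -- A measurable set of full measure inside the good points, so that Fubini applies: almost every
  -- line in the direction `d` meets it in almost every point.
  obtain ⟨G, hGsub, hGm, hGae⟩ : ∃ G ⊆ good, MeasurableSet G ∧ ∀ᵐ q, q ∈ G := by
    refine ⟨(toMeasurable volume goodᶜ)ᶜ, ?_, (measurableSet_toMeasurable _ _).compl, ?_⟩
    · rw [compl_subset_comm]; exact subset_toMeasurable _ _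
    · have h1 : volume goodᶜ = 0 := hgood_ae
      rw [← measure_toMeasurable] at h1
      exact measure_eq_zero_iff_ae_notMem.1 h1
  have hlines : ∀ᵐ x : E m, ∀ᵐ σ : ℝ, x + σ • d ∈ G := by
    rw [Measure.ae_ae_comm]
    · refine Eventually.of_forall fun σ => ?_
      exact (measurePreserving_add_right volume (σ • d)).quasiMeasurePreserving.ae hGae
    · have : Measurable fun p : E m × ℝ => p.1 + p.2 • d := by fun_prop
      exact this hGm
  have hx : ∀ x, (∀ᵐ σ : ℝ, x + σ • d ∈ G) → x ∈ Metric.ball q₀ (ρ - |τ| * ‖d‖) →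
      |f (x + τ • d) - f x - τ * c| ≤ η * |τ| := by
    intro x hxG hxb
    set φ : ℝ → ℝ := fun σ => f (x + σ • d) - σ * c with hφ
    have hlip : ∃ K, LipschitzWith K φ := by
      have h1 : LipschitzWith ‖d‖₊ fun σ : ℝ => x + σ • d := by
        refine LipschitzWith.of_dist_le_mul fun a b => ?_
        rw [dist_add_left, dist_eq_norm, ← sub_smul, norm_smul, mul_comm, ← dist_eq_norm]; rfl
      have h2 : LipschitzWith ‖c‖₊ fun σ : ℝ => σ * c := by
        refine LipschitzWith.of_dist_le_mul fun a b => ?_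
        rw [Real.dist_eq, ← sub_mul, abs_mul, mul_comm, Real.dist_eq]; rfl
      exact ⟨_, (hf.comp h1).sub h2⟩
    obtain ⟨K, hK⟩ := hlip
    have hac : AbsolutelyContinuousOnInterval φ 0 τ :=
      (hK.lipschitzOnWith (s := uIcc 0 τ)).absolutelyContinuousOnInterval
    have hInt := hac.integral_deriv_eq_sub
    have hbd : ‖∫ σ in (0 : ℝ)..τ, deriv φ σ‖ ≤ η * |τ - 0| := by
      refine intervalIntegral.norm_integral_le_of_norm_le_const_ae ?_
      filter_upwards [hxG] with σ hσ hσI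
      obtain ⟨hσd, hσb⟩ := hGsub hσ
      have hστ : |σ| ≤ |τ| := by
        rw [uIoc] at hσI
        rcases le_total 0 τ with h | h
        · rw [min_eq_left h, max_eq_right h] at hσI
          rw [abs_of_pos hσI.1, abs_of_nonneg h]; exact hσI.2
        · rw [min_eq_right h, max_eq_left h] at hσI
          rw [abs_of_nonpos hσI.2, abs_of_nonpos h]; linarith [hσI.1]
      have hmem : x + σ • d ∈ Metric.ball q₀ ρ := by
        rw [Metric.mem_ball, dist_eq_norm] at hxb ⊢
        have : x + σ • d - q₀ = (x - q₀) + σ • d := by abel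
        rw [this]
        refine (norm_add_le _ _).trans_lt ?_
        rw [norm_smul, Real.norm_eq_abs]
        have := mul_le_mul_of_nonneg_right hστ (norm_nonneg d)
        linarith
      have hd : HasDerivAt φ (fderiv ℝ f (x + σ • d) d - c) σ := by
        have h2 : HasDerivAt (fun σ : ℝ => x + σ • d) d σ := by
          simpa using ((hasDerivAt_id σ).smul_const d).const_add x
        have h4 : HasDerivAt (fun σ : ℝ => σ * c) c σ := by
          simpa using (hasDerivAt_id σ).mul_const c
        exact (hσd.hasFDerivAt.comp_hasDerivAt σ h2).sub h4
      rw [hd.deriv, Real.norm_eq_abs]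
      exact hσb hmem
    rw [hInt, sub_zero, Real.norm_eq_abs] at hbd
    have e1 : φ τ - φ 0 = f (x + τ • d) - f x - τ * c := by
      simp only [hφ, zero_smul, add_zero, zero_mul, sub_zero]; ring
    rwa [e1] at hbd
  -- The line through `q₀` itself may be bad. The good starting points are dense, and the inequality
  -- is closed in the starting point.
  have hdense := Measure.dense_of_ae (μ := (volume : Measure (E m))) hlines
  have hclosed : IsClosed {x | |f (x + τ • d) - f x - τ * c| ≤ η * |τ|} := by
    have := hf.continuous
    exact isClosed_le (by fun_prop) continuous_const
  have hmem : q₀ ∈ closure (Metric.ball q₀ (ρ - |τ| * ‖d‖) ∩ {x | ∀ᵐ σ : ℝ, x + σ • d ∈ G}) :=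
    hdense.open_subset_closure_inter Metric.isOpen_ball (Metric.mem_ball_self (by linarith))
  exact hclosed.closure_subset_iff.2 (fun x hxx => hx x hxx.2 hxx.1) hmem

namespace GraphChart

variable {S : Set (E m)} {p : E m} {r : ℝ} {e : E m} {κ : NNReal} {g : E m → ℝ}

/-- If a continuous vector field is tangent to the graph at almost every point, then at a boundary
point where a function has a maximum the derivative of the function in the direction of the field
vanishes. -/
theorem apply_eq_zero_of_isMaxOn (h : GraphChart S p r e κ g) (hS : IsOpen S)
    {q₀ : E m} (hq₀ : p = q₀ + (g q₀ - inner ℝ q₀ e) • e) {V : E m → E m}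
    {ρ : ℝ} (hρ : 0 < ρ) (hV : ContinuousWithinAt V (Metric.ball q₀ ρ) q₀)
    (hae : ∀ᵐ q, q ∈ Metric.ball q₀ ρ → DifferentiableAt ℝ g q →
      inner ℝ (V q) e = fderiv ℝ g q (V q))
    {J : E m → ℝ} {J' : E m →L[ℝ] ℝ} (hJ : HasFDerivAt J J' p) (hmax : IsMaxOn J (closure S) p) :
    J' (V q₀) = 0 := by
  set d := V q₀ with hd
  set b := inner ℝ d e with hb
  -- Although `g` need not be differentiable at `q₀`, it has a derivative in the one direction `d`:
  -- near `q₀` almost every derivative of `g` along `d` is close to `b`, and this can be integrated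
  -- along the segment.
  have hgd : HasDerivAt (fun τ : ℝ => g (q₀ + τ • d)) b 0 := by
    rw [hasDerivAt_iff_isLittleO, Asymptotics.isLittleO_iff]
    intro η hη
    have hη' : 0 < η / (κ + 1) := by positivity
    obtain ⟨δ, hδ, hδV⟩ := Metric.continuousWithinAt_iff.1 hV (η / (κ + 1)) hη'
    have hbound : ∀ᵐ q, q ∈ Metric.ball q₀ (min δ ρ) → DifferentiableAt ℝ g q →
        |fderiv ℝ g q d - b| ≤ η := by
      filter_upwards [hae] with q hq hqb hqd
      have hqρ : q ∈ Metric.ball q₀ ρ := Metric.ball_subset_ball (min_le_right _ _) hqb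
      have h1 := hq hqρ hqd
      have h2 : ‖V q - d‖ ≤ η / (κ + 1) := by
        rw [← dist_eq_norm]
        exact (hδV hqρ ((Metric.mem_ball.1 hqb).trans_le (min_le_left _ _))).le
      -- The tangency condition speaks of the direction `V q`; the error from replacing it by `d` is
      -- linear in `V q - d`.
      have h3 : fderiv ℝ g q d - b = inner ℝ (V q - d) e - fderiv ℝ g q (V q - d) := by
        rw [map_sub, inner_sub_left, h1]; ring
      have h4 := abs_real_inner_le_norm (V q - d) e
      rw [h.norm_e, mul_one] at h4
      have h5 : |fderiv ℝ g q (V q - d)| ≤ κ * ‖V q - d‖ := by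
        refine ((fderiv ℝ g q).le_opNorm _).trans ?_
        exact mul_le_mul_of_nonneg_right (norm_fderiv_le_of_lipschitz ℝ h.lip) (norm_nonneg _)
      rw [h3]
      refine (abs_sub _ _).trans ?_
      have h6 := mul_le_mul_of_nonneg_left h2 (by positivity : (0 : ℝ) ≤ κ + 1)
      rw [mul_div_cancel₀ _ (by positivity)] at h6
      linarith
    have hsmall : ∀ᶠ τ : ℝ in 𝓝 0, |τ| * ‖d‖ < min δ ρ := by
      have : Continuous fun τ : ℝ => |τ| * ‖d‖ := by fun_prop
      have h0 := this.tendsto 0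
      rw [abs_zero, zero_mul] at h0
      exact h0.eventually (gt_mem_nhds (by positivity))
    filter_upwards [hsmall] with τ hτ
    have := abs_sub_le_of_ae_fderiv h.lip hbound hτ
    simpa using this
  -- a curve in the graph with velocity `d`
  set c : ℝ → E m := fun τ => p + τ • d + (g (q₀ + τ • d) - g q₀ - τ * b) • e with hc
  have hcd : HasDerivAt c d 0 := by
    have h1 : HasDerivAt (fun τ : ℝ => p + τ • d) d 0 := by
      simpa using ((hasDerivAt_id (0 : ℝ)).smul_const d).const_add p
    have h2 : HasDerivAt (fun τ : ℝ => g (q₀ + τ • d) - g q₀ - τ * b) 0 0 := by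
      have h3 : HasDerivAt (fun τ : ℝ => τ * b) b 0 := by
        simpa using (hasDerivAt_id (0 : ℝ)).mul_const b
      have h4 := (hgd.sub_const (g q₀)).sub h3
      rw [sub_self] at h4
      exact h4
    have h5 := h1.add (h2.smul_const e)
    rw [zero_smul, add_zero] at h5
    exact h5
  have hc0 : c 0 = p := by simp [hc]
  have hpe : inner ℝ p e = g q₀ := by
    rw [hq₀, h.inner_add_smul]; ring
  have hcfr : ∀ᶠ τ in 𝓝 (0 : ℝ), c τ ∈ closure S := by
    have h1 : ∀ᶠ τ in 𝓝 (0 : ℝ), c τ ∈ Metric.ball p r :=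
      hcd.continuousAt.preimage_mem_nhds (by rw [hc0]; exact Metric.ball_mem_nhds _ h.pos)
    filter_upwards [h1] with τ hτ
    refine frontier_subset_closure ((h.mem_frontier_iff hS hτ).2 ?_)
    simp only [hc]
    rw [h.inner_add_smul, h.invariant]
    have e1 : p + τ • d = (q₀ + τ • d) + (g q₀ - inner ℝ q₀ e) • e := by
      conv_lhs => rw [hq₀]
      abel
    have e2 : g (p + τ • d) = g (q₀ + τ • d) := by rw [e1, h.invariant]
    rw [e2, inner_add_left, hpe, inner_smul_left]
    simp only [conj_trivial]; ring
  have hloc : IsLocalMax (fun τ => J (c τ)) 0 := by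
    filter_upwards [hcfr] with τ hτ
    simp only [hc0]
    exact hmax hτ
  have hJc : HasDerivAt (fun τ => J (c τ)) (J' d) 0 := by
    have : HasFDerivAt J J' (c 0) := by rwa [hc0]
    exact this.comp_hasDerivAt 0 hcd
  exact hloc.hasDerivAt_eq_zero hJc

end GraphChart

end BalanceLaw

/-! ### From the integrated flux balance to a pointwise one. -/

namespace BalanceLaw

variable {m : ℕ}

/-- A continuous function on `[0, T]` whose integrals over all subintervals vanish is zero. -/
theorem eq_zero_of_forall_intervalIntegral_eq_zero {Q : ℝ → ℂ} {T : ℝ}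
    (hQ : ContinuousOn Q (Icc 0 T))
    (h0 : ∀ T₁ T₂, 0 ≤ T₁ → T₁ < T₂ → T₂ ≤ T → ∫ t in T₁..T₂, Q t = 0) {t : ℝ} (ht : t ∈ Ioo 0 T) :
    Q t = 0 := by
  have hT : Icc 0 T ∈ 𝓝 t := Icc_mem_nhds ht.1 ht.2
  have hInt : IntervalIntegrable Q volume 0 t :=
    (hQ.mono (by rw [uIcc_of_le ht.1.le]; exact Icc_subset_Icc_right ht.2.le)).intervalIntegrable
  have hmeas : StronglyMeasurableAtFilter Q (𝓝 t) volume :=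
    (hQ.mono Ioo_subset_Icc_self).stronglyMeasurableAtFilter isOpen_Ioo t ht
  have hd := intervalIntegral.integral_hasDerivAt_right hInt hmeas (hQ.continuousAt hT)
  have hz : (fun τ => ∫ x in (0 : ℝ)..τ, Q x) =ᶠ[𝓝 t] fun _ => 0 := by
    filter_upwards [Ioo_mem_nhds ht.1 ht.2] with τ hτ
    exact h0 0 τ le_rfl hτ.1 hτ.2.le
  exact (hd.congr_of_eventuallyEq hz.symm).unique (hasDerivAt_const t 0)

/-- The parametrization of the lateral boundary over a graph chart: the coordinate of `q` along `e`
is the height. -/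
noncomputable def Shear.graphPt (N : Shear m) (e : E m) (g : E m → ℝ) (q : E m) : E (m + 1) :=
  N.pt (inner ℝ q e) (q + (g q - inner ℝ q e) • e)

/-- The outward normal in terms of the parametrization. -/
noncomputable def Shear.graphNormal (N : Shear m) (e : E m) (g : E m → ℝ) (q : E m) : E (m + 1) :=
  N.lift (inner ℝ q e) (e - grad (fderiv ℝ g q))

/-- The inverse of the parametrization. -/
noncomputable def Shear.graphCoord (N : Shear m) (e : E m) (x : E (m + 1)) : E m :=
  N.sc x + (N.ht x - inner ℝ (N.sc x) e) • e

section

variable (N : Shear m) {p : E m} {r : ℝ} {e : E m} {κ : NNReal} {g : E m → ℝ}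

theorem Shear.graphCoord_graphPt (h : GraphChart N.sec p r e κ g) (q : E m) :
    N.graphCoord e (N.graphPt e g q) = q := by
  rw [graphCoord, graphPt, N.sc_pt, N.ht_pt, h.inner_add_smul, add_assoc, ← add_smul]
  simp

theorem Shear.lipschitzOn_graphCoord (he : ‖e‖ = 1) :
    ∃ C : NNReal, LipschitzOnWith C (N.graphCoord e) {x | N.ht x ∈ N.range} := by
  refine ⟨⟨2 * (1 + N.lip) + 1, by positivity⟩, LipschitzOnWith.of_dist_le_mul fun x hx y hy => ?_⟩
  have h1 := N.norm_sc_sub_le hx hy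
  have h2 : N.graphCoord e x - N.graphCoord e y
      = (N.sc x - N.sc y) + (N.ht (x - y) - inner ℝ (N.sc x - N.sc y) e) • e := by
    simp only [graphCoord, map_sub, inner_sub_left, sub_smul]; abel
  rw [dist_eq_norm, dist_eq_norm, h2]
  refine (norm_add_le _ _).trans ?_
  rw [norm_smul, he, mul_one, Real.norm_eq_abs]
  have h3 := abs_sub (N.ht (x - y)) (inner ℝ (N.sc x - N.sc y) e)
  have h4 := N.abs_ht_le (x - y)
  have h5 := abs_real_inner_le_norm (N.sc x - N.sc y) e
  rw [he, mul_one] at h5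
  change _ ≤ (2 * (1 + N.lip) + 1 : ℝ) * _
  linarith

theorem GraphChart.norm_toGraph_sub_le {S : Set (E m)} (h : GraphChart S p r e κ g) (q q' : E m) :
    ‖(q + (g q - inner ℝ q e) • e) - (q' + (g q' - inner ℝ q' e) • e)‖ ≤ (2 + κ) * ‖q - q'‖ := by
  have h2 : (q + (g q - inner ℝ q e) • e) - (q' + (g q' - inner ℝ q' e) • e)
      = (q - q') + ((g q - g q') - inner ℝ (q - q') e) • e := by
    simp only [inner_sub_left, sub_smul]; abel
  rw [h2]
  refine (norm_add_le _ _).trans ?_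
  rw [norm_smul, h.norm_e, mul_one, Real.norm_eq_abs]
  have h3 := abs_sub (g q - g q') (inner ℝ (q - q') e)
  have h4 := h.lip.dist_le_mul q q'
  have h5 := abs_real_inner_le_norm (q - q') e
  rw [h.norm_e, mul_one] at h5
  rw [Real.dist_eq, dist_eq_norm] at h4
  linarith

theorem Shear.lipschitzOn_graphPt (h : GraphChart N.sec p r e κ g) :
    ∃ C : NNReal, LipschitzOnWith C (N.graphPt e g) {q | inner ℝ q e ∈ N.range} := by
  refine ⟨⟨(1 + N.lip) + (2 + κ), by positivity⟩, LipschitzOnWith.of_dist_le_mul fun x hx y hy => ?_⟩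
  have h1 := N.norm_pt_sub_le hx hy (x + (g x - inner ℝ x e) • e) (y + (g y - inner ℝ y e) • e)
  have h2 := h.norm_toGraph_sub_le x y
  have h3 := abs_real_inner_le_norm (x - y) e
  rw [h.norm_e, mul_one, inner_sub_left] at h3
  rw [dist_eq_norm, dist_eq_norm]
  refine h1.trans ?_
  change _ ≤ ((1 + N.lip) + (2 + κ) : ℝ) * _
  have := mul_le_mul_of_nonneg_left h3 (by positivity : (0 : ℝ) ≤ 1 + N.lip)
  linarith

/-- The flux balance holds pointwise, at almost every point of the lateral boundary. -/
theorem Shear.ae_flux_eq (h : GraphChart N.sec p r e κ g) (hS : IsOpen N.sec)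
    (hp : p ∈ frontier N.sec) {s₀ : ℝ} (hs₀ : s₀ ∈ N.range) {T : ℝ} {Z : Set (E (m + 1))}
    (hZ : N.lateral ⊆ Z) {G : E (m + 1) × ℝ → Fin (m + 1) → ℂ} {b : E (m + 1) × ℝ → ℂ}
    (hG : ContinuousOn G (Z ×ˢ Icc 0 T)) (hb : ContinuousOn b (Z ×ˢ Icc 0 T))
    (hbal : ∀ Γ ⊆ N.lateral, MeasurableSet Γ → ∀ T₁ T₂, 0 ≤ T₁ → T₁ < T₂ → T₂ ≤ T →
      (∫ t in T₁..T₂, ∫ x in Γ, dotC (outwardNormal N.dom x) (G (x, t))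
          ∂(Measure.hausdorffMeasure (m : ℝ)))
        = ∫ t in T₁..T₂, ∫ x in Γ, b (x, t) ∂(Measure.hausdorffMeasure (m : ℝ)))
    {t : ℝ} (ht : t ∈ Ioo 0 T) :
    ∃ ρ > 0, (∀ q ∈ Metric.ball (p + (s₀ - inner ℝ p e) • e) ρ, inner ℝ q e ∈ N.range ∧
        N.graphPt e g q ∈ N.lateral) ∧
      ∀ᵐ q, q ∈ Metric.ball (p + (s₀ - inner ℝ p e) • e) ρ → DifferentiableAt ℝ g q →
      IsOutwardNormal N.dom (N.graphPt e g q) (‖N.graphNormal e g q‖⁻¹ • N.graphNormal e g q) ∧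
        N.graphNormal e g q ≠ 0 ∧
        dotC (‖N.graphNormal e g q‖⁻¹ • N.graphNormal e g q) (G (N.graphPt e g q, t))
          = b (N.graphPt e g q, t) := by
  set q₀ := p + (s₀ - inner ℝ p e) • e with hq₀
  have hgc : Continuous g := h.lip.continuous
  have hq₀e : inner ℝ q₀ e = s₀ := by rw [hq₀, h.inner_add_smul]; ring
  have htg : q₀ + (g q₀ - inner ℝ q₀ e) • e = p := by
    have h1 := (h.mem_frontier_iff hS (Metric.mem_ball_self h.pos)).1 hp
    rw [hq₀e, hq₀, h.invariant, add_assoc, ← add_smul, ← h1]; simp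
  obtain ⟨ρ, hρ, hρ'⟩ : ∃ ρ > 0, ∀ q ∈ Metric.closedBall q₀ ρ, inner ℝ q e ∈ N.range ∧
      q + (g q - inner ℝ q e) • e ∈ Metric.ball p r := by
    have h1 : {q : E m | inner ℝ q e ∈ N.range} ∈ 𝓝 q₀ :=
      (Continuous.continuousAt (by fun_prop)).preimage_mem_nhds
        (N.isOpen_range.mem_nhds (by rwa [hq₀e]))
    have h2 : {q : E m | q + (g q - inner ℝ q e) • e ∈ Metric.ball p r} ∈ 𝓝 q₀ :=
      (Continuous.continuousAt (by fun_prop)).preimage_mem_nhds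
        (by rw [htg]; exact Metric.ball_mem_nhds _ h.pos)
    obtain ⟨ρ, hρ, hρ'⟩ := Metric.nhds_basis_closedBall.mem_iff.1 (inter_mem h1 h2)
    exact ⟨ρ, hρ, fun q hq => hρ' hq⟩
  set R := Metric.closedBall q₀ ρ with hR
  have hRc : IsCompact R := isCompact_closedBall _ _
  set Ψ := N.graphPt e g with hΨ
  have hlat : ∀ q ∈ R, Ψ q ∈ N.lateral := fun q hq =>
    N.pt_mem_lateral (hρ' q hq).1 ((h.mem_frontier_iff hS (hρ' q hq).2).2 (h.inner_toGraph q))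
  obtain ⟨C₁, hC₁⟩ := N.lipschitzOn_graphPt h
  obtain ⟨C₂, hC₂⟩ := N.lipschitzOn_graphCoord h.norm_e
  have hΨR : LipschitzOnWith C₁ Ψ R := hC₁.mono fun q hq => (hρ' q hq).1
  set Γ₀ := Ψ '' R with hΓ₀
  have hΓ₀c : IsCompact Γ₀ := hRc.image_of_continuousOn hΨR.continuousOn
  have hΓ₀m : MeasurableSet Γ₀ := hΓ₀c.measurableSet
  have hΓ₀l : Γ₀ ⊆ N.lateral := by rintro _ ⟨q, hq, rfl⟩; exact hlat q hq
  have hΓ₀s : Γ₀ ⊆ {x | N.ht x ∈ N.range} := fun x hx => (hΓ₀l hx).1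
  set H : Measure (E (m + 1)) := Measure.hausdorffMeasure (m : ℝ) with hH
  set H' : Measure (E m) := Measure.hausdorffMeasure (m : ℝ) with hH'
  have hm0 : (0 : ℝ) ≤ m := Nat.cast_nonneg m
  have hfin : H Γ₀ < ⊤ := by
    refine (hΨR.hausdorffMeasure_image_le hm0).trans_lt ?_
    exact ENNReal.mul_lt_top (ENNReal.rpow_lt_top_of_nonneg hm0 ENNReal.coe_ne_top)
      hRc.measure_lt_top
  set σ := H.restrict Γ₀ with hσ
  have : IsFiniteMeasure σ := ⟨by rwa [hσ, Measure.restrict_apply_univ]⟩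
  -- the normal
  have hnormal : ∀ q ∈ R, DifferentiableAt ℝ g q → N.graphNormal e g q ≠ 0 ∧
      IsOutwardNormal N.dom (Ψ q) (‖N.graphNormal e g q‖⁻¹ • N.graphNormal e g q) := by
    intro q hq hd
    exact N.isOutwardNormal h (hρ' q hq).1 (hρ' q hq).2 (h.inner_toGraph q)
      (h.hasFDerivAt_add_smul hd.hasFDerivAt _)
  -- The `m`-dimensional Hausdorff measure of the parameter space is an additive Haar measure, so
  -- Rademacher's theorem holds for it, and the Lipschitz parametrization maps null sets to null
  -- sets.
  have hdiff : ∀ᵐ x ∂σ, DifferentiableAt ℝ g (N.graphCoord e x) := by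
    rw [hσ, ae_restrict_iff' hΓ₀m]
    have hnull : H' {q | ¬ DifferentiableAt ℝ g q} = 0 := h.lip.ae_differentiableAt (μ := H')
    have h1 : H (Ψ '' (R ∩ {q | ¬ DifferentiableAt ℝ g q})) = 0 := by
      refine le_antisymm (((hΨR.mono inter_subset_left).hausdorffMeasure_image_le hm0).trans ?_)
        zero_le
      have : H' (R ∩ {q | ¬ DifferentiableAt ℝ g q}) = 0 :=
        measure_mono_null inter_subset_right hnull
      rw [this, mul_zero]
    filter_upwards [measure_eq_zero_iff_ae_notMem.1 h1] with x hx hxΓ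
    obtain ⟨q, hq, rfl⟩ := hxΓ
    rw [hΨ, N.graphCoord_graphPt h]
    by_contra hnd
    exact hx ⟨q, ⟨hq, hnd⟩, rfl⟩
  have hνeq : ∀ᵐ x ∂σ, outwardNormal N.dom x
      = ‖N.graphNormal e g (N.graphCoord e x)‖⁻¹ • N.graphNormal e g (N.graphCoord e x) := by
    filter_upwards [hdiff, ae_restrict_mem hΓ₀m] with x hx hxΓ
    obtain ⟨q, hq, rfl⟩ := hxΓ
    rw [hΨ, N.graphCoord_graphPt h] at hx ⊢
    exact (hnormal q hq hx).2.outwardNormal_eq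
  -- The outward normal is defined by a choice; its measurability comes from its almost everywhere
  -- agreement with the explicit formula in the chart.
  have hνm : AEMeasurable (outwardNormal N.dom) σ := by
    have hΛ : AEMeasurable (N.graphCoord e) σ :=
      (hC₂.continuousOn.mono hΓ₀s).aemeasurable hΓ₀m
    have hdp : AEMeasurable (fun x => N.dprof (inner ℝ (N.graphCoord e x) e)) σ := by
      refine ContinuousOn.aemeasurable ?_ hΓ₀m
      refine N.continuousOn_dprof.comp
        (((hC₂.continuousOn.mono hΓ₀s)).inner continuousOn_const) ?_
      rintro _ ⟨q, hq, rfl⟩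
      simp only [hΨ, N.graphCoord_graphPt h]
      exact (hρ' q hq).1
    have hgr : AEMeasurable (fun x => e - grad (fderiv ℝ g (N.graphCoord e x))) σ :=
      ((continuous_grad.measurable.comp (measurable_fderiv ℝ g)).comp_aemeasurable hΛ).const_sub e
    have hN : AEMeasurable (fun x => N.graphNormal e g (N.graphCoord e x)) σ := by
      unfold Shear.graphNormal Shear.lift
      exact (N.emb.continuous.measurable.comp_aemeasurable hgr).sub
        ((hgr.inner hdp).smul_const N.nrm)
    exact (hN.norm.inv.smul hN).congr (hνeq.mono fun x hx => hx.symm)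
  -- the densities
  set D : ℝ → E (m + 1) → ℂ := fun t x => dotC (outwardNormal N.dom x) (G (x, t)) with hD
  have hslice : ∀ t ∈ Icc 0 T, ContinuousOn (fun x => (x, t)) Γ₀ ∧
      MapsTo (fun x => (x, t)) Γ₀ (Z ×ˢ Icc 0 T) := fun t ht =>
    ⟨by fun_prop, fun x hx => ⟨hZ (hΓ₀l hx), ht⟩⟩
  have hDm : ∀ t ∈ Icc 0 T, AEStronglyMeasurable (D t) σ := by
    intro t ht
    have hGt : ContinuousOn (fun x => G (x, t)) Γ₀ := hG.comp (hslice t ht).1 (hslice t ht).2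
    have h1 : AEMeasurable (D t) σ := by
      simp only [hD, dotC]
      refine Finset.aemeasurable_fun_sum _ fun i _ => AEMeasurable.mul ?_ ?_
      · exact Complex.measurable_ofReal.comp_aemeasurable
          ((EuclideanSpace.proj (𝕜 := ℝ) i).continuous.measurable.comp_aemeasurable hνm)
      · exact ((continuous_apply i).comp_continuousOn hGt).aemeasurable hΓ₀m
    exact h1.aestronglyMeasurable
  have hbm : ∀ t ∈ Icc 0 T, AEStronglyMeasurable (fun x => b (x, t)) σ := fun t ht =>
    ((hb.comp (hslice t ht).1 (hslice t ht).2).aemeasurable hΓ₀m).aestronglyMeasurable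
  have hcomp : IsCompact (Γ₀ ×ˢ Icc 0 T) := hΓ₀c.prod isCompact_Icc
  have hsubs : Γ₀ ×ˢ Icc 0 T ⊆ Z ×ˢ Icc 0 T := prod_mono (hΓ₀l.trans hZ) le_rfl
  obtain ⟨CG, hCG⟩ := hcomp.exists_bound_of_continuousOn (hG.mono hsubs)
  obtain ⟨Cb, hCb⟩ := hcomp.exists_bound_of_continuousOn (hb.mono hsubs)
  have hDb : ∀ t ∈ Icc 0 T, ∀ x ∈ Γ₀, ‖D t x‖ ≤ ∑ _i : Fin (m + 1), CG := by
    intro t ht x hx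
    refine (norm_dotC_le _ _).trans ?_
    have h1 := norm_outwardNormal_le N.dom x
    have h2 : ∑ i, ‖G (x, t) i‖ ≤ ∑ _i : Fin (m + 1), CG :=
      Finset.sum_le_sum fun i _ => (norm_le_pi_norm _ i).trans (hCG _ ⟨hx, ht⟩)
    exact (mul_le_of_le_one_left (Finset.sum_nonneg fun _ _ => norm_nonneg _) h1).trans h2
  have hDi : ∀ t ∈ Icc 0 T, Integrable (D t) σ := fun t ht =>
    Integrable.of_bound (hDm t ht) _ (by
      filter_upwards [ae_restrict_mem hΓ₀m] with x hx using hDb t ht x hx)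
  have hbi : ∀ t ∈ Icc 0 T, Integrable (fun x => b (x, t)) σ := fun t ht =>
    Integrable.of_bound (hbm t ht) _ (by
      filter_upwards [ae_restrict_mem hΓ₀m] with x hx using hCb (x, t) ⟨hx, ht⟩)
  have htcont : ∀ x ∈ Γ₀, ContinuousOn (fun t => (x, t)) (Icc 0 T) ∧
      MapsTo (fun t => (x, t)) (Icc 0 T) (Z ×ˢ Icc 0 T) := fun x hx =>
    ⟨by fun_prop, fun t ht => ⟨hZ (hΓ₀l hx), ht⟩⟩
  -- Continuity in time and the freedom of the time interval remove the time integral at the given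
  -- `t`; the freedom of the set `A` then removes the surface integral.
  have hzero : ∀ A : Set (E (m + 1)), MeasurableSet A →
      ∫ x in A, (D t x - b (x, t)) ∂σ = 0 := by
    intro A hA
    have hAσ : σ.restrict A = H.restrict (A ∩ Γ₀) := by rw [hσ, Measure.restrict_restrict hA]
    have hQ1 : ContinuousOn (fun t => ∫ x in A, D t x ∂σ) (Icc 0 T) := by
      refine continuousOn_of_dominated (bound := fun _ => ∑ _i : Fin (m + 1), CG)
        (fun t ht => (hDm t ht).restrict) (fun t ht => ?_) (integrable_const _) ?_
      · filter_upwards [ae_restrict_of_ae (ae_restrict_mem hΓ₀m)] with x hx using hDb t ht x hx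
      · filter_upwards [ae_restrict_of_ae (ae_restrict_mem hΓ₀m)] with x hx
        simp only [hD, dotC]
        exact continuousOn_finsetSum _ fun i _ => continuousOn_const.mul
          ((continuous_apply i).comp_continuousOn (hG.comp (htcont x hx).1 (htcont x hx).2))
    have hQ2 : ContinuousOn (fun t => ∫ x in A, b (x, t) ∂σ) (Icc 0 T) := by
      refine continuousOn_of_dominated (bound := fun _ => Cb)
        (fun t ht => (hbm t ht).restrict) (fun t ht => ?_) (integrable_const _) ?_
      · filter_upwards [ae_restrict_of_ae (ae_restrict_mem hΓ₀m)] with x hx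
          using hCb (x, t) ⟨hx, ht⟩
      · filter_upwards [ae_restrict_of_ae (ae_restrict_mem hΓ₀m)] with x hx
        exact hb.comp (htcont x hx).1 (htcont x hx).2
    have hQ := eq_zero_of_forall_intervalIntegral_eq_zero
      (Q := fun t => (∫ x in A, D t x ∂σ) - ∫ x in A, b (x, t) ∂σ) (hQ1.sub hQ2) (fun T₁ T₂ h1 h2 h3 => by
      have hsub : uIcc T₁ T₂ ⊆ Icc 0 T := by
        rw [uIcc_of_le h2.le]; exact Icc_subset_Icc h1 h3
      rw [intervalIntegral.integral_sub (hQ1.mono hsub).intervalIntegrable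
        (hQ2.mono hsub).intervalIntegrable, sub_eq_zero, hAσ]
      exact hbal (A ∩ Γ₀) (inter_subset_right.trans hΓ₀l) (hA.inter hΓ₀m) T₁ T₂ h1 h2 h3) ht
    have ht' := Ioo_subset_Icc_self ht
    rw [integral_sub (hDi t ht').integrableOn (hbi t ht').integrableOn]
    exact hQ
  have hae := ((hDi t (Ioo_subset_Icc_self ht)).sub
    (hbi t (Ioo_subset_Icc_self ht))).ae_eq_zero_of_forall_setIntegral_eq_zero
    fun A hA _ => hzero A hA
  rw [hσ, Filter.EventuallyEq, ae_restrict_iff' hΓ₀m] at hae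
  -- transfer to the parameter domain
  set B : Set (E (m + 1)) := {x | x ∈ Γ₀ ∧ D t x ≠ b (x, t)} with hB
  have hB0 : H B = 0 := by
    refine measure_mono_null ?_ hae
    rintro x ⟨hx1, hx2⟩ hx3
    exact hx2 (sub_eq_zero.1 (hx3 hx1))
  have hΛB : volume (N.graphCoord e '' B) = 0 := by
    have h1 : H' (N.graphCoord e '' B) = 0 := by
      refine le_antisymm (((hC₂.mono ?_).hausdorffMeasure_image_le hm0).trans ?_) zero_le
      · exact fun x hx => hΓ₀s hx.1
      · rw [hB0, mul_zero]
    exact (Measure.absolutelyContinuous_isAddHaarMeasure volume H') h1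
  refine ⟨ρ, hρ, fun q hq => ⟨(hρ' q (Metric.ball_subset_closedBall hq)).1,
    hlat q (Metric.ball_subset_closedBall hq)⟩, ?_⟩
  filter_upwards [measure_eq_zero_iff_ae_notMem.1 hΛB] with q hq hqb hqd
  have hqR : q ∈ R := Metric.ball_subset_closedBall hqb
  obtain ⟨hn1, hn2⟩ := hnormal q hqR hqd
  refine ⟨hn2, hn1, ?_⟩
  by_contra hne
  refine hq ⟨Ψ q, ⟨⟨q, hqR, rfl⟩, ?_⟩, N.graphCoord_graphPt h q⟩
  simp only [hD]
  rwa [hn2.outwardNormal_eq]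

end

end BalanceLaw

namespace BalanceLaw

variable {m : ℕ}

/-! ### The flux along the solution -/

section Composite

variable {k : ℕ} {Ω : Set (E k)} {T α C : ℝ}

theorem FluxNormLE.norm_sub_le {f : E k → ℝ → ℂ → ℂ} (h : FluxNormLE Ω T α C f) {x x' : E k}
    {t t' : ℝ} (hx : x ∈ closure Ω) (hx' : x' ∈ closure Ω) (ht : t ∈ Icc 0 T) (ht' : t' ∈ Icc 0 T)
    (z z' : ℂ) : ‖f x t z - f x' t' z'‖
      ≤ C * dist x x' ^ α + C * |t - t'| ^ (α / 2) + C * ‖z - z'‖ ^ α := by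
  have h1 := (h.space t ht z).norm_sub_le hx hx' dist_nonneg
  have h2 := (h.time x' hx' z).norm_sub_le ht ht' dist_nonneg
  have h3 := (h.state x' hx' t' ht').norm_sub_le (mem_univ z) (mem_univ z') dist_nonneg
  rw [dist_eq_norm z] at h3
  rw [Real.dist_eq] at h2
  have : f x t z - f x' t' z'
    = (f x t z - f x' t z) + (f x' t z - f x' t' z) + (f x' t' z - f x' t' z') := by ring
  rw [this]
  exact (norm_add₃_le).trans (by linarith)

theorem SourceNormLE.norm_sub_le {f : E k → ℝ → ℂ → EuclideanSpace ℂ (Fin k) → ℂ}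
    (h : SourceNormLE Ω T α C f) {x x' : E k}
    {t t' : ℝ} (hx : x ∈ closure Ω) (hx' : x' ∈ closure Ω) (ht : t ∈ Icc 0 T) (ht' : t' ∈ Icc 0 T)
    (z z' : ℂ) (P P' : EuclideanSpace ℂ (Fin k)) : ‖f x t z P - f x' t' z' P'‖
      ≤ C * dist x x' ^ α + C * |t - t'| ^ (α / 2) + C * ‖z - z'‖ ^ α + C * ‖P - P'‖ ^ α := by
  have h1 := (h.space t ht z P).norm_sub_le hx hx' dist_nonneg
  have h2 := (h.time x' hx' z P).norm_sub_le ht ht' dist_nonneg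
  have h3 := (h.state x' hx' t' ht' P).norm_sub_le (mem_univ z) (mem_univ z') dist_nonneg
  have h4 := (h.grad x' hx' t' ht' z').norm_sub_le (mem_univ P) (mem_univ P') dist_nonneg
  rw [dist_eq_norm z] at h3
  rw [dist_eq_norm P] at h4
  rw [Real.dist_eq] at h2
  have : f x t z P - f x' t' z' P' = (f x t z P - f x' t z P) + (f x' t z P - f x' t' z P)
      + (f x' t' z P - f x' t' z' P) + (f x' t' z' P - f x' t' z' P') := by ring
  rw [this]
  exact (norm_add₄_le).trans (by linarith)

theorem tendsto_parabolic_modulus (hα : 0 < α) (C : ℝ) (q : E k × ℝ) (s : Set (E k × ℝ)) :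
    Tendsto (fun p : E k × ℝ => C * dist p.1 q.1 ^ α + C * |p.2 - q.2| ^ (α / 2))
      (𝓝[s] q) (𝓝 0) := by
  have hα2 : 0 < α / 2 := by positivity
  have hc : Continuous fun p : E k × ℝ => C * dist p.1 q.1 ^ α + C * |p.2 - q.2| ^ (α / 2) :=
    (continuous_const.mul ((by fun_prop : Continuous fun p : E k × ℝ =>
      dist p.1 q.1).rpow_const fun _ => Or.inr hα.le)).add
      (continuous_const.mul ((by fun_prop : Continuous fun p : E k × ℝ =>
        |p.2 - q.2|).rpow_const fun _ => Or.inr hα2.le))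
  have h := (hc.tendsto q).mono_left (nhdsWithin_le_nhds (s := s))
  rwa [dist_self, sub_self, abs_zero, Real.zero_rpow hα.ne', Real.zero_rpow hα2.ne', mul_zero,
    add_zero] at h

theorem FluxNormLE.continuousOn_comp {f : E k → ℝ → ℂ → ℂ} (hα : 0 < α)
    (h : FluxNormLE Ω T α C f) {u : E k → ℝ → ℂ}
    (hu : ContinuousOn (fun p : E k × ℝ => u p.1 p.2) (closure Ω ×ˢ Icc 0 T)) :
    ContinuousOn (fun p : E k × ℝ => f p.1 p.2 (u p.1 p.2)) (closure Ω ×ˢ Icc 0 T) := by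
  intro q hq
  rw [ContinuousWithinAt, tendsto_iff_norm_sub_tendsto_zero]
  have h1 : Tendsto (fun p : E k × ℝ => C * dist p.1 q.1 ^ α + C * |p.2 - q.2| ^ (α / 2)
      + C * ‖u p.1 p.2 - u q.1 q.2‖ ^ α) (𝓝[closure Ω ×ˢ Icc 0 T] q) (𝓝 0) := by
    have hu0 := tendsto_iff_norm_sub_tendsto_zero.1 (hu q hq)
    have a1 := tendsto_parabolic_modulus hα C q (closure Ω ×ˢ Icc 0 T)
    have a2 := (hu0.rpow_const (Or.inr hα.le) (p := α)).const_mul C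
    have a3 := a1.add a2
    rw [Real.zero_rpow hα.ne'] at a3
    simpa only [mul_zero, add_zero] using a3
  refine squeeze_zero' (Eventually.of_forall fun _ => norm_nonneg _) ?_ h1
  filter_upwards [self_mem_nhdsWithin] with p hp
  exact h.norm_sub_le hp.1 hq.1 hp.2 hq.2 _ _

theorem SourceNormLE.continuousOn_comp {f : E k → ℝ → ℂ → EuclideanSpace ℂ (Fin k) → ℂ}
    (hα : 0 < α) (h : SourceNormLE Ω T α C f) {u : E k → ℝ → ℂ}
    {Du : E k → ℝ → EuclideanSpace ℂ (Fin k)}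
    (hu : ContinuousOn (fun p : E k × ℝ => u p.1 p.2) (closure Ω ×ˢ Icc 0 T))
    (hDu : ContinuousOn (fun p : E k × ℝ => Du p.1 p.2) (closure Ω ×ˢ Icc 0 T)) :
    ContinuousOn (fun p : E k × ℝ => f p.1 p.2 (u p.1 p.2) (Du p.1 p.2))
      (closure Ω ×ˢ Icc 0 T) := by
  intro q hq
  rw [ContinuousWithinAt, tendsto_iff_norm_sub_tendsto_zero]
  have h1 : Tendsto (fun p : E k × ℝ => C * dist p.1 q.1 ^ α + C * |p.2 - q.2| ^ (α / 2)
      + C * ‖u p.1 p.2 - u q.1 q.2‖ ^ α + C * ‖Du p.1 p.2 - Du q.1 q.2‖ ^ α)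
      (𝓝[closure Ω ×ˢ Icc 0 T] q) (𝓝 0) := by
    have hu0 := tendsto_iff_norm_sub_tendsto_zero.1 (hu q hq)
    have hDu0 := tendsto_iff_norm_sub_tendsto_zero.1 (hDu q hq)
    have a1 := tendsto_parabolic_modulus hα C q (closure Ω ×ˢ Icc 0 T)
    have a2 := (hu0.rpow_const (Or.inr hα.le) (p := α)).const_mul C
    have a4 := (hDu0.rpow_const (Or.inr hα.le) (p := α)).const_mul C
    have a3 := (a1.add a2).add a4
    rw [Real.zero_rpow hα.ne'] at a3
    simpa only [mul_zero, add_zero] using a3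
  refine squeeze_zero' (Eventually.of_forall fun _ => norm_nonneg _) ?_ h1
  filter_upwards [self_mem_nhdsWithin] with p hp
  exact h.norm_sub_le hp.1 hq.1 hp.2 hq.2 _ _ _ _

end Composite

/-! ### Maxima on the cross-section -/

/-- A real vector field that is orthogonal to the normal at almost all points of the lateral boundary
is orthogonal to the lifted gradient of a function on the cross-section at a maximum. -/
theorem Shear.inner_lift_grad_eq_zero (N : Shear m) {p : E m} {r : ℝ} {e : E m} {κ : NNReal}
    {g : E m → ℝ} (h : GraphChart N.sec p r e κ g) (hS : IsOpen N.sec)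
    (hp : p ∈ frontier N.sec) {s : ℝ} {ρ : ℝ} (hρ : 0 < ρ)
    (hball : ∀ q ∈ Metric.ball (p + (s - inner ℝ p e) • e) ρ, inner ℝ q e ∈ N.range ∧
      N.graphPt e g q ∈ N.lateral) {U : E (m + 1) → E (m + 1)} (hU : ContinuousOn U N.lateral)
    (hae : ∀ᵐ q, q ∈ Metric.ball (p + (s - inner ℝ p e) • e) ρ → DifferentiableAt ℝ g q →
      inner ℝ (N.graphNormal e g q) (U (N.graphPt e g q)) = 0)
    {J : E m → ℝ} {J' : E m →L[ℝ] ℝ} (hJ : HasFDerivAt J J' p)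
    (hmax : IsMaxOn J (closure N.sec) p) :
    inner ℝ (N.lift s (grad J')) (U (N.pt s p)) = 0 := by
  set q₀ := p + (s - inner ℝ p e) • e with hq₀
  have hq₀e : inner ℝ q₀ e = s := by rw [hq₀, h.inner_add_smul]; ring
  have htg : q₀ + (g q₀ - inner ℝ q₀ e) • e = p := by
    have h1 := (h.mem_frontier_iff hS (Metric.mem_ball_self h.pos)).1 hp
    rw [hq₀e, hq₀, h.invariant, add_assoc, ← add_smul, ← h1]; simp
  have hpt : N.graphPt e g q₀ = N.pt s p := by rw [graphPt, htg, hq₀e]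
  -- The field after subtraction of the multiple of the curve's tangent that makes it parallel to
  -- the section. Orthogonality to the lifted normal becomes tangency to the graph.
  set V : E m → E m := fun q => N.proj (U (N.graphPt e g q))
    - N.ht (U (N.graphPt e g q)) • N.dprof (inner ℝ q e) with hV
  obtain ⟨C, hC⟩ := N.lipschitzOn_graphPt h
  have hVc : ContinuousOn V (Metric.ball q₀ ρ) := by
    have h1 : ContinuousOn (fun q => U (N.graphPt e g q)) (Metric.ball q₀ ρ) :=
      hU.comp (hC.continuousOn.mono fun q hq => (hball q hq).1) fun q hq => (hball q hq).2
    have h2 : ContinuousOn (fun q => N.dprof (inner ℝ q e)) (Metric.ball q₀ ρ) :=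
      N.continuousOn_dprof.comp (f := fun q : E m => inner ℝ q e) (by fun_prop)
        fun q hq => (hball q hq).1
    exact (N.proj.continuous.comp_continuousOn h1).sub
      ((N.ht.continuous.comp_continuousOn h1).smul h2)
  have hz := h.apply_eq_zero_of_isMaxOn hS htg.symm hρ
    (hVc q₀ (Metric.mem_ball_self hρ)) (by
      filter_upwards [hae] with q hq hqb hqd
      have h1 := hq hqb hqd
      rw [graphNormal, N.inner_lift, inner_sub_left, inner_grad, sub_eq_zero] at h1
      rw [real_inner_comm]; exact h1) hJ hmax
  rw [N.inner_lift, inner_grad, ← hpt, ← hq₀e]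
  exact hz

/-- The complex version, for a field that is orthogonal to the normal wherever the flux balance
holds pointwise. -/
theorem Shear.dotC_lift_grad_eq_zero (N : Shear m) (hS : IsLipschitzDomain N.sec) {p : E m}
    (hp : p ∈ frontier N.sec) {s : ℝ} (hs : s ∈ N.range) {T : ℝ} {Z : Set (E (m + 1))}
    (hZ : N.lateral ⊆ Z) {G : E (m + 1) × ℝ → Fin (m + 1) → ℂ} {b : E (m + 1) × ℝ → ℂ}
    (hG : ContinuousOn G (Z ×ˢ Icc 0 T)) (hb : ContinuousOn b (Z ×ˢ Icc 0 T))
    (hbal : ∀ Γ ⊆ N.lateral, MeasurableSet Γ → ∀ T₁ T₂, 0 ≤ T₁ → T₁ < T₂ → T₂ ≤ T →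
      (∫ t in T₁..T₂, ∫ x in Γ, dotC (outwardNormal N.dom x) (G (x, t))
          ∂(Measure.hausdorffMeasure (m : ℝ)))
        = ∫ t in T₁..T₂, ∫ x in Γ, b (x, t) ∂(Measure.hausdorffMeasure (m : ℝ)))
    {t : ℝ} (ht : t ∈ Ioo 0 T) {U : E (m + 1) → Fin (m + 1) → ℂ} (hU : ContinuousOn U N.lateral)
    (hUν : ∀ x ∈ N.lateral, ∀ ν, IsOutwardNormal N.dom x ν → dotC ν (G (x, t)) = b (x, t) →
      dotC ν (U x) = 0)
    {J : E m → ℝ} {J' : E m →L[ℝ] ℝ} (hJ : HasFDerivAt J J' p)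
    (hmax : IsMaxOn J (closure N.sec) p) :
    dotC (N.lift s (grad J')) (U (N.pt s p)) = 0 := by
  obtain ⟨r, e, κ, g, h⟩ := hS.exists_chart hp
  obtain ⟨ρ, hρ, hball, hae⟩ := N.ae_flux_eq h hS.isOpen hp hs hZ hG hb hbal ht
  have hae' : ∀ᵐ q, q ∈ Metric.ball (p + (s - inner ℝ p e) • e) ρ → DifferentiableAt ℝ g q →
      dotC (N.graphNormal e g q) (U (N.graphPt e g q)) = 0 := by
    filter_upwards [hae] with q hq hqb hqd
    obtain ⟨h1, h2, h3⟩ := hq hqb hqd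
    have h4 := hUν _ (hball q hqb).2 _ h1 h3
    rw [dotC_smul_left] at h4
    have h5 : ((‖N.graphNormal e g q‖⁻¹ : ℝ) : ℂ) ≠ 0 := by
      simpa using h2
    exact (mul_eq_zero.1 h4).resolve_left h5
  have hUi : ∀ i, ContinuousOn (fun x => U x i) N.lateral := fun i =>
    (continuous_apply i).comp_continuousOn hU
  apply Complex.ext
  · rw [re_dotC, Complex.zero_re]
    refine N.inner_lift_grad_eq_zero h hS.isOpen hp hρ hball
      (U := fun x => WithLp.toLp 2 fun i => (U x i).re) ?_ ?_ hJ hmax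
    · refine (PiLp.continuous_toLp 2 _).comp_continuousOn (continuousOn_pi.2 fun i => ?_)
      exact Complex.continuous_re.comp_continuousOn (hUi i)
    · filter_upwards [hae'] with q hq hqb hqd
      rw [← re_dotC, hq hqb hqd, Complex.zero_re]
  · rw [im_dotC, Complex.zero_im]
    refine N.inner_lift_grad_eq_zero h hS.isOpen hp hρ hball
      (U := fun x => WithLp.toLp 2 fun i => (U x i).im) ?_ ?_ hJ hmax
    · refine (PiLp.continuous_toLp 2 _).comp_continuousOn (continuousOn_pi.2 fun i => ?_)
      exact Complex.continuous_im.comp_continuousOn (hUi i)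
    · filter_upwards [hae'] with q hq hqb hqd
      rw [← im_dotC, hq hqb hqd, Complex.zero_im]

/-- The maximum of a linear function with a quadratic penalty, on a cross-section that is thin in the
direction of the linear function, is attained on the boundary and close to the centre. -/
theorem exists_max_penalized {S : Set (E m)} (ho : IsOpen S) (hb : Bornology.IsBounded S)
    {y v : E m} (hy : y ∈ S) {ε ρ : ℝ} (hε : 0 < ε) (hρ : 0 < ρ)
    (hthin : ∀ z ∈ S, ∀ z' ∈ S, inner ℝ v (z - z') ≤ ε) (hv : 2 * ε / ρ < ‖v‖) :
    ∃ p ∈ frontier S, ‖p - y‖ ≤ ρ ∧ ∃ (J : E m → ℝ) (J' : E m →L[ℝ] ℝ), HasFDerivAt J J' p ∧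
      IsMaxOn J (closure S) p ∧ grad J' = v - (2 * ε / ρ ^ 2) • (p - y) := by
  -- The penalty has weight ε/ρ² because the linear part can gain at most ε over its value at `y`;
  -- comparing `J y ≤ J p` confines the maximum to distance ρ.
  set J : E m → ℝ := fun z => inner ℝ v z - ε / ρ ^ 2 * ‖z - y‖ ^ 2 with hJ
  have hJc : Continuous J := by simp only [hJ]; fun_prop
  have hcomp : IsCompact (closure S) :=
    Metric.isCompact_of_isClosed_isBounded isClosed_closure hb.closure
  obtain ⟨p, hp, hmax⟩ := hcomp.exists_isMaxOn ⟨y, subset_closure hy⟩ hJc.continuousOn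
  have hthin' : inner ℝ v (p - y) ≤ ε := by
    have hcl : IsClosed {z | inner ℝ v (z - y) ≤ ε} := isClosed_le (by fun_prop) continuous_const
    exact hcl.closure_subset_iff.2 (fun z hz => hthin z hz y hy) hp
  have hpy : ‖p - y‖ ≤ ρ := by
    have h1 : J y ≤ J p := hmax (subset_closure hy)
    simp only [hJ, sub_self, norm_zero] at h1
    rw [inner_sub_right] at hthin'
    have h2 : ε / ρ ^ 2 * ‖p - y‖ ^ 2 ≤ ε := by nlinarith
    rw [div_mul_eq_mul_div, div_le_iff₀ (by positivity)] at h2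
    have h3 : ‖p - y‖ ^ 2 ≤ ρ ^ 2 := le_of_mul_le_mul_left h2 hε
    exact le_of_sq_le_sq h3 hρ.le
  set J' : E m →L[ℝ] ℝ := innerSL ℝ (v - (2 * ε / ρ ^ 2) • (p - y)) with hJ'
  have hd : HasFDerivAt J J' p := by
    have h1 : HasFDerivAt (fun z : E m => inner ℝ v z) (innerSL ℝ v) p := (innerSL ℝ v).hasFDerivAt
    have h2 : HasFDerivAt (fun z : E m => ‖z - y‖ ^ 2) (2 • (innerSL ℝ (p - y))) p :=
      ((hasFDerivAt_id p).sub_const y).norm_sq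
    have h3 := h1.sub (h2.const_mul (ε / ρ ^ 2))
    refine h3.congr_fderiv ?_
    ext z
    simp [hJ']
    ring
  have hgrad : grad J' = v - (2 * ε / ρ ^ 2) • (p - y) := by
    refine ext_inner_right ℝ fun z => ?_
    rw [inner_grad, hJ', innerSL_apply_apply]
  refine ⟨p, ?_, hpy, J, J', hd, hmax, hgrad⟩
  rw [ho.frontier_eq]
  refine ⟨hp, fun hpS => ?_⟩
  -- At an interior maximum `v` would equal the gradient of the penalty, which is at most 2ε/ρ
  -- within distance ρ; the lower bound on `‖v‖` excludes this.
  have hloc : IsLocalMax J p := by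
    filter_upwards [ho.mem_nhds hpS] with z hz using hmax (subset_closure hz)
  have h0 := hloc.hasFDerivAt_eq_zero hd
  have h1 : v = (2 * ε / ρ ^ 2) • (p - y) := by
    rw [← sub_eq_zero, ← hgrad, h0]
    refine ext_inner_right ℝ fun z => ?_
    rw [inner_grad]; simp
  have h2 : ‖v‖ ≤ 2 * ε / ρ := by
    rw [h1, norm_smul, Real.norm_eq_abs, abs_of_pos (by positivity)]
    calc 2 * ε / ρ ^ 2 * ‖p - y‖ ≤ 2 * ε / ρ ^ 2 * ρ :=
          mul_le_mul_of_nonneg_left hpy (by positivity)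
      _ = 2 * ε / ρ := by field_simp
  linarith

end BalanceLaw

namespace BalanceLaw

variable {m : ℕ}

/-! ### The flux near the lateral boundary -/

/-- The error in replacing `r` by the lift of its projection is measured by `inner ℝ r (N.tangent
s)`, which is small for the directions in which the flux is recovered. -/
theorem Shear.eq_lift_add (N : Shear m) (s : ℝ) (r : E (m + 1)) :
    r = N.lift s (N.proj r) + inner ℝ r (N.tangent s) • N.nrm := by
  conv_lhs => rw [← N.decomp r]
  have h1 : inner ℝ r (N.tangent s) = N.ht r + inner ℝ (N.proj r) (N.dprof s) := by
    rw [Shear.tangent, inner_add_right, N.inner_proj, N.ht_apply, real_inner_comm]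
  rw [h1, Shear.lift, add_smul]; abel

/-- A field that is orthogonal to the normal wherever the flux balance holds is small in the
directions `r` in which the domain is thin, at some point of the lateral boundary. -/
theorem Shear.exists_frontier_norm_dotC_le (N : Shear m) (hS : IsLipschitzDomain N.sec)
    {s : ℝ} (hs : s ∈ N.range) {T : ℝ} {Z : Set (E (m + 1))}
    (hZ : N.lateral ⊆ Z) {G : E (m + 1) × ℝ → Fin (m + 1) → ℂ} {b : E (m + 1) × ℝ → ℂ}
    (hG : ContinuousOn G (Z ×ˢ Icc 0 T)) (hb : ContinuousOn b (Z ×ˢ Icc 0 T))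
    (hbal : ∀ Γ ⊆ N.lateral, MeasurableSet Γ → ∀ T₁ T₂, 0 ≤ T₁ → T₁ < T₂ → T₂ ≤ T →
      (∫ t in T₁..T₂, ∫ x in Γ, dotC (outwardNormal N.dom x) (G (x, t))
          ∂(Measure.hausdorffMeasure (m : ℝ)))
        = ∫ t in T₁..T₂, ∫ x in Γ, b (x, t) ∂(Measure.hausdorffMeasure (m : ℝ)))
    {t : ℝ} (ht : t ∈ Ioo 0 T) {U : E (m + 1) → Fin (m + 1) → ℂ} (hU : ContinuousOn U N.lateral)
    (hUν : ∀ x ∈ N.lateral, ∀ ν, IsOutwardNormal N.dom x ν → dotC ν (G (x, t)) = b (x, t) →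
      dotC ν (U x) = 0) {A : ℝ} (hA : ∀ x ∈ N.lateral, ∑ i, ‖U x i‖ ≤ A)
    {y : E m} (hy : y ∈ N.sec) {r : E (m + 1)} {η ε ρ : ℝ} (hη : |inner ℝ r (N.tangent s)| ≤ η)
    (hε : 0 < ε) (hρ : 0 < ρ)
    (hthin : ∀ z ∈ N.sec, ∀ z' ∈ N.sec, inner ℝ (N.proj r) (z - z') ≤ ε)
    (hr : 2 * ε / ρ < ‖N.proj r‖) :
    ∃ p ∈ frontier N.sec, ‖p - y‖ ≤ ρ ∧
      ‖dotC r (U (N.pt s p))‖ ≤ (2 * (1 + N.lip) * (ε / ρ) + η) * A := by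
  obtain ⟨p, hp, hpy, J, J', hJ, hmax, hgrad⟩ :=
    exists_max_penalized hS.isOpen hS.isBounded hy hε hρ hthin hr
  refine ⟨p, hp, hpy, ?_⟩
  have h0 := N.dotC_lift_grad_eq_zero hS hp hs hZ hG hb hbal ht hU hUν hJ hmax
  set W := U (N.pt s p)
  have hA' : ∑ i, ‖W i‖ ≤ A := hA _ (N.pt_mem_lateral hs hp)
  have hW0 : 0 ≤ ∑ i, ‖W i‖ := Finset.sum_nonneg fun _ _ => norm_nonneg _
  have hdot : ∀ v : E (m + 1), ‖dotC v W‖ ≤ ‖v‖ * A := fun v =>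
    (norm_dotC_le v W).trans (mul_le_mul_of_nonneg_left hA' (norm_nonneg _))
  -- The lift of the gradient of the penalized function contributes nothing; the lift of the
  -- penalty's gradient is O(ε/ρ).
  have hlift : N.lift s (N.proj r)
      = N.lift s (grad J') + (2 * ε / ρ ^ 2) • N.lift s (p - y) := by
    rw [← N.lift_smul, ← N.lift_add, hgrad, sub_add_cancel]
  rw [N.eq_lift_add s r, hlift, dotC_add_left, dotC_add_left, h0, zero_add, dotC_smul_left,
    dotC_smul_left]
  refine (norm_add_le _ _).trans ?_
  rw [norm_mul, norm_mul, Complex.norm_real, Complex.norm_real, Real.norm_eq_abs, Real.norm_eq_abs,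
    abs_of_pos (show 0 < 2 * ε / ρ ^ 2 by positivity), add_mul]
  have hA0 : 0 ≤ A := hW0.trans hA'
  refine add_le_add ?_ ?_
  · have h1 : ‖N.lift s (p - y)‖ ≤ (1 + N.lip) * ρ :=
      (N.norm_lift_le hs _).trans (mul_le_mul_of_nonneg_left hpy (by positivity))
    calc 2 * ε / ρ ^ 2 * ‖dotC (N.lift s (p - y)) W‖
        ≤ 2 * ε / ρ ^ 2 * ((1 + N.lip) * ρ * A) := by
          refine mul_le_mul_of_nonneg_left ((hdot _).trans ?_) (by positivity)
          exact mul_le_mul_of_nonneg_right h1 hA0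
      _ = 2 * (1 + N.lip) * (ε / ρ) * A := by field_simp
  · have h1 := hdot N.nrm
    rw [N.norm_nrm, one_mul] at h1
    exact mul_le_mul hη h1 (norm_nonneg _) ((abs_nonneg _).trans hη)

/-! ### The flux of a setting -/

section Setting

variable {M : ℕ} {N : Fin M → Tube m} {T μ α₂ α₃ α₄ C₂ C₃ C₄ : ℝ} {H : ℂ → ℂ}
  {F : Fin 2 → E (m + 1) → ℝ → ℂ → Fin (m + 1) → ℂ}
  {f : Fin 2 → E (m + 1) → ℝ → ℂ → EuclideanSpace ℂ (Fin (m + 1)) → ℂ}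
  {u : Fin 2 → E (m + 1) → ℝ → ℂ} {Du : Fin 2 → E (m + 1) → ℝ → EuclideanSpace ℂ (Fin (m + 1))}
  {ut h : Fin 2 → E (m + 1) → ℝ → ℂ}

theorem Tube.dom_subset_unionDom (N : Fin M → Tube m) (i : Fin M) : (N i).dom ⊆ unionDom N :=
  subset_iUnion (fun i => (N i).dom) i

theorem IsSetting.continuousOn_u (hs : IsSetting N T μ α₂ α₃ α₄ C₂ C₃ C₄ H F f u Du ut h)
    (hα : 0 < α₄) (j : Fin 2) :
    ContinuousOn (fun p : E (m + 1) × ℝ => u j p.1 p.2) (closure (unionDom N) ×ˢ Icc 0 T) :=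
  (hs.solution_norm j).norm_u.continuousOn_parDist hα

theorem IsSetting.continuousOn_Du (hs : IsSetting N T μ α₂ α₃ α₄ C₂ C₃ C₄ H F f u Du ut h)
    (hα : 0 < α₄) (j : Fin 2) :
    ContinuousOn (fun p : E (m + 1) × ℝ => Du j p.1 p.2) (closure (unionDom N) ×ˢ Icc 0 T) :=
  (hs.solution_norm j).norm_Du.continuousOn_parDist hα

theorem IsSetting.continuousOn_h (hs : IsSetting N T μ α₂ α₃ α₄ C₂ C₃ C₄ H F f u Du ut h)
    (hα : 0 < α₄) (j : Fin 2) :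
    ContinuousOn (fun p : E (m + 1) × ℝ => h j p.1 p.2) (closure (unionDom N) ×ˢ Icc 0 T) := by
  obtain ⟨C, hC⟩ := hs.coupling j
  exact hC.continuousOn_parDist hα

theorem IsSetting.continuousOn_flux (hs : IsSetting N T μ α₂ α₃ α₄ C₂ C₃ C₄ H F f u Du ut h)
    (hα₃ : 0 < α₃) (hα : 0 < α₄) (i j : Fin 2) (k : Fin (m + 1)) :
    ContinuousOn (fun p : E (m + 1) × ℝ => F i p.1 p.2 (u j p.1 p.2) k)
      (closure (unionDom N) ×ˢ Icc 0 T) :=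
  (hs.flux i k).continuousOn_comp hα₃ (hs.continuousOn_u hα j)

/-- The difference of the two solutions at a fixed time. -/
theorem IsSetting.slice_sub (hs : IsSetting N T μ α₂ α₃ α₄ C₂ C₃ C₄ H F f u Du ut h)
    (hα : 0 < α₄) {t : ℝ} (ht : t ∈ Ioo 0 T) :
    SliceHolder (unionDom N) α₄ (2 * C₄) (fun x => u 0 x t - u 1 x t)
      (fun x => Du 0 x t - Du 1 x t) :=
  ((hs.solution_norm 0).slice hα ht).sub ((hs.solution_norm 1).slice hα ht)

/-- The flux component in a direction `r` in which the component `P` of the domain is thin. -/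
theorem IsSetting.norm_dotC_flux_sub_le
    (hs : IsSetting N T μ α₂ α₃ α₄ C₂ C₃ C₄ H F f u Du ut h) (hμ : 0 < μ) (hα₃ : 0 < α₃)
    (hα₄ : 0 < α₄) (hC₃ : 0 < C₃) (hC₄ : 0 < C₄) {i : Fin M} {P : Shear m}
    (hdom : P.dom = (N i).dom) (hlat : P.lateral = (N i).lateral) (hL : IsLipschitzDomain P.sec)
    {s : ℝ} (hsr : s ∈ P.range) {y : E m} (hy : y ∈ P.sec) {t : ℝ} (ht : t ∈ Ioo 0 T) (j : Fin 2)
    {r : E (m + 1)} (hr1 : ‖r‖ = 1) {η ε ρ ϑ D₁ D₂ : ℝ}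
    (hη : |inner ℝ r (P.tangent s)| ≤ η)
    (hε : 0 < ε) (hρ : 0 < ρ)
    (hthin : ∀ z ∈ P.sec, ∀ z' ∈ P.sec, inner ℝ (P.proj r) (z - z') ≤ ε)
    (hr : 2 * ε / ρ < ‖P.proj r‖)
    (hϑ₁ : ε / ρ ≤ ϑ) (hϑ₂ : ρ ^ α₃ ≤ ϑ) (hϑ₃ : ρ ^ α₄ ≤ ϑ)
    (hD₁ : ‖dotC r (fun k => Du 0 (P.pt s y) t k - Du 1 (P.pt s y) t k)‖ ≤ D₁ * ϑ)
    (hD₂ : ∀ p ∈ frontier P.sec, ‖p - y‖ ≤ ρ →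
      ‖u j (P.pt s y) t - u j (P.pt s p) t‖ ^ α₃ ≤ D₂ * ϑ) :
    ‖dotC r (fun k => F 0 (P.pt s y) t (u j (P.pt s y) t) k
        - F 1 (P.pt s y) t (u j (P.pt s y) t) k)‖
      ≤ (m + 1) * (2 * C₃ * (1 + D₂) * ϑ)
        + ((2 * (1 + P.lip) * ϑ + η) * ((m + 1) * (2 * C₃ + μ * (2 * C₄)))
          + μ * (D₁ * ϑ + 2 * C₄ * ϑ)) := by
  have ht' : t ∈ Icc 0 T := Ioo_subset_Icc_self ht
  have hΩ : P.dom ⊆ unionDom N := hdom ▸ Tube.dom_subset_unionDom N i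
  have hZ : P.lateral ⊆ closure (unionDom N) :=
    P.lateral_subset_closure.trans (closure_mono hΩ)
  set G : E (m + 1) × ℝ → Fin (m + 1) → ℂ := fun p k =>
    F 0 p.1 p.2 (u 0 p.1 p.2) k - F 1 p.1 p.2 (u 1 p.1 p.2) k with hGdef
  have hG : ContinuousOn G (closure (unionDom N) ×ˢ Icc 0 T) :=
    continuousOn_pi.2 fun k =>
      (hs.continuousOn_flux hα₃ hα₄ 0 0 k).sub (hs.continuousOn_flux hα₃ hα₄ 1 1 k)
  have hb : ContinuousOn (fun p : E (m + 1) × ℝ => (μ : ℂ) * (h 0 p.1 p.2 - h 1 p.1 p.2))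
      (closure (unionDom N) ×ˢ Icc 0 T) :=
    continuousOn_const.mul ((hs.continuousOn_h hα₄ 0).sub (hs.continuousOn_h hα₄ 1))
  -- The combination in which the coupling terms of the flux balance and of the Neumann data cancel,
  -- so that its normal component vanishes.
  set U : E (m + 1) → Fin (m + 1) → ℂ := fun x k =>
    G (x, t) k + μ * (Du 0 x t k - Du 1 x t k) with hUdef
  have hslice : ContinuousOn (fun x : E (m + 1) => (x, t)) P.lateral := by fun_prop
  have hmaps : MapsTo (fun x : E (m + 1) => (x, t)) P.lateral
    (closure (unionDom N) ×ˢ Icc 0 T) := fun x hx => ⟨hZ hx, ht'⟩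
  have hU : ContinuousOn U P.lateral := by
    refine continuousOn_pi.2 fun k => ?_
    refine ContinuousOn.add ((continuous_apply k).comp_continuousOn (hG.comp hslice hmaps)) ?_
    refine continuousOn_const.mul (ContinuousOn.sub ?_ ?_)
    · exact (EuclideanSpace.proj (𝕜 := ℂ) k).continuous.comp_continuousOn
        ((hs.continuousOn_Du hα₄ 0).comp hslice hmaps)
    · exact (EuclideanSpace.proj (𝕜 := ℂ) k).continuous.comp_continuousOn
        ((hs.continuousOn_Du hα₄ 1).comp hslice hmaps)
  have hUsplit : ∀ v x, dotC v (U x)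
      = dotC v (G (x, t)) + μ * dotC v (fun k => Du 0 x t k - Du 1 x t k) := by
    intro v x
    rw [← dotC_smul_right, ← dotC_add_right]; rfl
  have hFb : ∀ i' k x z, x ∈ closure (unionDom N) → ‖F i' x t z k‖ ≤ C₃ := fun i' k x z hx =>
    ((hs.flux i' k).space t ht' z).norm_le hx
  have hDb : ∀ i' k x, x ∈ closure (unionDom N) → ‖Du i' x t k‖ ≤ C₄ := fun i' k x hx =>
    (PiLp.norm_apply_le (Du i' x t) k).trans
      ((hs.solution_norm i').norm_Du.norm_le (x := (x, t)) ⟨hx, ht'⟩)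
  have hA : ∀ x ∈ P.lateral, ∑ k, ‖U x k‖ ≤ (m + 1) * (2 * C₃ + μ * (2 * C₄)) := by
    intro x hx
    have h1 : ∀ k, ‖U x k‖ ≤ 2 * C₃ + μ * (2 * C₄) := by
      intro k
      refine (norm_add_le _ _).trans (add_le_add ?_ ?_)
      · have e0 := hFb 0 k x (u 0 x t) (hZ hx)
        have e1 := hFb 1 k x (u 1 x t) (hZ hx)
        exact (norm_sub_le _ _).trans (by linarith)
      · rw [norm_mul, Complex.norm_real, Real.norm_eq_abs, abs_of_pos hμ]
        refine mul_le_mul_of_nonneg_left ((norm_sub_le _ _).trans ?_) hμ.le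
        linarith [hDb 0 k x (hZ hx), hDb 1 k x (hZ hx)]
    refine (Finset.sum_le_sum fun k _ => h1 k).trans (le_of_eq ?_)
    simp [mul_add]
  obtain ⟨p, hp, hpy, hpU⟩ := P.exists_frontier_norm_dotC_le hL hsr hZ hG hb (by
      intro Γ hΓ hm T₁ T₂ h1 h2 h3
      rw [hlat] at hΓ
      rw [hdom]
      exact hs.balance i Γ hΓ hm T₁ T₂ h1 h2 h3) ht hU (by
      intro x hx ν hν hbal
      rw [hUsplit, hbal]
      rw [hdom] at hν
      rw [hlat] at hx
      have h1 := hs.neumann i x hx t ht' ν hν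
      have h2 : dotC ν (fun k => Du 0 x t k - Du 1 x t k)
        = dotC ν (Du 0 x t) - dotC ν (Du 1 x t) := dotC_sub_right _ _ _
      rw [h2]
      linear_combination (μ : ℂ) * h1) hA hy hη hε hρ hthin hr
  set x := P.pt s y with hx
  set x' := P.pt s p with hx'
  have hxΩ : x ∈ closure (unionDom N) := subset_closure (hΩ (P.pt_mem_dom hsr hy))
  have hx'l : x' ∈ P.lateral := P.pt_mem_lateral hsr hp
  have hx'Ω : x' ∈ closure (unionDom N) := hZ hx'l
  have hdist : dist x x' ≤ ρ := by
    rw [hx, hx', P.dist_pt_pt_same, dist_comm, dist_eq_norm]; exact hpy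
  have hϑ0 : 0 ≤ ϑ := (by positivity : 0 ≤ ε / ρ).trans hϑ₁
  -- On the lateral boundary the two states coincide. So the balance, in which each flux is taken at
  -- its own state, there compares the two fluxes at the same state `u j`.
  have huj : ∀ i' : Fin 2, u i' x' t = u j x' t := by
    have h1 := hs.dirichlet i x' (hlat ▸ hx'l) t ht'
    intro i'
    fin_cases i' <;> fin_cases j <;> simp [h1]
  set Gj : Fin (m + 1) → ℂ := fun k => F 0 x t (u j x t) k - F 1 x t (u j x t) k
  have hFd : ∀ i' k, ‖F i' x t (u j x t) k - F i' x' t (u i' x' t) k‖ ≤ C₃ * (1 + D₂) * ϑ := by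
    intro i' k
    rw [huj]
    have h1 := (hs.flux i' k).norm_sub_le hxΩ hx'Ω ht' ht' (u j x t) (u j x' t)
    rw [sub_self, abs_zero, Real.zero_rpow (by positivity), mul_zero, add_zero] at h1
    have h2 : dist x x' ^ α₃ ≤ ϑ :=
      (Real.rpow_le_rpow dist_nonneg hdist hα₃.le).trans hϑ₂
    have h3 := hD₂ p hp hpy
    have h4 := mul_le_mul_of_nonneg_left h2 hC₃.le
    have h5 := mul_le_mul_of_nonneg_left h3 hC₃.le
    linarith
  have hG1 : ‖dotC r (Gj - G (x', t))‖ ≤ (m + 1) * (2 * C₃ * (1 + D₂) * ϑ) := by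
    refine (norm_dotC_le _ _).trans ?_
    rw [hr1, one_mul]
    have h1 : ∀ k, ‖(Gj - G (x', t)) k‖ ≤ 2 * C₃ * (1 + D₂) * ϑ := by
      intro k
      have : (Gj - G (x', t)) k = (F 0 x t (u j x t) k - F 0 x' t (u 0 x' t) k)
        - (F 1 x t (u j x t) k - F 1 x' t (u 1 x' t) k) := by
        simp only [Gj, hGdef, Pi.sub_apply]; ring
      rw [this]
      exact (norm_sub_le _ _).trans (by linarith [hFd 0 k, hFd 1 k])
    refine (Finset.sum_le_sum fun k _ => h1 k).trans (le_of_eq ?_)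
    simp
  have hG2 : dotC r Gj = dotC r (Gj - G (x', t)) + (dotC r (U x')
      - μ * dotC r (fun k => Du 0 x' t k - Du 1 x' t k)) := by
    rw [hUsplit, dotC_sub_right]; ring
  have hD3 : ‖dotC r (fun k => Du 0 x' t k - Du 1 x' t k)‖ ≤ D₁ * ϑ + 2 * C₄ * ϑ := by
    set W := Du 0 x t - Du 1 x t with hW
    set W' := Du 0 x' t - Du 1 x' t with hW'
    have h1 : dotC r (fun k => Du 0 x' t k - Du 1 x' t k)
        = dotC r (fun k => Du 0 x t k - Du 1 x t k) - dotC r (W - W') := by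
      have e1 : dotC r (W - W') = dotC r W - dotC r W' := dotC_sub_right _ _ _
      rw [e1]
      have e2 : dotC r (fun k => Du 0 x t k - Du 1 x t k) = dotC r W := rfl
      have e3 : dotC r (fun k => Du 0 x' t k - Du 1 x' t k) = dotC r W' := rfl
      rw [e2, e3]; ring
    rw [h1]
    refine (norm_sub_le _ _).trans (add_le_add hD₁ ?_)
    refine (norm_dotC_le_euclidean _ _).trans ?_
    rw [hr1, one_mul]
    refine ((hs.slice_sub hα₄ ht).holder x hxΩ x' hx'Ω).trans ?_
    refine mul_le_mul_of_nonneg_left ?_ (by positivity)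
    exact (Real.rpow_le_rpow dist_nonneg hdist hα₄.le).trans hϑ₃
  rw [hG2]
  refine (norm_add_le _ _).trans (add_le_add hG1 ?_)
  refine (norm_sub_le _ _).trans (add_le_add (hpU.trans ?_) ?_)
  · refine mul_le_mul_of_nonneg_right ?_ (by positivity)
    have := mul_le_mul_of_nonneg_left hϑ₁ (show (0 : ℝ) ≤ 2 * (1 + P.lip) by positivity)
    linarith
  · rw [norm_mul, Complex.norm_real, Real.norm_eq_abs, abs_of_pos hμ]
    exact mul_le_mul_of_nonneg_left hD3 hμ.le

end Setting

end BalanceLaw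

namespace BalanceLaw

variable {m : ℕ}

/-! ### Thin cross-sections -/

/-- The rows of the rotation matrix are unit vectors. -/
theorem exists_row (hm : m = 1 ∨ m = 2) (θ β : ℝ) (k : Fin (m + 1)) :
    ∃ r : E (m + 1), ‖r‖ = 1 ∧
      (∀ v : E (m + 1), ((rot m θ β).mulVec (fun i => v i)) k = inner ℝ r v) ∧
      ∀ G : Fin (m + 1) → ℂ, rotFlux θ β G k = dotC r G := by
  refine ⟨WithLp.toLp 2 (rot m θ β k), ?_, fun v => ?_, fun G => ?_⟩
  · rw [EuclideanSpace.norm_eq, Real.sqrt_eq_one]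
    have h1 := Real.sin_sq_add_cos_sq θ
    have h2 := Real.sin_sq_add_cos_sq β
    rcases hm with rfl | rfl
    · fin_cases k <;> simp [rot, Fin.sum_univ_succ]
    · fin_cases k <;> simp [rot, Fin.sum_univ_succ]
      · linear_combination Real.cos β ^ 2 * h1 + h2
      · linear_combination Real.sin β ^ 2 * h1 + h2
  · rw [real_inner_comm]
    simp [Matrix.mulVec, dotProduct, PiLp.inner_apply]
  · simp [rotFlux, Matrix.mulVec, dotProduct, dotC, Matrix.map_apply]

/-- In dimension at most two a nonzero remainder would be a third vector orthogonal to two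
orthonormal ones. -/
theorem eq_inner_smul_add_inner_smul (hm : m ≤ 2) {e f : E m} (he : ‖e‖ = 1) (hf : ‖f‖ = 1)
    (hef : inner ℝ e f = 0) (d : E m) : d = inner ℝ d e • e + inner ℝ d f • f := by
  by_contra hne
  set x := d - (inner ℝ d e • e + inner ℝ d f • f) with hx
  have hx0 : x ≠ 0 := sub_ne_zero.2 hne
  have hfe : inner ℝ f e = 0 := by rw [real_inner_comm]; exact hef
  have hee : inner ℝ e e = (1 : ℝ) := by rw [real_inner_self_eq_norm_sq, he]; norm_num
  have hff : inner ℝ f f = (1 : ℝ) := by rw [real_inner_self_eq_norm_sq, hf]; norm_num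
  have hxe : inner ℝ x e = 0 := by
    rw [hx, inner_sub_left, inner_add_left, real_inner_smul_left, real_inner_smul_left, hee, hfe]
    ring
  have hxf : inner ℝ x f = 0 := by
    rw [hx, inner_sub_left, inner_add_left, real_inner_smul_left, real_inner_smul_left, hff, hef]
    ring
  have he0 : e ≠ 0 := by rintro rfl; simp at he
  have hf0 : f ≠ 0 := by rintro rfl; simp at hf
  have hli : LinearIndependent ℝ ![e, f, x] := by
    refine linearIndependent_of_ne_zero_of_inner_eq_zero (𝕜 := ℝ) (fun i => ?_) fun i j hij => ?_
    · fin_cases i <;> simp [he0, hf0, hx0]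
    · have hex : inner ℝ e x = 0 := by rw [real_inner_comm]; exact hxe
      have hfx : inner ℝ f x = 0 := by rw [real_inner_comm]; exact hxf
      fin_cases i <;> fin_cases j <;>
      first
        | exact absurd rfl hij | exact hef | exact hfe | exact hxe | exact hxf | exact hex | exact hfx
  have := hli.fintype_card_le_finrank
  simp at this
  omega

/-- What is used about a cross-section: a bounded Lipschitz domain, thin in the direction `f`, and
either small or convex of length at least `1 / K`. -/
theorem Tube.IsSlab.isLipschitzDomain {N : Tube m} {ε K : ℝ} {e f : E m} (h : N.IsSlab ε K e f) :
    IsLipschitzDomain N.sec ∧ Convex ℝ N.sec := by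
  obtain ⟨v, hv⟩ := h.quadrilateral
  have hc : Convex ℝ N.sec := by rw [hv]; exact (convex_convexHull ℝ _).interior
  refine ⟨isLipschitzDomain_of_convex (by rw [hv]; exact isOpen_interior) h.nonempty ?_ hc, hc⟩
  rw [hv]
  exact ((isBounded_convexHull.2 (finite_range v).isBounded).subset interior_subset)

theorem Tube.IsProductType.isLipschitzDomain {N : Tube m} {ε K : ℝ} (h : N.IsProductType ε K) :
    IsLipschitzDomain N.sec := by
  rcases h.2 with h | ⟨e, f, h⟩
  · exact h.lipschitz
  · exact h.isLipschitzDomain.1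

theorem Tube.IsNozzle.dist_le {N : Tube m} {ε : ℝ} (h : N.IsNozzle ε) {y z : E m}
    (hy : y ∈ closure N.sec) (hz : z ∈ closure N.sec) : dist y z ≤ ε := by
  have h1 := Metric.dist_le_diam_of_mem h.lipschitz.isBounded.closure hy hz
  rw [Metric.diam_closure] at h1
  exact h1.trans h.diam_le

theorem Tube.IsNozzle.inner_le {N : Tube m} {ε : ℝ} (h : N.IsNozzle ε) {y z d : E m}
    (hy : y ∈ N.sec) (hz : z ∈ N.sec) (hd : ‖d‖ ≤ 1) : inner ℝ (y - z) d ≤ ε := by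
  have h1 := h.dist_le (subset_closure hy) (subset_closure hz)
  rw [dist_eq_norm] at h1
  have h2 := real_inner_le_norm (y - z) d
  nlinarith [norm_nonneg (y - z), norm_nonneg d]

theorem Tube.IsSlab.abs_inner_le {N : Tube m} {ε K : ℝ} {e f : E m} (h : N.IsSlab ε K e f)
    {y z : E m} (hy : y ∈ N.sec) (hz : z ∈ N.sec) : |inner ℝ (y - z) f| ≤ ε := by
  rw [abs_le]
  refine ⟨?_, h.width_le y hy z hz⟩
  have h1 := h.width_le z hz y hy
  rw [← neg_sub, inner_neg_left] at h1
  linarith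

section

variable {N : Shear m} {Ω : Set (E (m + 1))} {α B : ℝ} {w : E (m + 1) → ℂ}
  {Dw : E (m + 1) → EuclideanSpace ℂ (Fin (m + 1))}

/-- Every direction of the section has chords of length at most ε through each point, and the
tangential derivative vanishes at a boundary point at distance at most ε. -/
theorem SliceHolder.norm_dotC_le_of_nozzle (hα : 0 < α) (h : SliceHolder Ω α B w Dw)
    (hN : N.dom ⊆ Ω) (h0 : ∀ x ∈ N.lateral, w x = 0) {s : ℝ} (hs : s ∈ N.range) {y : E m}
    (hy : y ∈ N.sec) {ε : ℝ} (hm : 0 < m) (hε : 0 < ε) (ho : IsOpen N.sec)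
    (hb : Bornology.IsBounded N.sec)
    (hd : ∀ z ∈ N.sec, ∀ z' ∈ N.sec, ∀ d : E m, ‖d‖ = 1 → inner ℝ (z - z') d ≤ ε)
    (v : E (m + 1)) (hv : ‖v‖ ≤ 1) :
    ‖dotC v (Dw (N.pt s y))‖ ≤ (1 + N.lip) * (2 * B * ε ^ α) := by
  have hB := h.B_nonneg (subset_closure (hN (N.pt_mem_dom hs hy)))
  have hch : ∀ d : E m, ‖d‖ = 1 → HasShortChord N.sec y d ε := fun d hd1 =>
    hasShortChord_of_width ho hb hy hd1 fun z hz z' hz' => hd z hz z' hz' d hd1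
  have hb : ∀ d : E m, ‖d‖ ≤ 1 → ‖dotC (N.emb d) (Dw (N.pt s y))‖ ≤ B * ε ^ α := by
    intro d hd
    rcases eq_or_ne d 0 with rfl | hd0
    · simp only [map_zero, dotC_zero_left, norm_zero]; positivity
    have hd' : 0 < ‖d‖ := norm_pos_iff.2 hd0
    have h1 : ‖‖d‖⁻¹ • d‖ = 1 := by
      rw [norm_smul, norm_inv, norm_norm, inv_mul_cancel₀ hd'.ne']
    have h2 := h.norm_dotC_chord_le hα hN h0 hs hy h1 (hch _ h1)
    rw [map_smul, dotC_smul_left, norm_mul, Complex.norm_real, norm_inv, norm_norm,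
      inv_mul_le_iff₀ hd'] at h2
    refine h2.trans (mul_le_of_le_one_left (by positivity) hd)
  obtain ⟨τ₁, τ₂, h1, h2, h12, hf1, -, -⟩ :=
    hch (EuclideanSpace.single ⟨0, hm⟩ 1) (by simp)
  have := h.norm_dotC_le_of_section hα hN h0 hs hy hf1 (ℓ := ε) (by
    rw [dist_comm, dist_eq_norm, add_sub_cancel_left, norm_smul, Real.norm_eq_abs, abs_of_pos h1]
    simp; linarith) (by positivity : 0 ≤ B * ε ^ α) hb v hv
  linarith

/-- The short direction has chords of length ε. In the long direction chords are too long, but short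
chords give |w| ≤ Bε everywhere. A difference quotient over length ρ is therefore O(ε/ρ), and it
differs from the derivative by O(ρ^α). Convexity keeps the segment in the slab. -/
theorem SliceHolder.norm_dotC_le_of_slab (hα : 0 < α) (hα1 : α ≤ 1) (h : SliceHolder Ω α B w Dw)
    (hN : N.dom ⊆ Ω) (h0 : ∀ x ∈ N.lateral, w x = 0) {s : ℝ} (hs : s ∈ N.range) {y : E m}
    (hy : y ∈ N.sec) {ε ρ K ϑ : ℝ} (hm : m ≤ 2) (hε : 0 < ε) (hε1 : ε ≤ 1) (hρ : 0 < ρ)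
    (hερ : ε ≤ ρ) (hK : 0 < K) (hρK : 2 * K * ρ ≤ 1) {e f : E m} (S : Tube m)
    (hsec : S.sec = N.sec) (hS : S.IsSlab ε K e f)
    (hϑ₁ : ε / ρ ≤ ϑ) (hϑ₂ : ρ ^ α ≤ ϑ) (hϑ₃ : ε ^ α ≤ ϑ) (v : E (m + 1)) (hv : ‖v‖ ≤ 1) :
    ‖dotC v (Dw (N.pt s y))‖ ≤ (1 + N.lip) * (9 * B * ϑ) := by
  obtain ⟨hL, hc⟩ := hS.isLipschitzDomain
  rw [hsec] at hL hc
  have hx : N.pt s y ∈ closure Ω := subset_closure (hN (N.pt_mem_dom hs hy))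
  have hB := h.B_nonneg hx
  have hϑ0 : 0 ≤ ϑ := (by positivity : 0 ≤ ε / ρ).trans hϑ₁
  have hch : ∀ z ∈ N.sec, HasShortChord N.sec z f ε := fun z hz =>
    hasShortChord_of_width hL.isOpen hL.isBounded hz hS.norm_f (hsec ▸ hS.width_le)
  have hf := h.norm_dotC_chord_le hα hN h0 hs hy hS.norm_f (hch y hy)
  -- a point at distance comparable to `ρ` in the long direction
  obtain ⟨z, hz, hzy⟩ : ∃ z ∈ N.sec, 1 / (2 * K) ≤ |inner ℝ (z - y) e| := by
    obtain ⟨z₁, hz₁, z₂, hz₂, h12⟩ := hS.le_length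
    rw [hsec] at hz₁ hz₂
    by_contra! hcon
    have a1 := (abs_lt.1 (hcon z₁ hz₁)).2
    have a2 := (abs_lt.1 (hcon z₂ hz₂)).1
    have a3 : inner ℝ (z₁ - z₂) e = inner ℝ (z₁ - y) e - inner ℝ (z₂ - y) e := by
      rw [← inner_sub_left]; congr 1; abel
    have a4 : 1 / K = 1 / (2 * K) + 1 / (2 * K) := by field_simp; norm_num
    linarith
  set c := inner ℝ (z - y) e with hcdef
  have hcpos : 0 < |c| := lt_of_lt_of_le (by positivity) hzy
  set l := ρ / |c| with hl
  have hl0 : 0 < l := by positivity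
  have hl1 : l ≤ 1 := by
    rw [hl, div_le_one hcpos]
    refine le_trans ?_ hzy
    rw [le_div_iff₀ (by positivity)]; linarith
  set d := l • (z - y) with hd
  have hy' : y + d ∈ N.sec := hc.add_smul_sub_mem hy hz ⟨hl0.le, hl1⟩
  have hde : |inner ℝ d e| = ρ := by
    rw [hd, real_inner_smul_left, abs_mul, abs_of_pos hl0, ← hcdef, hl,
      div_mul_cancel₀ _ hcpos.ne']
  have hdf : |inner ℝ d f| ≤ ε := by
    rw [hd, real_inner_smul_left, abs_mul, abs_of_pos hl0]
    have := hS.abs_inner_le (hsec ▸ hz) (hsec ▸ hy)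
    exact (mul_le_of_le_one_left (abs_nonneg _) hl1).trans this
  have hdec := eq_inner_smul_add_inner_smul hm hS.norm_e hS.norm_f hS.orthogonal d
  have hdn : ‖d‖ ≤ 2 * ρ := by
    rw [hdec]
    refine (norm_add_le _ _).trans ?_
    rw [norm_smul, norm_smul, hS.norm_e, hS.norm_f, Real.norm_eq_abs, Real.norm_eq_abs, hde]
    linarith
  have hT := h.norm_sub_sub_le_of_dist_le hα (x := N.pt s y) (x' := N.pt s (y + d))
    (c := N.pt s y) hx (fun τ hτ => by
      rw [N.pt_segment]
      exact hN (N.pt_mem_dom hs (hc.add_smul_sub_mem hy hy' (Ioo_subset_Icc_self hτ))))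
    (R := 2 * ρ) (by rw [dist_self]; positivity)
    (by rw [N.dist_pt_pt_same, dist_eq_norm, add_sub_cancel_left]; exact hdn)
  rw [N.pt_sub_pt_same, add_sub_cancel_left, LinearIsometry.norm_map] at hT
  have hw1 := h.norm_le_of_chord hN h0 hs hy hS.norm_f (hch y hy)
  have hw2 := h.norm_le_of_chord hN h0 hs hy' hS.norm_f (hch _ hy')
  have h2ρ : (2 * ρ) ^ α ≤ 2 * ϑ := by
    rw [Real.mul_rpow (by norm_num) hρ.le]
    have : (2 : ℝ) ^ α ≤ 2 := by
      simpa using Real.rpow_le_rpow_of_exponent_le (by norm_num : (1 : ℝ) ≤ 2) hα1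
    exact mul_le_mul this hϑ₂ (by positivity) (by norm_num)
  have hT2 : B * (2 * ρ) ^ α * ‖d‖ ≤ 4 * B * ϑ * ρ := by
    calc B * (2 * ρ) ^ α * ‖d‖ ≤ B * (2 * ϑ) * (2 * ρ) := by gcongr
      _ = _ := by ring
  have hερϑ : ε ≤ ϑ * ρ := by rwa [div_le_iff₀ hρ] at hϑ₁
  have hεα : ε ^ α ≤ 1 := Real.rpow_le_one hε.le hε1 hα.le
  -- Of the factor 7, the two values of `w` contribute 2, the Taylor remainder 4, and the short
  -- component of `d` contributes 1.
  have hedir : ‖dotC (N.emb e) (Dw (N.pt s y))‖ ≤ 7 * B * ϑ := by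
    have h1 : (inner ℝ d e : ℂ) * dotC (N.emb e) (Dw (N.pt s y))
        = (w (N.pt s (y + d)) - w (N.pt s y))
          - (w (N.pt s (y + d)) - w (N.pt s y) - dotC (N.emb d) (Dw (N.pt s y)))
          - (inner ℝ d f : ℂ) * dotC (N.emb f) (Dw (N.pt s y)) := by
      have : dotC (N.emb d) (Dw (N.pt s y)) = (inner ℝ d e : ℂ) * dotC (N.emb e) (Dw (N.pt s y))
          + (inner ℝ d f : ℂ) * dotC (N.emb f) (Dw (N.pt s y)) := by
        conv_lhs => rw [hdec]
        rw [map_add, map_smul, map_smul, dotC_add_left, dotC_smul_left, dotC_smul_left]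
      rw [this]; ring
    have h2 := congrArg norm h1
    rw [norm_mul, Complex.norm_real, Real.norm_eq_abs, hde] at h2
    have h3 : ‖(inner ℝ d f : ℂ) * dotC (N.emb f) (Dw (N.pt s y))‖ ≤ B * ε := by
      rw [norm_mul, Complex.norm_real, Real.norm_eq_abs]
      calc _ ≤ ε * (B * 1) := by
            refine mul_le_mul hdf (hf.trans ?_) (norm_nonneg _) hε.le
            exact mul_le_mul_of_nonneg_left hεα hB
        _ = B * ε := by ring
    have h4 : ρ * ‖dotC (N.emb e) (Dw (N.pt s y))‖ ≤ ρ * (7 * B * ϑ) := by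
      rw [h2]
      refine (_root_.norm_sub_le _ _).trans ((add_le_add (_root_.norm_sub_le _ _) h3).trans ?_)
      have h5 := _root_.norm_sub_le (w (N.pt s (y + d))) (w (N.pt s y))
      have h6 := mul_le_mul_of_nonneg_left hερϑ hB
      linarith [hT.trans hT2]
    exact le_of_mul_le_mul_left h4 hρ
  have hfdir : ‖dotC (N.emb f) (Dw (N.pt s y))‖ ≤ B * ϑ :=
    hf.trans (mul_le_mul_of_nonneg_left hϑ₃ hB)
  have hb : ∀ d : E m, ‖d‖ ≤ 1 → ‖dotC (N.emb d) (Dw (N.pt s y))‖ ≤ 8 * B * ϑ := by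
    intro d hd
    have h1 := eq_inner_smul_add_inner_smul hm hS.norm_e hS.norm_f hS.orthogonal d
    have h2 : |inner ℝ d e| ≤ 1 :=
      (abs_real_inner_le_norm d e).trans (by rw [hS.norm_e, mul_one]; exact hd)
    have h3 : |inner ℝ d f| ≤ 1 :=
      (abs_real_inner_le_norm d f).trans (by rw [hS.norm_f, mul_one]; exact hd)
    rw [h1, map_add, map_smul, map_smul, dotC_add_left, dotC_smul_left, dotC_smul_left]
    refine (norm_add_le _ _).trans ?_
    rw [norm_mul, norm_mul, Complex.norm_real, Complex.norm_real, Real.norm_eq_abs,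
      Real.norm_eq_abs]
    have h4 := mul_le_mul h2 hedir (norm_nonneg _) zero_le_one
    have h5 := mul_le_mul h3 hfdir (norm_nonneg _) zero_le_one
    linarith
  obtain ⟨τ₁, τ₂, h1, h2, h12, hf1, -, -⟩ := hch y hy
  have := h.norm_dotC_le_of_section hα hN h0 hs hy hf1 (ℓ := ε) (by
    rw [dist_comm, dist_eq_norm, add_sub_cancel_left, norm_smul, Real.norm_eq_abs, abs_of_pos h1,
      hS.norm_f]
    linarith) (by positivity : 0 ≤ 8 * B * ϑ) hb v hv
  refine this.trans (mul_le_mul_of_nonneg_left ?_ (by positivity))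
  linarith [mul_le_mul_of_nonneg_left hϑ₃ hB]

end

end BalanceLaw

namespace BalanceLaw

variable {m : ℕ}

/-! ### Recovery of the flux -/

theorem Tube.CurveBound.norm_deriv_sub_le {N : Tube m} {K : ℝ} (h : N.CurveBound K) {a b : ℝ}
    (ha : a ∈ N.I) (hb : b ∈ N.I) : ‖deriv N.curve a - deriv N.curve b‖ ≤ K * |a - b| := by
  have hd : DifferentiableOn ℝ (deriv N.curve) N.I :=
    ((contDiffOn_succ_iff_deriv_of_isOpen (n := 1) isOpen_Ioo).1
      (by norm_num; exact h.smooth)).2.2.differentiableOn one_ne_zero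
  exact (convex_Ioo _ _).norm_image_sub_le_of_norm_deriv_le
    (fun x hx => (hd x hx).differentiableAt (isOpen_Ioo.mem_nhds hx)) h.deriv2_le hb ha

/-- This is how constants that depend on K or T are absorbed by a spare positive power of ε. -/
theorem exists_pos_forall_mul_rpow_le_one (D : ℝ) {δ : ℝ} (hδ : 0 < δ) :
    ∃ ε₀ : ℝ, 0 < ε₀ ∧ ε₀ ≤ 1 ∧ ∀ ε : ℝ, 0 < ε → ε < ε₀ → D * ε ^ δ ≤ 1 := by
  have hc : Continuous fun ε : ℝ => D * ε ^ δ :=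
    continuous_const.mul (continuous_id.rpow_const fun _ => Or.inr hδ.le)
  have h0 := hc.tendsto 0
  rw [Real.zero_rpow hδ.ne', mul_zero] at h0
  have h1 := h0.eventually (gt_mem_nhds one_pos)
  obtain ⟨ε₁, hε₁, h2⟩ := Metric.eventually_nhds_iff.1 h1
  refine ⟨min ε₁ 1, by positivity, min_le_right _ _, fun ε hε hlt => (h2 ?_).le⟩
  rw [Real.dist_eq, sub_zero, abs_of_pos hε]
  exact hlt.trans_le (min_le_left _ _)

/-- With a = α₃α₄ the rate is largest at l = 1/(1+a), with value a/(1+a). As a is smaller than both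
α₃ and α₄, this lies strictly below the exponent that the penalization argument yields. -/
theorem fluxRate_lt {α₃ α₄ l : ℝ} (h₃ : α₃ ∈ Ioo (0 : ℝ) 1) (h₄ : α₄ ∈ Ioo (0 : ℝ) 1) (hl : 0 < l) :
    fluxRate (α₃ * α₄) l
      < min (min (min α₃ α₄ / (1 + min α₃ α₄)) l) (α₃ * α₄) := by
  obtain ⟨h30, h31⟩ := h₃
  obtain ⟨h40, h41⟩ := h₄
  set a := α₃ * α₄ with ha
  have ha0 : 0 < a := by positivity
  have ha3 : a < α₃ := by nlinarith
  have ha4 : a < α₄ := by nlinarith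
  have has : a < min α₃ α₄ := lt_min ha3 ha4
  have hmono : a / (1 + a) < min α₃ α₄ / (1 + min α₃ α₄) := by
    rw [div_lt_div_iff₀ (by positivity) (by linarith)]; linarith
  have haa : a / (1 + a) < a := by
    rw [div_lt_iff₀ (by positivity)]; nlinarith
  have ha1 : a < 1 := ha3.trans h31
  have hτ : fluxRate a l ≤ a / (1 + a) ∧ fluxRate a l < l := by
    unfold fluxRate
    split_ifs with h1 h2
    · refine ⟨?_, by nlinarith⟩
      calc a * l ≤ a * (1 / (1 + a)) := mul_le_mul_of_nonneg_left h1 ha0.le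
        _ = a / (1 + a) := by ring
    · rw [not_le, div_lt_iff₀ (by positivity)] at h1
      refine ⟨?_, by nlinarith⟩
      rw [div_le_div_iff₀ (by norm_num) (by positivity)]
      nlinarith
    · rw [not_lt] at h2
      refine ⟨?_, by linarith⟩
      rw [div_le_div_iff₀ (by norm_num) (by positivity)]
      nlinarith
  exact lt_min (lt_min (hτ.1.trans_lt hmono) hτ.2) (hτ.1.trans_lt haa)

/-- The constant in the estimate of the flux on tubes with the bound `K`. -/
noncomputable def fluxConst (m : ℕ) (μ α₃ C₃ C₄ K : ℝ) : ℝ :=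
  (m + 1) * (2 * C₃ * (1 + C₄ ^ α₃))
    + ((2 * (1 + K ^ 2) + K ^ 2) * ((m + 1) * (2 * C₃ + μ * (2 * C₄)))
      + μ * ((1 + K ^ 2) * (18 * C₄) + 2 * C₄))

section Setting

variable {M : ℕ} {N : Fin M → Tube m} {T μ α₂ α₃ α₄ C₂ C₃ C₄ : ℝ} {H : ℂ → ℂ}
  {F : Fin 2 → E (m + 1) → ℝ → ℂ → Fin (m + 1) → ℂ}
  {f : Fin 2 → E (m + 1) → ℝ → ℂ → EuclideanSpace ℂ (Fin (m + 1)) → ℂ}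
  {u : Fin 2 → E (m + 1) → ℝ → ℂ} {Du : Fin 2 → E (m + 1) → ℝ → EuclideanSpace ℂ (Fin (m + 1))}
  {ut h : Fin 2 → E (m + 1) → ℝ → ℂ}

/-- All error terms are collected in one quantity ϑ: the slope ε/ρ of the penalty, the Hölder moduli
at distance ρ, the turning ε^l of the tangent, and the oscillation of the state in a nozzle. -/
theorem IsSetting.norm_rotFlux_sub_le_of_mem_Ioo
    (hs : IsSetting N T μ α₂ α₃ α₄ C₂ C₃ C₄ H F f u Du ut h) (hm : m = 1 ∨ m = 2) (hμ : 0 < μ)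
    (hα₃ : α₃ ∈ Ioo (0 : ℝ) 1) (hα₄ : α₄ ∈ Ioo (0 : ℝ) 1) (hC₃ : 0 < C₃) (hC₄ : 0 < C₄) {K : ℝ}
    (hK : 0 < K) {ε l ρ ϑ : ℝ} {i : Fin M} (hN : (N i).IsProductType ε K) (hε : 0 < ε)
    (hε1 : ε ≤ 1) (hρ : 0 < ρ) (hερ : ε ≤ ρ)
    (hϑ₁ : ε / ρ ≤ ϑ) (hϑ₂ : ρ ^ α₃ ≤ ϑ) (hϑ₃ : ρ ^ α₄ ≤ ϑ) (hϑ₄ : ε ^ l ≤ ϑ)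
    (hϑ₅ : (ε ^ α₄) ^ α₃ ≤ ϑ) (hϑK : 4 * (1 + K ^ 2) * ϑ < 1) (hρK : 2 * K * ρ ≤ 1)
    {a : ℝ} (ha : a ∈ (N i).I) {y : E m} (hy : y ∈ (N i).sec) {t : ℝ} (ht : t ∈ Ioo 0 T)
    (j : Fin 2) {a₁ a₂ b₁ b₂ : ℝ} (hw : (N i).IsWindow ε l a₁ a₂ b₁ b₂) (haw : a ∈ Icc a₁ a₂)
    {θ β : ℝ} {k : Fin (m + 1)} (hk : IsRecovered (N i) ε K b₁ θ β k) {r : E (m + 1)}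
    (hr1 : ‖r‖ = 1)
    (hrv : ∀ v : E (m + 1), ((rot m θ β).mulVec (fun i => v i)) k = inner ℝ r v) :
    ‖dotC r (fun k => F 0 ((N i).curve a + (N i).emb y) t (u j ((N i).curve a + (N i).emb y) t) k
        - F 1 ((N i).curve a + (N i).emb y) t (u j ((N i).curve a + (N i).emb y) t) k)‖
      ≤ fluxConst m μ α₃ C₃ C₄ K * ϑ := by
  have ht' : t ∈ Icc 0 T := Ioo_subset_Icc_self ht
  obtain ⟨P, hemb, hsec, hdom, hlat, hlip, -, hcurve⟩ := hN.1.exists_shear hK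
  obtain ⟨s, hsr, hpt, c, hc, hcd⟩ := hcurve a ha
  have hb₁ : b₁ ∈ (N i).I := ⟨hw.left_mem.1.trans hw.fst_mem.1, hw.fst_mem.2.trans hw.right_mem.2⟩
  have hk' : k ≠ tangentAxis m := by
    rcases hk.2 with h | ⟨e, f, -, -, rfl⟩
    · exact h.2
    · rcases hm with rfl | rfl <;> decide
  -- the direction `r` is almost orthogonal to the tangent
  have hrb : inner ℝ r (deriv (N i).curve b₁) = 0 := by rw [← hrv]; exact hk.1 k hk'
  -- The row is orthogonal to the velocity at `b₁`, and the bound on the second derivative limits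
  -- its change over the window. Passing from the velocity to the normalized tangent costs another
  -- factor K.
  have hη : |inner ℝ r (P.tangent s)| ≤ K ^ 2 * ϑ := by
    have h1 : inner ℝ r (deriv (N i).curve a) = c * inner ℝ r (P.tangent s) := by
      rw [hcd, real_inner_smul_right]
    have h2 : |inner ℝ r (deriv (N i).curve a)| ≤ K * ε ^ l := by
      have h3 : inner ℝ r (deriv (N i).curve a)
          = inner ℝ r (deriv (N i).curve a - deriv (N i).curve b₁) := by
        rw [inner_sub_right, hrb, sub_zero]
      rw [h3]
      refine (abs_real_inner_le_norm _ _).trans ?_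
      rw [hr1, one_mul]
      refine (hN.1.norm_deriv_sub_le ha hb₁).trans (mul_le_mul_of_nonneg_left ?_ hK.le)
      refine le_trans ?_ hw.length_le
      rw [abs_le]
      constructor <;> linarith [haw.1, haw.2, hw.fst_mem.1, hw.fst_mem.2]
    rw [h1, abs_mul] at h2
    have h4 : 1 / K * |inner ℝ r (P.tangent s)| ≤ K * ϑ :=
      (mul_le_mul_of_nonneg_right hc (abs_nonneg _)).trans
        (h2.trans (mul_le_mul_of_nonneg_left hϑ₄ hK.le))
    rw [div_mul_eq_mul_div, one_mul, div_le_iff₀ hK] at h4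
    linarith
  have hϑ0 : 0 < ϑ := lt_of_lt_of_le (by positivity) hϑ₁
  -- A unit vector almost orthogonal to the tangent is nearly the lift of its projection, so the
  -- projection cannot be small; this forces the maximum to the boundary.
  have hr : 2 * ε / ρ < ‖P.proj r‖ := by
    have h1 : ‖r‖ ≤ (1 + P.lip) * ‖P.proj r‖ + K ^ 2 * ϑ := by
      conv_lhs => rw [P.eq_lift_add s r]
      refine (norm_add_le _ _).trans (add_le_add (P.norm_lift_le hsr _) ?_)
      rw [norm_smul, P.norm_nrm, mul_one]; exact hη
    rw [hr1, hlip] at h1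
    have h2 : 2 * ε / ρ ≤ 2 * ϑ := by rw [mul_div_assoc]; linarith
    have h3 : (1 + K ^ 2) * (2 * ϑ) < (1 + K ^ 2) * ‖P.proj r‖ := by nlinarith
    exact h2.trans_lt (lt_of_mul_lt_mul_left h3 (by positivity))
  have hpr : ‖P.proj r‖ ≤ 1 := (P.norm_proj_le r).trans hr1.le
  have hΩ : P.dom ⊆ unionDom N := hdom ▸ Tube.dom_subset_unionDom N i
  have hL : IsLipschitzDomain P.sec := hsec ▸ hN.isLipschitzDomain
  have hyP : y ∈ P.sec := hsec ▸ hy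
  have hdir : ∀ x ∈ P.lateral, u 0 x t - u 1 x t = 0 := fun x hx =>
    sub_eq_zero.2 (hs.dirichlet i x (hlat ▸ hx) t ht')
  have hsl := hs.slice_sub hα₄.1 ht
  have hεα : ε ^ α₄ ≤ ϑ := (Real.rpow_le_rpow hε.le hερ hα₄.1.le).trans hϑ₃
  have hxcl : P.pt s y ∈ closure (unionDom N) := subset_closure (hΩ (P.pt_mem_dom hsr hyP))
  have hfcl : ∀ p ∈ frontier P.sec, P.pt s p ∈ closure (unionDom N) := fun p hp =>
    closure_mono hΩ (P.lateral_subset_closure (P.pt_mem_lateral hsr hp))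
  have hest : (∀ z ∈ P.sec, ∀ z' ∈ P.sec, inner ℝ (P.proj r) (z - z') ≤ ε) ∧
      ‖dotC r (fun k => Du 0 (P.pt s y) t k - Du 1 (P.pt s y) t k)‖
        ≤ (1 + K ^ 2) * (18 * C₄) * ϑ ∧
      ∀ p ∈ frontier P.sec, ‖p - y‖ ≤ ρ →
        ‖u j (P.pt s y) t - u j (P.pt s p) t‖ ^ α₃ ≤ C₄ ^ α₃ * ϑ := by
    -- A nozzle need not be convex, so the state is compared through its Hölder norm, but over
    -- distance ε only. A slab is convex, and the gradient bound controls the state over distance ρ.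
    rcases hk.2 with ⟨hnz, -⟩ | ⟨e, f, hsb, horth, rfl⟩
    · refine ⟨fun z hz z' hz' => ?_, ?_, fun p hp _ => ?_⟩
      · rw [real_inner_comm]
        exact hnz.inner_le (hsec ▸ hz) (hsec ▸ hz') hpr
      · have h1 := hsl.norm_dotC_le_of_nozzle hα₄.1 hΩ hdir hsr hyP
          (show 0 < m by rcases hm with rfl | rfl <;> norm_num) hε hL.isOpen hL.isBounded
          (fun z hz z' hz' d hd => hnz.inner_le (hsec ▸ hz) (hsec ▸ hz') hd.le) r hr1.le
        refine h1.trans ?_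
        rw [hlip]
        have : 2 * (2 * C₄) * ε ^ α₄ ≤ 18 * C₄ * ϑ := by
          calc 2 * (2 * C₄) * ε ^ α₄ ≤ 2 * (2 * C₄) * ϑ := by gcongr
            _ ≤ 18 * C₄ * ϑ := mul_le_mul_of_nonneg_right (by linarith) hϑ0.le
        rw [mul_assoc (1 + K ^ 2)]
        exact mul_le_mul_of_nonneg_left this (by positivity)
      · have h1 := ((hs.solution_norm j).norm_u).norm_sub_le (x := (P.pt s y, t))
          (y := (P.pt s p, t)) ⟨hxcl, ht'⟩ ⟨hfcl p hp, ht'⟩ (parDist_nonneg _ _)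
        rw [parDist_same_time, P.dist_pt_pt_same] at h1
        have h2 : ‖u j (P.pt s y) t - u j (P.pt s p) t‖ ≤ C₄ * ε ^ α₄ := by
          refine h1.trans (mul_le_mul_of_nonneg_left ?_ hC₄.le)
          refine Real.rpow_le_rpow dist_nonneg ?_ hα₄.1.le
          exact hnz.dist_le (subset_closure hy) (hsec ▸ frontier_subset_closure hp)
        calc ‖u j (P.pt s y) t - u j (P.pt s p) t‖ ^ α₃ ≤ (C₄ * ε ^ α₄) ^ α₃ :=
              Real.rpow_le_rpow (norm_nonneg _) h2 hα₃.1.le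
          _ = C₄ ^ α₃ * (ε ^ α₄) ^ α₃ := Real.mul_rpow hC₄.le (by positivity)
          _ ≤ C₄ ^ α₃ * ϑ := by gcongr
    · have hm2 : m ≤ 2 := by rcases hm with rfl | rfl <;> norm_num
      have hcv : Convex ℝ P.sec := hsec ▸ hsb.isLipschitzDomain.2
      refine ⟨fun z hz z' hz' => ?_, ?_, fun p hp hpρ => ?_⟩
      · have h1 := eq_inner_smul_add_inner_smul hm2 hsb.norm_e hsb.norm_f hsb.orthogonal (P.proj r)
        have h2 : inner ℝ (P.proj r) e = 0 := by
          rw [P.inner_proj, hemb, ← hrv]; exact horth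
        have h3 : |inner ℝ (P.proj r) f| ≤ 1 :=
          (abs_real_inner_le_norm _ _).trans (by rw [hsb.norm_f, mul_one]; exact hpr)
        rw [h2, zero_smul, zero_add] at h1
        rw [h1, real_inner_smul_left, real_inner_comm (z - z')]
        have h4 := hsb.abs_inner_le (hsec ▸ hz) (hsec ▸ hz')
        refine (le_abs_self _).trans ?_
        rw [abs_mul]
        exact (mul_le_of_le_one_left (abs_nonneg _) h3).trans h4
      · have h1 := hsl.norm_dotC_le_of_slab hα₄.1 hα₄.2.le hΩ hdir hsr hyP hm2 hε hε1 hρ hερ hK hρK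
          (N i) hsec.symm hsb hϑ₁ hϑ₃ hεα r hr1.le
        refine h1.trans (le_of_eq ?_)
        rw [hlip]; ring
      · have h1 := ((hs.solution_norm j).slice hα₄.1 ht).norm_sub_le (x := P.pt s p)
          (x' := P.pt s y) fun τ hτ => by
            rw [P.pt_segment]
            refine hΩ (P.pt_mem_dom hsr ?_)
            have h3 := hcv.add_smul_sub_mem_interior' (frontier_subset_closure hp)
              (hL.isOpen.interior_eq.symm ▸ hyP) ⟨hτ.1, hτ.2.le⟩
            rwa [hL.isOpen.interior_eq] at h3
        rw [← dist_eq_norm (P.pt s y), P.dist_pt_pt_same, dist_comm, dist_eq_norm p] at h1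
        calc ‖u j (P.pt s y) t - u j (P.pt s p) t‖ ^ α₃ ≤ (C₄ * ρ) ^ α₃ :=
              Real.rpow_le_rpow (norm_nonneg _)
                (h1.trans (mul_le_mul_of_nonneg_left hpρ hC₄.le)) hα₃.1.le
          _ = C₄ ^ α₃ * ρ ^ α₃ := Real.mul_rpow hC₄.le hρ.le
          _ ≤ C₄ ^ α₃ * ϑ := by gcongr
  obtain ⟨hthin, hD₁, hD₂⟩ := hest
  have := hs.norm_dotC_flux_sub_le hμ hα₃.1 hα₄.1 hC₃ hC₄ hdom hlat hL hsr hyP ht j hr1 hη hε hρ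
    hthin hr hϑ₁ hϑ₂ hϑ₃ hD₁ hD₂
  rw [hpt]
  refine this.trans (le_of_eq ?_)
  rw [hlip, fluxConst]; ring

end Setting

/-- The estimate at rate κ with the constant `fluxConst`, after the choice of ρ; the spare factor
ε^(κ − τ) brings the constant down to 1. -/
theorem flux_recovery (hm : m = 1 ∨ m = 2) {μ : ℝ} (hμ : 0 < μ)
    {α₂ α₃ α₄ : ℝ} (hα₃ : α₃ ∈ Set.Ioo 0 1) (hα₄ : α₄ ∈ Set.Ioo 0 1) (l : ℝ) (hl : 0 < l)
    {C₂ C₃ C₄ : ℝ} (hC₃ : 0 < C₃) (hC₄ : 0 < C₄) {K : ℝ} (hK : 0 < K) :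
    ∃ ε₀ : ℝ, 0 < ε₀ ∧ ∀ ε : ℝ, 0 < ε → ε < ε₀ →
      ∀ (M : ℕ) (N : Fin M → Tube m), (∀ i, (N i).IsProductType ε K) →
      ∀ (T : ℝ) (H : ℂ → ℂ) (F : Fin 2 → E (m + 1) → ℝ → ℂ → Fin (m + 1) → ℂ)
        (f : Fin 2 → E (m + 1) → ℝ → ℂ → EuclideanSpace ℂ (Fin (m + 1)) → ℂ)
        (u : Fin 2 → E (m + 1) → ℝ → ℂ)
        (Du : Fin 2 → E (m + 1) → ℝ → EuclideanSpace ℂ (Fin (m + 1)))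
        (ut h : Fin 2 → E (m + 1) → ℝ → ℂ), 0 < T →
        IsSetting N T μ α₂ α₃ α₄ C₂ C₃ C₄ H F f u Du ut h →
      ∀ i, ∀ a ∈ (N i).I, ∀ y ∈ (N i).sec, ∀ x, x = (N i).curve a + (N i).emb y →
      ∀ t ∈ Set.Icc 0 T, ∀ j : Fin 2,
      ∀ a₁ a₂ b₁ b₂ : ℝ, (N i).IsWindow ε l a₁ a₂ b₁ b₂ → a ∈ Set.Icc a₁ a₂ →
      ∀ (θ β : ℝ) (k : Fin (m + 1)), IsRecovered (N i) ε K b₁ θ β k →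
        ‖rotFlux θ β (F 0 x t (u j x t)) k - rotFlux θ β (F 1 x t (u j x t)) k‖
          ≤ 1 * ε ^ fluxRate (α₃ * α₄) l := by
  set s₀ := min α₃ α₄ with hs₀
  have hs₀0 : 0 < s₀ := lt_min hα₃.1 hα₄.1
  set κ := min (min (s₀ / (1 + s₀)) l) (α₃ * α₄) with hκ
  have ha0 : 0 < α₃ * α₄ := mul_pos hα₃.1 hα₄.1
  have hκ0 : 0 < κ := lt_min (lt_min (by positivity) hl) ha0
  have hτκ : fluxRate (α₃ * α₄) l < κ := fluxRate_lt hα₃ hα₄ hl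
  obtain ⟨ε₁, h1, h1', h1D⟩ := exists_pos_forall_mul_rpow_le_one (fluxConst m μ α₃ C₃ C₄ K)
    (sub_pos.2 hτκ)
  obtain ⟨ε₂, h2, -, h2D⟩ := exists_pos_forall_mul_rpow_le_one (5 * (1 + K ^ 2)) hκ0
  obtain ⟨ε₃, h3, -, h3D⟩ := exists_pos_forall_mul_rpow_le_one (2 * K)
    (show 0 < 1 / (1 + s₀) by positivity)
  refine ⟨min ε₁ (min ε₂ ε₃), by positivity, ?_⟩
  intro ε hε hlt M N hN T H F f u Du ut h hT hs i a ha y hy x hx t ht j a₁ a₂ b₁ b₂ hw haw θ β k hk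
  have hlt1 : ε < ε₁ := hlt.trans_le (min_le_left _ _)
  have hlt2 : ε < ε₂ := hlt.trans_le ((min_le_right _ _).trans (min_le_left _ _))
  have hlt3 : ε < ε₃ := hlt.trans_le ((min_le_right _ _).trans (min_le_right _ _))
  have hε1 : ε ≤ 1 := (hlt1.trans_le h1').le
  -- This exponent balances the slope ε/ρ of the penalty against the weaker Hölder modulus ρ^s₀.
  set ρ := ε ^ (1 / (1 + s₀)) with hρdef
  have hρ : 0 < ρ := by positivity
  have hexp : ∀ {p q : ℝ}, p ≤ q → ε ^ q ≤ ε ^ p := fun hpq =>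
    Real.rpow_le_rpow_of_exponent_ge hε hε1 hpq
  have hκ1 : κ ≤ s₀ / (1 + s₀) := (min_le_left _ _).trans (min_le_left _ _)
  have hκ2 : κ ≤ l := (min_le_left _ _).trans (min_le_right _ _)
  have hκ3 : κ ≤ α₃ * α₄ := min_le_right _ _
  have hρα : ∀ α, s₀ ≤ α → ρ ^ α ≤ ε ^ κ := by
    intro α hα
    rw [hρdef, ← Real.rpow_mul hε.le]
    refine hexp (hκ1.trans ?_)
    rw [div_mul_eq_mul_div, one_mul]
    gcongr
  have hερ : ε ≤ ρ := by
    have h5 : ε ^ (1 : ℝ) ≤ ε ^ (1 / (1 + s₀)) :=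
      hexp (by rw [div_le_one (by positivity)]; linarith)
    rwa [Real.rpow_one] at h5
  have hϑ₁ : ε / ρ ≤ ε ^ κ := by
    have h5 : ε / ρ = ε ^ (1 - 1 / (1 + s₀)) := by rw [Real.rpow_sub hε, Real.rpow_one]
    rw [h5]
    refine hexp (hκ1.trans (le_of_eq ?_))
    field_simp; ring
  obtain ⟨r, hr1, hrv, hrF⟩ := exists_row hm θ β k
  rw [hrF, hrF, ← dotC_sub_right]
  have hmain : ∀ t ∈ Ioo 0 T, ‖dotC r (F 0 x t (u j x t) - F 1 x t (u j x t))‖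
      ≤ 1 * ε ^ fluxRate (α₃ * α₄) l := by
    intro t ht
    rw [hx]
    refine (hs.norm_rotFlux_sub_le_of_mem_Ioo hm hμ hα₃ hα₄ hC₃ hC₄ hK (hN i) hε hε1 hρ hερ hϑ₁
      (hρα _ (min_le_left _ _)) (hρα _ (min_le_right _ _)) (hexp hκ2) ?_ ?_ ?_ ha hy ht j hw haw
      hk hr1 hrv).trans ?_
    · rw [← Real.rpow_mul hε.le, mul_comm]; exact hexp hκ3
    · have h5 := h2D ε hε hlt2
      have h6 : 0 < (1 + K ^ 2) * ε ^ κ := by positivity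
      linarith
    · exact h3D ε hε hlt3
    · have h5 := h1D ε hε hlt1
      have h6 : ε ^ κ = ε ^ (κ - fluxRate (α₃ * α₄) l) * ε ^ fluxRate (α₃ * α₄) l := by
        rw [← Real.rpow_add hε, sub_add_cancel]
      rw [h6, ← mul_assoc]
      exact mul_le_mul_of_nonneg_right h5 (by positivity)
  have hxΩ : x ∈ closure (unionDom N) :=
    subset_closure (Tube.dom_subset_unionDom N i ⟨a, ha, y, hy, hx⟩)
  have hcl : closure (Ioo 0 T) = Icc 0 T := closure_Ioo hT.ne
  -- Differentiability of the states is known only at interior times; the endpoints follow by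
  -- continuity.
  have hcont : ContinuousOn (fun t => ‖dotC r (F 0 x t (u j x t) - F 1 x t (u j x t))‖)
      (closure (Ioo 0 T)) := by
    rw [hcl]
    have h5 : ∀ i' k, ContinuousOn (fun t => F i' x t (u j x t) k) (Icc 0 T) := fun i' k =>
      (hs.continuousOn_flux hα₃.1 hα₄.1 i' j k).comp (f := fun t => (x, t)) (by fun_prop)
        fun t ht => ⟨hxΩ, ht⟩
    refine ContinuousOn.norm ?_
    unfold dotC
    exact continuousOn_finsetSum _ fun k _ => continuousOn_const.mul ((h5 0 k).sub (h5 1 k))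
  exact le_on_closure hmain hcont continuousOn_const (hcl ▸ ht)

end BalanceLaw

namespace BalanceLaw

variable {m : ℕ}

/-! ### Vanishing of the gradient on the lateral boundary -/

section

variable {N : Shear m} {Ω : Set (E (m + 1))} {α B : ℝ} {w : E (m + 1) → ℂ}
  {Dw : E (m + 1) → EuclideanSpace ℂ (Fin (m + 1))}

/-- The gradient is orthogonal to the tangent vectors of the boundary of the cross-section. -/
theorem SliceHolder.dotC_graph_tangent_eq_zero (hα : 0 < α) (h : SliceHolder Ω α B w Dw)
    (hN : N.dom ⊆ Ω) (h0 : ∀ x ∈ N.lateral, w x = 0) (hS : IsOpen N.sec) {s : ℝ}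
    (hs : s ∈ N.range) {p : E m} {r : ℝ} {e : E m} {κ : NNReal} {g : E m → ℝ}
    (hc : GraphChart N.sec p r e κ g) {q : E m} (hqb : q ∈ Metric.ball p r)
    (hq : q ∈ frontier N.sec) {g' : E m →L[ℝ] ℝ} (hg : HasFDerivAt g g' q) (d : E m) :
    dotC (N.emb (d + (g' d - inner ℝ d e) • e)) (Dw (N.pt s q)) = 0 := by
  have hqg : inner ℝ q e = g q := (hc.mem_frontier_iff hS hqb).1 hq
  set P := Dw (N.pt s q) with hP
  set z : ℝ → E m := fun σ => (q + σ • d) + (g (q + σ • d) - inner ℝ (q + σ • d) e) • e with hz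
  have hcl : N.pt s q ∈ closure Ω :=
    closure_mono hN (N.lateral_subset_closure (N.pt_mem_lateral hs hq))
  have hB := h.B_nonneg hcl
  set A : ℝ := (2 + κ) * ‖d‖ with hA
  have hA0 : 0 ≤ A := by positivity
  -- Lowering the segment from `q` to `z σ` by `M * σ` puts it strictly below the graph: the
  -- lowering exceeds what the slope of the segment and the Lipschitz constant can consume.
  set M : ℝ := (1 + κ) * A + 1 with hM
  have hM0 : 0 < M := by positivity
  have hzq : ∀ σ, 0 ≤ σ → ‖z σ - q‖ ≤ A * σ := by
    intro σ hσ
    have h1 : z σ - q = σ • d + ((g (q + σ • d) - g q) - σ * inner ℝ d e) • e := by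
      simp only [hz, inner_add_left, real_inner_smul_left, hqg]
      rw [← sub_sub]; abel
    rw [h1]
    refine (norm_add_le _ _).trans ?_
    rw [norm_smul, norm_smul, hc.norm_e, mul_one, Real.norm_eq_abs, abs_of_nonneg hσ]
    have h2 : ‖g (q + σ • d) - g q‖ ≤ κ * (σ * ‖d‖) := by
      have := hc.lip.dist_le_mul (q + σ • d) q
      rwa [dist_eq_norm, dist_eq_norm, add_sub_cancel_left, norm_smul, Real.norm_eq_abs σ,
        abs_of_nonneg hσ] at this
    have h3 : |σ * inner ℝ d e| ≤ σ * ‖d‖ := by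
      rw [abs_mul, abs_of_nonneg hσ]
      refine mul_le_mul_of_nonneg_left ((abs_real_inner_le_norm d e).trans ?_) hσ
      rw [hc.norm_e, mul_one]
    have h4 := _root_.norm_sub_le (g (q + σ • d) - g q) (σ * inner ℝ d e)
    rw [Real.norm_eq_abs (σ * inner ℝ d e)] at h4
    rw [hA]; nlinarith
  obtain ⟨r', hr', hball⟩ := Metric.isOpen_iff.1 Metric.isOpen_ball q hqb
  have hmem : ∀ y, ‖y - q‖ < r' → inner ℝ y e < g y → y ∈ N.sec := fun y hy hlt =>
    (hc.mem_iff y (hball (by rwa [Metric.mem_ball, dist_eq_norm]))).2 hlt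
  have hinv : ∀ y (τ : ℝ), g (y - τ • e) = g y := fun y τ => by
    rw [sub_eq_add_neg, ← neg_smul, hc.invariant]
  have hinn : ∀ y (τ : ℝ), inner ℝ (y - τ • e) e = inner ℝ y e - τ := fun y τ => by
    rw [sub_eq_add_neg, ← neg_smul, hc.inner_add_smul]; ring
  set R : ℝ → ℝ := fun σ => (A + M) * σ with hR
  -- The straight segment between two boundary points may leave the section. A detour of length O(σ)
  -- inside it, with `w` zero at both ends, shows that the linearization along the displacement is
  -- o(σ).
  have key : ∀ σ, 0 < σ → R σ < r' →
      ‖dotC (N.emb (z σ - q)) P‖ ≤ 3 * B * (R σ) ^ α * R σ := by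
    intro σ hσ hσr
    have hMσ : 0 < M * σ := by positivity
    have hAσ : 0 ≤ A * σ := by positivity
    have hRσ : R σ = A * σ + M * σ := by simp only [hR]; ring
    have hzσ := hzq σ hσ.le
    have hzg : inner ℝ (z σ) e = g (z σ) := hc.inner_toGraph _
    have hne : ‖(M * σ) • e‖ = M * σ := by
      rw [norm_smul, hc.norm_e, mul_one, Real.norm_eq_abs, abs_of_pos hMσ]
    have hdn : ∀ y, ‖y - q‖ ≤ A * σ → ∀ τ ∈ Icc (0 : ℝ) 1, ‖y - (τ * (M * σ)) • e - q‖ ≤ R σ := by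
      intro y hy τ hτ
      have h1 : y - (τ * (M * σ)) • e - q = (y - q) - (τ * (M * σ)) • e := by abel
      rw [h1]
      refine (_root_.norm_sub_le _ _).trans ?_
      rw [norm_smul, hc.norm_e, mul_one, Real.norm_eq_abs,
        abs_of_nonneg (mul_nonneg hτ.1 hMσ.le), hRσ]
      nlinarith [hτ.2]
    have hvert : ∀ y, ‖y - q‖ ≤ A * σ → inner ℝ y e = g y → ∀ τ ∈ Ioc (0 : ℝ) 1,
        y - (τ * (M * σ)) • e ∈ N.sec := by
      intro y hy hyg τ hτ
      refine hmem _ ((hdn y hy τ ⟨hτ.1.le, hτ.2⟩).trans_lt hσr) ?_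
      rw [hinv, hinn, hyg]
      linarith [mul_pos hτ.1 hMσ]
    have hq0 : ‖q - q‖ ≤ A * σ := by rw [sub_self, norm_zero]; exact hAσ
    have hT : ∀ x x' : E m, ‖x - q‖ ≤ R σ → ‖x' - q‖ ≤ R σ → ‖x' - x‖ ≤ R σ →
        (∀ τ ∈ Ioo (0 : ℝ) 1, x + τ • (x' - x) ∈ N.sec) →
        ‖w (N.pt s x') - w (N.pt s x) - dotC (N.emb (x' - x)) P‖ ≤ B * R σ ^ α * R σ := by
      intro x x' hx hx' hxx hseg
      have h1 := h.norm_sub_sub_le_of_dist_le hα (x := N.pt s x) (x' := N.pt s x') hcl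
        (fun τ hτ => by rw [N.pt_segment]; exact hN (N.pt_mem_dom hs (hseg τ hτ))) (R := R σ)
        (by rw [N.dist_pt_pt_same, dist_eq_norm]; exact hx)
        (by rw [N.dist_pt_pt_same, dist_eq_norm]; exact hx')
      rw [N.pt_sub_pt_same, LinearIsometry.norm_map] at h1
      refine h1.trans (mul_le_mul_of_nonneg_left hxx ?_)
      have : 0 ≤ R σ := by rw [hRσ]; positivity
      positivity
    have hR0 : 0 ≤ R σ := by rw [hRσ]; positivity
    have hone : (1 : ℝ) ∈ Icc (0 : ℝ) 1 := by simp
    have e1 := hdn q hq0 1 hone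
    have e2 := hdn (z σ) hzσ 1 hone
    rw [one_mul] at e1 e2
    -- down, along and up
    have t1 := hT q (q - (M * σ) • e) (by rw [sub_self, norm_zero]; exact hR0) e1
      (by rw [sub_sub_cancel_left, norm_neg, hne, hRσ]; linarith) fun τ hτ => by
        have := hvert q hq0 hqg τ ⟨hτ.1, hτ.2.le⟩
        rwa [sub_sub_cancel_left, smul_neg, smul_smul, ← sub_eq_add_neg]
    have t2 := hT (q - (M * σ) • e) (z σ - (M * σ) • e) e1 e2
      (by rw [sub_sub_sub_cancel_right]; exact hzσ.trans (by rw [hRσ]; linarith)) fun τ hτ => by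
        have hyn : ‖q + τ • (z σ - q) - q‖ ≤ A * σ := by
          rw [add_sub_cancel_left, norm_smul, Real.norm_eq_abs, abs_of_pos hτ.1]
          exact (mul_le_of_le_one_left (norm_nonneg _) hτ.2.le).trans hzσ
        have e3 : q - (M * σ) • e + τ • (z σ - (M * σ) • e - (q - (M * σ) • e))
            = q + τ • (z σ - q) - (M * σ) • e := by
          rw [sub_sub_sub_cancel_right]; abel
        rw [e3]
        have e4 := hdn _ hyn 1 hone
        rw [one_mul] at e4
        refine hmem _ (e4.trans_lt hσr) ?_
        rw [hinv, hinn]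
        have e5 := hc.lip.dist_le_mul (q + τ • (z σ - q)) q
        rw [dist_eq_norm (q + τ • (z σ - q)), Real.dist_eq] at e5
        have e6 := (abs_le.1 e5).1
        have e7 := mul_le_mul_of_nonneg_left hyn κ.coe_nonneg
        have e8 : inner ℝ (q + τ • (z σ - q)) e ≤ g q + A * σ := by
          have e9 := real_inner_le_norm (q + τ • (z σ - q) - q) e
          rw [hc.norm_e, mul_one, inner_sub_left, hqg] at e9
          linarith
        have e10 : M * σ = A * σ + κ * (A * σ) + σ := by rw [hM]; ring
        linarith
    have t3 := hT (z σ - (M * σ) • e) (z σ) e2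
      (hzσ.trans (by rw [hRσ]; linarith))
      (by rw [sub_sub_cancel, hne, hRσ]; linarith) fun τ hτ => by
        have := hvert (z σ) hzσ hzg (1 - τ) ⟨by linarith [hτ.2], by linarith [hτ.1]⟩
        have e3 : z σ - (M * σ) • e + τ • (z σ - (z σ - (M * σ) • e))
            = z σ - ((1 - τ) * (M * σ)) • e := by
          rw [sub_sub_cancel, sub_mul, one_mul, sub_smul, smul_smul]; abel
        rwa [e3]
    have hzS : z σ ∈ frontier N.sec :=
      (hc.mem_frontier_iff hS (hball (by
        rw [Metric.mem_ball, dist_eq_norm]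
        exact (hzσ.trans (by rw [hRσ]; linarith)).trans_lt hσr))).2 hzg
    have w0 := h0 _ (N.pt_mem_lateral hs hq)
    have w1 := h0 _ (N.pt_mem_lateral hs hzS)
    have hsum : dotC (N.emb (z σ - q)) P
        = -((w (N.pt s (q - (M * σ) • e)) - w (N.pt s q)
            - dotC (N.emb (q - (M * σ) • e - q)) P)
          + (w (N.pt s (z σ - (M * σ) • e)) - w (N.pt s (q - (M * σ) • e))
            - dotC (N.emb (z σ - (M * σ) • e - (q - (M * σ) • e))) P)
          + (w (N.pt s (z σ)) - w (N.pt s (z σ - (M * σ) • e))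
            - dotC (N.emb (z σ - (z σ - (M * σ) • e))) P)) := by
      rw [w0, w1]
      simp only [map_sub, dotC_sub_left]
      ring
    rw [hsum, norm_neg]
    refine (norm_add₃_le).trans ?_
    linarith
  -- the derivative at zero
  have hdz : HasDerivAt (fun σ : ℝ => dotC (N.emb (z σ - q)) P)
      (dotC (N.emb (d + (g' d - inner ℝ d e) • e)) P) 0 := by
    have l1 : HasDerivAt (fun σ : ℝ => q + σ • d) d 0 := by
      simpa using ((hasDerivAt_id (0 : ℝ)).smul_const d).const_add q
    have l2 : HasDerivAt (fun σ : ℝ => g (q + σ • d)) (g' d) 0 := by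
      have hg2 : HasFDerivAt g g' (q + (0 : ℝ) • d) := by simpa using hg
      exact hg2.comp_hasDerivAt (0 : ℝ) l1
    have l3 : HasDerivAt (fun σ : ℝ => inner ℝ (q + σ • d) e) (inner ℝ d e) 0 := by
      have h3 := ((innerSL ℝ e).hasFDerivAt (x := q + (0 : ℝ) • d)).comp_hasDerivAt (0 : ℝ) l1
      rw [real_inner_comm]
      refine h3.congr_of_eventuallyEq (Eventually.of_forall fun σ => ?_)
      simp [real_inner_comm e]
    have l4 : HasDerivAt (fun σ => z σ - q) (d + (g' d - inner ℝ d e) • e) 0 :=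
      (l1.add ((l2.sub l3).smul_const e)).sub_const q
    have l5 := N.emb.toContinuousLinearMap.hasFDerivAt.comp_hasDerivAt (0 : ℝ) l4
    unfold dotC
    refine HasDerivAt.fun_sum fun i _ => ?_
    exact ((EuclideanSpace.proj (𝕜 := ℝ) i).hasFDerivAt.comp_hasDerivAt
      (0 : ℝ) l5).ofReal_comp.mul_const (P i)
  have hz0 : dotC (N.emb (z 0 - q)) P = 0 := by
    have : z 0 - q = 0 := by simp [hz, hqg]
    rw [this, map_zero, dotC_zero_left]
  have hsl := (hasDerivAt_iff_tendsto_slope.1 hdz).mono_left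
    (nhdsWithin_mono (0 : ℝ) (fun x (hx : x ∈ Ioi (0 : ℝ)) => ne_of_gt hx))
  set L := dotC (N.emb (d + (g' d - inner ℝ d e) • e)) P with hL
  have hbd : Tendsto (fun σ : ℝ => 3 * B * (R σ) ^ α * (A + M)) (𝓝[>] 0) (𝓝 0) := by
    have hcont : Continuous fun σ : ℝ => 3 * B * (R σ) ^ α * (A + M) := by
      have : Continuous R := by simp only [hR]; fun_prop
      exact (continuous_const.mul (this.rpow_const fun _ => Or.inr hα.le)).mul continuous_const
    have h1 := (hcont.tendsto 0).mono_left (nhdsWithin_le_nhds (s := Ioi 0))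
    have h2 : R 0 = 0 := by simp [hR]
    rwa [h2, Real.zero_rpow hα.ne', mul_zero, zero_mul] at h1
  have hle : ‖L‖ ≤ 0 := by
    refine le_of_tendsto_of_tendsto hsl.norm hbd ?_
    have hRlt : ∀ᶠ σ in 𝓝[>] (0 : ℝ), R σ < r' := by
      have hcont : Continuous R := by simp only [hR]; fun_prop
      have h2 : R 0 = 0 := by simp [hR]
      exact ((hcont.tendsto 0).mono_left nhdsWithin_le_nhds).eventually
        (gt_mem_nhds (by rw [h2]; exact hr'))
    filter_upwards [self_mem_nhdsWithin, hRlt] with σ hσ hσr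
    have hσ' : 0 < σ := hσ
    have h3 := key σ hσ' hσr
    rw [slope_def_module, hz0, sub_zero, sub_zero, norm_smul, norm_inv, Real.norm_eq_abs,
      abs_of_pos hσ', inv_mul_le_iff₀ hσ']
    refine h3.trans (le_of_eq ?_)
    simp only [hR]; ring
  exact norm_le_zero_iff.1 hle

/-- Orthogonality to the tangent makes `V` a lift; orthogonality to the tangents of the graph makes
its projection a multiple of `n`; orthogonality to the normal removes that multiple. -/
theorem Shear.eq_zero_of_orthogonal (N : Shear m) {s : ℝ} {e n : E m} {V : E (m + 1)}
    (ht : inner ℝ (N.tangent s) V = 0)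
    (hd : ∀ d : E m, inner ℝ (N.emb (d - inner ℝ n d • e)) V = 0)
    (hn : N.lift s n ≠ 0) (hV : inner ℝ (N.lift s n) V = 0) : V = 0 := by
  have h1 := N.eq_lift_add s V
  rw [real_inner_comm, ht, zero_smul, add_zero] at h1
  set v := N.proj V with hv
  have h2 : v = inner ℝ e v • n := by
    refine ext_inner_left ℝ fun d => ?_
    have h3 := hd d
    rw [real_inner_comm, ← N.inner_proj, ← hv, inner_sub_right, real_inner_smul_right, sub_eq_zero,
      real_inner_comm] at h3
    rw [h3, real_inner_smul_right, real_inner_comm n d, real_inner_comm v e]; ring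
  rw [h2, N.lift_smul] at h1
  rw [h1, real_inner_smul_right, real_inner_self_eq_norm_sq, mul_eq_zero] at hV
  rcases hV with h | h
  · rw [h1, h, zero_smul]
  · exact absurd (by simpa using h) hn

/-- If the normal derivative vanishes, then so does the gradient. -/
theorem SliceHolder.grad_eq_zero (hα : 0 < α) (h : SliceHolder Ω α B w Dw)
    (hN : N.dom ⊆ Ω) (h0 : ∀ x ∈ N.lateral, w x = 0) (hS : IsLipschitzDomain N.sec)
    (hν : ∀ x ∈ N.lateral, ∀ ν, IsOutwardNormal N.dom x ν → dotC ν (Dw x) = 0) :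
    ∀ x ∈ N.lateral, Dw x = 0 := by
  intro x hx
  obtain ⟨hs, hp⟩ := hx
  set s := N.ht x with hsdef
  set p := N.sc x with hpdef
  have hxp : x = N.pt s p := (N.pt_ht_sc x).symm
  obtain ⟨r, e, κ, g, hc⟩ := hS.exists_chart hp
  -- At a regular boundary point the tangent of the curve, the tangents of the graph and the normal
  -- span all directions.
  have hreg : ∀ q ∈ Metric.ball p r, q ∈ frontier N.sec → DifferentiableAt ℝ g q →
      Dw (N.pt s q) = 0 := by
    intro q hqb hq hgq
    have hg := hgq.hasFDerivAt
    set g' := fderiv ℝ g q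
    have hqg : inner ℝ q e = g q := (hc.mem_frontier_iff hS.isOpen hqb).1 hq
    obtain ⟨hne, hout⟩ := N.isOutwardNormal hc hs hqb hqg hg
    have a1 := h.dotC_tangent_eq_zero hα hN h0 hs hq
    have a2 := fun d => h.dotC_graph_tangent_eq_zero hα hN h0 hS.isOpen hs hc hqb hq hg d
    have a3 := hν _ (N.pt_mem_lateral hs hq) _ hout
    rw [dotC_smul_left] at a3
    have a4 := (mul_eq_zero.1 a3).resolve_left (by simpa using hne)
    have a5 : ∀ d : E m, d + (g' d - inner ℝ d e) • e = d - inner ℝ (e - grad g') d • e := by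
      intro d
      rw [inner_sub_left, inner_grad, real_inner_comm, ← neg_sub (inner ℝ e d), neg_smul,
        ← sub_eq_add_neg]
    have hre := N.eq_zero_of_orthogonal (s := s) (e := e) (n := e - grad g')
      (V := WithLp.toLp 2 fun i => (Dw (N.pt s q) i).re)
      (by rw [← re_dotC, a1, Complex.zero_re])
      (fun d => by rw [← re_dotC, ← a5, a2, Complex.zero_re]) hne
      (by rw [← re_dotC, a4, Complex.zero_re])
    have him := N.eq_zero_of_orthogonal (s := s) (e := e) (n := e - grad g')
      (V := WithLp.toLp 2 fun i => (Dw (N.pt s q) i).im)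
      (by rw [← im_dotC, a1, Complex.zero_im])
      (fun d => by rw [← im_dotC, ← a5, a2, Complex.zero_im]) hne
      (by rw [← im_dotC, a4, Complex.zero_im])
    ext i
    have b1 : (Dw (N.pt s q) i).re = 0 := congrArg (fun v : E (m + 1) => v i) hre
    have b2 : (Dw (N.pt s q) i).im = 0 := congrArg (fun v : E (m + 1) => v i) him
    exact Complex.ext b1 b2
  by_contra hne
  rw [hxp] at hne
  have hcl : N.lateral ⊆ closure Ω := N.lateral_subset_closure.trans (closure_mono hN)
  have hcont : ContinuousOn (fun q => Dw (N.pt s q)) (frontier N.sec) :=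
    (h.continuousOn_grad hα).comp (N.continuous_pt_right s).continuousOn
      fun q hq => hcl (N.pt_mem_lateral hs hq)
  -- A gradient nonzero at `p` would stay nonzero on the nearby boundary, where regular points are
  -- dense.
  have hev := (hcont p hp).eventually (isOpen_ne.mem_nhds hne)
  obtain ⟨U, hU, hUs⟩ := mem_nhdsWithin_iff_exists_mem_nhds_inter.1 hev
  obtain ⟨q, hqU, hqb, hqf, hqd⟩ := hc.exists_differentiable_near hS.isOpen hp hU
  exact hUs ⟨hqU, hqf⟩ (hreg q hqb hqf hqd)

/-- A function that vanishes to first order on the lateral boundary. -/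
theorem SliceHolder.norm_le_of_chord_of_grad_eq_zero (hα : 0 < α) (h : SliceHolder Ω α B w Dw)
    (hN : N.dom ⊆ Ω) (h0 : ∀ x ∈ N.lateral, w x = 0) (h1 : ∀ x ∈ N.lateral, Dw x = 0) {s : ℝ}
    (hs : s ∈ N.range) {y d : E m} (hy : y ∈ N.sec) (hd : ‖d‖ = 1) {ℓ : ℝ}
    (hch : HasShortChord N.sec y d ℓ) :
    ‖w (N.pt s y)‖ ≤ B * ℓ ^ α * ℓ ∧ ‖Dw (N.pt s y)‖ ≤ B * ℓ ^ α := by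
  obtain ⟨τ₁, τ₂, h1', h2', h12, hf1, -, hin⟩ := hch
  have hx : N.pt s y ∈ closure Ω := subset_closure (hN (N.pt_mem_dom hs hy))
  have hB := h.B_nonneg hx
  have hlat := N.pt_mem_lateral hs hf1
  have hcl : N.pt s (y + τ₁ • d) ∈ closure Ω := closure_mono hN (N.lateral_subset_closure hlat)
  have hℓ : 0 ≤ ℓ := by linarith
  have hdist : dist (N.pt s y) (N.pt s (y + τ₁ • d)) ≤ ℓ := by
    rw [N.dist_pt_pt_same, dist_comm, dist_eq_norm, add_sub_cancel_left, norm_smul, hd, mul_one,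
      Real.norm_eq_abs, abs_of_pos h1']
    linarith
  constructor
  · have hT := h.norm_sub_sub_le_of_dist_le hα (x := N.pt s y) (x' := N.pt s (y + τ₁ • d)) hcl
      (fun τ hτ => by
        rw [N.pt_segment, add_sub_cancel_left, smul_smul]
        exact hN (N.pt_mem_dom hs (hin _ ⟨by nlinarith [hτ.1], by nlinarith [hτ.2]⟩))) hdist
      (by rw [dist_self]; exact hℓ)
    have h2 : dotC (N.pt s (y + τ₁ • d) - N.pt s y) (Dw (N.pt s (y + τ₁ • d))) = 0 := by
      rw [h1 _ hlat]; simp [dotC]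
    rw [h2, h0 _ hlat, sub_zero, zero_sub, norm_neg, ← dist_eq_norm, dist_comm] at hT
    exact hT.trans (mul_le_mul_of_nonneg_left hdist (by positivity))
  · have h2 := h.holder _ hx _ hcl
    rw [h1 _ hlat, sub_zero] at h2
    exact h2.trans (mul_le_mul_of_nonneg_left (Real.rpow_le_rpow dist_nonneg hdist hα.le) hB)

end

end BalanceLaw

namespace BalanceLaw

variable {m : ℕ}

/-! ### Volumes in a straightened tube -/

namespace Shear

variable (N : Shear m)

/-- The splitting of the space into the height and the projection to the hyperplane. -/
noncomputable def split : E (m + 1) ≃L[ℝ] ℝ × E m :=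
  ContinuousLinearEquiv.equivOfInverse (N.ht.prod N.proj)
    ((ContinuousLinearMap.fst ℝ ℝ (E m)).smulRight N.nrm
      + N.emb.toContinuousLinearMap.comp (ContinuousLinearMap.snd ℝ ℝ (E m)))
    (fun x => by simpa using N.decomp x)
    (fun p => by
      ext1
      · simp [N.ht_emb, N.ht_nrm]
      · simp [N.proj_emb, N.proj_nrm])

/-- By Fubini: over each height the slice is a translate of `A`. -/
theorem volume_skew {J : Set ℝ} (hJ : MeasurableSet J) (hJN : J ⊆ N.range) {A : Set (E m)}
    (hA : MeasurableSet A) :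
    MeasurableSet {p : ℝ × E m | p.1 ∈ J ∧ p.2 - N.prof p.1 ∈ A} ∧
      ((volume : Measure ℝ).prod (volume : Measure (E m))) {p | p.1 ∈ J ∧ p.2 - N.prof p.1 ∈ A}
        = volume J * volume A := by
  classical
  -- The profile is continuous only on the range of heights; its cut-off by `J` is measurable
  -- everywhere and gives the same set.
  have hprof : Measurable (J.indicator N.prof) := by
    rw [← piecewise_eq_indicator]
    exact (N.continuousOn_prof.mono hJN).measurable_piecewise continuousOn_const hJ
  have heq : {p : ℝ × E m | p.1 ∈ J ∧ p.2 - N.prof p.1 ∈ A}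
      = Prod.fst ⁻¹' J ∩ (fun p : ℝ × E m => p.2 - J.indicator N.prof p.1) ⁻¹' A := by
    ext p
    simp only [mem_ofPred_eq, mem_inter_iff, mem_preimage]
    refine and_congr_right fun hp => ?_
    rw [indicator_of_mem hp]
  have hmeas : MeasurableSet {p : ℝ × E m | p.1 ∈ J ∧ p.2 - N.prof p.1 ∈ A} := by
    rw [heq]
    exact (measurable_fst hJ).inter
      ((measurable_snd.sub (hprof.comp measurable_fst)) hA)
  refine ⟨hmeas, ?_⟩
  rw [Measure.prod_apply hmeas]
  have h1 : ∀ s, (volume : Measure (E m)) (Prod.mk s ⁻¹' {p : ℝ × E m | p.1 ∈ J ∧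
      p.2 - N.prof p.1 ∈ A}) = J.indicator (fun _ => volume A) s := by
    intro s
    by_cases hs : s ∈ J
    · rw [indicator_of_mem hs]
      have : Prod.mk s ⁻¹' {p : ℝ × E m | p.1 ∈ J ∧ p.2 - N.prof p.1 ∈ A}
          = (fun z => z - N.prof s) ⁻¹' A := by
        ext z; simp [hs]
      rw [this]
      simp only [sub_eq_add_neg]
      exact measure_preimage_add_right _ _ _
    · rw [indicator_of_notMem hs]
      have : Prod.mk s ⁻¹' {p : ℝ × E m | p.1 ∈ J ∧ p.2 - N.prof p.1 ∈ A} = ∅ := by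
        ext z; simp [hs]
      rw [this, measure_empty]
  simp_rw [h1]
  rw [lintegral_indicator_const hJ, mul_comm]

/-- The part of the tube over `J` with the cross-section replaced by `A`. -/
def cell (J : Set ℝ) (A : Set (E m)) : Set (E (m + 1)) := {x | N.ht x ∈ J ∧ N.sc x ∈ A}

/-- The volume is, up to a constant factor, the product of the length and of the volume of the
cross-section. -/
theorem exists_volume_cell : ∃ c : ℝ, 0 < c ∧ ∀ J : Set ℝ, MeasurableSet J → J ⊆ N.range →
    ∀ A : Set (E m), MeasurableSet A → MeasurableSet (N.cell J A) ∧
      volume (N.cell J A) = ENNReal.ofReal c * (volume J * volume A) := by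
  -- Uniqueness of Haar measure up to a factor. The value of the factor is immaterial, as it cancels
  -- in the cell estimate.
  have hL : (volume : Measure (E (m + 1))).map N.split
      = Measure.addHaarScalarFactor ((volume : Measure (E (m + 1))).map N.split)
          ((volume : Measure ℝ).prod (volume : Measure (E m)))
        • ((volume : Measure ℝ).prod (volume : Measure (E m))) :=
    Measure.isAddLeftInvariant_eq_smul _ _
  set c := Measure.addHaarScalarFactor ((volume : Measure (E (m + 1))).map N.split)
    ((volume : Measure ℝ).prod (volume : Measure (E m))) with hc
  have hc0 : 0 < c := Measure.addHaarScalarFactor_pos_of_isAddHaarMeasure _ _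
  refine ⟨c, by exact_mod_cast hc0, fun J hJ hJN A hA => ?_⟩
  obtain ⟨h1, h2⟩ := N.volume_skew hJ hJN hA
  have h3 : N.cell J A = N.split ⁻¹' {p : ℝ × E m | p.1 ∈ J ∧ p.2 - N.prof p.1 ∈ A} := by
    ext x; rfl
  refine ⟨?_, ?_⟩
  · rw [h3]; exact N.split.continuous.measurable h1
  · rw [h3, ← Measure.map_apply N.split.continuous.measurable h1, hL, Measure.smul_apply, h2]
    simp [ENNReal.smul_def]

end Shear

/-! ### Cut-off functions -/

/-- A smooth cut-off function of an open set, with a gradient of the order of the inverse of the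
distance to the complement. -/
theorem exists_smooth_cutoff {k : ℕ} (V : Set (E k)) {δ : ℝ} (hδ : 0 < δ) :
    ∃ χ : E k → ℝ, ContDiff ℝ ∞ χ ∧ (∀ x, 0 ≤ χ x) ∧ (∀ x, χ x ≤ 1) ∧
      (∀ x, Metric.infDist x Vᶜ ≤ δ → χ x = 0) ∧ (∀ x, 4 * δ ≤ Metric.infDist x Vᶜ → χ x = 1) ∧
      ∀ x, ‖fderiv ℝ χ x‖ ≤ 1 / δ := by
  set D : E k → ℝ := fun x => Metric.infDist x Vᶜ with hD
  have hDl : ∀ x y, |D x - D y| ≤ dist x y := fun x y => by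
    have := (Metric.lipschitz_infDist_pt (Vᶜ : Set (E k))).dist_le_mul x y
    simpa [Real.dist_eq] using this
  -- A piecewise linear function of the distance, rising between 2δ and 3δ. Mollification at radius
  -- δ moves these thresholds to δ and 4δ at worst and keeps the Lipschitz constant 1/δ.
  set g : E k → ℝ := fun x => max 0 (min 1 (D x / δ - 2)) with hg
  have hg0 : ∀ x, 0 ≤ g x := fun x => le_max_left _ _
  have hg1 : ∀ x, g x ≤ 1 := fun x => max_le zero_le_one (min_le_left _ _)
  have hgl : ∀ x y, |g x - g y| ≤ 1 / δ * dist x y := by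
    intro x y
    have h1 : |g x - g y| ≤ |D x / δ - 2 - (D y / δ - 2)| := by
      simp only [hg]
      rw [max_comm 0, max_comm 0]
      refine (abs_max_sub_max_le_abs _ _ _).trans ((abs_min_sub_min_le_max _ _ _ _).trans ?_)
      rw [sub_self, abs_zero]
      exact max_le (abs_nonneg _) le_rfl
    refine h1.trans ?_
    rw [sub_sub_sub_cancel_right, ← sub_div, abs_div, abs_of_pos hδ, div_eq_mul_inv, mul_comm,
      one_div]
    exact mul_le_mul_of_nonneg_left (hDl x y) (by positivity)
  have hgc : Continuous g := by
    have : Continuous D := Metric.continuous_infDist_pt _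
    simp only [hg]; fun_prop
  set φ : ContDiffBump (0 : E k) := ⟨δ / 2, δ, by positivity, by linarith⟩ with hφ
  set ρ : E k → ℝ := φ.normed volume with hρ
  have hρc : HasCompactSupport ρ := φ.hasCompactSupport_normed
  have hρs : ContDiff ℝ ∞ ρ := φ.contDiff_normed
  have hρ0 : ∀ x, 0 ≤ ρ x := fun x => φ.nonneg_normed x
  have hρ1 : ∫ x, ρ x = 1 := φ.integral_normed
  have hρi : Integrable ρ := φ.integrable_normed
  have hInt : ∀ x, Integrable fun z => ρ z * g (x - z) := fun x =>
    Integrable.mul_bdd (c := 1) hρi (by fun_prop) (Eventually.of_forall fun z => by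
      rw [Real.norm_eq_abs, abs_of_nonneg (hg0 _)]; exact hg1 _)
  set χ : E k → ℝ := convolution ρ g (ContinuousLinearMap.lsmul ℝ ℝ) volume with hχ
  have hχe : ∀ x, χ x = ∫ z, ρ z * g (x - z) := fun x => by
    simp only [hχ, convolution_def, ContinuousLinearMap.lsmul_apply, smul_eq_mul]
  refine ⟨χ, hρc.contDiff_convolution_left _ hρs hgc.locallyIntegrable, fun x => ?_, fun x => ?_,
    fun x hx => ?_, fun x hx => ?_, fun x => ?_⟩
  · rw [hχe]; exact integral_nonneg fun z => mul_nonneg (hρ0 z) (hg0 _)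
  · rw [hχe, ← hρ1]
    exact integral_mono (hInt x) hρi fun z => mul_le_of_le_one_right (hρ0 z) (hg1 _)
  · have hz : ∀ y ∈ Metric.ball x φ.rOut, g y = g x := by
      have h0 : ∀ y, D y ≤ 2 * δ → g y = 0 := fun y hy => by
        simp only [hg]
        refine max_eq_left ((min_le_right _ _).trans ?_)
        rw [sub_nonpos, div_le_iff₀ hδ]; exact hy
      intro y hy
      rw [Metric.mem_ball] at hy
      have h1 := (abs_le.1 (hDl y x)).2
      have h2 : φ.rOut = δ := rfl
      rw [h0 x (by simp only [hD]; linarith), h0 y (by rw [h2] at hy; simp only [hD] at *; linarith)]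
    have h1 : χ x = g x := φ.normed_convolution_eq_right hz
    rw [h1]
    simp only [hg]
    refine max_eq_left ((min_le_right _ _).trans ?_)
    rw [sub_nonpos, div_le_iff₀ hδ]; simp only [hD]; linarith
  · have h0 : ∀ y, 3 * δ ≤ D y → g y = 1 := fun y hy => by
      simp only [hg]
      rw [min_eq_left, max_eq_right zero_le_one]
      rw [le_sub_iff_add_le, le_div_iff₀ hδ]; linarith
    have hz : ∀ y ∈ Metric.ball x φ.rOut, g y = g x := by
      intro y hy
      rw [Metric.mem_ball] at hy
      have h1 := (abs_le.1 (hDl y x)).1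
      have h2 : φ.rOut = δ := rfl
      rw [h0 x (by simp only [hD]; linarith), h0 y (by rw [h2] at hy; simp only [hD] at *; linarith)]
    have h1 : χ x = g x := φ.normed_convolution_eq_right hz
    rw [h1, h0 x (by simp only [hD]; linarith)]
  · have hlip : LipschitzWith (Real.toNNReal (1 / δ)) χ := by
      refine LipschitzWith.of_dist_le_mul fun x y => ?_
      rw [Real.coe_toNNReal _ (by positivity), Real.dist_eq, hχe, hχe,
        ← integral_sub (hInt x) (hInt y)]
      have h1 : ∀ z, ‖ρ z * g (x - z) - ρ z * g (y - z)‖ ≤ ρ z * (1 / δ * dist x y) := by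
        intro z
        rw [← mul_sub, norm_mul, Real.norm_eq_abs, abs_of_nonneg (hρ0 z), Real.norm_eq_abs]
        refine mul_le_mul_of_nonneg_left ?_ (hρ0 z)
        have := hgl (x - z) (y - z)
        rwa [dist_sub_right] at this
      have h2 := norm_integral_le_of_norm_le (hρi.mul_const _) (Eventually.of_forall h1)
      rwa [integral_mul_const, hρ1, one_mul, Real.norm_eq_abs] at h2
    have := norm_fderiv_le_of_lipschitz ℝ hlip (x₀ := x)
    rwa [Real.coe_toNNReal _ (by positivity)] at this

/-- A smooth bump function of one variable. -/
theorem exists_bump : ∃ (η : ℝ → ℝ) (c : ℝ), 0 < c ∧ ContDiff ℝ ∞ η ∧ (∀ x, 0 ≤ η x) ∧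
    (∀ x, η x ≤ 1) ∧ (∀ x, |x| ≤ 1 → η x = 1) ∧ (∀ x, 2 ≤ |x| → η x = 0) ∧
    (∀ x, |deriv η x| ≤ c) ∧ ∀ x, |deriv (deriv η) x| ≤ c := by
  set φ : ContDiffBump (0 : ℝ) := ⟨1, 2, one_pos, one_lt_two⟩ with hφ
  have hs : ContDiff ℝ ∞ φ := φ.contDiff
  have hs1 : ContDiff ℝ ∞ (deriv φ) := (contDiff_infty_iff_deriv.1 hs).2
  have hs2 : ContDiff ℝ ∞ (deriv (deriv φ)) := (contDiff_infty_iff_deriv.1 hs1).2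
  have hc : HasCompactSupport φ := φ.hasCompactSupport
  obtain ⟨c₁, h1⟩ := hs1.continuous.bounded_above_of_compact_support hc.deriv
  obtain ⟨c₂, h2⟩ := hs2.continuous.bounded_above_of_compact_support hc.deriv.deriv
  refine ⟨φ, |c₁| + |c₂| + 1, by positivity, hs, fun x => φ.nonneg, fun x => φ.le_one,
    fun x hx => ?_, fun x hx => ?_, fun x => ?_, fun x => ?_⟩
  · exact φ.one_of_mem_closedBall (by simpa using hx)
  · exact φ.zero_of_le_dist (by simpa using hx)
  · have := h1 x
    rw [Real.norm_eq_abs] at this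
    linarith [le_abs_self c₁, abs_nonneg c₂]
  · have := h2 x
    rw [Real.norm_eq_abs] at this
    linarith [le_abs_self c₂, abs_nonneg c₁]

end BalanceLaw

namespace BalanceLaw

variable {m : ℕ}

/-! ### The difference of the weak equations -/

instance isAddHaarMeasure_spacetime (k : ℕ) :
    (volume : Measure (E k × ℝ)).IsAddHaarMeasure := by
  rw [Measure.volume_eq_prod]; infer_instance

section Integrals

variable {k : ℕ} {U : Set (E k × ℝ)} {φ : E k × ℝ → ℝ}

theorem integrable_mul_of_tsupport_subset {g : E k × ℝ → ℂ} (hg : ContinuousOn g U)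
    (hφ : Continuous φ) (hc : HasCompactSupport φ) (hs : tsupport φ ⊆ U) :
    Integrable fun p => g p * (φ p : ℂ) := by
  have h1 : IntegrableOn (fun p => g p * (φ p : ℂ)) (tsupport φ) :=
    ((hg.mono hs).mul (Complex.continuous_ofReal.comp hφ).continuousOn).integrableOn_compact hc
  refine (integrableOn_iff_integrable_of_support_subset fun p hp => ?_).1 h1
  refine subset_tsupport _ fun h0 => hp ?_
  simp only [h0, Complex.ofReal_zero, mul_zero]

theorem integrable_mul_fderiv_of_tsupport_subset {g : E k × ℝ → ℂ} (hg : ContinuousOn g U)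
    (hφ : ContDiff ℝ 1 φ) (hc : HasCompactSupport φ) (hs : tsupport φ ⊆ U) (v : E k × ℝ) :
    Integrable fun p => g p * (fderiv ℝ φ p v : ℂ) :=
  integrable_mul_of_tsupport_subset hg ((hφ.continuous_fderiv one_ne_zero).clm_apply continuous_const)
    (hc.fderiv_apply (𝕜 := ℝ) v) ((tsupport_fderiv_apply_subset ℝ v).trans hs)

theorem fderiv_apply_eq_zero_of_notMem {φ : E k × ℝ → ℝ} {p : E k × ℝ} (hp : p ∉ tsupport φ)
    (v : E k × ℝ) : fderiv ℝ φ p v = 0 := by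
  have h := image_eq_zero_of_notMem_tsupport (f := fun p => fderiv ℝ φ p v)
    fun h => hp (tsupport_fderiv_apply_subset ℝ v h)
  exact h

/-- Integration by parts against a test function. -/
theorem integral_dotC_mul_eq_neg {w : E k × ℝ → ℂ} {Dw : E k × ℝ → EuclideanSpace ℂ (Fin k)}
    {v : E k} (hw : ContinuousOn w U) (hDw : ContinuousOn Dw U)
    (hd : ∀ p ∈ U, ∃ L : E k × ℝ →L[ℝ] ℂ, HasFDerivAt w L p ∧ L (v, 0) = dotC v (Dw p))
    (hφ : ContDiff ℝ 1 φ) (hc : HasCompactSupport φ) (hs : tsupport φ ⊆ U) :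
    ∫ p, dotC v (Dw p) * (φ p : ℂ) = -∫ p, w p * (fderiv ℝ φ p (v, 0) : ℂ) := by
  have hcd : ContinuousOn (fun p => dotC v (Dw p)) U := by
    unfold dotC
    exact continuousOn_finsetSum _ fun i _ => continuousOn_const.mul
      ((EuclideanSpace.proj (𝕜 := ℂ) i).continuous.comp_continuousOn hDw)
  have hi1 := integrable_mul_of_tsupport_subset hcd hφ.continuous hc hs
  have hi2 := integrable_mul_fderiv_of_tsupport_subset hw hφ hc hs (v, 0)
  have hi3 := integrable_mul_of_tsupport_subset hw hφ.continuous hc hs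
  have hsup : tsupport (fun p => (φ p : ℂ)) ⊆ tsupport φ :=
    closure_mono fun p hp h0 => hp (by simp [h0])
  have h := integral_bilinear_hasLineDerivAt_right_eq_neg_left_of_integrable
    (μ := (volume : Measure (E k × ℝ))) (f := w) (f' := fun p => dotC v (Dw p))
    (g := fun p => (φ p : ℂ)) (g' := fun p => (fderiv ℝ φ p (v, 0) : ℂ)) (v := (v, 0))
    (B := ContinuousLinearMap.mul ℝ ℂ) hi1 hi2 hi3
    (fun p hp => by
      obtain ⟨L, hL, hLv⟩ := hd p (hs (hsup hp))
      have := hL.hasLineDerivAt (v, 0)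
      rwa [hLv] at this)
    (fun p _ => by
      have h1 := ((hφ.differentiable one_ne_zero) p).hasFDerivAt
      exact (Complex.ofRealCLM.hasFDerivAt.comp p h1).hasLineDerivAt (v, 0))
  simp only [ContinuousLinearMap.mul_apply'] at h
  rw [h, neg_neg]

/-- The averaging argument: a function that is almost constant on a cell, and whose integral against
a cut-off function of the cell is small, is small. -/
theorem norm_sub_mul_le_of_integral_eq {g J : E k × ℝ → ℂ} {V₀ V₁ L : Set (E k)} {I₀ I₁ : Set ℝ}
    (hV₀ : MeasurableSet V₀) (hV₁ : MeasurableSet V₁) (hL : MeasurableSet L)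
    (hI₀ : MeasurableSet I₀) (hI₁ : MeasurableSet I₁) (hV₀' : volume V₀ < ⊤) (hV₁' : volume V₁ < ⊤)
    (hL' : volume L < ⊤) (hI₀' : volume I₀ < ⊤) (hI₁' : volume I₁ < ⊤)
    (hφ : Integrable φ) (hgφ : Integrable fun p => g p * (φ p : ℂ))
    (hφ0 : ∀ p, 0 ≤ φ p) (hφ1 : ∀ p ∈ (V₀ \ L) ×ˢ I₀, φ p = 1) {c₀ : ℂ} {o A R : ℝ}
    (hosc : ∀ p, φ p ≠ 0 → ‖g p - c₀‖ ≤ o) (ho : o ≤ ‖c₀‖)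
    (hJ : ∀ p, ‖J p‖ ≤ (V₁ ×ˢ I₁).indicator (fun _ => A) p + (L ×ˢ I₁).indicator (fun _ => R) p)
    (heq : ∫ p, g p * (φ p : ℂ) = ∫ p, J p) :
    (‖c₀‖ - o) * ((volume.real V₀ - volume.real L) * volume.real I₀)
      ≤ A * (volume.real V₁ * volume.real I₁) + R * (volume.real L * volume.real I₁) := by
  have hprod : ∀ (A : Set (E k)) (B : Set ℝ), (volume : Measure (E k × ℝ)) (A ×ˢ B)
      = volume A * volume B := fun A B => by
    rw [Measure.volume_eq_prod, Measure.prod_prod]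
  have hprodr : ∀ (A : Set (E k)) (B : Set ℝ), (volume : Measure (E k × ℝ)).real (A ×ˢ B)
      = volume.real A * volume.real B := fun A B => by
    rw [Measure.real, hprod, ENNReal.toReal_mul]; rfl
  have hfin1 : (volume : Measure (E k × ℝ)) (V₁ ×ˢ I₁) < ⊤ := by
    rw [hprod]; exact ENNReal.mul_lt_top hV₁' hI₁'
  have hfin2 : (volume : Measure (E k × ℝ)) (L ×ˢ I₁) < ⊤ := by
    rw [hprod]; exact ENNReal.mul_lt_top hL' hI₁'
  have hdiff : volume (V₀ \ L) < ⊤ := (measure_mono sdiff_subset).trans_lt hV₀'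
  have hfin0 : (volume : Measure (E k × ℝ)) ((V₀ \ L) ×ˢ I₀) < ⊤ := by
    rw [hprod]; exact ENNReal.mul_lt_top hdiff hI₀'
  have hi1 : Integrable ((V₁ ×ˢ I₁).indicator fun _ : E k × ℝ => A) :=
    (integrable_indicator_iff (hV₁.prod hI₁)).2 (integrableOn_const hfin1.ne)
  have hi2 : Integrable ((L ×ˢ I₁).indicator fun _ : E k × ℝ => R) :=
    (integrable_indicator_iff (hL.prod hI₁)).2 (integrableOn_const hfin2.ne)
  have hup := norm_integral_le_of_norm_le (hi1.add hi2) (Eventually.of_forall hJ)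
  rw [integral_add' hi1 hi2, integral_indicator_const _ (hV₁.prod hI₁),
    integral_indicator_const _ (hL.prod hI₁), hprodr, hprodr, smul_eq_mul, smul_eq_mul] at hup
  -- the lower bound of the integral of the cut-off function
  have hlow : (volume.real V₀ - volume.real L) * volume.real I₀ ≤ ∫ p, φ p := by
    have h1 : ∫ p in (V₀ \ L) ×ˢ I₀, φ p ≤ ∫ p, φ p :=
      setIntegral_le_integral hφ (Eventually.of_forall hφ0)
    have h2 : ∫ p in (V₀ \ L) ×ˢ I₀, φ p = volume.real (V₀ \ L) * volume.real I₀ := by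
      rw [setIntegral_congr_fun ((hV₀.diff hL).prod hI₀) hφ1]
      rw [setIntegral_const, hprodr]; simp
    have h3 : volume.real V₀ - volume.real L ≤ volume.real (V₀ \ L) :=
      le_measureReal_sdiff (h := hL'.ne)
    have h4 := mul_le_mul_of_nonneg_right h3 (measureReal_nonneg (μ := volume) (s := I₀))
    linarith
  have hosc' : ‖∫ p, (g p - c₀) * (φ p : ℂ)‖ ≤ o * ∫ p, φ p := by
    rw [← integral_const_mul]
    refine norm_integral_le_of_norm_le (hφ.const_mul o) (Eventually.of_forall fun p => ?_)
    rw [norm_mul, Complex.norm_real, Real.norm_eq_abs, abs_of_nonneg (hφ0 p)]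
    by_cases hp : φ p = 0
    · rw [hp, mul_zero, mul_zero]
    · exact mul_le_mul_of_nonneg_right (hosc p hp) (hφ0 p)
  have hsplit : c₀ * ((∫ p, φ p : ℝ) : ℂ)
      = (∫ p, g p * (φ p : ℂ)) - ∫ p, (g p - c₀) * (φ p : ℂ) := by
    have h1 : Integrable fun p => c₀ * (φ p : ℂ) := hφ.ofReal.const_mul c₀
    have h2 : ∀ p, (g p - c₀) * (φ p : ℂ) = g p * (φ p : ℂ) - c₀ * (φ p : ℂ) := fun p => by ring
    simp_rw [h2]
    rw [integral_sub hgφ h1, integral_const_mul, integral_complex_ofReal]; ring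
  have hint0 : 0 ≤ ∫ p, φ p := integral_nonneg hφ0
  have h3 : ‖c₀‖ * ∫ p, φ p ≤ ‖∫ p, J p‖ + o * ∫ p, φ p := by
    have h4 := congrArg norm hsplit
    rw [norm_mul, Complex.norm_real, Real.norm_eq_abs, abs_of_nonneg hint0] at h4
    rw [h4, ← heq]
    exact (norm_sub_le _ _).trans (add_le_add le_rfl hosc')
  have h5 := mul_le_mul_of_nonneg_left hlow (sub_nonneg.2 ho)
  linarith

end Integrals

section Setting

variable {M : ℕ} {N : Fin M → Tube m} {T μ α₂ α₃ α₄ C₂ C₃ C₄ : ℝ} {H : ℂ → ℂ}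
  {F : Fin 2 → E (m + 1) → ℝ → ℂ → Fin (m + 1) → ℂ}
  {f : Fin 2 → E (m + 1) → ℝ → ℂ → EuclideanSpace ℂ (Fin (m + 1)) → ℂ}
  {u : Fin 2 → E (m + 1) → ℝ → ℂ} {Du : Fin 2 → E (m + 1) → ℝ → EuclideanSpace ℂ (Fin (m + 1))}
  {ut h : Fin 2 → E (m + 1) → ℝ → ℂ}

/-- The two weak equations are subtracted; the flux terms cancel because the fluxes agree along the
solutions. -/
theorem IsSetting.integral_sub_eq (hs : IsSetting N T μ α₂ α₃ α₄ C₂ C₃ C₄ H F f u Du ut h)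
    (hα₂ : 0 < α₂) (hα₃ : 0 < α₃) (hα₄ : 0 < α₄) (hH : Continuous H) (hΩ : IsOpen (unionDom N))
    (hF : ∀ x ∈ unionDom N, ∀ t ∈ Icc 0 T, F 0 x t (u 0 x t) = F 1 x t (u 1 x t))
    {φ : E (m + 1) × ℝ → ℝ} (hφ : ContDiff ℝ ∞ φ) (hc : HasCompactSupport φ)
    (hsupp : tsupport φ ⊆ unionDom N ×ˢ Ioo 0 T) :
    ∫ p, (f 0 p.1 p.2 (u 0 p.1 p.2) (Du 0 p.1 p.2) - f 1 p.1 p.2 (u 1 p.1 p.2) (Du 1 p.1 p.2))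
        * (φ p : ℂ)
      = ∫ p, (-((H (u 0 p.1 p.2) - H (u 1 p.1 p.2)) * (fderiv ℝ φ p (0, 1) : ℂ))
        + (μ : ℂ) * ∑ i, (Du 0 p.1 p.2 i - Du 1 p.1 p.2 i)
          * (fderiv ℝ φ p (EuclideanSpace.single i 1, 0) : ℂ)) := by
  set Q := unionDom N ×ˢ Ioo 0 T with hQ
  have hQo : IsOpen Q := hΩ.prod isOpen_Ioo
  have hQs : Q ⊆ closure (unionDom N) ×ˢ Icc 0 T :=
    prod_mono subset_closure Ioo_subset_Icc_self
  have hφ1 : ContDiff ℝ 1 φ := hφ.of_le (by norm_cast)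
  have hu : ∀ j, ContinuousOn (fun p : E (m + 1) × ℝ => u j p.1 p.2) Q := fun j =>
    (hs.continuousOn_u hα₄ j).mono hQs
  have hDu : ∀ j, ContinuousOn (fun p : E (m + 1) × ℝ => Du j p.1 p.2) Q := fun j =>
    (hs.continuousOn_Du hα₄ j).mono hQs
  set X : Fin 2 → E (m + 1) × ℝ → ℂ := fun j p =>
    -(H (u j p.1 p.2) * (fderiv ℝ φ p (0, 1) : ℂ))
      - ∑ i, F j p.1 p.2 (u j p.1 p.2) i * (fderiv ℝ φ p (EuclideanSpace.single i 1, 0) : ℂ)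
      + (μ : ℂ) * ∑ i, Du j p.1 p.2 i * (fderiv ℝ φ p (EuclideanSpace.single i 1, 0) : ℂ) with hX
  set Y : Fin 2 → E (m + 1) × ℝ → ℂ := fun j p =>
    f j p.1 p.2 (u j p.1 p.2) (Du j p.1 p.2) * (φ p : ℂ) with hY
  have hXi : ∀ j, Integrable (X j) := by
    intro j
    refine Integrable.add (Integrable.sub (Integrable.neg ?_) ?_) (Integrable.const_mul ?_ _)
    · exact integrable_mul_fderiv_of_tsupport_subset (hH.comp_continuousOn (hu j)) hφ1 hc hsupp _
    · exact integrable_finsetSum _ fun i _ => integrable_mul_fderiv_of_tsupport_subset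
        ((hs.continuousOn_flux hα₃ hα₄ j j i).mono hQs) hφ1 hc hsupp _
    · exact integrable_finsetSum _ fun i _ => integrable_mul_fderiv_of_tsupport_subset
        ((EuclideanSpace.proj (𝕜 := ℂ) i).continuous.comp_continuousOn (hDu j)) hφ1 hc hsupp _
  have hYi : ∀ j, Integrable (Y j) := fun j =>
    integrable_mul_of_tsupport_subset (((hs.source j).continuousOn_comp hα₂
      (hs.continuousOn_u hα₄ j) (hs.continuousOn_Du hα₄ j)).mono hQs) hφ1.continuous hc hsupp
  -- Outside Q the test function and its derivatives vanish, so the integrals may be taken over the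
  -- whole space-time.
  have hX0 : ∀ j p, p ∉ Q → X j p = 0 := by
    intro j p hp
    have h1 : p ∉ tsupport φ := fun h => hp (hsupp h)
    simp only [hX, fderiv_apply_eq_zero_of_notMem h1, Complex.ofReal_zero, mul_zero,
      Finset.sum_const_zero, neg_zero, sub_zero, add_zero]
  have hY0 : ∀ j p, p ∉ Q → Y j p = 0 := by
    intro j p hp
    have h1 : p ∉ tsupport φ := fun h => hp (hsupp h)
    simp only [hY, image_eq_zero_of_notMem_tsupport h1, Complex.ofReal_zero, mul_zero]
  have hXY : ∀ j, ∫ p, X j p = ∫ p, Y j p := by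
    intro j
    rw [← setIntegral_eq_integral_of_forall_compl_eq_zero (hX0 j),
      ← setIntegral_eq_integral_of_forall_compl_eq_zero (hY0 j)]
    exact hs.solution j φ hφ hc hsupp
  have h1 : ∀ p : E (m + 1) × ℝ,
      (f 0 p.1 p.2 (u 0 p.1 p.2) (Du 0 p.1 p.2) - f 1 p.1 p.2 (u 1 p.1 p.2) (Du 1 p.1 p.2))
        * (φ p : ℂ) = Y 0 p - Y 1 p := fun p => by simp only [hY]; ring
  simp_rw [h1]
  rw [integral_sub (hYi 0) (hYi 1), ← hXY, ← hXY, ← integral_sub (hXi 0) (hXi 1)]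
  refine integral_congr_ae (Eventually.of_forall fun p => ?_)
  by_cases hp : p ∈ Q
  · have hFp := hF p.1 hp.1 p.2 (Ioo_subset_Icc_self hp.2)
    simp only [hX, hFp, sub_mul, Finset.sum_sub_distrib, mul_sub]
    ring
  · have h2 : p ∉ tsupport φ := fun h => hp (hsupp h)
    simp only [hX0 _ p hp, fderiv_apply_eq_zero_of_notMem h2, Complex.ofReal_zero, mul_zero,
      Finset.sum_const_zero, neg_zero, sub_zero, add_zero]

end Setting

end BalanceLaw

namespace BalanceLaw

variable {m : ℕ}

/-! ### Test functions on cells -/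

/-- A bump function of one variable around `s₀` at scale `r`, with its first two derivatives. -/
structure ScaledBump (c s₀ r : ℝ) where
  val : ℝ → ℝ
  d1 : ℝ → ℝ
  d2 : ℝ → ℝ
  smooth : ContDiff ℝ ∞ val
  smooth_d1 : ContDiff ℝ ∞ d1
  hasDerivAt_val : ∀ s, HasDerivAt val (d1 s) s
  hasDerivAt_d1 : ∀ s, HasDerivAt d1 (d2 s) s
  nonneg : ∀ s, 0 ≤ val s
  le_one : ∀ s, val s ≤ 1
  eq_one : ∀ s, |s - s₀| ≤ r → val s = 1
  eq_zero : ∀ s, 2 * r < |s - s₀| → val s = 0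
  d1_eq_zero : ∀ s, 2 * r < |s - s₀| → d1 s = 0
  abs_d1_le : ∀ s, |d1 s| ≤ c / r
  abs_d2_le : ∀ s, |d2 s| ≤ c / r ^ 2

theorem exists_scaledBump : ∃ c : ℝ, 0 < c ∧ ∀ s₀ r : ℝ, 0 < r → Nonempty (ScaledBump c s₀ r) := by
  obtain ⟨η, c, hc, hs, h0, h1, hone, hzero, hd1, hd2⟩ := exists_bump
  refine ⟨c, hc, fun s₀ r hr => ?_⟩
  have hs1 : ContDiff ℝ ∞ (deriv η) := (contDiff_infty_iff_deriv.1 hs).2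
  have hlin : ContDiff ℝ ∞ fun s : ℝ => (s - s₀) / r := by fun_prop
  have hdl : ∀ s, HasDerivAt (fun s : ℝ => (s - s₀) / r) (1 / r) s := fun s =>
    ((hasDerivAt_id s).sub_const s₀).div_const r
  have hv : ∀ s, HasDerivAt (fun s => η ((s - s₀) / r)) (deriv η ((s - s₀) / r) / r) s := by
    intro s
    have h2 := ((hs.differentiable (by simp)) ((s - s₀) / r)).hasDerivAt.comp s (hdl s)
    rw [mul_one_div] at h2
    exact h2
  have hz : ∀ s, 2 * r < |s - s₀| → η ((s - s₀) / r) = 0 := fun s h2 => by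
    refine hzero _ ?_
    rw [abs_div, abs_of_pos hr, le_div_iff₀ hr]; exact h2.le
  refine ⟨⟨fun s => η ((s - s₀) / r), fun s => deriv η ((s - s₀) / r) / r,
    fun s => deriv (deriv η) ((s - s₀) / r) / r / r, hs.comp hlin,
    (hs1.comp hlin).div_const r, hv, fun s => ?_, fun s => h0 _, fun s => h1 _, fun s h2 => ?_, hz,
    fun s h2 => ?_, fun s => ?_, fun s => ?_⟩⟩
  · have h2 := ((hs1.differentiable (by simp)) ((s - s₀) / r)).hasDerivAt.comp s (hdl s)
    rw [mul_one_div] at h2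
    exact h2.div_const r
  · refine hone _ ?_
    rw [abs_div, abs_of_pos hr, div_le_one hr]; exact h2
  · have h3 : (fun s => η ((s - s₀) / r)) =ᶠ[𝓝 s] fun _ => 0 := by
      have : IsOpen {s : ℝ | 2 * r < |s - s₀|} := isOpen_lt continuous_const (by fun_prop)
      filter_upwards [this.mem_nhds h2] with s' hs' using hz s' hs'
    exact (hv s).unique ((hasDerivAt_const s (0 : ℝ)).congr_of_eventuallyEq h3)
  · rw [abs_div, abs_of_pos hr]; exact div_le_div_of_nonneg_right (hd1 _) hr.le
  · rw [abs_div, abs_div, abs_of_pos hr, div_div, ← pow_two]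
    exact div_le_div_of_nonneg_right (hd2 _) (by positivity)

/-- The product of functions of the time, of the height, and of a further coordinate, with a
function of the position. -/
noncomputable def testFn {k : ℕ} (n l : E k) (x₀ : E k) (θ A B : ℝ → ℝ) (χ : E k → ℝ) (p : E k × ℝ) : ℝ :=
  θ p.2 * A (inner ℝ n p.1) * B (inner ℝ (p.1 - x₀) l) * χ p.1

section TestFn

variable {k : ℕ} {n l x₀ : E k} {θ A B : ℝ → ℝ} {χ : E k → ℝ}

theorem contDiff_testFn (hθ : ContDiff ℝ ∞ θ) (hA : ContDiff ℝ ∞ A) (hB : ContDiff ℝ ∞ B)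
    (hχ : ContDiff ℝ ∞ χ) : ContDiff ℝ ∞ (testFn n l x₀ θ A B χ) := by
  have h1 : ContDiff ℝ ∞ fun p : E k × ℝ => inner ℝ n p.1 :=
    contDiff_const.inner ℝ contDiff_fst
  have h2 : ContDiff ℝ ∞ fun p : E k × ℝ => inner ℝ (p.1 - x₀) l :=
    (contDiff_fst.sub contDiff_const).inner ℝ contDiff_const
  exact (((hθ.comp contDiff_snd).mul (hA.comp h1)).mul (hB.comp h2)).mul (hχ.comp contDiff_fst)

theorem fderiv_testFn {θ1 A1 B1 : ℝ → ℝ} (hθ : ∀ s, HasDerivAt θ (θ1 s) s)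
    (hA : ∀ s, HasDerivAt A (A1 s) s) (hB : ∀ s, HasDerivAt B (B1 s) s)
    (hχ : ContDiff ℝ ∞ χ) (p v : E k × ℝ) :
    fderiv ℝ (testFn n l x₀ θ A B χ) p v
      = θ1 p.2 * v.2 * A (inner ℝ n p.1) * B (inner ℝ (p.1 - x₀) l) * χ p.1
        + θ p.2 * (A1 (inner ℝ n p.1) * inner ℝ n v.1) * B (inner ℝ (p.1 - x₀) l) * χ p.1
        + θ p.2 * A (inner ℝ n p.1) * (B1 (inner ℝ (p.1 - x₀) l) * inner ℝ v.1 l) * χ p.1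
        + θ p.2 * A (inner ℝ n p.1) * B (inner ℝ (p.1 - x₀) l) * fderiv ℝ χ p.1 v.1 := by
  have e1 : HasFDerivAt (fun p : E k × ℝ => inner ℝ n p.1)
      ((innerSL ℝ n).comp (ContinuousLinearMap.fst ℝ (E k) ℝ)) p :=
    ((innerSL ℝ n).comp (ContinuousLinearMap.fst ℝ (E k) ℝ)).hasFDerivAt
  have e2 : HasFDerivAt (fun p : E k × ℝ => inner ℝ (p.1 - x₀) l)
      ((innerSL ℝ l).comp (ContinuousLinearMap.fst ℝ (E k) ℝ)) p := by
    have h1 := (((innerSL ℝ l).comp (ContinuousLinearMap.fst ℝ (E k) ℝ)).hasFDerivAt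
      (x := p)).sub_const (inner ℝ l x₀)
    refine h1.congr_of_eventuallyEq (Eventually.of_forall fun q => ?_)
    simp [inner_sub_right, real_inner_comm l]
  have dθ := (hθ p.2).comp_hasFDerivAt p (hasFDerivAt_snd (𝕜 := ℝ) (p := p))
  have dA := (hA (inner ℝ n p.1)).comp_hasFDerivAt p e1
  have dB := (hB (inner ℝ (p.1 - x₀) l)).comp_hasFDerivAt p e2
  have dχ : HasFDerivAt (fun p : E k × ℝ => χ p.1)
      ((fderiv ℝ χ p.1).comp (ContinuousLinearMap.fst ℝ (E k) ℝ)) p :=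
    ((hχ.differentiable (by simp)) p.1).hasFDerivAt.comp p hasFDerivAt_fst
  have h := ((dθ.mul dA).mul dB).mul dχ
  have h' : HasFDerivAt (testFn n l x₀ θ A B χ) _ p := h
  rw [h'.fderiv]
  simp [real_inner_comm l]
  ring

end TestFn

namespace Shear

variable (N : Shear m)

/-- The support of the test functions on a cell. -/
def cellSupport (e : E m) (x₀ : E (m + 1)) (s₀ r R δ t₀ q : ℝ) : Set (E (m + 1) × ℝ) :=
  {p | |N.ht p.1 - s₀| ≤ 2 * r ∧ |inner ℝ (p.1 - x₀) (N.emb e)| ≤ 2 * R ∧ |p.2 - t₀| ≤ 2 * q ∧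
    δ ≤ Metric.infDist p.1 N.domᶜ}

variable {N} {e : E m} {x₀ : E (m + 1)} {s₀ r R δ t₀ q : ℝ}

theorem mem_dom_of_infDist_pos {x : E (m + 1)} (hx : 0 < Metric.infDist x N.domᶜ) : x ∈ N.dom := by
  by_contra h
  rw [Metric.infDist_zero_of_mem (show x ∈ N.domᶜ from h)] at hx
  exact lt_irrefl _ hx

theorem isClosed_cellSupport : IsClosed (N.cellSupport e x₀ s₀ r R δ t₀ q) := by
  have h1 : Continuous fun p : E (m + 1) × ℝ => Metric.infDist p.1 N.domᶜ :=
    (Metric.continuous_infDist_pt _).comp continuous_fst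
  have h2 : Continuous fun p : E (m + 1) × ℝ => N.ht p.1 := N.ht.continuous.comp continuous_fst
  have h3 : Continuous fun p : E (m + 1) × ℝ => |N.ht p.1 - s₀| := by fun_prop
  have h4 : Continuous fun p : E (m + 1) × ℝ => |inner ℝ (p.1 - x₀) (N.emb e)| := by fun_prop
  have h5 : Continuous fun p : E (m + 1) × ℝ => |p.2 - t₀| := by fun_prop
  exact (isClosed_le h3 continuous_const).inter ((isClosed_le h4 continuous_const).inter
    ((isClosed_le h5 continuous_const).inter (isClosed_le continuous_const h1)))

theorem isCompact_cellSupport (hS : Bornology.IsBounded N.sec) (hδ : 0 < δ) (hr : 0 < r)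
    (hrange : Icc (s₀ - 3 * r) (s₀ + 3 * r) ⊆ N.range) :
    IsCompact (N.cellSupport e x₀ s₀ r R δ t₀ q) := by
  refine Metric.isCompact_of_isClosed_isBounded isClosed_cellSupport ?_
  obtain ⟨ρ, hρ⟩ := hS.subset_closedBall 0
  have hs₀ : s₀ ∈ N.range := hrange ⟨by linarith, by linarith⟩
  refine (((Metric.isBounded_closedBall (x := N.pt s₀ 0)
    (r := (1 + N.lip) * (2 * r) + ρ)).prod (Metric.isBounded_closedBall (x := t₀)
      (r := 2 * q)))).subset fun p hp => ?_
  obtain ⟨h1, -, h3, h4⟩ := hp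
  have hd := mem_dom_of_infDist_pos (hδ.trans_le h4)
  refine ⟨?_, by rw [Metric.mem_closedBall, Real.dist_eq]; exact h3⟩
  rw [Metric.mem_closedBall, dist_eq_norm, ← N.pt_ht_sc p.1]
  refine (N.norm_pt_sub_le hd.1 hs₀ _ _).trans (add_le_add ?_ ?_)
  · exact mul_le_mul_of_nonneg_left h1 (by positivity)
  · have := hρ hd.2
    rwa [Metric.mem_closedBall, dist_eq_norm] at this

theorem testFn_support {A B θ : ℝ → ℝ} {χ : E (m + 1) → ℝ}
    (hS : Bornology.IsBounded N.sec) (hδ : 0 < δ) (hr : 0 < r)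
    (hrange : Icc (s₀ - 3 * r) (s₀ + 3 * r) ⊆ N.range)
    (hθ : ∀ t, 2 * q < |t - t₀| → θ t = 0) (hA : ∀ s, 2 * r < |s - s₀| → A s = 0)
    (hB : ∀ s, 2 * R < |s - 0| → B s = 0) (hχ : ∀ x, Metric.infDist x N.domᶜ ≤ δ → χ x = 0) :
    HasCompactSupport (testFn N.nrm (N.emb e) x₀ θ A B χ) ∧
      tsupport (testFn N.nrm (N.emb e) x₀ θ A B χ) ⊆ N.cellSupport e x₀ s₀ r R δ t₀ q := by
  have hz : ∀ p ∉ N.cellSupport e x₀ s₀ r R δ t₀ q, testFn N.nrm (N.emb e) x₀ θ A B χ p = 0 := by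
    intro p hp
    simp only [cellSupport, mem_ofPred_eq, not_and_or, not_le] at hp
    unfold testFn
    rcases hp with h | h | h | h
    · rw [← N.ht_apply, hA _ h]; ring
    · rw [hB _ (by rwa [sub_zero])]; ring
    · rw [hθ _ h]; ring
    · rw [hχ _ h.le]; ring
  refine ⟨HasCompactSupport.intro (isCompact_cellSupport hS hδ hr hrange) hz, ?_⟩
  refine closure_minimal (fun p hp => ?_) isClosed_cellSupport
  by_contra h
  exact hp (hz p h)

/-- The nearest point of the lateral boundary. -/
theorem exists_lateral_near (hS : IsOpen N.sec) (hne : N.domᶜ.Nonempty)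
    (hrange : Icc (s₀ - 3 * r) (s₀ + 3 * r) ⊆ N.range) {x : E (m + 1)} (hx : x ∈ N.dom)
    (hxs : |N.ht x - s₀| ≤ 2 * r) (hd : Metric.infDist x N.domᶜ ≤ r) :
    ∃ z ∈ N.lateral, dist x z = Metric.infDist x N.domᶜ ∧
      ∀ τ ∈ Ioo (0 : ℝ) 1, x + τ • (z - x) ∈ N.dom := by
  have hcl : IsClosed N.domᶜ := (N.isOpen_dom hS).isClosed_compl
  obtain ⟨z, hz, hzx⟩ := hcl.exists_infDist_eq_dist hne x
  have hpos : 0 < dist x z := dist_pos.2 fun h => hz (h ▸ hx)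
  have hseg : ∀ τ ∈ Ioo (0 : ℝ) 1, x + τ • (z - x) ∈ N.dom := by
    intro τ hτ
    by_contra h
    have h1 := Metric.infDist_le_dist_of_mem (x := x) (show x + τ • (z - x) ∈ N.domᶜ from h)
    rw [hzx, dist_comm x (x + _), dist_eq_norm (x + _), add_sub_cancel_left, norm_smul,
      Real.norm_eq_abs, abs_of_pos hτ.1, ← dist_eq_norm, dist_comm z x] at h1
    nlinarith [hτ.2]
  have hzcl : z ∈ closure N.dom := by
    have h1 : (1 : ℝ) ∈ closure (Ioo (0 : ℝ) 1) := by rw [closure_Ioo zero_ne_one]; simp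
    have h2 := map_mem_closure (f := fun τ : ℝ => x + τ • (z - x)) (by fun_prop) h1 hseg
    simpa using h2
  -- The nearest point of the complement is at most `r` away, so its height is within `3 * r` of
  -- `s₀`: it lies on the lateral boundary and not on an end face.
  refine ⟨z, N.mem_lateral_of_closure hS hzcl hz (hrange ?_), hzx.symm, hseg⟩
  have h1 := N.abs_ht_le (z - x)
  rw [← dist_eq_norm, dist_comm, ← hzx, map_sub] at h1
  have h2 := abs_le.1 (h1.trans hd)
  have h3 := abs_le.1 hxs
  constructor <;> linarith [h2.1, h2.2, h3.1, h3.2]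

end Shear

end BalanceLaw

namespace BalanceLaw

variable {m : ℕ}

/-! ### The estimate on a cell -/

/-- The difference of two solutions of the balance law on the tube `P`: the difference `w` of the
states with gradient `Dw`, the difference `dH` of the densities and the difference `g` of the
sources satisfy the difference of the weak equations, and `w` vanishes to first order on the lateral
boundary. -/
structure IsDifference (P : Shear m) (Ω : Set (E (m + 1))) (T μ α B b W : ℝ)
    (w dH g : E (m + 1) × ℝ → ℂ) (Dw : E (m + 1) × ℝ → EuclideanSpace ℂ (Fin (m + 1))) : Prop where
  subset : P.dom ⊆ Ω
  pos : 0 < μ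
  nonneg : 0 ≤ B
  nonneg_b : 0 ≤ b
  nonneg_W : 0 ≤ W
  continuousOn_w : ContinuousOn w (Ω ×ˢ Ioo 0 T)
  continuousOn_Dw : ContinuousOn Dw (Ω ×ˢ Ioo 0 T)
  continuousOn_dH : ContinuousOn dH (Ω ×ˢ Ioo 0 T)
  continuousOn_g : ContinuousOn g (Ω ×ˢ Ioo 0 T)
  deriv : ∀ p ∈ Ω ×ˢ Ioo 0 T, ∀ v, ∃ L : E (m + 1) × ℝ →L[ℝ] ℂ,
    HasFDerivAt w L p ∧ L (v, 0) = dotC v (Dw p)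
  weak : ∀ φ : E (m + 1) × ℝ → ℝ, ContDiff ℝ ∞ φ → HasCompactSupport φ →
    tsupport φ ⊆ Ω ×ˢ Ioo 0 T → ∫ p, g p * (φ p : ℂ)
      = ∫ p, (-(dH p * (fderiv ℝ φ p (0, 1) : ℂ))
        + (μ : ℂ) * ∑ i, Dw p i * (fderiv ℝ φ p (EuclideanSpace.single i 1, 0) : ℂ))
  norm_w_le : ∀ p ∈ P.dom ×ˢ Ioo 0 T, ‖w p‖ ≤ W
  norm_dH_le : ∀ p ∈ P.dom ×ˢ Ioo 0 T, ‖dH p‖ ≤ b * W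
  norm_w_le_dist : ∀ p ∈ P.dom ×ˢ Ioo 0 T, ∀ z ∈ P.lateral,
    (∀ τ ∈ Ioo (0 : ℝ) 1, p.1 + τ • (z - p.1) ∈ P.dom) → ‖w p‖ ≤ B * dist p.1 z
  norm_Dw_le_dist : ∀ p ∈ P.dom ×ˢ Ioo 0 T, ∀ z ∈ P.lateral, ‖Dw p‖ ≤ B * dist p.1 z ^ α

section

variable {P : Shear m} {Ω : Set (E (m + 1))} {T μ α B b W : ℝ} {w dH g : E (m + 1) × ℝ → ℂ}
  {Dw : E (m + 1) × ℝ → EuclideanSpace ℂ (Fin (m + 1))}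

theorem sum_mul_inner_single (W : EuclideanSpace ℂ (Fin m)) (n : E m) :
    ∑ i, W i * ((inner ℝ n (EuclideanSpace.single i (1 : ℝ)) : ℝ) : ℂ) = dotC n W := by
  unfold dotC
  refine Finset.sum_congr rfl fun i _ => ?_
  rw [EuclideanSpace.inner_single_right]
  simp [mul_comm]

theorem norm_sum_mul_clm_le (W : EuclideanSpace ℂ (Fin m)) (L : E m →L[ℝ] ℝ) :
    ‖∑ i, W i * ((L (EuclideanSpace.single i 1) : ℝ) : ℂ)‖ ≤ m * (‖W‖ * ‖L‖) := by
  refine (norm_sum_le _ _).trans ?_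
  have h1 : ∀ i, ‖W i * ((L (EuclideanSpace.single i 1) : ℝ) : ℂ)‖ ≤ ‖W‖ * ‖L‖ := by
    intro i
    rw [norm_mul, Complex.norm_real]
    refine mul_le_mul (PiLp.norm_apply_le W i) ?_ (norm_nonneg _) (norm_nonneg _)
    have := L.le_opNorm (EuclideanSpace.single i (1 : ℝ))
    simpa using this
  refine (Finset.sum_le_sum fun i _ => h1 i).trans (le_of_eq ?_)
  simp

/-- The mean of `g` against the test function is bounded by two kinds of terms. Derivatives of the
bumps in time, height and long direction act on `w` and `dH` over the whole cell and cost W/r².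
Terms with a derivative of the spatial cut-off live in the layer `L` near the lateral boundary,
where `w` and `Dw` are small. -/
theorem IsDifference.cell_estimate_of_cutoff (h : IsDifference P Ω T μ α B b W w dH g Dw)
    (hα : 0 < α) (hS : IsLipschitzDomain P.sec) (hne : P.domᶜ.Nonempty) {c : ℝ} (hc : 0 < c)
    {s₀ r R t₀ δ : ℝ} (hr : 0 < r) (hrR : r ≤ R) (hδ : 0 < δ) (hδr : 4 * δ ≤ r)
    (θ : ScaledBump c t₀ (r ^ 2)) (A : ScaledBump c s₀ r) (D : ScaledBump c 0 R)
    (hrange : Icc (s₀ - 3 * r) (s₀ + 3 * r) ⊆ P.range)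
    (htime : Icc (t₀ - 2 * r ^ 2) (t₀ + 2 * r ^ 2) ⊆ Ioo 0 T) {e : E m} (he : ‖e‖ ≤ 1)
    {x₀ : E (m + 1)} {V₀ V₁ L : Set (E (m + 1))} (hV₀ : MeasurableSet V₀) (hV₁ : MeasurableSet V₁)
    (hL : MeasurableSet L) (hV₀' : volume V₀ < ⊤) (hV₁' : volume V₁ < ⊤) (hL' : volume L < ⊤)
    (hsub₀ : ∀ x ∈ V₀, x ∈ P.dom ∧ |P.ht x - s₀| ≤ r ∧ |inner ℝ (x - x₀) (P.emb e)| ≤ R)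
    (hsub₁ : ∀ x ∈ P.dom, |P.ht x - s₀| ≤ 2 * r → |inner ℝ (x - x₀) (P.emb e)| ≤ 2 * R → x ∈ V₁)
    (hsubL : ∀ x ∈ P.dom, |P.ht x - s₀| ≤ 2 * r → Metric.infDist x P.domᶜ ≤ 4 * δ → x ∈ L)
    {c₀ : ℂ} {o : ℝ} (ho : o ≤ ‖c₀‖)
    (hosc : ∀ x ∈ V₁, ∀ t ∈ Icc (t₀ - 2 * r ^ 2) (t₀ + 2 * r ^ 2), ‖g (x, t) - c₀‖ ≤ o) :
    (‖c₀‖ - o) * ((volume.real V₀ - volume.real L) * (2 * r ^ 2))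
      ≤ (b + 2 * μ) * c * (W / r ^ 2) * (volume.real V₁ * (4 * r ^ 2))
        + (μ * ((m + 1) * (B * (4 * δ) ^ α / δ) + 4 * B * (2 * c / r)))
          * (volume.real L * (4 * r ^ 2)) := by
  obtain ⟨χ, hχs, hχ0, hχ1, hχz, hχone, hχd⟩ := exists_smooth_cutoff P.dom hδ
  set n := P.nrm with hn
  set l := P.emb e with hl
  have hnn : inner ℝ n n = (1 : ℝ) := by rw [real_inner_self_eq_norm_sq, P.norm_nrm]; norm_num
  have hnl : inner ℝ n l = 0 := P.orth e
  have hln : inner ℝ l n = 0 := by rw [real_inner_comm]; exact hnl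
  have hll : |inner ℝ l l| ≤ (1 : ℝ) := by
    rw [real_inner_self_eq_norm_sq, hl, LinearIsometry.norm_map, abs_of_nonneg (by positivity)]
    exact pow_le_one₀ (norm_nonneg _) he
  have hR : 0 < R := hr.trans_le hrR
  set φ := testFn n l x₀ θ.val A.val D.val χ with hφ
  -- Those parts of the gradient of the test function that come from the bumps point along `n` and
  -- `l`. Against them the equation is integrated by parts once more; the part from the cut-off χ
  -- stays paired with `Dw`.
  set G₁ := testFn n l x₀ θ.val A.d1 D.val χ with hG₁
  set G₂ := testFn n l x₀ θ.val A.val D.d1 χ with hG₂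
  have sφ : ContDiff ℝ ∞ φ := contDiff_testFn θ.smooth A.smooth D.smooth hχs
  have sG₁ : ContDiff ℝ ∞ G₁ := contDiff_testFn θ.smooth A.smooth_d1 D.smooth hχs
  have sG₂ : ContDiff ℝ ∞ G₂ := contDiff_testFn θ.smooth A.smooth D.smooth_d1 hχs
  have dφ := fderiv_testFn (n := n) (l := l) (x₀ := x₀) θ.hasDerivAt_val A.hasDerivAt_val
    D.hasDerivAt_val hχs
  have dG₁ := fderiv_testFn (n := n) (l := l) (x₀ := x₀) θ.hasDerivAt_val A.hasDerivAt_d1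
    D.hasDerivAt_val hχs
  have dG₂ := fderiv_testFn (n := n) (l := l) (x₀ := x₀) θ.hasDerivAt_val A.hasDerivAt_val
    D.hasDerivAt_d1 hχs
  obtain ⟨cφ, tφ⟩ := Shear.testFn_support (x₀ := x₀) (e := e) hS.isBounded hδ hr hrange θ.eq_zero
    A.eq_zero D.eq_zero hχz
  obtain ⟨cG₁, tG₁⟩ := Shear.testFn_support (x₀ := x₀) (e := e) hS.isBounded hδ hr hrange θ.eq_zero
    A.d1_eq_zero D.eq_zero hχz
  obtain ⟨cG₂, tG₂⟩ := Shear.testFn_support (x₀ := x₀) (e := e) hS.isBounded hδ hr hrange θ.eq_zero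
    A.eq_zero D.d1_eq_zero hχz
  set Q := Ω ×ˢ Ioo 0 T with hQ
  have hIcc : ∀ t, |t - t₀| ≤ 2 * r ^ 2 → t ∈ Icc (t₀ - 2 * r ^ 2) (t₀ + 2 * r ^ 2) := by
    intro t ht
    rw [abs_le] at ht
    constructor <;> linarith [ht.1, ht.2]
  have hCd : ∀ p ∈ P.cellSupport e x₀ s₀ r R δ t₀ (r ^ 2), p ∈ P.dom ×ˢ Ioo 0 T := fun p hp =>
    ⟨Shear.mem_dom_of_infDist_pos (hδ.trans_le hp.2.2.2), htime (hIcc _ hp.2.2.1)⟩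
  have hCQ : P.cellSupport e x₀ s₀ r R δ t₀ (r ^ 2) ⊆ Q := fun p hp =>
    ⟨h.subset (hCd p hp).1, (hCd p hp).2⟩
  have of1 : ∀ {ψ : E (m + 1) × ℝ → ℝ}, ContDiff ℝ ∞ ψ → ContDiff ℝ 1 ψ := fun hψ =>
    hψ.of_le (by norm_cast)
  -- integration by parts
  set J : E (m + 1) × ℝ → ℂ := fun p =>
    -(dH p * (fderiv ℝ φ p (0, 1) : ℂ))
      + (μ : ℂ) * ((∑ i, Dw p i * (fderiv ℝ φ p (EuclideanSpace.single i 1, 0) : ℂ)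
          - dotC n (Dw p) * (G₁ p : ℂ) - dotC l (Dw p) * (G₂ p : ℂ))
        - w p * (fderiv ℝ G₁ p (n, 0) : ℂ) - w p * (fderiv ℝ G₂ p (l, 0) : ℂ)) with hJdef
  have hdot : ∀ v : E (m + 1), ContinuousOn (fun p => dotC v (Dw p)) Q := by
    intro v
    unfold dotC
    exact continuousOn_finsetSum _ fun i _ => continuousOn_const.mul
      ((EuclideanSpace.proj (𝕜 := ℂ) i).continuous.comp_continuousOn h.continuousOn_Dw)
  have i0 : Integrable fun p => -(dH p * (fderiv ℝ φ p (0, 1) : ℂ)) :=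
    (integrable_mul_fderiv_of_tsupport_subset h.continuousOn_dH (of1 sφ) cφ (tφ.trans hCQ) _).neg
  have i1 : Integrable fun p => ∑ i, Dw p i
      * (fderiv ℝ φ p (EuclideanSpace.single i 1, 0) : ℂ) :=
    integrable_finsetSum _ fun i _ => integrable_mul_fderiv_of_tsupport_subset
      ((EuclideanSpace.proj (𝕜 := ℂ) i).continuous.comp_continuousOn h.continuousOn_Dw)
      (of1 sφ) cφ (tφ.trans hCQ) _
  have i2 : Integrable fun p => dotC n (Dw p) * (G₁ p : ℂ) :=
    integrable_mul_of_tsupport_subset (hdot n) sG₁.continuous cG₁ (tG₁.trans hCQ)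
  have i3 : Integrable fun p => dotC l (Dw p) * (G₂ p : ℂ) :=
    integrable_mul_of_tsupport_subset (hdot l) sG₂.continuous cG₂ (tG₂.trans hCQ)
  have i4 : Integrable fun p => w p * (fderiv ℝ G₁ p (n, 0) : ℂ) :=
    integrable_mul_fderiv_of_tsupport_subset h.continuousOn_w (of1 sG₁) cG₁ (tG₁.trans hCQ) _
  have i5 : Integrable fun p => w p * (fderiv ℝ G₂ p (l, 0) : ℂ) :=
    integrable_mul_fderiv_of_tsupport_subset h.continuousOn_w (of1 sG₂) cG₂ (tG₂.trans hCQ) _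
  have hibp1 := integral_dotC_mul_eq_neg (v := n) h.continuousOn_w h.continuousOn_Dw
    (fun p hp => h.deriv p hp n) (of1 sG₁) cG₁ (tG₁.trans hCQ)
  have hibp2 := integral_dotC_mul_eq_neg (v := l) h.continuousOn_w h.continuousOn_Dw
    (fun p hp => h.deriv p hp l) (of1 sG₂) cG₂ (tG₂.trans hCQ)
  have heq : ∫ p, g p * (φ p : ℂ) = ∫ p, J p := by
    rw [h.weak φ sφ cφ (tφ.trans hCQ), integral_add i0 (i1.const_mul _), integral_const_mul]
    have i6 : Integrable fun p => ∑ i, Dw p i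
        * (fderiv ℝ φ p (EuclideanSpace.single i 1, 0) : ℂ)
          - dotC n (Dw p) * (G₁ p : ℂ) - dotC l (Dw p) * (G₂ p : ℂ) := (i1.sub i2).sub i3
    have i7 : Integrable fun p => (∑ i, Dw p i
        * (fderiv ℝ φ p (EuclideanSpace.single i 1, 0) : ℂ)
          - dotC n (Dw p) * (G₁ p : ℂ) - dotC l (Dw p) * (G₂ p : ℂ))
        - w p * (fderiv ℝ G₁ p (n, 0) : ℂ) := i6.sub i4
    have i8 : Integrable fun p => (∑ i, Dw p i
        * (fderiv ℝ φ p (EuclideanSpace.single i 1, 0) : ℂ)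
          - dotC n (Dw p) * (G₁ p : ℂ) - dotC l (Dw p) * (G₂ p : ℂ))
        - w p * (fderiv ℝ G₁ p (n, 0) : ℂ) - w p * (fderiv ℝ G₂ p (l, 0) : ℂ) := i7.sub i5
    have i9 : Integrable fun p => ∑ i, Dw p i
        * (fderiv ℝ φ p (EuclideanSpace.single i 1, 0) : ℂ)
          - dotC n (Dw p) * (G₁ p : ℂ) := i1.sub i2
    have e1 : ∫ p, J p = (∫ p, -(dH p * (fderiv ℝ φ p (0, 1) : ℂ)))
        + (μ : ℂ) * ((((∫ p, ∑ i, Dw p i * (fderiv ℝ φ p (EuclideanSpace.single i 1, 0) : ℂ))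
            - ∫ p, dotC n (Dw p) * (G₁ p : ℂ)) - ∫ p, dotC l (Dw p) * (G₂ p : ℂ))
          - (∫ p, w p * (fderiv ℝ G₁ p (n, 0) : ℂ))
          - ∫ p, w p * (fderiv ℝ G₂ p (l, 0) : ℂ)) := by
      simp only [hJdef]
      rw [integral_add i0 (i8.const_mul _), integral_const_mul, integral_sub i7 i5,
        integral_sub i6 i4, integral_sub i9 i3, integral_sub i1 i2]
    rw [e1, hibp1, hibp2]
    ring
  -- the pointwise bound
  have hD0 : (0 : ℝ) ≤ (m + 1) * (B * (4 * δ) ^ α / δ) + 4 * B * (2 * c / r) := by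
    have := h.nonneg
    positivity
  have hA0 : 0 ≤ (b + 2 * μ) * c * (W / r ^ 2) := by
    have := h.nonneg_b
    have := h.pos
    have := h.nonneg_W
    positivity
  have hJ : ∀ p, ‖J p‖ ≤ (V₁ ×ˢ Icc (t₀ - 2 * r ^ 2) (t₀ + 2 * r ^ 2)).indicator
        (fun _ => (b + 2 * μ) * c * (W / r ^ 2)) p
      + (L ×ˢ Icc (t₀ - 2 * r ^ 2) (t₀ + 2 * r ^ 2)).indicator
        (fun _ => μ * ((m + 1) * (B * (4 * δ) ^ α / δ) + 4 * B * (2 * c / r))) p := by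
    intro p
    by_cases hp : p ∈ P.cellSupport e x₀ s₀ r R δ t₀ (r ^ 2)
    swap
    · have z1 : p ∉ tsupport φ := fun hh => hp (tφ hh)
      have z2 : p ∉ tsupport G₁ := fun hh => hp (tG₁ hh)
      have z3 : p ∉ tsupport G₂ := fun hh => hp (tG₂ hh)
      have : J p = 0 := by
        simp only [hJdef, fderiv_apply_eq_zero_of_notMem z1, fderiv_apply_eq_zero_of_notMem z2,
          fderiv_apply_eq_zero_of_notMem z3, image_eq_zero_of_notMem_tsupport z2,
          image_eq_zero_of_notMem_tsupport z3, Complex.ofReal_zero, mul_zero,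
          Finset.sum_const_zero, neg_zero, sub_zero, add_zero]
      rw [this, norm_zero]
      refine add_nonneg (indicator_nonneg (fun _ _ => hA0) _) (indicator_nonneg (fun _ _ => ?_) _)
      exact mul_nonneg h.pos.le hD0
    have hpd := hCd p hp
    obtain ⟨hp1, hp2, hp3, hp4⟩ := hp
    have htI := hIcc _ hp3
    rw [indicator_of_mem (show p ∈ V₁ ×ˢ _ from ⟨hsub₁ _ hpd.1 hp1 hp2, htI⟩)]
    set x := p.1 with hx
    set a := A.val (inner ℝ n x)
    set a1 := A.d1 (inner ℝ n x) with ha1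
    set a2 := A.d2 (inner ℝ n x) with ha2
    set d := D.val (inner ℝ (x - x₀) l)
    set d1 := D.d1 (inner ℝ (x - x₀) l) with hd1
    set d2 := D.d2 (inner ℝ (x - x₀) l) with hd2
    set θ0 := θ.val p.2
    set θ1 := θ.d1 p.2 with hθ1
    set X := χ x
    set X' := fderiv ℝ χ x with hX'
    -- The first-order terms along `n` and `l` cancel. As `n` and `l` are orthogonal, no mixed
    -- derivatives of the bumps appear.
    have eJ : J p = -(dH p * ((θ1 * a * d * X : ℝ) : ℂ))
        + (μ : ℂ) * (((θ0 * a * d : ℝ) : ℂ)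
            * ∑ i, Dw p i * ((X' (EuclideanSpace.single i 1) : ℝ) : ℂ)
          - w p * ((θ0 * a2 * d * X + θ0 * a1 * d * X' n : ℝ) : ℂ)
          - w p * ((θ0 * a * (d2 * inner ℝ l l) * X + θ0 * a * d1 * X' l : ℝ) : ℂ)) := by
      have f1 : fderiv ℝ φ p (0, 1) = θ1 * a * d * X := by
        rw [hφ, dφ]; simp only [inner_zero_left, inner_zero_right, map_zero]; ring
      have f2 : fderiv ℝ G₁ p (n, 0) = θ0 * a2 * d * X + θ0 * a1 * d * X' n := by
        rw [hG₁, dG₁]; simp only [hnn, hnl]; ring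
      have f3 : fderiv ℝ G₂ p (l, 0)
          = θ0 * a * (d2 * inner ℝ l l) * X + θ0 * a * d1 * X' l := by
        rw [hG₂, dG₂]; simp only [hnl]; ring
      have f4 : ∀ i, (fderiv ℝ φ p (EuclideanSpace.single i 1, 0) : ℂ)
          = ((θ0 * a1 * d * X : ℝ) : ℂ) * ((inner ℝ n (EuclideanSpace.single i (1 : ℝ)) : ℝ) : ℂ)
            + ((θ0 * a * d1 * X : ℝ) : ℂ) * ((inner ℝ l (EuclideanSpace.single i (1 : ℝ)) : ℝ) : ℂ)
            + ((θ0 * a * d : ℝ) : ℂ) * ((X' (EuclideanSpace.single i 1) : ℝ) : ℂ) := by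
        intro i
        rw [hφ, dφ]
        dsimp only
        rw [real_inner_comm l (EuclideanSpace.single i 1)]
        push_cast
        ring
      have f5 : ∑ i, Dw p i * (fderiv ℝ φ p (EuclideanSpace.single i 1, 0) : ℂ)
          = dotC n (Dw p) * (G₁ p : ℂ) + dotC l (Dw p) * (G₂ p : ℂ)
            + ((θ0 * a * d : ℝ) : ℂ)
              * ∑ i, Dw p i * ((X' (EuclideanSpace.single i 1) : ℝ) : ℂ) := by
        have g1 : G₁ p = θ0 * a1 * d * X := rfl
        have g2 : G₂ p = θ0 * a * d1 * X := rfl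
        rw [g1, g2, ← sum_mul_inner_single, ← sum_mul_inner_single, Finset.sum_mul, Finset.sum_mul,
          Finset.mul_sum, ← Finset.sum_add_distrib, ← Finset.sum_add_distrib]
        refine Finset.sum_congr rfl fun i _ => ?_
        rw [f4]; ring
      simp only [hJdef]
      rw [f1, f2, f3, f5]
      ring
    have ba : |a| ≤ 1 := by rw [abs_of_nonneg (A.nonneg _)]; exact A.le_one _
    have bd : |d| ≤ 1 := by rw [abs_of_nonneg (D.nonneg _)]; exact D.le_one _
    have bθ : |θ0| ≤ 1 := by rw [abs_of_nonneg (θ.nonneg _)]; exact θ.le_one _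
    have bX : |X| ≤ 1 := by rw [abs_of_nonneg (hχ0 _)]; exact hχ1 _
    have ba1 : |a1| ≤ c / r := A.abs_d1_le _
    have ba2 : |a2| ≤ c / r ^ 2 := A.abs_d2_le _
    have bd1 : |d1| ≤ c / r := (D.abs_d1_le _).trans (by gcongr)
    have bd2 : |d2| ≤ c / r ^ 2 := (D.abs_d2_le _).trans (by gcongr)
    have bθ1 : |θ1| ≤ c / r ^ 2 := θ.abs_d1_le _
    have bXn : |X' n| ≤ ‖X'‖ := by
      have := X'.le_opNorm n
      rwa [hn, P.norm_nrm, mul_one] at this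
    have bXl : |X' l| ≤ ‖X'‖ := by
      have h1 := X'.le_opNorm l
      have h2 : ‖l‖ ≤ 1 := by rw [hl, LinearIsometry.norm_map]; exact he
      exact h1.trans (mul_le_of_le_one_right (norm_nonneg _) h2)
    have prod3 : ∀ {α₁ α₂ α₃ : ℝ}, |α₁| ≤ 1 → |α₂| ≤ 1 → |α₃| ≤ 1 → |α₁ * α₂ * α₃| ≤ 1 := by
      intro α₁ α₂ α₃ h1 h2 h3
      rw [abs_mul, abs_mul]
      exact mul_le_one₀ (mul_le_one₀ h1 (abs_nonneg _) h2) (abs_nonneg _) h3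
    have mulb : ∀ {α₁ β₁ γ : ℝ}, |α₁| ≤ 1 → |β₁| ≤ γ → |α₁ * β₁| ≤ γ := by
      intro α₁ β₁ γ h1 h2
      rw [abs_mul]
      exact (mul_le_of_le_one_left (abs_nonneg _) h1).trans h2
    have hw := h.norm_w_le p hpd
    have hdH := h.norm_dH_le p hpd
    set S := ∑ i, Dw p i * ((X' (EuclideanSpace.single i 1) : ℝ) : ℂ) with hS'
    have hSn : ‖S‖ ≤ (m + 1) * (‖Dw p‖ * ‖X'‖) := by
      have := norm_sum_mul_clm_le (Dw p) X'
      push_cast at this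
      exact this
    have q1 : |θ1 * a * d * X| ≤ c / r ^ 2 := by
      have : θ1 * a * d * X = (a * d * X) * θ1 := by ring
      rw [this]; exact mulb (prod3 ba bd bX) bθ1
    have q2 : |θ0 * a2 * d * X + θ0 * a1 * d * X' n| ≤ c / r ^ 2 + c / r * ‖X'‖ := by
      refine (abs_add_le _ _).trans (add_le_add ?_ ?_)
      · have : θ0 * a2 * d * X = (θ0 * d * X) * a2 := by ring
        rw [this]; exact mulb (prod3 bθ bd bX) ba2
      · have : θ0 * a1 * d * X' n = (θ0 * d * 1) * (a1 * X' n) := by ring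
        rw [this]
        refine mulb (prod3 bθ bd (by simp)) ?_
        rw [abs_mul]
        exact mul_le_mul ba1 bXn (abs_nonneg _) (by positivity)
    have q3 : |θ0 * a * (d2 * inner ℝ l l) * X + θ0 * a * d1 * X' l|
        ≤ c / r ^ 2 + c / r * ‖X'‖ := by
      refine (abs_add_le _ _).trans (add_le_add ?_ ?_)
      · have : θ0 * a * (d2 * inner ℝ l l) * X = (θ0 * a * X) * (inner ℝ l l * d2) := by ring
        rw [this]; exact mulb (prod3 bθ ba bX) (mulb hll bd2)
      · have : θ0 * a * d1 * X' l = (θ0 * a * 1) * (d1 * X' l) := by ring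
        rw [this]
        refine mulb (prod3 bθ ba (by simp)) ?_
        rw [abs_mul]
        exact mul_le_mul bd1 bXl (abs_nonneg _) (by positivity)
    have q4 : |θ0 * a * d| ≤ 1 := prod3 bθ ba bd
    have hnJ : ‖J p‖ ≤ ‖dH p‖ * (c / r ^ 2) + μ * ((m + 1) * (‖Dw p‖ * ‖X'‖)
        + ‖w p‖ * (c / r ^ 2 + c / r * ‖X'‖) + ‖w p‖ * (c / r ^ 2 + c / r * ‖X'‖)) := by
      rw [eJ]
      refine (norm_add_le _ _).trans (add_le_add ?_ ?_)
      · rw [norm_neg, norm_mul, Complex.norm_real, Real.norm_eq_abs]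
        exact mul_le_mul_of_nonneg_left q1 (norm_nonneg _)
      · rw [norm_mul, Complex.norm_real, Real.norm_eq_abs, abs_of_pos h.pos]
        refine mul_le_mul_of_nonneg_left ?_ h.pos.le
        refine (norm_sub_le _ _).trans (add_le_add ((norm_sub_le _ _).trans (add_le_add ?_ ?_)) ?_)
        · rw [norm_mul, Complex.norm_real, Real.norm_eq_abs]
          exact (mul_le_of_le_one_left (norm_nonneg _) q4).trans hSn
        · rw [norm_mul, Complex.norm_real, Real.norm_eq_abs]
          exact mul_le_mul_of_nonneg_left q2 (norm_nonneg _)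
        · rw [norm_mul, Complex.norm_real, Real.norm_eq_abs]
          exact mul_le_mul_of_nonneg_left q3 (norm_nonneg _)
    have hmain : ‖dH p‖ * (c / r ^ 2) + μ * (2 * ‖w p‖ * (c / r ^ 2))
        ≤ (b + 2 * μ) * c * (W / r ^ 2) := by
      have h1 : ‖dH p‖ * (c / r ^ 2) ≤ b * W * (c / r ^ 2) := by gcongr
      have h2 : μ * (2 * ‖w p‖ * (c / r ^ 2)) ≤ μ * (2 * W * (c / r ^ 2)) := by
        have := h.pos
        gcongr
      have h3 : (b + 2 * μ) * c * (W / r ^ 2)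
          = b * W * (c / r ^ 2) + μ * (2 * W * (c / r ^ 2)) := by ring
      linarith
    -- Within 4δ of the boundary `w` is O(δ) and `Dw` is O(δ^α), against the bound 1/δ for the
    -- derivative of the cut-off; farther inside, that derivative vanishes.
    rcases le_or_gt (Metric.infDist x P.domᶜ) (4 * δ) with hd4 | hd4
    · rw [indicator_of_mem (show p ∈ L ×ˢ _ from ⟨hsubL _ hpd.1 hp1 hd4, htI⟩)]
      obtain ⟨z, hz, hxz, hseg⟩ := Shear.exists_lateral_near hS.isOpen hne hrange hpd.1 hp1
        (hd4.trans hδr)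
      have w1 := h.norm_w_le_dist p hpd z hz hseg
      have w2 := h.norm_Dw_le_dist p hpd z hz
      rw [hxz] at w1 w2
      have w3 : ‖w p‖ ≤ B * (4 * δ) := w1.trans (mul_le_mul_of_nonneg_left hd4 h.nonneg)
      have w4 : ‖Dw p‖ ≤ B * (4 * δ) ^ α := w2.trans (mul_le_mul_of_nonneg_left
        (Real.rpow_le_rpow Metric.infDist_nonneg hd4 hα.le) h.nonneg)
      have w5 : ‖X'‖ ≤ 1 / δ := hχd x
      have hB := h.nonneg
      have k1 : ‖Dw p‖ * ‖X'‖ ≤ B * (4 * δ) ^ α / δ := by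
        calc ‖Dw p‖ * ‖X'‖ ≤ B * (4 * δ) ^ α * (1 / δ) := by gcongr
          _ = _ := by ring
      have k2 : ‖w p‖ * (c / r * ‖X'‖) ≤ 4 * B * (c / r) := by
        calc ‖w p‖ * (c / r * ‖X'‖) ≤ B * (4 * δ) * (c / r * (1 / δ)) := by gcongr
          _ = _ := by field_simp
      have k3 : μ * ((m + 1) * (‖Dw p‖ * ‖X'‖) + 2 * (‖w p‖ * (c / r * ‖X'‖)))
          ≤ μ * ((m + 1) * (B * (4 * δ) ^ α / δ) + 4 * B * (2 * c / r)) := by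
        refine mul_le_mul_of_nonneg_left (add_le_add ?_ ?_) h.pos.le
        · exact mul_le_mul_of_nonneg_left k1 (by positivity)
        · calc 2 * (‖w p‖ * (c / r * ‖X'‖)) ≤ 2 * (4 * B * (c / r)) := by linarith
            _ = _ := by ring
      calc ‖J p‖ ≤ _ := hnJ
        _ = (‖dH p‖ * (c / r ^ 2) + μ * (2 * ‖w p‖ * (c / r ^ 2)))
            + μ * ((m + 1) * (‖Dw p‖ * ‖X'‖) + 2 * (‖w p‖ * (c / r * ‖X'‖))) := by ring
        _ ≤ _ := add_le_add hmain k3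
    · have hX0 : X' = 0 := by
        have h1 : χ =ᶠ[𝓝 x] fun _ => (1 : ℝ) := by
          have : IsOpen {y | 4 * δ < Metric.infDist y P.domᶜ} :=
            isOpen_lt continuous_const (Metric.continuous_infDist_pt _)
          filter_upwards [this.mem_nhds hd4] with y hy using hχone y (le_of_lt hy)
        rw [hX', h1.fderiv_eq]; simp
      rw [hX0, norm_zero] at hnJ
      have h0 : 0 ≤ (L ×ˢ Icc (t₀ - 2 * r ^ 2) (t₀ + 2 * r ^ 2)).indicator
        (fun _ => μ * ((m + 1) * (B * (4 * δ) ^ α / δ) + 4 * B * (2 * c / r))) p :=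
        indicator_nonneg (fun _ _ => mul_nonneg h.pos.le hD0) _
      have h2 : ‖J p‖ ≤ ‖dH p‖ * (c / r ^ 2) + μ * (2 * ‖w p‖ * (c / r ^ 2)) :=
        hnJ.trans (le_of_eq (by ring))
      linarith
  have hφi : Integrable φ := sφ.continuous.integrable_of_hasCompactSupport cφ
  have hgi : Integrable fun p => g p * (φ p : ℂ) :=
    integrable_mul_of_tsupport_subset h.continuousOn_g sφ.continuous cφ (tφ.trans hCQ)
  have hmain := norm_sub_mul_le_of_integral_eq (I₀ := Icc (t₀ - r ^ 2) (t₀ + r ^ 2))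
    (I₁ := Icc (t₀ - 2 * r ^ 2) (t₀ + 2 * r ^ 2)) hV₀ hV₁ hL measurableSet_Icc measurableSet_Icc
    hV₀' hV₁' hL' measure_Icc_lt_top measure_Icc_lt_top hφi hgi
    (fun p => mul_nonneg (mul_nonneg (mul_nonneg (θ.nonneg _) (A.nonneg _)) (D.nonneg _)) (hχ0 _))
    (by
      rintro ⟨x, t⟩ ⟨⟨hx0, hxL⟩, ht⟩
      obtain ⟨h1, h2, h3⟩ := hsub₀ x hx0
      have h4 : 4 * δ ≤ Metric.infDist x P.domᶜ := by
        by_contra hcon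
        exact hxL (hsubL x h1 (by linarith) (le_of_lt (not_le.1 hcon)))
      have e1 : θ.val t = 1 := θ.eq_one t (by
        rw [abs_le]; constructor <;> linarith [ht.1, ht.2])
      have e2 : A.val (inner ℝ n x) = 1 := A.eq_one _ h2
      have e3 : D.val (inner ℝ (x - x₀) l) = 1 := D.eq_one _ (by rwa [sub_zero])
      change θ.val t * A.val (inner ℝ n x) * D.val (inner ℝ (x - x₀) l) * χ x = 1
      rw [e1, e2, e3, hχone x h4]; norm_num)
    (c₀ := c₀) (o := o)
    (fun p hp => by
      have hp' := tφ (subset_tsupport _ hp)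
      have hpd := hCd p hp'
      exact hosc p.1 (hsub₁ _ hpd.1 hp'.1 hp'.2.1) p.2 (hIcc _ hp'.2.2.1)) ho hJ heq
  have v0 : volume.real (Icc (t₀ - r ^ 2) (t₀ + r ^ 2)) = 2 * r ^ 2 := by
    rw [Real.volume_real_Icc_of_le (by nlinarith)]; ring
  have v1 : volume.real (Icc (t₀ - 2 * r ^ 2) (t₀ + 2 * r ^ 2)) = 4 * r ^ 2 := by
    rw [Real.volume_real_Icc_of_le (by nlinarith)]; ring
  rwa [v0, v1] at hmain

end

end BalanceLaw

/-! ### Doubling of cells and removal of the cut-off layer. -/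

namespace BalanceLaw

variable {m : ℕ}

/-- The part of the cross-section at distance at most `ρ` from `y₀` in the direction `e`. -/
def stripe (S : Set (E m)) (e y₀ : E m) (ρ : ℝ) : Set (E m) := {z ∈ S | |inner ℝ (z - y₀) e| ≤ ρ}

theorem measurableSet_stripe {S : Set (E m)} (hS : IsOpen S) (e y₀ : E m) (ρ : ℝ) :
    MeasurableSet (stripe S e y₀ ρ) :=
  hS.measurableSet.inter (isClosed_le (by fun_prop) continuous_const :
    IsClosed {z : E m | |inner ℝ (z - y₀) e| ≤ ρ}).measurableSet

theorem volume_stripe_lt_top {S : Set (E m)} (hS : Bornology.IsBounded S) (e y₀ : E m) (ρ : ℝ) :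
    volume (stripe S e y₀ ρ) < ⊤ :=
  (hS.subset fun _ hz => hz.1).measure_lt_top

theorem volume_stripe_pos {S : Set (E m)} (hS : IsOpen S) {e y₀ : E m} (hy : y₀ ∈ S) {ρ : ℝ}
    (hρ : 0 < ρ) : 0 < volume (stripe S e y₀ ρ) := by
  have h1 : IsOpen (S ∩ {z : E m | |inner ℝ (z - y₀) e| < ρ}) :=
    hS.inter (isOpen_lt (by fun_prop) continuous_const)
  have h2 : (S ∩ {z : E m | |inner ℝ (z - y₀) e| < ρ}).Nonempty := ⟨y₀, hy, by simpa using hρ⟩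
  refine (h1.measure_pos volume h2).trans_le (measure_mono fun z hz => ?_)
  exact ⟨hz.1, le_of_lt hz.2⟩

/-- Convex sets are doubling. -/
theorem volume_stripe_mul_le {S : Set (E m)} (hS : Convex ℝ S) (hb : Bornology.IsBounded S)
    {e y₀ : E m} (hy : y₀ ∈ S) (ρ : ℝ) {a : ℝ} (ha : 1 ≤ a) :
    volume.real (stripe S e y₀ (a * ρ)) ≤ a ^ m * volume.real (stripe S e y₀ ρ) := by
  have ha0 : 0 < a := one_pos.trans_le ha
  have hsub : AffineMap.homothety y₀ a⁻¹ '' stripe S e y₀ (a * ρ) ⊆ stripe S e y₀ ρ := by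
    rintro _ ⟨z, hz, rfl⟩
    have h1 : AffineMap.homothety y₀ a⁻¹ z = y₀ + a⁻¹ • (z - y₀) := by
      rw [AffineMap.homothety_apply, vsub_eq_sub, vadd_eq_add, add_comm]
    rw [h1]
    refine ⟨hS.add_smul_sub_mem hy hz.1 ⟨by positivity, inv_le_one_of_one_le₀ ha⟩, ?_⟩
    rw [add_sub_cancel_left, real_inner_smul_left, abs_mul, abs_of_pos (inv_pos.2 ha0),
      inv_mul_le_iff₀ ha0]
    exact hz.2
  have h2 := measure_mono (μ := volume) hsub
  rw [Measure.addHaar_image_homothety, finrank_euclideanSpace, Fintype.card_fin] at h2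
  have h3 := ENNReal.toReal_mono (volume_stripe_lt_top hb e y₀ ρ).ne h2
  rw [ENNReal.toReal_mul, ENNReal.toReal_ofReal (abs_nonneg _), abs_of_pos (by positivity),
    inv_pow, inv_mul_le_iff₀ (by positivity)] at h3
  exact h3

section

variable {P : Shear m} {Ω : Set (E (m + 1))} {T μ α B b W : ℝ} {w dH g : E (m + 1) × ℝ → ℂ}
  {Dw : E (m + 1) × ℝ → EuclideanSpace ℂ (Fin (m + 1))}

/-- The test functions use the coordinate of the point along `e`, the stripes that of its section
coordinate. They differ by the drift of the profile, which is why `P.lip` enters the widths of the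
cells. -/
theorem Shear.inner_sub_pt_emb (P : Shear m) (x : E (m + 1)) (s₀ : ℝ) (y₀ e : E m) :
    inner ℝ (x - P.pt s₀ y₀) (P.emb e)
      = inner ℝ (P.sc x - y₀) e + inner ℝ (P.prof (P.ht x) - P.prof s₀) e := by
  rw [← P.inner_proj, ← inner_add_left]
  congr 1
  simp only [map_sub, Shear.pt, map_add, map_smul, P.proj_nrm, P.proj_emb, Shear.sc, smul_zero]
  abel

/-- The source is controlled by the state on a cell of size `r`. -/
theorem IsDifference.norm_le_of_cell (h : IsDifference P Ω T μ α B b W w dH g Dw)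
    (hα : 0 < α) (hS : IsLipschitzDomain P.sec) (hne : P.domᶜ.Nonempty) {c : ℝ} (hc : 0 < c)
    (hbump : ∀ s₀ r : ℝ, 0 < r → Nonempty (ScaledBump c s₀ r))
    {s₀ r t₀ : ℝ} (hr : 0 < r) (hrange : Icc (s₀ - 3 * r) (s₀ + 3 * r) ⊆ P.range)
    (htime : Icc (t₀ - 2 * r ^ 2) (t₀ + 2 * r ^ 2) ⊆ Ioo 0 T) {e y₀ : E m} (he : ‖e‖ ≤ 1)
    (hy₀ : y₀ ∈ P.sec) {D : ℝ}
    (hD : volume.real (stripe P.sec e y₀ ((2 + 4 * P.lip) * r))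
      ≤ D * volume.real (stripe P.sec e y₀ r))
    {c₀ : ℂ} {o : ℝ} (ho : o ≤ ‖c₀‖)
    (hosc : ∀ s ∈ Icc (s₀ - 2 * r) (s₀ + 2 * r), ∀ y ∈ stripe P.sec e y₀ ((2 + 4 * P.lip) * r),
      ∀ t ∈ Icc (t₀ - 2 * r ^ 2) (t₀ + 2 * r ^ 2), ‖g (P.pt s y, t) - c₀‖ ≤ o) :
    ‖c₀‖ ≤ o + 4 * D * ((b + 2 * μ) * c * (W / r ^ 2)) := by
  obtain ⟨κ, hκ, hcell⟩ := P.exists_volume_cell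
  obtain ⟨θ⟩ := hbump t₀ (r ^ 2) (by positivity)
  obtain ⟨A⟩ := hbump s₀ r hr
  -- The bump must equal 1 on the inner cell, where the drift of the profile adds up to `P.lip * r`.
  -- Its support has width `2 * (1 + P.lip) * r`, and a drift of `2 * P.lip * r` yields the outer
  -- stripe of width `(2 + 4 * P.lip) * r`.
  have hR : 0 < (1 + P.lip) * r := by positivity
  obtain ⟨F⟩ := hbump 0 ((1 + P.lip) * r) hR
  have hlip := P.lip.coe_nonneg
  have hrR : r ≤ (1 + P.lip) * r := by nlinarith
  have hJ2 : Icc (s₀ - 2 * r) (s₀ + 2 * r) ⊆ P.range := fun s hs =>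
    hrange ⟨by linarith [hs.1], by linarith [hs.2]⟩
  have hJ1 : Icc (s₀ - r) (s₀ + r) ⊆ P.range := fun s hs =>
    hrange ⟨by linarith [hs.1], by linarith [hs.2]⟩
  have hs₀ : s₀ ∈ P.range := hrange ⟨by linarith, by linarith⟩
  set S₀ := stripe P.sec e y₀ r with hS₀
  set S₁ := stripe P.sec e y₀ ((2 + 4 * P.lip) * r) with hS₁
  set V₀ := P.cell (Icc (s₀ - r) (s₀ + r)) S₀ with hV₀
  set V₁ := P.cell (Icc (s₀ - 2 * r) (s₀ + 2 * r)) S₁ with hV₁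
  have hcellr : ∀ J : Set ℝ, MeasurableSet J → J ⊆ P.range → ∀ A : Set (E m), MeasurableSet A →
      volume.real (P.cell J A) = κ * (volume.real J * volume.real A) := by
    intro J hJ hJP A hA
    rw [Measure.real, (hcell J hJ hJP A hA).2, ENNReal.toReal_mul, ENNReal.toReal_mul,
      ENNReal.toReal_ofReal hκ.le]
    rfl
  have hcellt : ∀ a b : ℝ, Icc a b ⊆ P.range → ∀ A : Set (E m), MeasurableSet A → volume A < ⊤ →
      volume (P.cell (Icc a b) A) < ⊤ := by
    intro a b hab A hA hAt
    rw [(hcell _ measurableSet_Icc hab A hA).2]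
    exact ENNReal.mul_lt_top ENNReal.ofReal_lt_top (ENNReal.mul_lt_top measure_Icc_lt_top hAt)
  have mS₀ := measurableSet_stripe hS.isOpen e y₀ r
  have mS₁ := measurableSet_stripe hS.isOpen e y₀ ((2 + 4 * P.lip) * r)
  have v₀ : volume.real V₀ = κ * (2 * r * volume.real S₀) := by
    rw [hV₀, hcellr _ measurableSet_Icc hJ1 _ mS₀, Real.volume_real_Icc_of_le (by linarith)]
    ring
  have v₁ : volume.real V₁ = κ * (4 * r * volume.real S₁) := by
    rw [hV₁, hcellr _ measurableSet_Icc hJ2 _ mS₁, Real.volume_real_Icc_of_le (by linarith)]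
    ring
  have habs : ∀ {s ρ : ℝ}, |s - s₀| ≤ ρ → s ∈ Icc (s₀ - ρ) (s₀ + ρ) := by
    intro s ρ hs
    rw [abs_le] at hs
    constructor <;> linarith [hs.1, hs.2]
  have habs' : ∀ {s ρ : ℝ}, s ∈ Icc (s₀ - ρ) (s₀ + ρ) → |s - s₀| ≤ ρ := by
    intro s ρ hs
    rw [abs_le]
    constructor <;> linarith [hs.1, hs.2]
  have hprof : ∀ {x : E (m + 1)} {ρ : ℝ}, P.ht x ∈ P.range → |P.ht x - s₀| ≤ ρ →
      |inner ℝ (P.prof (P.ht x) - P.prof s₀) e| ≤ P.lip * ρ := by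
    intro x ρ hx hxs
    refine (abs_real_inner_le_norm _ _).trans ?_
    refine (mul_le_of_le_one_right (norm_nonneg _) he).trans ?_
    exact (P.norm_prof_sub_le hx hs₀).trans (mul_le_mul_of_nonneg_left hxs hlip)
  obtain ⟨Cl, δl, hCl, hδl, hlayer⟩ := hS.exists_volume_layer_le
  set X := ‖c₀‖ - o with hX
  have hX0 : 0 ≤ X := sub_nonneg.2 ho
  set Y := (b + 2 * μ) * c * (W / r ^ 2) with hY
  set Z := κ * (4 * r * (Cl * ((1 + P.lip) * 4))) with hZ
  have hZ0 : 0 ≤ Z := by positivity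
  -- The layer has volume O(δ), so the singular factor 1/δ cancels and a positive power of δ
  -- remains.
  have hδmain : ∀ δ, 0 < δ → 4 * δ ≤ r → (1 + P.lip) * (4 * δ) ≤ δl →
      X * ((volume.real V₀ - Z * δ) * (2 * r ^ 2)) ≤ Y * (volume.real V₁ * (4 * r ^ 2))
        + μ * ((m + 1) * (B * (4 * δ) ^ α) + 4 * B * (2 * c / r) * δ) * (Z * (4 * r ^ 2)) := by
    intro δ hδ hδr hδl'
    obtain ⟨L, hLm, hLt, hLv, hLs⟩ := hlayer ((1 + P.lip) * (4 * δ)) (by positivity) hδl'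
    set LL := P.cell (Icc (s₀ - 2 * r) (s₀ + 2 * r)) L with hLL
    have vL : volume.real LL ≤ Z * δ := by
      rw [hLL, hcellr _ measurableSet_Icc hJ2 _ hLm, Real.volume_real_Icc_of_le (by linarith)]
      calc κ * ((s₀ + 2 * r - (s₀ - 2 * r)) * volume.real L)
          ≤ κ * ((s₀ + 2 * r - (s₀ - 2 * r)) * (Cl * ((1 + P.lip) * (4 * δ)))) := by
            refine mul_le_mul_of_nonneg_left (mul_le_mul_of_nonneg_left hLv ?_) hκ.le
            linarith
        _ = Z * δ := by rw [hZ]; ring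
    have hest := h.cell_estimate_of_cutoff hα hS hne hc hr hrR hδ hδr θ A F hrange htime he
      (x₀ := P.pt s₀ y₀) (V₀ := V₀) (V₁ := V₁) (L := LL) (hcell _ measurableSet_Icc hJ1 _ mS₀).1
      (hcell _ measurableSet_Icc hJ2 _ mS₁).1 (hcell _ measurableSet_Icc hJ2 _ hLm).1
      (hcellt _ _ hJ1 _ mS₀ (volume_stripe_lt_top hS.isBounded _ _ _))
      (hcellt _ _ hJ2 _ mS₁ (volume_stripe_lt_top hS.isBounded _ _ _))
      (hcellt _ _ hJ2 _ hLm hLt)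
      (by
        rintro x ⟨hx1, hx2⟩
        refine ⟨⟨hJ1 hx1, hx2.1⟩, habs' hx1, ?_⟩
        rw [P.inner_sub_pt_emb]
        refine (abs_add_le _ _).trans ?_
        have h1 := hx2.2
        have h2 := hprof (hJ1 hx1) (habs' hx1)
        linarith)
      (by
        intro x hx hx1 hx2
        refine ⟨habs hx1, hx.2, ?_⟩
        rw [P.inner_sub_pt_emb] at hx2
        have h2 := hprof hx.1 hx1
        rw [abs_le] at h2 hx2 ⊢
        constructor <;> linarith [h2.1, h2.2, hx2.1, hx2.2])
      (by
        intro x hx hx1 hx2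
        refine ⟨habs hx1, ?_⟩
        obtain ⟨z, hz, hxz, -⟩ := Shear.exists_lateral_near hS.isOpen hne hrange hx hx1
          (hx2.trans hδr)
        refine hLs (P.sc z) hz.2 _ ?_
        rw [dist_eq_norm]
        refine (P.norm_sc_sub_le hx.1 hz.1).trans (mul_le_mul_of_nonneg_left ?_ (by positivity))
        rw [← dist_eq_norm, hxz]; exact hx2) ho
      (by
        rintro x ⟨hx1, hx2⟩ t ht
        rw [← P.pt_ht_sc x]
        exact hosc _ hx1 _ hx2 t ht)
    have hB := h.nonneg
    have hμ := h.pos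
    have k1 : X * ((volume.real V₀ - Z * δ) * (2 * r ^ 2))
        ≤ X * ((volume.real V₀ - volume.real LL) * (2 * r ^ 2)) := by
      gcongr
    have k2 : (μ * ((m + 1) * (B * (4 * δ) ^ α / δ) + 4 * B * (2 * c / r)))
          * (volume.real LL * (4 * r ^ 2))
        ≤ (μ * ((m + 1) * (B * (4 * δ) ^ α / δ) + 4 * B * (2 * c / r)))
          * (Z * δ * (4 * r ^ 2)) := by
      gcongr
    have k3 : (μ * ((m + 1) * (B * (4 * δ) ^ α / δ) + 4 * B * (2 * c / r)))
          * (Z * δ * (4 * r ^ 2))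
        = μ * ((m + 1) * (B * (4 * δ) ^ α) + 4 * B * (2 * c / r) * δ) * (Z * (4 * r ^ 2)) := by
      field_simp
    linarith
  -- As δ → 0 the layer terms disappear. The bound keeps neither `B` nor the Lipschitz constants of
  -- the section, on which the layer estimate depends.
  have hlim : X * (volume.real V₀ * (2 * r ^ 2)) ≤ Y * (volume.real V₁ * (4 * r ^ 2)) := by
    have c1 : Continuous fun δ : ℝ => X * ((volume.real V₀ - Z * δ) * (2 * r ^ 2)) := by fun_prop
    have c2 : Continuous fun δ : ℝ => Y * (volume.real V₁ * (4 * r ^ 2))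
        + μ * ((m + 1) * (B * (4 * δ) ^ α) + 4 * B * (2 * c / r) * δ) * (Z * (4 * r ^ 2)) := by
      have : Continuous fun δ : ℝ => (4 * δ) ^ α :=
        (continuous_const.mul continuous_id).rpow_const fun _ => Or.inr hα.le
      fun_prop
    have t1 := (c1.tendsto 0).mono_left (nhdsWithin_le_nhds (s := Ioi 0))
    have t2 := (c2.tendsto 0).mono_left (nhdsWithin_le_nhds (s := Ioi 0))
    rw [mul_zero, Real.zero_rpow hα.ne'] at t2
    have := le_of_tendsto_of_tendsto t1 t2 (by
      have hmin : 0 < min (r / 4) (δl / ((1 + P.lip) * 4)) := by positivity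
      filter_upwards [Ioo_mem_nhdsGT hmin] with δ hδ
      have h1 := hδ.2.le.trans (min_le_left _ _)
      have h2 := hδ.2.le.trans (min_le_right _ _)
      rw [le_div_iff₀ (by positivity)] at h2
      exact hδmain δ hδ.1 (by linarith) (by linarith))
    simpa using this
  have hS0 : 0 < volume.real S₀ :=
    ENNReal.toReal_pos (volume_stripe_pos hS.isOpen hy₀ hr).ne'
      (volume_stripe_lt_top hS.isBounded _ _ _).ne
  have hY0 : 0 ≤ Y := by
    have := h.nonneg_b
    have := h.pos
    have := h.nonneg_W
    positivity
  rw [v₀, v₁] at hlim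
  have k1 : Y * (κ * (4 * r * volume.real S₁) * (4 * r ^ 2))
      ≤ Y * (κ * (4 * r * (D * volume.real S₀)) * (4 * r ^ 2)) := by gcongr
  have k2 : (κ * r * volume.real S₀ * (4 * r ^ 2)) * X
      ≤ (κ * r * volume.real S₀ * (4 * r ^ 2)) * (4 * D * Y) := by nlinarith
  have k3 : X ≤ 4 * D * Y := le_of_mul_le_mul_left k2 (by positivity)
  linarith

end

end BalanceLaw

namespace BalanceLaw

variable {m : ℕ}

/-! ### Recovery of the source -/

/-- A cross-section is thin in a direction `d`, small up to its extent in a direction `e`, and its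
parts between hyperplanes orthogonal to `e` are doubling. -/
theorem Tube.IsProductType.exists_directions {N : Tube m} {ε K : ℝ} (h : N.IsProductType ε K)
    (hm : m = 1 ∨ m = 2) : ∃ d e : E m, ‖d‖ = 1 ∧ ‖e‖ ≤ 1 ∧
      (∀ z ∈ N.sec, ∀ z' ∈ N.sec, inner ℝ (z - z') d ≤ ε) ∧
      (∀ z ∈ N.sec, ∀ z' ∈ N.sec, ‖z - z'‖ ≤ |inner ℝ (z - z') e| + ε) ∧
      ∀ y ∈ N.sec, ∀ ρ a : ℝ, 0 ≤ ρ → 1 ≤ a →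
        volume.real (stripe N.sec e y (a * ρ)) ≤ a ^ m * volume.real (stripe N.sec e y ρ) := by
  rcases h.2 with h | ⟨e, f, h⟩
  · have : Nontrivial (E m) := by
      rcases hm with rfl | rfl <;> infer_instance
    obtain ⟨d, hd⟩ := exists_norm_eq (E m) zero_le_one
    -- For a nozzle there is no long direction: with `e = 0` every stripe is the whole section and
    -- doubling is trivial.
    refine ⟨d, 0, hd, by simp, fun z hz z' hz' => h.inner_le hz hz' hd.le, fun z hz z' hz' => ?_,
      fun y _ ρ a hρ ha => ?_⟩
    · rw [inner_zero_right, abs_zero, zero_add, ← dist_eq_norm]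
      exact h.dist_le (subset_closure hz) (subset_closure hz')
    · have hst : ∀ ρ : ℝ, 0 ≤ ρ → stripe N.sec 0 y ρ = N.sec := fun ρ hρ => by
        ext z; simp [stripe, hρ]
      rw [hst _ (mul_nonneg (by linarith) hρ), hst _ hρ]
      exact le_mul_of_one_le_left measureReal_nonneg (one_le_pow₀ ha)
  · refine ⟨f, e, h.norm_f, h.norm_e.le, h.width_le, fun z hz z' hz' => ?_,
      fun y hy ρ a _ ha => volume_stripe_mul_le h.isLipschitzDomain.2
        h.isLipschitzDomain.1.isBounded hy ρ ha⟩
    have h1 := eq_inner_smul_add_inner_smul (by rcases hm with rfl | rfl <;> norm_num) h.norm_e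
      h.norm_f h.orthogonal (z - z')
    have h2 := norm_add_le (inner ℝ (z - z') e • e) (inner ℝ (z - z') f • f)
    rw [← h1, norm_smul, norm_smul, h.norm_e, h.norm_f, mul_one, mul_one, Real.norm_eq_abs,
      Real.norm_eq_abs] at h2
    linarith [h.abs_inner_le hz hz']

theorem isOpen_unionDom {M : ℕ} {N : Fin M → Tube m} {ε K : ℝ} (hK : 0 < K)
    (hN : ∀ i, (N i).IsProductType ε K) : IsOpen (unionDom N) := by
  refine isOpen_iUnion fun i => ?_
  obtain ⟨P, -, hsec, hdom, -⟩ := (hN i).1.exists_shear hK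
  rw [← hdom]
  exact P.isOpen_dom (hsec ▸ (hN i).isLipschitzDomain.isOpen)

theorem StateC1NormLE.norm_sub_le {α C : ℝ} {H : ℂ → ℂ} (h : StateC1NormLE α C H) (z z' : ℂ) :
    ‖H z - H z'‖ ≤ C * ‖z - z'‖ :=
  convex_univ.norm_image_sub_le_of_norm_fderiv_le (𝕜 := ℝ)
    (fun x _ => (h.1.differentiable one_ne_zero) x) (fun _ hx => h.2.2.norm_le hx)
    (mem_univ z') (mem_univ z)

/-- The modulus of continuity of the source along a state. -/
theorem SourceNormLE.norm_comp_sub_le {k : ℕ} {Ω : Set (E k)} {T α₂ α₄ C₂ C₄ : ℝ}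
    {f : E k → ℝ → ℂ → EuclideanSpace ℂ (Fin k) → ℂ} (h : SourceNormLE Ω T α₂ C₂ f)
    {u : E k → ℝ → ℂ} {Du : E k → ℝ → EuclideanSpace ℂ (Fin k)} {ut : E k → ℝ → ℂ}
    (hu : C1HolderLE Ω T α₄ C₄ u Du ut) (hα₂ : α₂ ∈ Ioo (0 : ℝ) 1) (hα₄ : α₄ ∈ Ioo (0 : ℝ) 1)
    (hC₂ : 0 < C₂) (hC₄ : 0 < C₄) {p q : E k × ℝ} (hp : p ∈ closure Ω ×ˢ Icc 0 T)
    (hq : q ∈ closure Ω ×ˢ Icc 0 T) {A r : ℝ} (hA : 1 ≤ A) (hr : 0 < r) (hr1 : r ≤ 1)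
    (hpq : parDist p q ≤ A * r) :
    ‖f p.1 p.2 (u p.1 p.2) (Du p.1 p.2) - f q.1 q.2 (u q.1 q.2) (Du q.1 q.2)‖
      ≤ 2 * C₂ * A * (1 + C₄ ^ α₂) * r ^ (α₂ * α₄) := by
  obtain ⟨h20, h21⟩ := hα₂
  obtain ⟨h40, h41⟩ := hα₄
  have hA0 : 0 < A := one_pos.trans_le hA
  have hb : α₂ * α₄ ≤ α₂ := by nlinarith
  have hpow : ∀ d : ℝ, 0 ≤ d → d ≤ A * r → ∀ β, α₂ * α₄ ≤ β → β ≤ 1 →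
      d ^ β ≤ A * r ^ (α₂ * α₄) := by
    intro d hd hdr β hβ hβ1
    have hβ0 : 0 ≤ β := (mul_pos h20 h40).le.trans hβ
    calc d ^ β ≤ (A * r) ^ β := Real.rpow_le_rpow hd hdr hβ0
      _ = A ^ β * r ^ β := Real.mul_rpow hA0.le hr.le
      _ ≤ A ^ (1 : ℝ) * r ^ (α₂ * α₄) := mul_le_mul
          (Real.rpow_le_rpow_of_exponent_le hA hβ1)
          (Real.rpow_le_rpow_of_exponent_ge hr hr1 hβ) (by positivity) (by positivity)
      _ = A * r ^ (α₂ * α₄) := by rw [Real.rpow_one]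
  have hx : dist p.1 q.1 ≤ A * r := (le_add_of_nonneg_right (Real.sqrt_nonneg _)).trans hpq
  have ht : √|p.2 - q.2| ≤ A * r := (le_add_of_nonneg_left dist_nonneg).trans hpq
  have h1 := hpow _ dist_nonneg hx α₂ hb h21.le
  have h2 : |p.2 - q.2| ^ (α₂ / 2) ≤ A * r ^ (α₂ * α₄) := by
    have h3 : |p.2 - q.2| ^ (α₂ / 2) = √|p.2 - q.2| ^ α₂ := by
      rw [Real.sqrt_eq_rpow, ← Real.rpow_mul (abs_nonneg _)]; ring_nf
    rw [h3]
    exact hpow _ (Real.sqrt_nonneg _) ht α₂ hb h21.le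
  have hstate : ∀ v : ℝ, 0 ≤ v → v ≤ C₄ * parDist p q ^ α₄ →
      v ^ α₂ ≤ C₄ ^ α₂ * (A * r ^ (α₂ * α₄)) := by
    intro v hv0 hv
    calc v ^ α₂ ≤ (C₄ * parDist p q ^ α₄) ^ α₂ := Real.rpow_le_rpow hv0 hv h20.le
      _ = C₄ ^ α₂ * parDist p q ^ (α₂ * α₄) := by
        rw [Real.mul_rpow hC₄.le (Real.rpow_nonneg (parDist_nonneg _ _) _),
          ← Real.rpow_mul (parDist_nonneg _ _), mul_comm α₄]
      _ ≤ _ := mul_le_mul_of_nonneg_left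
        (hpow _ (parDist_nonneg _ _) hpq _ le_rfl (hb.trans h21.le)) (by positivity)
  have h3 := hstate _ (norm_nonneg _) (hu.norm_u.norm_sub_le hp hq (parDist_nonneg _ _))
  have h4 := hstate _ (norm_nonneg _) (hu.norm_Du.norm_sub_le hp hq (parDist_nonneg _ _))
  refine (h.norm_sub_le hp.1 hq.1 hp.2 hq.2 _ _ _ _).trans ?_
  have e1 := mul_le_mul_of_nonneg_left h1 hC₂.le
  have e2 := mul_le_mul_of_nonneg_left h2 hC₂.le
  have e3 := mul_le_mul_of_nonneg_left h3 hC₂.le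
  have e4 := mul_le_mul_of_nonneg_left h4 hC₂.le
  linarith

section Setting

variable {M : ℕ} {N : Fin M → Tube m} {T μ α₁ α₂ α₃ α₄ C₁ C₂ C₃ C₄ : ℝ} {H : ℂ → ℂ}
  {F : Fin 2 → E (m + 1) → ℝ → ℂ → Fin (m + 1) → ℂ}
  {f : Fin 2 → E (m + 1) → ℝ → ℂ → EuclideanSpace ℂ (Fin (m + 1)) → ℂ}
  {u : Fin 2 → E (m + 1) → ℝ → ℂ} {Du : Fin 2 → E (m + 1) → ℝ → EuclideanSpace ℂ (Fin (m + 1))}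
  {ut h : Fin 2 → E (m + 1) → ℝ → ℂ}

theorem IsSetting.continuousOn_source (hs : IsSetting N T μ α₂ α₃ α₄ C₂ C₃ C₄ H F f u Du ut h)
    (hα₂ : 0 < α₂) (hα₄ : 0 < α₄) (i j : Fin 2) :
    ContinuousOn (fun p : E (m + 1) × ℝ => f i p.1 p.2 (u j p.1 p.2) (Du j p.1 p.2))
      (closure (unionDom N) ×ˢ Icc 0 T) :=
  (hs.source i).continuousOn_comp hα₂ (hs.continuousOn_u hα₄ j) (hs.continuousOn_Du hα₄ j)

/-- With equal coupling terms the gradients agree on the lateral boundary. -/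
theorem IsSetting.grad_sub_eq_zero (hs : IsSetting N T μ α₂ α₃ α₄ C₂ C₃ C₄ H F f u Du ut h)
    (hα₄ : 0 < α₄) (hh : ∀ x ∈ unionDom N, ∀ t ∈ Icc 0 T, h 0 x t = h 1 x t)
    {i : Fin M} {P : Shear m} (hdom : P.dom = (N i).dom) (hlat : P.lateral = (N i).lateral)
    (hL : IsLipschitzDomain P.sec) {t : ℝ} (ht : t ∈ Ioo 0 T) :
    ∀ x ∈ P.lateral, Du 0 x t - Du 1 x t = 0 := by
  have ht' : t ∈ Icc 0 T := Ioo_subset_Icc_self ht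
  have hΩ : P.dom ⊆ unionDom N := hdom ▸ Tube.dom_subset_unionDom N i
  refine (hs.slice_sub hα₄ ht).grad_eq_zero hα₄ hΩ
    (fun x hx => sub_eq_zero.2 (hs.dirichlet i x (hlat ▸ hx) t ht')) hL ?_
  intro x hx ν hν
  have hxc : x ∈ closure (unionDom N) := closure_mono hΩ (P.lateral_subset_closure hx)
  have hc : ∀ j, ContinuousOn (fun x => h j x t) (closure (unionDom N)) := fun j =>
    (hs.continuousOn_h hα₄ j).comp (f := fun x => (x, t)) (by fun_prop) fun x hx => ⟨hx, ht'⟩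
  have h1 : h 0 x t = h 1 x t :=
    EqOn.of_subset_closure (f := fun x => h 0 x t) (g := fun x => h 1 x t)
      (s := unionDom N) (fun x hx => hh x hx t ht') (hc 0) (hc 1) subset_closure subset_rfl hxc
  have h2 := hs.neumann i x (hlat ▸ hx) t ht' ν (hdom ▸ hν)
  rw [h1] at h2
  have h3 : dotC ν (Du 0 x t - Du 1 x t).ofLp = dotC ν (Du 0 x t) - dotC ν (Du 1 x t) :=
    dotC_sub_right _ _ _
  rw [h3, add_right_cancel h2, sub_self]

/-- The difference of the states and of their gradients in a tube of width `ε`. -/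
theorem IsSetting.norm_sub_le_of_thin (hs : IsSetting N T μ α₂ α₃ α₄ C₂ C₃ C₄ H F f u Du ut h)
    (hα₄ : 0 < α₄) (hh : ∀ x ∈ unionDom N, ∀ t ∈ Icc 0 T, h 0 x t = h 1 x t)
    {i : Fin M} {P : Shear m} (hdom : P.dom = (N i).dom) (hlat : P.lateral = (N i).lateral)
    (hL : IsLipschitzDomain P.sec) {ε : ℝ} {d : E m} (hd : ‖d‖ = 1)
    (hthin : ∀ z ∈ P.sec, ∀ z' ∈ P.sec, inner ℝ (z - z') d ≤ ε)
    {x : E (m + 1)} (hx : x ∈ P.dom) {t : ℝ} (ht : t ∈ Ioo 0 T) :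
    ‖u 0 x t - u 1 x t‖ ≤ 2 * C₄ * ε ^ α₄ * ε ∧ ‖Du 0 x t - Du 1 x t‖ ≤ 2 * C₄ * ε ^ α₄ := by
  have h1 := (hs.slice_sub hα₄ ht).norm_le_of_chord_of_grad_eq_zero hα₄
    (hdom ▸ Tube.dom_subset_unionDom N i : P.dom ⊆ unionDom N)
    (fun x hx => sub_eq_zero.2 (hs.dirichlet i x (hlat ▸ hx) t (Ioo_subset_Icc_self ht)))
    (hs.grad_sub_eq_zero hα₄ hh hdom hlat hL ht) hx.1 hx.2 hd
    (hasShortChord_of_width hL.isOpen hL.isBounded hx.2 hd hthin)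
  simpa only [P.pt_ht_sc] using h1

/-- Since `w` vanishes to first order on the lateral boundary, a chord of length at most ε bounds it
by the order ε^(1+α₄); the Lipschitz bound on `H` passes this on to the densities. -/
theorem IsSetting.isDifference (hs : IsSetting N T μ α₂ α₃ α₄ C₂ C₃ C₄ H F f u Du ut h)
    (hμ : 0 < μ) (hα₂ : 0 < α₂) (hα₃ : 0 < α₃) (hα₄ : 0 < α₄) (hC₁ : 0 < C₁) (hC₄ : 0 < C₄)
    (hH : StateC1NormLE α₁ C₁ H) (hopen : IsOpen (unionDom N))
    (hF : ∀ x ∈ unionDom N, ∀ t ∈ Icc 0 T, F 0 x t (u 0 x t) = F 1 x t (u 1 x t))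
    (hh : ∀ x ∈ unionDom N, ∀ t ∈ Icc 0 T, h 0 x t = h 1 x t)
    {i : Fin M} {P : Shear m} (hdom : P.dom = (N i).dom) (hlat : P.lateral = (N i).lateral)
    (hL : IsLipschitzDomain P.sec) {ε : ℝ} (hε : 0 < ε) {d : E m} (hd : ‖d‖ = 1)
    (hthin : ∀ z ∈ P.sec, ∀ z' ∈ P.sec, inner ℝ (z - z') d ≤ ε) :
    IsDifference P (unionDom N) T μ α₄ (2 * C₄) C₁ (2 * C₄ * ε ^ α₄ * ε)
      (fun p => u 0 p.1 p.2 - u 1 p.1 p.2) (fun p => H (u 0 p.1 p.2) - H (u 1 p.1 p.2))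
      (fun p => f 0 p.1 p.2 (u 0 p.1 p.2) (Du 0 p.1 p.2)
        - f 1 p.1 p.2 (u 1 p.1 p.2) (Du 1 p.1 p.2))
      (fun p => Du 0 p.1 p.2 - Du 1 p.1 p.2) := by
  have hQs : unionDom N ×ˢ Ioo 0 T ⊆ closure (unionDom N) ×ˢ Icc 0 T :=
    prod_mono subset_closure Ioo_subset_Icc_self
  have hΩ : P.dom ⊆ unionDom N := hdom ▸ Tube.dom_subset_unionDom N i
  have hu := fun j => (hs.continuousOn_u hα₄ j).mono hQs
  have hDu := fun j => (hs.continuousOn_Du hα₄ j).mono hQs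
  have hf := fun j => (hs.continuousOn_source hα₂ hα₄ j j).mono hQs
  have hw := fun p (hp : p ∈ P.dom ×ˢ Ioo 0 T) =>
    (hs.norm_sub_le_of_thin hα₄ hh hdom hlat hL hd hthin hp.1 hp.2).1
  exact
    { subset := hΩ
      pos := hμ
      nonneg := by positivity
      nonneg_b := hC₁.le
      nonneg_W := by positivity
      continuousOn_w := (hu 0).sub (hu 1)
      continuousOn_Dw := (hDu 0).sub (hDu 1)
      continuousOn_dH := (hH.1.continuous.comp_continuousOn (hu 0)).sub
        (hH.1.continuous.comp_continuousOn (hu 1))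
      continuousOn_g := (hf 0).sub (hf 1)
      deriv := fun p hp v => by
        obtain ⟨L, hL, hL1, -⟩ := (hs.solution_norm 0).deriv p.1 hp.1 p.2 hp.2
        obtain ⟨L', hL', hL1', -⟩ := (hs.solution_norm 1).deriv p.1 hp.1 p.2 hp.2
        refine ⟨L - L', hL.sub hL', clm_apply_eq_dotC _ _ (fun j => ?_) v⟩
        rw [_root_.sub_apply, hL1, hL1']; rfl
      weak := fun φ hφ hc hsupp =>
        hs.integral_sub_eq hα₂ hα₃ hα₄ hH.1.continuous hopen hF hφ hc hsupp
      norm_w_le := hw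
      norm_dH_le := fun p hp => (hH.norm_sub_le _ _).trans
        (mul_le_mul_of_nonneg_left (hw p hp) hC₁.le)
      norm_w_le_dist := fun p hp z hz hseg => by
        have h1 := (hs.slice_sub hα₄ hp.2).norm_sub_le (x := p.1) (x' := z)
          fun τ hτ => hΩ (hseg τ hτ)
        simp only [hs.dirichlet i z (hlat ▸ hz) p.2 (Ioo_subset_Icc_self hp.2), sub_self] at h1
        rwa [zero_sub, norm_neg, ← dist_eq_norm z, dist_comm] at h1
      norm_Dw_le_dist := fun p hp z hz => by
        have h1 := (hs.slice_sub hα₄ hp.2).holder p.1 (subset_closure (hΩ hp.1)) z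
          (closure_mono hΩ (P.lateral_subset_closure hz))
        simp only [hs.grad_sub_eq_zero hα₄ hh hdom hlat hL hp.2 z hz, sub_zero] at h1
        exact h1 }

end Setting

end BalanceLaw

/-! ### The source estimate and the choice of the cell size. -/

namespace BalanceLaw

variable {m : ℕ}

/-- An interval of length `6 r` with endpoint `s` in a set with room on one side of `s`. -/
theorem exists_center {R : Set ℝ} {s ℓ r : ℝ} (h : Icc s (s + ℓ) ⊆ R ∨ Icc (s - ℓ) s ⊆ R)
    (hr : 0 ≤ r) (hrℓ : 6 * r ≤ ℓ) :
    ∃ s₀, |s₀ - s| ≤ 3 * r ∧ Icc (s₀ - 3 * r) (s₀ + 3 * r) ⊆ R := by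
  rcases h with h | h
  · refine ⟨s + 3 * r, ?_, fun x hx => h ⟨by linarith [hx.1], by linarith [hx.2]⟩⟩
    rw [add_sub_cancel_left, abs_of_nonneg (by positivity)]
  · refine ⟨s - 3 * r, ?_, fun x hx => h ⟨by linarith [hx.1], by linarith [hx.2]⟩⟩
    rw [abs_le]
    constructor <;> linarith

/-- An interval of length `4 ρ` in `(0, T)` with endpoint `t`. -/
theorem exists_time_center {T t ρ : ℝ} (ht : t ∈ Ioo 0 T) (hρ : 0 ≤ ρ) (hρT : 8 * ρ < T) :
    ∃ t₀, |t₀ - t| ≤ 2 * ρ ∧ Icc (t₀ - 2 * ρ) (t₀ + 2 * ρ) ⊆ Ioo 0 T := by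
  rcases le_total t (T / 2) with h | h
  · refine ⟨t + 2 * ρ, ?_, fun x hx => ⟨?_, ?_⟩⟩
    · rw [add_sub_cancel_left, abs_of_nonneg (by positivity)]
    · linarith [hx.1, ht.1]
    · linarith [hx.2]
  · refine ⟨t - 2 * ρ, ?_, fun x hx => ⟨?_, ?_⟩⟩
    · rw [abs_le]
      constructor <;> linarith
    · linarith [hx.1]
    · linarith [hx.2, ht.2]

/-- The constant in the estimate of the source on tubes with the bound `K`; here `c` bounds the
derivatives of the cutoff functions. -/
noncomputable def sourceConst (m : ℕ) (μ c α₂ C₁ C₂ C₄ K : ℝ) : ℝ :=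
  4 * C₂ * (10 + 9 * K ^ 2) * (1 + C₄ ^ α₂)
    + 4 * (2 + 4 * K ^ 2) ^ m * ((C₁ + 2 * μ) * c * (2 * C₄)) + 4 * C₂ * (2 * C₄) ^ α₂

section Setting

variable {M : ℕ} {N : Fin M → Tube m} {T μ α₁ α₂ α₃ α₄ C₁ C₂ C₃ C₄ : ℝ} {H : ℂ → ℂ}
  {F : Fin 2 → E (m + 1) → ℝ → ℂ → Fin (m + 1) → ℂ}
  {f : Fin 2 → E (m + 1) → ℝ → ℂ → EuclideanSpace ℂ (Fin (m + 1)) → ℂ}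
  {u : Fin 2 → E (m + 1) → ℝ → ℂ} {Du : Fin 2 → E (m + 1) → ℝ → EuclideanSpace ℂ (Fin (m + 1))}
  {ut h : Fin 2 → E (m + 1) → ℝ → ℂ}

/-- The cell estimate bounds the difference of the sources, each at its own state. Exchanging the
states then costs only a Hölder modulus of u¹ − u² and of its gradient, both O(ε^α₄). -/
theorem IsSetting.norm_source_sub_le_of_mem_Ioo
    (hs : IsSetting N T μ α₂ α₃ α₄ C₂ C₃ C₄ H F f u Du ut h) (hm : m = 1 ∨ m = 2) (hμ : 0 < μ)
    (hα₂ : α₂ ∈ Ioo (0 : ℝ) 1) (hα₃ : α₃ ∈ Ioo (0 : ℝ) 1) (hα₄ : α₄ ∈ Ioo (0 : ℝ) 1)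
    (hC₁ : 0 < C₁) (hC₂ : 0 < C₂) (hC₄ : 0 < C₄) (hH : StateC1NormLE α₁ C₁ H)
    (hF : ∀ x ∈ unionDom N, ∀ t ∈ Icc 0 T, F 0 x t (u 0 x t) = F 1 x t (u 1 x t))
    (hh : ∀ x ∈ unionDom N, ∀ t ∈ Icc 0 T, h 0 x t = h 1 x t) {K : ℝ} (hK : 0 < K) {ε r : ℝ}
    (hN : ∀ i, (N i).IsProductType ε K) (hε : 0 < ε) (hr : 0 < r) (hr1 : r ≤ 1) (hεr : ε ≤ r)
    (hrε : ε ^ α₄ * ε ≤ r ^ (α₂ * α₄) * r ^ 2) (hrK : 6 * r ≤ 1 / (2 * K ^ 2))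
    (hrT : 8 * r ^ 2 < T) {c : ℝ} (hc : 0 < c)
    (hbump : ∀ s₀ r : ℝ, 0 < r → Nonempty (ScaledBump c s₀ r))
    {x : E (m + 1)} (hx : x ∈ unionDom N) {t : ℝ} (ht : t ∈ Ioo 0 T) (j : Fin 2) :
    ‖f 0 x t (u j x t) (Du j x t) - f 1 x t (u j x t) (Du j x t)‖
      ≤ sourceConst m μ c α₂ C₁ C₂ C₄ K * r ^ (α₂ * α₄) := by
  obtain ⟨i, hxi⟩ := mem_iUnion.1 hx
  have ht' : t ∈ Icc 0 T := Ioo_subset_Icc_self ht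
  obtain ⟨P, -, hsec, hdom, hlat, hlip, hroom, -⟩ := (hN i).1.exists_shear hK
  obtain ⟨d, e, hd, he, hthin, hext, hdbl⟩ := (hN i).exists_directions hm
  rw [← hsec] at hthin hext hdbl
  have hL : IsLipschitzDomain P.sec := hsec ▸ (hN i).isLipschitzDomain
  have hΩ : P.dom ⊆ unionDom N := hdom ▸ Tube.dom_subset_unionDom N i
  have hxP : x ∈ P.dom := hdom ▸ hxi
  obtain ⟨hsr, hy⟩ := id hxP
  set s := P.ht x with hsdef
  set y := P.sc x with hydef
  have hxpt : P.pt s y = x := P.pt_ht_sc x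
  have hne : P.domᶜ.Nonempty := by
    obtain ⟨τ, -, hτ, -⟩ := exists_exit hL.isOpen hL.isBounded hy
      (show d ≠ 0 by rintro rfl; simp at hd)
    exact ⟨P.pt s (y + τ • d), P.disjoint_lateral_dom hL.isOpen (P.pt_mem_lateral hsr hτ)⟩
  have hdiff := hs.isDifference hμ hα₂.1 hα₃.1 hα₄.1 hC₁ hC₄ hH (isOpen_unionDom hK hN) hF hh
    hdom hlat hL hε hd hthin
  -- Near an end of the tube or of the time interval there is room on one side only, so the cell is
  -- not centred at the point; it stays within a comparable distance.
  obtain ⟨s₀, hs₀, hrange⟩ := exists_center (hroom s hsr) hr.le hrK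
  obtain ⟨t₀, ht₀, htime⟩ := exists_time_center ht (sq_nonneg r) hrT
  -- In units of r: `5 * (1 + K ^ 2)` from the height, `2 + 4 * K ^ 2` from the stripe, 1 from the
  -- thin extent ε ≤ r, and 2 from the time.
  set A := 10 + 9 * K ^ 2 with hA
  have hA1 : 1 ≤ A := by rw [hA]; nlinarith [sq_nonneg K]
  set o := 4 * C₂ * A * (1 + C₄ ^ α₂) * r ^ (α₂ * α₄) with ho
  have hxc : (x, t) ∈ closure (unionDom N) ×ˢ Icc 0 T := ⟨subset_closure hx, ht'⟩
  have hosc : ∀ s' ∈ Icc (s₀ - 2 * r) (s₀ + 2 * r),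
      ∀ y' ∈ stripe P.sec e y ((2 + 4 * P.lip) * r),
      ∀ t' ∈ Icc (t₀ - 2 * r ^ 2) (t₀ + 2 * r ^ 2),
      ‖(f 0 (P.pt s' y') t' (u 0 (P.pt s' y') t') (Du 0 (P.pt s' y') t')
        - f 1 (P.pt s' y') t' (u 1 (P.pt s' y') t') (Du 1 (P.pt s' y') t'))
        - (f 0 x t (u 0 x t) (Du 0 x t) - f 1 x t (u 1 x t) (Du 1 x t))‖ ≤ o := by
    intro s' hs' y' hy' t' ht1
    have hs'r : s' ∈ P.range := hrange ⟨by linarith [hs'.1], by linarith [hs'.2]⟩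
    have hpc : (P.pt s' y', t') ∈ closure (unionDom N) ×ˢ Icc 0 T :=
      ⟨subset_closure (hΩ (P.pt_mem_dom hs'r hy'.1)), Ioo_subset_Icc_self (htime ht1)⟩
    have hpar : parDist (P.pt s' y', t') (x, t) ≤ A * r := by
      have h1 := P.norm_pt_sub_le hs'r hsr y' y
      rw [hxpt, hlip] at h1
      have h2 : |s' - s| ≤ 5 * r := by
        rw [abs_le] at hs₀ ⊢
        constructor <;> linarith [hs₀.1, hs₀.2, hs'.1, hs'.2]
      have h3 := hext y' hy'.1 y hy
      have h4 := hy'.2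
      rw [hlip] at h4
      have h5 : √|t' - t| ≤ 2 * r := by
        rw [Real.sqrt_le_left (by positivity), abs_le]
        rw [abs_le] at ht₀
        constructor <;> nlinarith [ht₀.1, ht₀.2, ht1.1, ht1.2]
      have h6 : (1 + K ^ 2) * |s' - s| ≤ (1 + K ^ 2) * (5 * r) :=
        mul_le_mul_of_nonneg_left h2 (by positivity)
      have h7 : parDist (P.pt s' y', t') (x, t) = ‖P.pt s' y' - x‖ + √|t' - t| := by
        rw [parDist, dist_eq_norm]
      rw [h7, hA]
      linarith
    have h1 := fun j => (hs.source j).norm_comp_sub_le (hs.solution_norm j) hα₂ hα₄ hC₂ hC₄ hpc hxc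
      hA1 hr hr1 hpar
    rw [sub_sub_sub_comm]
    refine (norm_sub_le _ _).trans ((add_le_add (h1 0) (h1 1)).trans (le_of_eq ?_))
    rw [ho]; ring
  have hg : ‖f 0 x t (u 0 x t) (Du 0 x t) - f 1 x t (u 1 x t) (Du 1 x t)‖
      ≤ (4 * C₂ * A * (1 + C₄ ^ α₂)
        + 4 * (2 + 4 * K ^ 2) ^ m * ((C₁ + 2 * μ) * c * (2 * C₄))) * r ^ (α₂ * α₄) := by
    have hrest : 0 ≤ 4 * (2 + 4 * K ^ 2) ^ m * ((C₁ + 2 * μ) * c * (2 * C₄)) * r ^ (α₂ * α₄) := by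
      positivity
    rw [add_mul]
    -- If the value does not exceed the oscillation there is nothing to prove; otherwise the cell
    -- estimate, which needs `o ≤ ‖c₀‖`, applies.
    rcases le_total ‖f 0 x t (u 0 x t) (Du 0 x t) - f 1 x t (u 1 x t) (Du 1 x t)‖ o with hle | hle
    · exact hle.trans (le_add_of_nonneg_right hrest)
    · have h1 := hdiff.norm_le_of_cell hα₄.1 hL hne hc hbump hr hrange htime he hy
        (hdbl y hy r (2 + 4 * P.lip) hr.le (by linarith [P.lip.coe_nonneg])) hle hosc
      rw [hlip] at h1
      have h2 : 2 * C₄ * ε ^ α₄ * ε / r ^ 2 ≤ 2 * C₄ * r ^ (α₂ * α₄) := by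
        rw [div_le_iff₀ (by positivity)]
        have := mul_le_mul_of_nonneg_left hrε (show 0 ≤ 2 * C₄ by positivity)
        linarith
      refine h1.trans (add_le_add le_rfl ?_)
      have h3 : 4 * (2 + 4 * K ^ 2) ^ m * ((C₁ + 2 * μ) * c * (2 * C₄ * ε ^ α₄ * ε / r ^ 2))
          ≤ 4 * (2 + 4 * K ^ 2) ^ m * ((C₁ + 2 * μ) * c * (2 * C₄ * r ^ (α₂ * α₄))) := by
        gcongr
      refine h3.trans (le_of_eq ?_)
      ring
  -- exchange of the states
  obtain ⟨hw, hDw⟩ := hs.norm_sub_le_of_thin hα₄.1 hh hdom hlat hL hd hthin hxP ht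
  have hw' : ‖u 0 x t - u 1 x t‖ ≤ 2 * C₄ * ε ^ α₄ :=
    hw.trans (mul_le_of_le_one_right (by positivity) (hεr.trans hr1))
  have hpow : ∀ v : ℝ, 0 ≤ v → v ≤ 2 * C₄ * ε ^ α₄ → v ^ α₂ ≤ (2 * C₄) ^ α₂ * r ^ (α₂ * α₄) := by
    intro v hv0 hv
    calc v ^ α₂ ≤ (2 * C₄ * ε ^ α₄) ^ α₂ := Real.rpow_le_rpow hv0 hv hα₂.1.le
      _ = (2 * C₄) ^ α₂ * ε ^ (α₂ * α₄) := by
        rw [Real.mul_rpow (by positivity) (by positivity), ← Real.rpow_mul hε.le, mul_comm α₄]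
      _ ≤ (2 * C₄) ^ α₂ * r ^ (α₂ * α₄) := by
        have := mul_pos hα₂.1 hα₄.1
        gcongr
  have hD := hpow _ (norm_nonneg _) hDw
  have hU := hpow _ (norm_nonneg _) hw'
  have hswap : ∀ i', ‖f i' x t (u 0 x t) (Du 0 x t) - f i' x t (u 1 x t) (Du 1 x t)‖
      ≤ 2 * C₂ * ((2 * C₄) ^ α₂ * r ^ (α₂ * α₄)) := by
    intro i'
    have h1 := (hs.source i').norm_sub_le hxc.1 hxc.1 ht' ht' (u 0 x t) (u 1 x t) (Du 0 x t)
      (Du 1 x t)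
    have := hα₂.1
    rw [dist_self, sub_self, abs_zero, Real.zero_rpow this.ne', Real.zero_rpow (by positivity),
      mul_zero, zero_add, zero_add] at h1
    have h2 := mul_le_mul_of_nonneg_left hD hC₂.le
    have h3 := mul_le_mul_of_nonneg_left hU hC₂.le
    linarith
  have hfin : ‖f 0 x t (u j x t) (Du j x t) - f 1 x t (u j x t) (Du j x t)‖
      ≤ ‖f 0 x t (u 0 x t) (Du 0 x t) - f 1 x t (u 1 x t) (Du 1 x t)‖
        + 2 * C₂ * ((2 * C₄) ^ α₂ * r ^ (α₂ * α₄)) := by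
    fin_cases j
    · refine le_trans (le_of_eq ?_) ((norm_sub_le (_ - _) (f 1 x t (u 0 x t) (Du 0 x t)
        - f 1 x t (u 1 x t) (Du 1 x t))).trans (add_le_add le_rfl (hswap 1)))
      congr 1
      simp only [Fin.zero_eta]
      ring
    · refine le_trans (le_of_eq ?_) ((norm_sub_le (_ - _) (f 0 x t (u 0 x t) (Du 0 x t)
        - f 0 x t (u 1 x t) (Du 1 x t))).trans (add_le_add le_rfl (hswap 0)))
      congr 1
      simp only [Fin.mk_one]
      ring
  have hpos : 0 ≤ 2 * C₂ * ((2 * C₄) ^ α₂ * r ^ (α₂ * α₄)) := by positivity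
  rw [sourceConst]
  linarith

end Setting

/-- After division by α₂α₄ and clearing of denominators this is α₄ < 1 + α₂α₄. -/
theorem sourceRate_lt {α₂ α₄ : ℝ} (h₂ : α₂ ∈ Ioo (0 : ℝ) 1) (h₄ : α₄ ∈ Ioo (0 : ℝ) 1) :
    sourceRate α₂ α₄ < (1 + α₄) / (2 + α₂ * α₄) * (α₂ * α₄) := by
  have hb : 0 < α₂ * α₄ := mul_pos h₂.1 h₄.1
  have h1 : sourceRate α₂ α₄ = α₄ / (1 + α₂ * α₄) * (α₂ * α₄) := by rw [sourceRate]; ring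
  rw [h1]
  refine mul_lt_mul_of_pos_right ?_ hb
  rw [div_lt_div_iff₀ (by positivity) (by positivity)]
  nlinarith [h₄.2]

/-- The estimate at rate `q * b` with the constant `sourceConst`; the strictly smaller `sourceRate`
leaves a positive power of ε that absorbs the constant. -/
theorem source_recovery (hm : m = 1 ∨ m = 2) {μ : ℝ} (hμ : 0 < μ)
    {α₁ α₂ α₃ α₄ : ℝ} (hα₂ : α₂ ∈ Set.Ioo 0 1) (hα₃ : α₃ ∈ Set.Ioo 0 1) (hα₄ : α₄ ∈ Set.Ioo 0 1)
    {C₁ C₂ C₃ C₄ : ℝ} (hC₁ : 0 < C₁) (hC₂ : 0 < C₂) (hC₄ : 0 < C₄) {K T : ℝ} (hK : 0 < K)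
    (hT : 0 < T) :
    ∃ ε₀ : ℝ, 0 < ε₀ ∧ ∀ ε : ℝ, 0 < ε → ε < ε₀ →
      ∀ (M : ℕ) (N : Fin M → Tube m), (∀ i, (N i).IsProductType ε K) →
      ∀ (H : ℂ → ℂ) (F : Fin 2 → E (m + 1) → ℝ → ℂ → Fin (m + 1) → ℂ)
        (f : Fin 2 → E (m + 1) → ℝ → ℂ → EuclideanSpace ℂ (Fin (m + 1)) → ℂ)
        (u : Fin 2 → E (m + 1) → ℝ → ℂ)
        (Du : Fin 2 → E (m + 1) → ℝ → EuclideanSpace ℂ (Fin (m + 1)))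
        (ut h : Fin 2 → E (m + 1) → ℝ → ℂ),
        IsSetting N T μ α₂ α₃ α₄ C₂ C₃ C₄ H F f u Du ut h →
        StateC1NormLE α₁ C₁ H →
        (∀ x ∈ unionDom N, ∀ t ∈ Set.Icc 0 T, F 0 x t (u 0 x t) = F 1 x t (u 1 x t)) →
        (∀ x ∈ unionDom N, ∀ t ∈ Set.Icc 0 T, h 0 x t = h 1 x t) →
      ∀ x ∈ unionDom N, ∀ t ∈ Set.Icc 0 T, ∀ j : Fin 2,
        ‖f 0 x t (u j x t) (Du j x t) - f 1 x t (u j x t) (Du j x t)‖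
          ≤ 1 * ε ^ sourceRate α₂ α₄ := by
  obtain ⟨c, hc, hbump⟩ := exists_scaledBump
  set b := α₂ * α₄ with hb
  have hb0 : 0 < b := mul_pos hα₂.1 hα₄.1
  -- The solution of ε^(1+α₄) / r² = r^b for r = ε^q: the cost of the derivatives of the bumps
  -- equals the oscillation of the source over the cell.
  set q := (1 + α₄) / (2 + b) with hq
  have hq0 : 0 < q := div_pos (by linarith [hα₄.1]) (by linarith)
  have hq1 : q ≤ 1 := by
    rw [hq, div_le_one (by linarith)]; linarith [hα₄.2]
  have hlt' : sourceRate α₂ α₄ < q * b := sourceRate_lt hα₂ hα₄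
  obtain ⟨ε₁, h1, h1', h1D⟩ := exists_pos_forall_mul_rpow_le_one
    (sourceConst m μ c α₂ C₁ C₂ C₄ K) (sub_pos.2 hlt')
  obtain ⟨ε₂, h2, -, h2D⟩ := exists_pos_forall_mul_rpow_le_one (12 * K ^ 2) hq0
  -- Gives `9 * r ≤ T`, and as `r ≤ 1` this leaves room for `8 * r ^ 2 < T`.
  obtain ⟨ε₃, h3, -, h3D⟩ := exists_pos_forall_mul_rpow_le_one (9 / T) hq0
  refine ⟨min ε₁ (min ε₂ ε₃), by positivity, ?_⟩
  intro ε hε hlt M N hN H F f u Du ut h hs hH hF hh x hx t ht j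
  have hlt1 : ε < ε₁ := hlt.trans_le (min_le_left _ _)
  have hlt2 : ε < ε₂ := hlt.trans_le ((min_le_right _ _).trans (min_le_left _ _))
  have hlt3 : ε < ε₃ := hlt.trans_le ((min_le_right _ _).trans (min_le_right _ _))
  have hε1 : ε ≤ 1 := (hlt1.trans_le h1').le
  set r := ε ^ q with hrdef
  have hr : 0 < r := by positivity
  have hr1 : r ≤ 1 := Real.rpow_le_one hε.le hε1 hq0.le
  have hεr : ε ≤ r := by
    have h5 := Real.rpow_le_rpow_of_exponent_ge hε hε1 hq1
    rwa [Real.rpow_one] at h5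
  have hrε : ε ^ α₄ * ε ≤ r ^ b * r ^ 2 := by
    have h5 : ε ^ α₄ * ε = ε ^ (1 + α₄) := by
      rw [add_comm, Real.rpow_add hε, Real.rpow_one]
    have h6 : r ^ b * r ^ 2 = ε ^ (q * (2 + b)) := by
      rw [Real.rpow_mul hε.le, ← hrdef, add_comm, Real.rpow_add hr, Real.rpow_two]
    rw [h5, h6, hq, div_mul_cancel₀ _ (by linarith)]
  have hrK : 6 * r ≤ 1 / (2 * K ^ 2) := by
    have h5 := h2D ε hε hlt2
    rw [le_div_iff₀ (by positivity)]
    linarith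
  have hrT : 8 * r ^ 2 < T := by
    have h5 := h3D ε hε hlt3
    rw [div_mul_eq_mul_div, div_le_one hT] at h5
    nlinarith
  have hmain : ∀ t ∈ Ioo 0 T, ‖f 0 x t (u j x t) (Du j x t) - f 1 x t (u j x t) (Du j x t)‖
      ≤ 1 * ε ^ sourceRate α₂ α₄ := by
    intro t ht
    refine (hs.norm_source_sub_le_of_mem_Ioo hm hμ hα₂ hα₃ hα₄ hC₁ hC₂ hC₄ hH hF hh hK hN hε hr hr1
      hεr hrε hrK hrT hc hbump hx ht j).trans ?_
    have h5 := h1D ε hε hlt1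
    have h6 : r ^ b = ε ^ (q * b - sourceRate α₂ α₄) * ε ^ sourceRate α₂ α₄ := by
      rw [← Real.rpow_add hε, sub_add_cancel, Real.rpow_mul hε.le]
    rw [h6, ← mul_assoc]
    exact mul_le_mul_of_nonneg_right h5 (by positivity)
  have hcl : closure (Ioo 0 T) = Icc 0 T := closure_Ioo hT.ne
  have hcont : ContinuousOn
      (fun t => ‖f 0 x t (u j x t) (Du j x t) - f 1 x t (u j x t) (Du j x t)‖)
      (closure (Ioo 0 T)) := by
    rw [hcl]
    have h5 : ∀ i', ContinuousOn (fun t => f i' x t (u j x t) (Du j x t)) (Icc 0 T) := fun i' =>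
      (hs.continuousOn_source hα₂.1 hα₄.1 i' j).comp (f := fun t => (x, t)) (by fun_prop)
        fun t ht => ⟨subset_closure hx, ht⟩
    exact ((h5 0).sub (h5 1)).norm
  exact le_on_closure hmain hcont continuousOn_const (hcl ▸ ht)

end BalanceLaw

theorem theorem2p1 (m : ℕ) (hm : m = 1 ∨ m = 2) (μ : ℝ) (hμ : 0 < μ)
    (α₁ α₂ α₃ α₄ : ℝ) (hα₁ : α₁ ∈ Set.Ioo 0 1) (hα₂ : α₂ ∈ Set.Ioo 0 1)
    (hα₃ : α₃ ∈ Set.Ioo 0 1) (hα₄ : α₄ ∈ Set.Ioo 0 1) :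
    -- (a) recovery of the rotated flux components
    (∀ l : ℝ, 0 < l → l < 1 + α₃ * α₄ →
      ∀ C₁ C₂ C₃ C₄ Ch : ℝ, 0 < C₁ → 0 < C₂ → 0 < C₃ → 0 < C₄ → 0 < Ch →
      ∃ C : ℝ, 0 < C ∧ ∀ K T : ℝ, 0 < K → 0 < T → ∃ ε₀ : ℝ, 0 < ε₀ ∧
      ∀ ε : ℝ, 0 < ε → ε < ε₀ →
      ∀ (M : ℕ) (N : Fin M → Tube m), (∀ i, (N i).IsProductType ε K) →
        (Pairwise fun i i' => Disjoint (N i).dom (N i').dom) →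
        (∀ i, (N i).RepeatedTangents ε l) →
      ∀ (H : ℂ → ℂ) (F : Fin 2 → E (m + 1) → ℝ → ℂ → Fin (m + 1) → ℂ)
        (f : Fin 2 → E (m + 1) → ℝ → ℂ → EuclideanSpace ℂ (Fin (m + 1)) → ℂ)
        (u : Fin 2 → E (m + 1) → ℝ → ℂ)
        (Du : Fin 2 → E (m + 1) → ℝ → EuclideanSpace ℂ (Fin (m + 1)))
        (ut h : Fin 2 → E (m + 1) → ℝ → ℂ),
        IsSetting N T μ α₂ α₃ α₄ C₂ C₃ C₄ H F f u Du ut h →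
        StateNormLE α₁ C₁ H →
        (∀ x ∈ unionDom N, ∀ t ∈ Set.Icc 0 T, ‖h 0 x t - h 1 x t‖ ≤ Ch) →
      ∀ i, ∀ a ∈ (N i).I, ∀ y ∈ (N i).sec, ∀ x, x = (N i).curve a + (N i).emb y →
      ∀ t ∈ Set.Icc 0 T, ∀ j : Fin 2,
      ∀ a₁ a₂ b₁ b₂ : ℝ, (N i).IsWindow ε l a₁ a₂ b₁ b₂ → a ∈ Set.Icc a₁ a₂ →
      ∀ (θ β : ℝ) (k : Fin (m + 1)), IsRecovered (N i) ε K b₁ θ β k →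
        ‖rotFlux θ β (F 0 x t (u j x t)) k - rotFlux θ β (F 1 x t (u j x t)) k‖
          ≤ C * ε ^ fluxRate (α₃ * α₄) l) ∧
    -- (b) recovery of the source
    (∀ C₁' C₂ C₄ : ℝ, 0 < C₁' → 0 < C₂ → 0 < C₄ →
      ∃ C' : ℝ, 0 < C' ∧ ∀ C₃ K T : ℝ, 0 < C₃ → 0 < K → 0 < T → ∃ ε₀ : ℝ, 0 < ε₀ ∧
      ∀ ε : ℝ, 0 < ε → ε < ε₀ →
      ∀ (M : ℕ) (N : Fin M → Tube m), (∀ i, (N i).IsProductType ε K) →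
        (Pairwise fun i i' => Disjoint (N i).dom (N i').dom) →
        (∀ x ∈ unionDom N, ∃ i, ∃ x₀ ∈ (N i).lateral, ∃ ν,
          IsOutwardNormal (N i).dom x₀ ν ∧ ∃ c : ℝ, x - x₀ = c • ν) →
      ∀ (H : ℂ → ℂ) (F : Fin 2 → E (m + 1) → ℝ → ℂ → Fin (m + 1) → ℂ)
        (f : Fin 2 → E (m + 1) → ℝ → ℂ → EuclideanSpace ℂ (Fin (m + 1)) → ℂ)
        (u : Fin 2 → E (m + 1) → ℝ → ℂ)
        (Du : Fin 2 → E (m + 1) → ℝ → EuclideanSpace ℂ (Fin (m + 1)))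
        (ut h : Fin 2 → E (m + 1) → ℝ → ℂ),
        IsSetting N T μ α₂ α₃ α₄ C₂ C₃ C₄ H F f u Du ut h →
        StateC1NormLE α₁ C₁' H →
        (∀ x ∈ unionDom N, ∀ t ∈ Set.Icc 0 T, F 0 x t (u 0 x t) = F 1 x t (u 1 x t)) →
        (∀ x ∈ unionDom N, ∀ t ∈ Set.Icc 0 T, h 0 x t = h 1 x t) →
      ∀ x ∈ unionDom N, ∀ t ∈ Set.Icc 0 T, ∀ j : Fin 2,
        ‖f 0 x t (u j x t) (Du j x t) - f 1 x t (u j x t) (Du j x t)‖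
          ≤ C' * ε ^ sourceRate α₂ α₄) := by
  -- Both constants are 1, since all dependence on K and the data has been moved into ε₀.
  refine ⟨fun l hl _ C₁ C₂ C₃ C₄ Ch _ _ hC₃ hC₄ _ => ⟨1, one_pos, fun K T hK hT => ?_⟩,
    fun C₁ C₂ C₄ hC₁ hC₂ hC₄ => ⟨1, one_pos, fun C₃ K T _ hK hT => ?_⟩⟩
  · obtain ⟨ε₀, h0, hε⟩ := flux_recovery hm hμ (α₂ := α₂) hα₃ hα₄ l hl (C₂ := C₂) hC₃ hC₄ hK
    refine ⟨ε₀, h0, ?_⟩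
    intro ε hε0 hlt M N hN _ _ H F f u Du ut h hs _ _
    exact hε ε hε0 hlt M N hN T H F f u Du ut h hT hs
  · obtain ⟨ε₀, h0, hε⟩ := source_recovery hm hμ (α₁ := α₁) hα₂ hα₃ hα₄ (C₃ := C₃) hC₁ hC₂ hC₄ hK hT
    refine ⟨ε₀, h0, ?_⟩
    intro ε hε0 hlt M N hN _ _
    exact hε ε hε0 hlt M N hN
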